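/- **Conventions.** For a Riemannian metric $g$ on an $n$-manifold, $\nabla$ is the Levi-Civita connection, $Rm_g=(Rm_{ijkl})$ is the Riemann tensor, with the sign for which $Rm_{ijij}>0$ on round spheres, $R_g=g^{ik}g^{jl}Rm_{ijkl}$ is the scalar curvature, $\Delta=-\nabla^\alpha\nabla_\alpha$, and $(\delta\tilde\delta Rm_g)_{ij}=\nabla^\alpha\nabla^\beta Rm_{\alpha i\beta j}$. Norms of curvature are those of double-forms: $|Rm|^2=\frac14 Rm_{ijkl}Rm^{ijkl}$ and $|\nabla^mRm|^2=\frac14\nabla_{i_1}\cdots\nabla_{i_m}Rm_{jkpq}\,\nabla^{i_1}\cdots\nabla^{i_m}Rm^{jkpq}$; $\mathcal F_{Rm}(g)=\int_M|Rm_g|^2_g\,dv_g$, and $\|Rm_g\|_\infty=\sup_M|Rm_g|_g$. The symbol $Rm_g*Rm_g$ stands for any linear combination, with constant coefficients independent of the metric, of $(2,0)$-tensors obtained from $Rm_g\otimes Rm_g$ by taking tensor products with $g$ and $g^{-1}$, contracting and permuting indices. **Theorem.** Let $n\ge 3$, let $a,b\in\mathbb R$ with $a<\frac{1}{2(n-1)}$,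 and let $P$ be an operator on Riemannian metrics of $n$-manifolds of the form $$P(g)=\delta\tilde\delta Rm_g+a\,\Delta R_g\, g+b\,\nabla^2R_g+Rm_g*Rm_g .$$ For every integer $k\ge 0$ there is a constant $C=C(n,P,k)$ such that the following holds. Let $M$ be a compact $n$-manifold without boundary, let $g_0$ be a smooth Riemannian metric on $M$, let $0<T\le\infty$, and let $(g_t)_{t\in[0,T)}$ be a smooth family of Riemannian metrics on $M$ with $\partial_tg_t=P(g_t)$ on $[0,T)$ and initial value $g_0$. Suppose that $\|Rm_{g_t}\|_\infty\le D$ for all $t\in[0,T)$, where $D$ is a constant. Then for all $t\in(0,T)$ the function $|\nabla^{2k}Rm_{g_t}|^2_{g_t}$ is integrable and $$\int_M|\nabla^{2k}Rm_{g_t}|_{g_t}^2\,dv_{g_t}\le \mathcal F_{Rm}(g_0)\,\frac{e^{C(1+D)(1+Dt)^{k+1}}}{t^k}.$$ -/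

import Mathlib

open scoped Manifold ContDiff

noncomputable section

namespace CurvatureFlow

/-! ### Tensor calculus in a coordinate domain of `ℝⁿ`

A covariant tensor field of order `m` is given by its components `T y c`, where `y` is the point
and `c : Fin m → Fin n` lists the (lower) indices. -/

/-- The model space `ℝⁿ` with its Euclidean structure. -/
abbrev Coord (n : ℕ) : Type := EuclideanSpace ℝ (Fin n)

/-- Components of a covariant tensor field of order `m` in coordinates. -/
abbrev CTensor (n m : ℕ) : Type := Coord n → (Fin m → Fin n) → ℝ

/-- Components `g_ij` of a metric in coordinates. -/
abbrev CMetric (n : ℕ) : Type := Coord n → Matrix (Fin n) (Fin n) ℝ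

variable {n : ℕ}

/-- The partial derivative `∂_i f`. -/
def partialDeriv (i : Fin n) (f : Coord n → ℝ) (y : Coord n) : ℝ :=
  fderiv ℝ f y (EuclideanSpace.single i 1)

/-- The Christoffel symbols
`Γ^k_ij = 1/2 g^{kl} (∂_i g_jl + ∂_j g_il - ∂_l g_ij)`. -/
def christoffel (G : CMetric n) (k i j : Fin n) (y : Coord n) : ℝ :=
  (1 / 2) * ∑ l, (G y)⁻¹ k l *
    (partialDeriv i (fun z => G z j l) y + partialDeriv j (fun z => G z i l) y
      - partialDeriv l (fun z => G z i j) y)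

/-- The covariant derivative of a covariant tensor field; the new index comes first:
`(∇T)_{i c_0 … c_{m-1}} = ∂_i T_{c_0 … c_{m-1}} - ∑_l Γ^a_{i c_l} T_{c_0 … a … c_{m-1}}`. -/
def covDeriv {m : ℕ} (G : CMetric n) (T : CTensor n m) : CTensor n (m + 1) := fun y c =>
  partialDeriv (c 0) (fun z => T z (Fin.tail c)) y
    - ∑ l : Fin m, ∑ a : Fin n,
        christoffel G a (c 0) (Fin.tail c l) y * T y (Function.update (Fin.tail c) l a)

/-- The iterated covariant derivative `∇^k T`, with
`(∇^k T)(y, ![i_1, …, i_k, c_0, …]) = ∇_{i_1} ⋯ ∇_{i_k} T_{c_0 …}`. -/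
def iterCovDeriv {m : ℕ} (G : CMetric n) (T : CTensor n m) : (k : ℕ) → CTensor n (m + k)
  | 0 => T
  | k + 1 => covDeriv G (iterCovDeriv G T k)

/-- The squared norm of a tensor by full contraction,
`g^{c_1 d_1} ⋯ g^{c_m d_m} T_{c_1 … c_m} T_{d_1 … d_m}`. -/
def contractSq {m : ℕ} (G : CMetric n) (T : CTensor n m) (y : Coord n) : ℝ :=
  ∑ c : Fin m → Fin n, ∑ d : Fin m → Fin n, (∏ l, (G y)⁻¹ (c l) (d l)) * (T y c * T y d)

/-- The Riemann curvature tensor `Rm_{ijkl} = ⟨R(∂_i, ∂_j) ∂_l, ∂_k⟩`, that is,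
`Rm_{ijkl} = g_{kp} (∂_i Γ^p_{jl} - ∂_j Γ^p_{il} + Γ^p_{iq} Γ^q_{jl} - Γ^p_{jq} Γ^q_{il})`;
with this sign `Rm_{ijij}` is positive on round spheres. -/
def riem (G : CMetric n) : CTensor n 4 := fun y c =>
  ∑ p, G y (c 2) p *
    (partialDeriv (c 0) (christoffel G p (c 1) (c 3)) y
      - partialDeriv (c 1) (christoffel G p (c 0) (c 3)) y
      + ∑ q, (christoffel G p (c 0) q y * christoffel G q (c 1) (c 3) y
          - christoffel G p (c 1) q y * christoffel G q (c 0) (c 3) y))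

/-- The scalar curvature `R = g^{ik} g^{jl} Rm_{ijkl}`, as a tensor of order `0`. -/
def scal (G : CMetric n) : CTensor n 0 := fun y _ =>
  ∑ i, ∑ j, ∑ k, ∑ l, (G y)⁻¹ i k * (G y)⁻¹ j l * riem G y ![i, j, k, l]

/-- The Hessian `(∇² R)_ij` of the scalar curvature. -/
def hessScal (G : CMetric n) (y : Coord n) (i j : Fin n) : ℝ :=
  iterCovDeriv G (scal G) 2 y ![i, j]

/-- The Laplacian of the scalar curvature with the sign for which it is a nonnegative operator:
`ΔR = -g^{ij} ∇_i ∇_j R`. -/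
def lapScal (G : CMetric n) (y : Coord n) : ℝ :=
  -∑ i, ∑ j, (G y)⁻¹ i j * hessScal G y i j

/-- The double divergence `∇^α ∇^β Rm_{α i β j}` of the curvature tensor. -/
def divDivRiem (G : CMetric n) (y : Coord n) (i j : Fin n) : ℝ :=
  ∑ α, ∑ β, ∑ γ, ∑ ε, (G y)⁻¹ α γ * (G y)⁻¹ β ε *
    iterCovDeriv G (riem G) 2 y ![γ, ε, α, i, β, j]

/-! ### Universal quadratic expressions `Rm * Rm` -/

/-- The lower index slots of `Rm ⊗ Rm ⊗ g^{⊗p}`. -/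
abbrev LowerSlots (p : ℕ) : Type := (Fin 2 × Fin 4) ⊕ (Fin p × Fin 2)

/-- The destinations of these slots: the two free indices, or one of the two indices of one of the
factors of `(g⁻¹)^{⊗(p+3)}`. -/
abbrev Destinations (p : ℕ) : Type := Fin 2 ⊕ (Fin (p + 3) × Fin 2)

/-- A complete contraction scheme producing a `2`-tensor from
`Rm ⊗ Rm ⊗ g^{⊗p} ⊗ (g⁻¹)^{⊗(p+3)}`: the slot `slot (inl 0)` (resp. `slot (inl 1)`) carries the
first (resp. second) free index, and the two indices of the `s`-th inverse metric are contracted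
with the slots `slot (inr (s, 0))` and `slot (inr (s, 1))`. -/
structure StarTerm where
  /-- the number of factors `g` -/
  p : ℕ
  /-- the permutation of indices -/
  slot : Destinations p ≃ LowerSlots p

/-- The components of the `2`-tensor described by a contraction scheme. -/
def StarTerm.eval (τ : StarTerm) (G : CMetric n) (y : Coord n) (i j : Fin n) : ℝ :=
  ∑ c : LowerSlots τ.p → Fin n,
    if c (τ.slot (.inl 0)) = i ∧ c (τ.slot (.inl 1)) = j then
      (∏ q : Fin 2, riem G y (fun l => c (.inl (q, l))))
        * (∏ r : Fin τ.p, G y (c (.inr (r, 0))) (c (.inr (r, 1))))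
        * ∏ s : Fin (τ.p + 3), (G y)⁻¹ (c (τ.slot (.inr (s, 0)))) (c (τ.slot (.inr (s, 1))))
    else 0

/-- The data of an operator
`P(g) = ∇^α ∇^β Rm_{α i β j} + a ΔR g + b ∇²R + Rm * Rm`,
where `Rm * Rm` is a linear combination, with constant coefficients, of contraction schemes. -/
structure FlowOperator where
  /-- the coefficient of `ΔR g` -/
  a : ℝ
  /-- the coefficient of `∇²R` -/
  b : ℝ
  /-- the coefficients and the contraction schemes of the quadratic term `Rm * Rm` -/
  quad : List (ℝ × StarTerm)

/-- The components `P(g)_ij`. -/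
def FlowOperator.eval (P : FlowOperator) (G : CMetric n) (y : Coord n) (i j : Fin n) : ℝ :=
  divDivRiem G y i j + P.a * lapScal G y * G y i j + P.b * hessScal G y i j
    + (P.quad.map fun q => q.1 * q.2.eval G y i j).sum

/-! ### Riemannian metrics on a manifold -/

section Manifold

variable {M : Type*} [TopologicalSpace M] [ChartedSpace (Coord n) M] [IsManifold (𝓡 n) ∞ M]

variable (n M) in
/-- Smooth Riemannian metrics on the `n`-manifold `M`. -/
abbrev SmoothMetric : Type _ :=
  Bundle.ContMDiffRiemannianMetric (𝓡 n) ∞ (Coord n) (fun x : M => TangentSpace (𝓡 n) x)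

/-- The coordinate vector field `∂_i` of the chart `e` at the point of coordinates `y`. -/
def coordVector (e : OpenPartialHomeomorph M (Coord n)) (y : Coord n) (i : Fin n) :
    TangentSpace (𝓡 n) (e.symm y) :=
  mfderiv (𝓡 n) (𝓡 n) e.symm y (EuclideanSpace.single i (1 : ℝ) : Coord n)

/-- The components `g_ij = g(∂_i, ∂_j)` of a metric in the chart `e`; they are meaningful at the
points of `e.target`. -/
def metricCoord (g : SmoothMetric n M) (e : OpenPartialHomeomorph M (Coord n)) : CMetric n :=
  fun y => Matrix.of fun i j => g.inner (e.symm y) (coordVector e y i) (coordVector e y j)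

/-- The pointwise squared norm `|∇^k Rm|²` of the iterated covariant derivatives of the curvature,
`Rm` being seen as a double-form, so that `|Rm|² = 1/4 Rm_{ijkl} Rm^{ijkl}`. -/
def normSqRm (g : SmoothMetric n M) (k : ℕ) (x : M) : ℝ :=
  let G := metricCoord g (chartAt (Coord n) x)
  (1 / 4) * contractSq G (iterCovDeriv G (riem G) k) (chartAt (Coord n) x x)

/-- A nonempty compact manifold is covered by a sequence of its preferred charts. -/
theorem exists_chart_cover (n : ℕ) (M : Type*) [TopologicalSpace M] [ChartedSpace (Coord n) M]
    [CompactSpace M] [Nonempty M] :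
    ∃ u : ℕ → M, ⋃ i, (chartAt (Coord n) (u i)).source = Set.univ := by
  obtain ⟨s, hs, hcov⟩ := countable_cover_nhds_of_sigmaCompact
    (f := fun x : M => (chartAt (Coord n) x).source) (fun x => chart_source_mem_nhds (Coord n) x)
  have hne : s.Nonempty := by
    obtain ⟨x⟩ := ‹Nonempty M›
    have hx : x ∈ ⋃ y ∈ s, (chartAt (Coord n) y).source := by rw [hcov]; trivial
    simp only [Set.mem_iUnion] at hx
    obtain ⟨y, hy, -⟩ := hx
    exact ⟨y, hy⟩
  obtain ⟨u, rfl⟩ := hs.exists_eq_range hne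
  exact ⟨u, by simpa [Set.biUnion_range] using hcov⟩

/-- The restriction to `A ⊆ e.source` of the Riemannian volume: the image under `e.symm` of the
measure `√(det g_ij) dy` on `e(A)`. -/
def volumePiece [MeasurableSpace M] (g : SmoothMetric n M)
    (e : OpenPartialHomeomorph M (Coord n)) (A : Set M) : MeasureTheory.Measure M :=
  ((MeasureTheory.volume.restrict (e.target ∩ e.symm ⁻¹' A)).withDensity
    fun y => ENNReal.ofReal (Real.sqrt (metricCoord g e y).det)).map e.symm

open Classical in
/-- The Riemannian volume measure `dv_g` of a compact manifold, obtained by cutting `M` into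
disjoint pieces that are contained in chart domains. (By the change of variables formula it does not
depend on the chosen charts.) -/
def vol [MeasurableSpace M] [CompactSpace M] (g : SmoothMetric n M) :
    MeasureTheory.Measure M :=
  if _h : Nonempty M then
    let u : ℕ → M := Classical.choose (exists_chart_cover n M)
    MeasureTheory.Measure.sum fun i =>
      volumePiece g (chartAt (Coord n) (u i))
        (disjointed (fun j => (chartAt (Coord n) (u j)).source) i)
  else 0

/-- The time interval `[0, T)`, where `T` may be infinite. -/
def timeInterval (T : EReal) : Set ℝ := {t | 0 ≤ t ∧ (t : EReal) < T}

/-- `g_t`, `t ∈ [0, T)`, is a smooth solution on `M` of `∂_t g = P(g)`, `g(0) = g₀`. -/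
structure IsFlowSolution (P : FlowOperator) (g₀ : SmoothMetric n M) (T : EReal)
    (g : ℝ → SmoothMetric n M) : Prop where
  /-- the family is smooth on `[0, T) × M` -/
  smooth : ∀ e ∈ atlas (Coord n) M, ∀ i j : Fin n,
    ContDiffOn ℝ ∞ (fun q : ℝ × Coord n => metricCoord (g q.1) e q.2 i j)
      (timeInterval T ×ˢ e.target)
  /-- the initial condition -/
  initial : g 0 = g₀
  /-- the evolution equation (with a one-sided derivative at `t = 0`) -/
  evolution : ∀ t ∈ timeInterval T, ∀ e ∈ atlas (Coord n) M, ∀ y ∈ e.target, ∀ i j : Fin n,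
    HasDerivWithinAt (fun s => metricCoord (g s) e y i j)
      (P.eval (metricCoord (g t) e) y i j) (timeInterval T) t

end Manifold

end CurvatureFlow

end

/-! The proof is an energy argument for `e_j(t) = ∫ |∇^{2j} Rm|²`. Each energy satisfies `e_j' ≤
-c_j e_{j+1} + C_j ∫ |Rm|^{2j+4}` with constants depending only on `n`, `P` and `j`
(`exists_energy_evolution`). The curvature bound turns the last integral into a multiple of
`D^{2j+2} e_0`. A weighted sum `∑ β_j t^j e_j` then satisfies a Grönwall inequality
(`exists_smoothing_constant`), whence `t^k e_k(t) ≤ e_0(0) exp (K (1 + D² t))`, which implies the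
bound of the theorem.

Dissipation. Write `T` for the double divergence of `Rm` (`ddRm`) and `□R` for the trace of the
Hessian of `R` (`boxScal`). Modulo lower order terms, the derivative of `Rm` along `∂_t g = h` is a
combination of second derivatives of `h` (`linRm`), and two integrations by parts show that half the
derivative of `∫ |∇^m Rm|²` is `-2 ∫ ⟨∇^m h, ∇^m T⟩`. Modulo lower order, `T` is symmetric and
divergence free; its trace is `□R / 2`. For `h = P(g)` the result is therefore `-2 ∫ |∇^m T|² + a ∫
|∇^m □R|²`, and the term `b ∇²R` drops out (`neq_flowT`). The second Bianchi identity, used twice,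
gives `∫ |∇^{m+2} Rm|² = 4 ∫ |∇^m T|²` modulo lower order (`neq_rmT`). Positivity of `∫ |∇^m (T + r
(∇²R - □R g))|²` for `r = 1 / (2 (n - 1))` gives `∫ |∇^m □R|² ≤ 4 (n - 1) ∫ |∇^m T|²` modulo lower
order (`neq_trace`). Together these are dissipative under the condition `a < 1 / (2 (n - 1))`
(`exists_dissipation`).

Lower order terms. Instead of writing polynomials in the `∇^i Rm`, a natural tensor is given a
weight `s` and an order `ℓ` (`Ctl`): its `k`-th covariant derivative is bounded by a constant times
`(∑_{i ≤ ℓ + k} |∇^i Rm|^{1/(i+2)})^{s+k}`. Products, contractions and derivatives respect this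
bookkeeping, and a commutator of derivatives has weight `s + 2` but still order `ℓ` (`Ctl.comm`). A
scalar of weight `2 q + 4` built from factors of order at most `q`, one of them of order less than
`q`, is negligible: its integral is at most `ε ∫ |∇^q Rm|² + C ∫ |Rm|^{q+2}` for every `ε > 0`
(`Negl.of_abs_le`). This follows from Young's inequality and from interpolation
(`CInt.exists_rmPow_le`), which comes from integrating the divergence of `|∇A|^{2s-2} ⟨A, ∇A⟩` with
`A = ∇^i Rm`. The computations above are congruences modulo negligible terms, with `q = m + 2`.

Uniformity. The integral inequalities are proved for every `CInt`: a monotone linear functional on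
functions natural in the metric that kills divergences. The constants thus cannot depend on the
manifold. Integration over a compact Riemannian manifold is such a functional (`cInt`): naturality
gives independence of the charts, and the divergence theorem is proved with a partition of unity. -/

open scoped Manifold ContDiff

noncomputable section

namespace CurvatureFlow

/-! ### Pointwise tensor algebra -/

section Algebra

open Function Matrix

variable {n : ℕ} {ι κ : Type} [Fintype ι] [DecidableEq ι] [Fintype κ] [DecidableEq κ]

/-- Square matrices of size `n`. -/
abbrev Mat (n : ℕ) : Type := Matrix (Fin n) (Fin n) ℝ

/-- Components of a covariant tensor whose slots are labelled by `ι`. -/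
abbrev Comp (n : ℕ) (ι : Type) : Type := (ι → Fin n) → ℝ

/-- The derivation of the tensor algebra induced by a matrix. -/
def der (A : Mat n) (t : Comp n ι) : Comp n ι :=
  fun c => ∑ l, ∑ a, A a (c l) * t (update c l a)

/-- The pullback of a tensor by a matrix. -/
def act (J : Mat n) (t : Comp n ι) : Comp n ι :=
  fun c => ∑ d : ι → Fin n, (∏ l, J (d l) (c l)) * t d

/-- The derivative of `act` at `J` in the direction `B`. -/
def actD (J B : Mat n) (t : Comp n ι) : Comp n ι :=
  fun c => ∑ d : ι → Fin n, (∑ l, B (d l) (c l) * ∏ m ∈ Finset.univ.erase l, J (d m) (c m)) * t d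

/-- The bilinear form induced on tensors by a bilinear form on covectors. -/
def ip (H : Mat n) (s t : Comp n ι) : ℝ :=
  ∑ c : ι → Fin n, ∑ d : ι → Fin n, (∏ l, H (c l) (d l)) * (s c * t d)

/-- The derivative of `ip` at `H` in the direction `B`. -/
def ipD (H B : Mat n) (s t : Comp n ι) : ℝ :=
  ∑ c : ι → Fin n, ∑ d : ι → Fin n,
    (∑ l, B (c l) (d l) * ∏ m ∈ Finset.univ.erase l, H (c m) (d m)) * (s c * t d)

/-- Adding a slot in front. -/
def oc (a : Fin n) (c : ι → Fin n) : Option ι → Fin n := fun o => o.elim a c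

omit [Fintype ι] [DecidableEq ι] in
@[simp] lemma oc_none (a : Fin n) (c : ι → Fin n) : oc a c none = a := rfl
omit [Fintype ι] [DecidableEq ι] in
@[simp] lemma oc_some (a : Fin n) (c : ι → Fin n) (i : ι) : oc a c (some i) = c i := rfl
omit [Fintype ι] [DecidableEq ι] in
@[simp] lemma oc_comp_some (a : Fin n) (c : ι → Fin n) : oc a c ∘ some = c := rfl

omit [Fintype ι] [DecidableEq ι] in
lemma oc_eta (c : Option ι → Fin n) : oc (c none) (c ∘ some) = c := by
  funext o; cases o <;> rfl

omit [Fintype ι] in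
lemma update_oc_none (a b : Fin n) (c : ι → Fin n) : update (oc a c) none b = oc b c := by
  funext o; cases o <;> simp [update]

omit [Fintype ι] in
lemma update_oc_some (a b : Fin n) (c : ι → Fin n) (i : ι) :
    update (oc a c) (some i) b = oc a (update c i b) := by
  funext o; cases o with
  | none => simp [update]
  | some j => simp [update]

lemma sum_oc (f : (Option ι → Fin n) → ℝ) : ∑ c, f c = ∑ a, ∑ c, f (oc a c) := by
  rw [← Fintype.sum_prod_type']
  refine (Fintype.sum_equiv (Equiv.mk (fun p : Fin n × (ι → Fin n) => oc p.1 p.2)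
    (fun c => (c none, c ∘ some)) (fun p => rfl) (fun c => oc_eta c)) _ _ (fun p => rfl)).symm

/-- Tensor product. -/
def mulC (s : Comp n ι) (t : Comp n κ) : Comp n (ι ⊕ κ) :=
  fun c => s (c ∘ Sum.inl) * t (c ∘ Sum.inr)

/-- Relabelling of slots. -/
def relabC (f : ι → κ) (t : Comp n ι) : Comp n κ := fun c => t (c ∘ f)

/-- Contraction of the first two slots. -/
def trcC (H : Mat n) (t : Comp n (Option (Option ι))) : Comp n ι :=
  fun c => ∑ a, ∑ b, H a b * t (oc a (oc b c))

lemma sum_sumType (f : (ι ⊕ κ → Fin n) → ℝ) :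
    ∑ c, f c = ∑ c : ι → Fin n, ∑ d : κ → Fin n, f (Sum.elim c d) := by
  rw [← Fintype.sum_prod_type']
  exact Fintype.sum_equiv (Equiv.sumArrowEquivProdArrow ι κ (Fin n)) _ _
    (fun c => by simp [Equiv.sumArrowEquivProdArrow, Sum.elim_comp_inl_inr])

/-- The map `(c, a) ↦ (update c l a, c l)`, which exchanges the value in slot `l` with the free
index, is an involution. This is how `der` is moved from one factor of a sum over components to
another. -/
lemma sum_update_swap (l : ι) (f : (ι → Fin n) → Fin n → ℝ) :
    ∑ c, ∑ a, f c a = ∑ c, ∑ a, f (update c l a) (c l) := by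
  rw [← Fintype.sum_prod_type', ← Fintype.sum_prod_type']
  refine Fintype.sum_equiv (Equiv.mk (fun p : (ι → Fin n) × Fin n => (update p.1 l p.2, p.1 l))
    (fun p => (update p.1 l p.2, p.1 l)) (fun p => by simp) (fun p => by simp)) _ _ (fun p => ?_)
  simp

lemma der_add_left (A B : Mat n) (t : Comp n ι) : der (A + B) t = der A t + der B t := by
  funext c; simp [der, add_mul, Finset.sum_add_distrib]

lemma der_sub_left (A B : Mat n) (t : Comp n ι) : der (A - B) t = der A t - der B t := by
  funext c; simp [der, sub_mul, Finset.sum_sub_distrib]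

lemma der_smul_left (r : ℝ) (A : Mat n) (t : Comp n ι) : der (r • A) t = r • der A t := by
  funext c; simp [der, Finset.mul_sum, mul_assoc]

lemma der_sum_left {α : Type*} (s : Finset α) (A : α → Mat n) (t : Comp n ι) :
    der (∑ i ∈ s, A i) t = ∑ i ∈ s, der (A i) t := by
  classical
  induction s using Finset.induction_on with
  | empty => funext c; simp [der]
  | insert a s ha ih => rw [Finset.sum_insert ha, Finset.sum_insert ha, der_add_left, ih]

lemma der_add_right (A : Mat n) (s t : Comp n ι) : der A (s + t) = der A s + der A t := by
  funext c; simp [der, mul_add, Finset.sum_add_distrib]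

lemma der_sub_right (A : Mat n) (s t : Comp n ι) : der A (s - t) = der A s - der A t := by
  funext c; simp [der, mul_sub, Finset.sum_sub_distrib]

lemma der_smul_right (r : ℝ) (A : Mat n) (t : Comp n ι) : der A (r • t) = r • der A t := by
  funext c; simp [der, Finset.mul_sum, mul_left_comm]

/-- `der` is an antirepresentation of the Lie algebra of matrices. -/
lemma der_comm (A B : Mat n) (t : Comp n ι) :
    der A (der B t) - der B (der A t) = der (B * A - A * B) t := by
  have key : ∀ (A B : Mat n) (c : ι → Fin n), der A (der B t) c = der (B * A) t c
      + ∑ l, ∑ m ∈ Finset.univ.erase l, ∑ a, ∑ b, A a (c l) * B b (c m) *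
          t (update (update c l a) m b) := by
    intro A B c
    simp only [der]
    rw [← Finset.sum_add_distrib]
    refine Finset.sum_congr rfl fun l _ => ?_
    have h1 : ∀ a, ∑ m, ∑ b, B b ((update c l a) m) * t (update (update c l a) m b)
        = ∑ b, B b a * t (update c l b) +
          ∑ m ∈ Finset.univ.erase l, ∑ b, B b (c m) * t (update (update c l a) m b) := by
      intro a
      rw [← Finset.add_sum_erase _ _ (Finset.mem_univ l)]
      simp only [update_self, update_idem]
      congr 1
      refine Finset.sum_congr rfl fun m hm => ?_
      simp [update_of_ne (Finset.ne_of_mem_erase hm)]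
    simp only [h1, mul_add, Finset.sum_add_distrib]
    congr 1
    · simp only [Matrix.mul_apply, Finset.sum_mul, Finset.mul_sum]
      rw [Finset.sum_comm]
      refine Finset.sum_congr rfl fun a _ => Finset.sum_congr rfl fun b _ => by ring
    · simp only [Finset.mul_sum]
      rw [Finset.sum_comm]
      refine Finset.sum_congr rfl fun a _ => Finset.sum_congr rfl fun b _ =>
        Finset.sum_congr rfl fun b _ => by ring
  funext c
  rw [der_sub_left]
  simp only [Pi.sub_apply, key]
  have : ∑ l, ∑ m ∈ Finset.univ.erase l, ∑ a, ∑ b, A a (c l) * B b (c m) *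
          t (update (update c l a) m b) = ∑ l, ∑ m ∈ Finset.univ.erase l, ∑ a, ∑ b,
          B a (c l) * A b (c m) * t (update (update c l a) m b) := by
    rw [Finset.sum_comm' (t' := Finset.univ) (s' := fun m => Finset.univ.erase m)
      (by intro x y; simp [eq_comm])]
    refine Finset.sum_congr rfl fun l _ => Finset.sum_congr rfl fun m hm => ?_
    rw [Finset.sum_comm]
    refine Finset.sum_congr rfl fun a _ => Finset.sum_congr rfl fun b _ => ?_
    rw [update_comm (Finset.ne_of_mem_erase hm)]
    ring
  rw [this]; ring

lemma act_one (t : Comp n ι) : act 1 t = t := by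
  funext c
  simp only [act]
  rw [Finset.sum_eq_single c]
  · simp
  · intro d _ hd
    obtain ⟨l, hl⟩ := Function.ne_iff.1 hd
    rw [Finset.prod_eq_zero (Finset.mem_univ l) (by simp [hl]), zero_mul]
  · simp

lemma act_add (J : Mat n) (s t : Comp n ι) : act J (s + t) = act J s + act J t := by
  funext c; simp [act, mul_add, Finset.sum_add_distrib]

lemma act_sub (J : Mat n) (s t : Comp n ι) : act J (s - t) = act J s - act J t := by
  funext c; simp [act, mul_sub, Finset.sum_sub_distrib]

lemma act_smul (J : Mat n) (r : ℝ) (t : Comp n ι) : act J (r • t) = r • act J t := by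
  funext c; simp [act, Finset.mul_sum, mul_left_comm]

lemma prod_mul_apply (J K : Mat n) (c d : ι → Fin n) :
    ∏ l, (J * K) (d l) (c l) = ∑ e : ι → Fin n, (∏ l, J (d l) (e l)) * ∏ l, K (e l) (c l) := by
  simp only [Matrix.mul_apply, ← Finset.prod_mul_distrib]
  rw [Finset.prod_univ_sum]
  simp

lemma act_act (J K : Mat n) (t : Comp n ι) : act K (act J t) = act (J * K) t := by
  funext c
  simp only [act, prod_mul_apply, Finset.mul_sum, Finset.sum_mul]
  rw [Finset.sum_comm]
  exact Finset.sum_congr rfl fun d _ => Finset.sum_congr rfl fun e _ => by ring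

/-- `ip H s t` is the pairing of `act H s` with `t`, so the claim reduces to the composition rule
`act_act`. -/
lemma ip_act (H J : Mat n) (s t : Comp n ι) :
    ip H (act J s) (act J t) = ip (J * H * Jᵀ) s t := by
  have h : ∀ (H : Mat n) (s t : Comp n ι), ip H s t = ∑ d, act H s d * t d := by
    intro H s t
    simp only [ip, act, Finset.sum_mul]
    rw [Finset.sum_comm]
    exact Finset.sum_congr rfl fun d _ => Finset.sum_congr rfl fun e _ => by ring
  rw [h, h, act_act, Matrix.mul_assoc, ← Matrix.mul_assoc, ← act_act (J * H) Jᵀ]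
  simp only [act, Finset.mul_sum, Finset.sum_mul, Matrix.transpose_apply]
  rw [Finset.sum_comm]
  refine Finset.sum_congr rfl fun d _ => ?_
  rw [Finset.sum_comm]
  rw [Finset.sum_comm]
  refine Finset.sum_congr rfl fun d _ => Finset.sum_congr rfl fun e _ => by ring

lemma ip_one (s t : Comp n ι) : ip 1 s t = ∑ c, s c * t c := by
  simp only [ip]
  refine Finset.sum_congr rfl fun c _ => ?_
  rw [Finset.sum_eq_single c]
  · simp
  · intro d _ hd
    obtain ⟨l, hl⟩ := Function.ne_iff.1 hd
    rw [Finset.prod_eq_zero (Finset.mem_univ l) (by simp [Ne.symm hl]), zero_mul]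
  · simp

lemma prod_update_left (J : Mat n) (c d : ι → Fin n) (l : ι) (a : Fin n) :
    ∏ m, J (update d l a m) (c m) = J a (c l) * ∏ m ∈ Finset.univ.erase l, J (d m) (c m) := by
  rw [← Finset.mul_prod_erase _ _ (Finset.mem_univ l), update_self]
  congr 1
  exact Finset.prod_congr rfl fun m hm => by rw [update_of_ne (Finset.ne_of_mem_erase hm)]

lemma prod_update_right (J : Mat n) (c d : ι → Fin n) (l : ι) (a : Fin n) :
    ∏ m, J (d m) (update c l a m) = J (d l) a * ∏ m ∈ Finset.univ.erase l, J (d m) (c m) := by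
  rw [← Finset.mul_prod_erase _ _ (Finset.mem_univ l), update_self]
  congr 1
  exact Finset.prod_congr rfl fun m hm => by rw [update_of_ne (Finset.ne_of_mem_erase hm)]

lemma der_act (A J : Mat n) (t : Comp n ι) : der A (act J t) = actD J (J * A) t := by
  funext c
  simp only [der, act, actD, prod_update_right, Finset.mul_sum, Finset.sum_mul]
  conv_rhs => rw [Finset.sum_comm]
  refine Finset.sum_congr rfl fun l _ => ?_
  rw [Finset.sum_comm]
  refine Finset.sum_congr rfl fun d _ => ?_
  simp only [Matrix.mul_apply, Finset.sum_mul]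
  exact Finset.sum_congr rfl fun e _ => by ring

lemma act_der (A J : Mat n) (t : Comp n ι) : act J (der A t) = actD J (A * J) t := by
  funext c
  simp only [der, act, actD, Finset.mul_sum, Finset.sum_mul]
  rw [Finset.sum_comm]
  conv_rhs => rw [Finset.sum_comm]
  refine Finset.sum_congr rfl fun l _ => ?_
  rw [sum_update_swap l]
  refine Finset.sum_congr rfl fun d _ => ?_
  simp only [prod_update_left, Matrix.mul_apply, Finset.sum_mul, update_self, update_idem,
    update_eq_self]
  exact Finset.sum_congr rfl fun e _ => by ring

/-- Both sides are the derivative of `act` at `J` in the direction `A * J`. -/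
lemma act_der_conj (A J : Mat n) (hJ : IsUnit J.det) (t : Comp n ι) :
    act J (der A t) = der (J⁻¹ * A * J) (act J t) := by
  rw [act_der, der_act, ← Matrix.mul_assoc, Matrix.mul_nonsing_inv_cancel_left _ _ hJ]

lemma ip_der_left (H A : Mat n) (s t : Comp n ι) : ip H (der A s) t = ipD H (A * H) s t := by
  simp only [ip, ipD]
  rw [Finset.sum_comm]
  conv_rhs => rw [Finset.sum_comm]
  refine Finset.sum_congr rfl fun d _ => ?_
  simp only [der, Finset.sum_mul, Finset.mul_sum]
  rw [Finset.sum_comm]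
  conv_rhs => rw [Finset.sum_comm]
  refine Finset.sum_congr rfl fun l _ => ?_
  rw [sum_update_swap l]
  refine Finset.sum_congr rfl fun c _ => ?_
  simp only [prod_update_left, Matrix.mul_apply, Finset.sum_mul, update_self, update_idem,
    update_eq_self]
  exact Finset.sum_congr rfl fun e _ => by ring

lemma ip_comm (H : Mat n) (s t : Comp n ι) : ip H s t = ip Hᵀ t s := by
  simp only [ip]
  rw [Finset.sum_comm]
  exact Finset.sum_congr rfl fun d _ => Finset.sum_congr rfl fun e _ => by
    simp only [Matrix.transpose_apply]; ring

lemma ipD_comm (H B : Mat n) (s t : Comp n ι) : ipD H B s t = ipD Hᵀ Bᵀ t s := by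
  simp only [ipD]
  rw [Finset.sum_comm]
  exact Finset.sum_congr rfl fun d _ => Finset.sum_congr rfl fun e _ => by
    simp only [Matrix.transpose_apply]; ring

lemma ip_der_right (H A : Mat n) (s t : Comp n ι) : ip H s (der A t) = ipD H (H * Aᵀ) s t := by
  rw [ip_comm, ip_der_left, ipD_comm]
  simp [Matrix.transpose_mul]

lemma ipD_add (H B B' : Mat n) (s t : Comp n ι) :
    ipD H (B + B') s t = ipD H B s t + ipD H B' s t := by
  simp [ipD, add_mul, Finset.sum_add_distrib]

lemma ipD_neg (H B : Mat n) (s t : Comp n ι) : ipD H (-B) s t = -ipD H B s t := by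
  simp [ipD]

lemma ip_add_left (H : Mat n) (s s' t : Comp n ι) : ip H (s + s') t = ip H s t + ip H s' t := by
  simp [ip, mul_add, add_mul, Finset.sum_add_distrib]

lemma ip_add_right (H : Mat n) (s t t' : Comp n ι) : ip H s (t + t') = ip H s t + ip H s t' := by
  simp [ip, mul_add, Finset.sum_add_distrib]

lemma ip_smul_left (H : Mat n) (r : ℝ) (s t : Comp n ι) : ip H (r • s) t = r * ip H s t := by
  simp [ip, Finset.mul_sum, mul_left_comm, mul_assoc]

lemma ip_smul_right (H : Mat n) (r : ℝ) (s t : Comp n ι) : ip H s (r • t) = r * ip H s t := by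
  simp [ip, Finset.mul_sum, mul_left_comm]

lemma ip_neg_left (H : Mat n) (s t : Comp n ι) : ip H (-s) t = -ip H s t := by
  simp [ip]

lemma ip_neg_right (H : Mat n) (s t : Comp n ι) : ip H s (-t) = -ip H s t := by
  simp [ip]

lemma ip_sub_left (H : Mat n) (s s' t : Comp n ι) : ip H (s - s') t = ip H s t - ip H s' t := by
  rw [sub_eq_add_neg, ip_add_left, ip_neg_left, sub_eq_add_neg]

lemma ip_sub_right (H : Mat n) (s t t' : Comp n ι) : ip H s (t - t') = ip H s t - ip H s t' := by
  rw [sub_eq_add_neg, ip_add_right, ip_neg_right, sub_eq_add_neg]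

lemma ip_oc (H : Mat n) (s t : Comp n (Option ι)) :
    ip H s t = ∑ a, ∑ b, H a b * ip H (fun c => s (oc a c)) (fun c => t (oc b c)) := by
  simp only [ip, Finset.mul_sum]
  rw [sum_oc]
  refine Finset.sum_congr rfl fun a _ => ?_
  rw [Finset.sum_comm]
  simp only [sum_oc]
  refine Finset.sum_congr rfl fun b _ => ?_
  rw [Finset.sum_comm]
  refine Finset.sum_congr rfl fun c _ => Finset.sum_congr rfl fun d _ => ?_
  simp [Fintype.prod_option, mul_assoc]

lemma ip_mulC (H : Mat n) (s s' : Comp n ι) (t t' : Comp n κ) :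
    ip H (mulC s t) (mulC s' t') = ip H s s' * ip H t t' := by
  have h4 : ∀ (X : (ι → Fin n) → (ι → Fin n) → ℝ) (Y : (κ → Fin n) → (κ → Fin n) → ℝ),
      ∑ c, ∑ d, ∑ c', ∑ d', X c c' * Y d d' = (∑ c, ∑ c', X c c') * ∑ d, ∑ d', Y d d' := by
    intro X Y
    rw [Finset.sum_mul_sum]
    refine Finset.sum_congr rfl fun c _ => Finset.sum_congr rfl fun d _ => ?_
    rw [Finset.sum_mul_sum]
  simp only [ip]
  rw [← h4]
  simp only [mulC, sum_sumType, Fintype.prod_sum_type, Sum.elim_inl, Sum.elim_inr,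
    Sum.elim_comp_inl, Sum.elim_comp_inr]
  refine Finset.sum_congr rfl fun c _ => Finset.sum_congr rfl fun d _ =>
    Finset.sum_congr rfl fun c' _ => Finset.sum_congr rfl fun d' _ => by ring

lemma act_mulC (J : Mat n) (s : Comp n ι) (t : Comp n κ) :
    act J (mulC s t) = mulC (act J s) (act J t) := by
  funext c
  simp only [act, mulC, sum_sumType, Fintype.prod_sum_type, Sum.elim_inl, Sum.elim_inr,
    Sum.elim_comp_inl, Sum.elim_comp_inr, Finset.sum_mul_sum, Function.comp_apply]
  refine Finset.sum_congr rfl fun c' _ => Finset.sum_congr rfl fun d _ => by ring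

lemma sum_comp_bij {f : ι → κ} (hf : Bijective f) (F : (ι → Fin n) → ℝ) :
    ∑ c : κ → Fin n, F (c ∘ f) = ∑ c : ι → Fin n, F c :=
  Fintype.sum_equiv ((Equiv.ofBijective f hf).symm.arrowCongr (Equiv.refl _)) _ _ (fun c => by
    congr 1)

lemma ip_relabC (H : Mat n) {f : ι → κ} (hf : Bijective f) (s t : Comp n ι) :
    ip H (relabC f s) (relabC f t) = ip H s t := by
  simp only [ip, relabC]
  have h : ∀ c d : κ → Fin n, ∏ l, H (c l) (d l) = ∏ l, H ((c ∘ f) l) ((d ∘ f) l) :=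
    fun c d => (Function.Bijective.prod_comp hf (fun l => H (c l) (d l))).symm
  simp only [h]
  rw [sum_comp_bij hf (fun c => ∑ d : κ → Fin n, (∏ l, H (c l) ((d ∘ f) l)) *
    (s c * t (d ∘ f)))]
  refine Finset.sum_congr rfl fun c _ => ?_
  rw [sum_comp_bij hf (fun d => (∏ l, H (c l) (d l)) * (s c * t d))]

lemma act_relabC (J : Mat n) {f : ι → κ} (hf : Bijective f) (t : Comp n ι) :
    act J (relabC f t) = relabC f (act J t) := by
  funext c
  simp only [act, relabC]
  have h : ∀ d : κ → Fin n, ∏ l, J (d l) (c l) = ∏ l, J ((d ∘ f) l) ((c ∘ f) l) :=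
    fun d => (Function.Bijective.prod_comp hf (fun l => J (d l) (c l))).symm
  simp only [h]
  rw [sum_comp_bij hf (fun d => (∏ l, J (d l) ((c ∘ f) l)) * t d)]

lemma act_oc (J : Mat n) (t : Comp n (Option ι)) (a : Fin n) (c : ι → Fin n) :
    act J t (oc a c) = ∑ b, J b a * act J (fun d => t (oc b d)) c := by
  simp only [act, sum_oc, Fintype.prod_option, oc_none, oc_some, Finset.mul_sum, mul_assoc]

lemma trcC_act (H J : Mat n) (t : Comp n (Option (Option ι))) :
    trcC H (act J t) = act J (trcC (J * H * Jᵀ) t) := by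
  funext c
  have hr : act J (trcC (J * H * Jᵀ) t) c
      = ∑ a, ∑ b, (J * H * Jᵀ) a b * act J (fun d => t (oc a (oc b d))) c := by
    simp only [act, trcC, Finset.mul_sum]
    rw [Finset.sum_comm]
    refine Finset.sum_congr rfl fun a _ => ?_
    rw [Finset.sum_comm]
    exact Finset.sum_congr rfl fun a _ => Finset.sum_congr rfl fun a _ => by ring
  rw [hr]
  simp only [trcC, act_oc, Matrix.mul_apply, Matrix.transpose_apply, Finset.mul_sum,
    Finset.sum_mul]
  have h1 : ∀ F : Fin n → Fin n → Fin n → Fin n → ℝ,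
      ∑ a, ∑ b, ∑ p, ∑ q, F a b p q = ∑ p, ∑ q, ∑ b, ∑ a, F a b p q := by
    intro F
    calc _ = ∑ a, ∑ p, ∑ q, ∑ b, F a b p q := by
          refine Finset.sum_congr rfl fun a _ => ?_
          rw [Finset.sum_comm]
          exact Finset.sum_congr rfl fun p _ => Finset.sum_comm
      _ = ∑ p, ∑ q, ∑ a, ∑ b, F a b p q := by
          rw [Finset.sum_comm]
          exact Finset.sum_congr rfl fun p _ => Finset.sum_comm
      _ = _ := by
          exact Finset.sum_congr rfl fun p _ => Finset.sum_congr rfl fun q _ => Finset.sum_comm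
  rw [h1]
  exact Finset.sum_congr rfl fun p _ => Finset.sum_congr rfl fun q _ =>
    Finset.sum_congr rfl fun a _ => Finset.sum_congr rfl fun b _ => by ring

/-! ### Norms -/

-- With this factorization `act J` passes to an orthonormal frame, in which `ip H` becomes the
-- Euclidean product (`ip_mul_transpose`). Positivity, Cauchy–Schwarz and the bound on traces are
-- proved there.
open scoped MatrixOrder Matrix.Norms.L2Operator in
lemma posDef_eq_mul_transpose {H : Mat n} (hH : H.PosDef) :
    ∃ J : Mat n, IsUnit J.det ∧ H = J * Jᵀ := by
  obtain ⟨B, hB, h⟩ := CStarAlgebra.isStrictlyPositive_iff_eq_star_mul_self.mp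
        hH.isStrictlyPositive
  refine ⟨Bᵀ, ?_, ?_⟩
  · rw [Matrix.det_transpose]; exact (Matrix.isUnit_iff_isUnit_det B).1 hB
  · rw [h, Matrix.transpose_transpose, Matrix.star_eq_conjTranspose]
    rfl

lemma ip_mul_transpose (J : Mat n) (s t : Comp n ι) :
    ip (J * Jᵀ) s t = ∑ c, act J s c * act J t c := by
  rw [← ip_one, ip_act, Matrix.mul_one]

lemma ip_self_nonneg {H : Mat n} (hH : H.PosDef) (t : Comp n ι) : 0 ≤ ip H t t := by
  obtain ⟨J, -, rfl⟩ := posDef_eq_mul_transpose hH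
  rw [ip_mul_transpose]
  exact Finset.sum_nonneg fun c _ => mul_self_nonneg _

/-- The norm of a tensor. -/
def nrm (H : Mat n) (t : Comp n ι) : ℝ := Real.sqrt (ip H t t)

lemma nrm_nonneg (H : Mat n) (t : Comp n ι) : 0 ≤ nrm H t := Real.sqrt_nonneg _

lemma nrm_sq {H : Mat n} (hH : H.PosDef) (t : Comp n ι) : nrm H t ^ 2 = ip H t t :=
  Real.sq_sqrt (ip_self_nonneg hH t)

lemma abs_ip_le {H : Mat n} (hH : H.PosDef) (s t : Comp n ι) :
    |ip H s t| ≤ nrm H s * nrm H t := by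
  rw [← abs_of_nonneg (mul_nonneg (nrm_nonneg H s) (nrm_nonneg H t))]
  refine sq_le_sq.1 ?_
  rw [mul_pow, nrm_sq hH, nrm_sq hH]
  obtain ⟨J, -, rfl⟩ := posDef_eq_mul_transpose hH
  simp only [ip_mul_transpose]
  have := Finset.sum_mul_sq_le_sq_mul_sq Finset.univ (act J s) (act J t)
  simpa [sq] using this

lemma ip_symm {H : Mat n} (hH : H.PosDef) (s t : Comp n ι) : ip H s t = ip H t s := by
  rw [ip_comm]
  congr 1
  have := hH.1
  rwa [Matrix.IsHermitian, Matrix.conjTranspose_eq_transpose_of_trivial] at this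

lemma nrm_add_le {H : Mat n} (hH : H.PosDef) (s t : Comp n ι) :
    nrm H (s + t) ≤ nrm H s + nrm H t := by
  refine Real.sqrt_le_iff.2 ⟨add_nonneg (nrm_nonneg _ _) (nrm_nonneg _ _), ?_⟩
  rw [ip_add_left, ip_add_right, ip_add_right, ip_symm hH t s, ← nrm_sq hH s, ← nrm_sq hH t]
  have := (abs_le.1 (abs_ip_le hH s t)).2
  nlinarith

lemma nrm_smul (H : Mat n) (r : ℝ) (t : Comp n ι) : nrm H (r • t) = |r| * nrm H t := by
  rw [nrm, ip_smul_left, ip_smul_right, ← mul_assoc, ← sq, Real.sqrt_mul (sq_nonneg r),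
    Real.sqrt_sq_eq_abs, nrm]

lemma nrm_mulC {H : Mat n} (hH : H.PosDef) (s : Comp n ι) (t : Comp n κ) :
    nrm H (mulC s t) = nrm H s * nrm H t := by
  rw [nrm, ip_mulC, Real.sqrt_mul (ip_self_nonneg hH s)]; rfl

lemma nrm_relabC (H : Mat n) {f : ι → κ} (hf : Bijective f) (t : Comp n ι) :
    nrm H (relabC f t) = nrm H t := by
  rw [nrm, ip_relabC H hf]; rfl

/-- In an orthonormal frame a contraction is a sum of `n` diagonal components. Cauchy–Schwarz costs
the factor `√n`, and the diagonal components are some of the components of `t`. -/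
lemma nrm_trcC_le {H : Mat n} (hH : H.PosDef) (t : Comp n (Option (Option ι))) :
    nrm H (trcC H t) ≤ Real.sqrt n * nrm H t := by
  rw [nrm, nrm, ← Real.sqrt_mul (Nat.cast_nonneg n)]
  refine Real.sqrt_le_sqrt ?_
  obtain ⟨J, -, rfl⟩ := posDef_eq_mul_transpose hH
  simp only [ip_mul_transpose]
  have h : act J (trcC (J * Jᵀ) t) = trcC 1 (act J t) := by
    rw [trcC_act, Matrix.mul_one]
  rw [h]
  generalize act J t = u
  have h1 : ∀ c, trcC 1 u c = ∑ a, u (oc a (oc a c)) := by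
    intro c
    simp [trcC, Matrix.one_apply]
  simp only [h1, sum_oc (fun c => u c * u c)]
  simp only [sum_oc (fun c => u (oc _ c) * u (oc _ c))]
  calc ∑ c, (∑ a, u (oc a (oc a c))) * (∑ a, u (oc a (oc a c)))
      ≤ ∑ c, n * ∑ a, u (oc a (oc a c)) * u (oc a (oc a c)) := by
        refine Finset.sum_le_sum fun c _ => ?_
        have := sq_sum_le_card_mul_sum_sq (s := Finset.univ) (f := fun a => u (oc a (oc a c)))
        simpa [sq] using this
    _ = n * ∑ a, ∑ c, u (oc a (oc a c)) * u (oc a (oc a c)) := by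
        rw [← Finset.mul_sum, Finset.sum_comm]
    _ ≤ _ := by
        refine mul_le_mul_of_nonneg_left (Finset.sum_le_sum fun a _ => ?_) (Nat.cast_nonneg n)
        exact Finset.single_le_sum (f := fun b => ∑ c, u (oc a (oc b c)) * u (oc a (oc b c)))
          (fun b _ => Finset.sum_nonneg fun c _ => mul_self_nonneg _) (Finset.mem_univ a)

end Algebra

/-! ### Coordinate calculus -/

section Calculus

open Function Matrix

variable {n : ℕ} {ι κ : Type} [Fintype ι] [DecidableEq ι] [Fintype κ] [DecidableEq κ]

/-- Tensor fields with slots labelled by `ι`. -/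
abbrev TField (n : ℕ) (ι : Type) : Type := Coord n → Comp n ι

/-- Componentwise partial derivative of a tensor field. -/
def pd (i : Fin n) (T : TField n ι) : TField n ι := fun y c => partialDeriv i (fun z => T z c) y

/-- The matrix `(a, b) ↦ Γ^a_{ib}`. -/
def chrM (G : CMetric n) (i : Fin n) (y : Coord n) : Mat n :=
  Matrix.of fun a b => christoffel G a i b y

/-- The covariant derivative in the direction `i`. -/
def cov (G : CMetric n) (i : Fin n) (T : TField n ι) : TField n ι :=
  fun y => pd i T y - der (chrM G i y) (T y)

/-- The covariant derivative as a tensor, for arbitrary slot labels. -/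
def gcov (G : CMetric n) (T : TField n ι) : TField n (Option ι) :=
  fun y c => cov G (c none) T y (c ∘ some)

lemma gcov_oc (G : CMetric n) (T : TField n ι) (y : Coord n) (i : Fin n) (c : ι → Fin n) :
    gcov G T y (oc i c) = cov G i T y c := rfl

/-- The identification of slots `Option (Fin m) → Fin (m + 1)`. -/
def optFin (m : ℕ) : Option (Fin m) → Fin (m + 1) := fun o => o.elim 0 Fin.succ

lemma optFin_bijective (m : ℕ) : Bijective (optFin m) := by
  have : optFin m = (finSuccEquiv m).symm := by
    funext o; cases o <;> simp [optFin]
  rw [this]; exact Equiv.bijective _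

lemma covDeriv_eq_cov {m : ℕ} (G : CMetric n) (T : CTensor n m) (y : Coord n)
    (c : Fin (m + 1) → Fin n) : covDeriv G T y c = cov G (c 0) T y (Fin.tail c) := rfl

lemma covDeriv_eq_relabC {m : ℕ} (G : CMetric n) (T : CTensor n m) (y : Coord n) :
    covDeriv G T y = relabC (optFin m) (gcov G T y) := rfl

/-- `G` is a smooth Riemannian metric on the open set `U`. -/
structure RiemOn (G : CMetric n) (U : Set (Coord n)) : Prop where
  isOpen : IsOpen U
  smooth : ∀ i j, ContDiffOn ℝ ∞ (fun y => G y i j) U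
  posDef : ∀ y ∈ U, (G y).PosDef

/-- `𝒢` is a smooth family, indexed by `I`, of Riemannian metrics on the open set `U`. -/
structure RiemFam (𝒢 : ℝ → CMetric n) (I : Set ℝ) (U : Set (Coord n)) : Prop where
  uniqueDiff : UniqueDiffOn ℝ I
  isOpen : IsOpen U
  smooth : ∀ i j, ContDiffOn ℝ ∞ (fun q : ℝ × Coord n => 𝒢 q.1 q.2 i j) (I ×ˢ U)
  posDef : ∀ t ∈ I, ∀ y ∈ U, (𝒢 t y).PosDef

/-- Lets every smoothness statement be proved once, for families depending on time, and then be used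
for a single metric. -/
lemma RiemOn.fam {G : CMetric n} {U : Set (Coord n)} (h : RiemOn G U) :
    RiemFam (fun _ => G) Set.univ U where
  uniqueDiff := uniqueDiffOn_univ
  isOpen := h.isOpen
  smooth i j := (h.smooth i j).comp contDiff_snd.contDiffOn (fun _ hq => hq.2)
  posDef _ _ := h.posDef

lemma contDiffOn_slice {f : ℝ → Coord n → ℝ} {I : Set ℝ} {U : Set (Coord n)}
    (h : ContDiffOn ℝ ∞ (fun q : ℝ × Coord n => f q.1 q.2) (I ×ˢ U)) {t : ℝ} (ht : t ∈ I) :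
    ContDiffOn ℝ ∞ (f t) U :=
  h.comp (f := fun y => (t, y)) (contDiff_prodMk_right t).contDiffOn (fun _ hy => ⟨ht, hy⟩)

lemma RiemFam.riemOn {𝒢 : ℝ → CMetric n} {I : Set ℝ} {U : Set (Coord n)} (h : RiemFam 𝒢 I U)
    {t : ℝ} (ht : t ∈ I) : RiemOn (𝒢 t) U where
  isOpen := h.isOpen
  smooth i j := contDiffOn_slice (f := fun t y => 𝒢 t y i j) (h.smooth i j) ht
  posDef := h.posDef t ht

lemma RiemOn.symm {G : CMetric n} {U : Set (Coord n)} (h : RiemOn G U) {y : Coord n}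
    (hy : y ∈ U) (i j : Fin n) : G y i j = G y j i := by
  have := (h.posDef y hy).1
  rw [Matrix.IsHermitian, Matrix.conjTranspose_eq_transpose_of_trivial] at this
  exact congrFun (congrFun this j) i

lemma RiemOn.transpose {G : CMetric n} {U : Set (Coord n)} (h : RiemOn G U) {y : Coord n}
    (hy : y ∈ U) : (G y)ᵀ = G y := by
  ext i j; exact h.symm hy j i

lemma RiemOn.isUnit_det {G : CMetric n} {U : Set (Coord n)} (h : RiemOn G U) {y : Coord n}
    (hy : y ∈ U) : IsUnit (G y).det := (h.posDef y hy).det_pos.ne'.isUnit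

lemma RiemOn.inv_transpose {G : CMetric n} {U : Set (Coord n)} (h : RiemOn G U) {y : Coord n}
    (hy : y ∈ U) : ((G y)⁻¹)ᵀ = (G y)⁻¹ := by
  rw [Matrix.transpose_nonsing_inv, h.transpose hy]

section Smooth

variable {I : Set ℝ} {U : Set (Coord n)}

lemma hasFDerivAt_slice {f : ℝ → Coord n → ℝ} (hU : IsOpen U)
    (hf : ContDiffOn ℝ ∞ (fun q : ℝ × Coord n => f q.1 q.2) (I ×ˢ U)) {t : ℝ} (ht : t ∈ I)
    {y : Coord n} (hy : y ∈ U) :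
    HasFDerivAt (f t) ((fderivWithin ℝ (fun q : ℝ × Coord n => f q.1 q.2) (I ×ˢ U) (t, y)).comp
      (ContinuousLinearMap.inr ℝ ℝ (Coord n))) y := by
  have h1 : HasFDerivWithinAt (fun q : ℝ × Coord n => f q.1 q.2)
      (fderivWithin ℝ (fun q : ℝ × Coord n => f q.1 q.2) (I ×ˢ U) (t, y)) (I ×ˢ U) (t, y) :=
    ((hf.differentiableOn (by simp)) (t, y) ⟨ht, hy⟩).hasFDerivWithinAt
  have h2 : HasFDerivWithinAt (fun z : Coord n => (t, z))
      (ContinuousLinearMap.inr ℝ ℝ (Coord n)) U y := (hasFDerivAt_prodMk_right t y).hasFDerivWithinAt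
  exact (h1.comp (f := fun z : Coord n => (t, z)) y h2 (fun z hz => ⟨ht, hz⟩)).hasFDerivAt
    (hU.mem_nhds hy)

/-- The partial derivative is `fderivWithin` of the joint function applied to `(0, e_i)`. The set
`I` need not be open, since it will be `[0, T)`; unique differentiability of `I ×ˢ U` is what makes
`fderivWithin` smooth up to the initial time. -/
lemma contDiffOn_partialDeriv {f : ℝ → Coord n → ℝ} (hI : UniqueDiffOn ℝ I) (hU : IsOpen U)
    (hf : ContDiffOn ℝ ∞ (fun q : ℝ × Coord n => f q.1 q.2) (I ×ˢ U)) (i : Fin n) :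
    ContDiffOn ℝ ∞ (fun q : ℝ × Coord n => partialDeriv i (f q.1) q.2) (I ×ˢ U) := by
  have h1 : ContDiffOn ℝ ∞ (fderivWithin ℝ (fun q : ℝ × Coord n => f q.1 q.2) (I ×ˢ U))
      (I ×ˢ U) := hf.fderivWithin (hI.prod hU.uniqueDiffOn) (by simp)
  have h2 : ContDiffOn ℝ ∞ (fun q => fderivWithin ℝ (fun q : ℝ × Coord n => f q.1 q.2) (I ×ˢ U) q
      (0, EuclideanSpace.single i 1)) (I ×ˢ U) := h1.clm_apply contDiffOn_const
  refine h2.congr fun q hq => ?_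
  rw [partialDeriv, (hasFDerivAt_slice hU hf hq.1 hq.2).fderiv]
  simp

lemma contDiffOn_det {α : Type*} [NormedAddCommGroup α] [NormedSpace ℝ α] {S : Set α} {m : ℕ}
    {A : α → Matrix (Fin m) (Fin m) ℝ}
    (h : ∀ i j, ContDiffOn ℝ ∞ (fun q => A q i j) S) : ContDiffOn ℝ ∞ (fun q => (A q).det) S := by
  simp only [Matrix.det_apply']
  exact ContDiffOn.sum fun σ _ => contDiffOn_const.mul (contDiffOn_prod fun i _ => h _ _)

lemma contDiffOn_inv {α : Type*} [NormedAddCommGroup α] [NormedSpace ℝ α] {S : Set α}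
    {A : α → Mat n} (h : ∀ i j, ContDiffOn ℝ ∞ (fun q => A q i j) S)
    (h0 : ∀ q ∈ S, (A q).det ≠ 0) (i j : Fin n) : ContDiffOn ℝ ∞ (fun q => (A q)⁻¹ i j) S := by
  have hadj : ContDiffOn ℝ ∞ (fun q => (A q).adjugate i j) S := by
    simp only [Matrix.adjugate_apply]
    refine contDiffOn_det fun k l => ?_
    by_cases hk : k = j
    · subst hk; simp only [Matrix.updateRow_self]; exact contDiffOn_const
    · simp only [Matrix.updateRow_ne hk]; exact h k l
  have : ContDiffOn ℝ ∞ (fun q => ((A q).det)⁻¹ * (A q).adjugate i j) S :=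
    ((contDiffOn_det h).inv h0).mul hadj
  refine this.congr fun q hq => ?_
  rw [Matrix.inv_def, Matrix.smul_apply, Ring.inverse_eq_inv', smul_eq_mul]

lemma RiemFam.contDiffOn_inv {𝒢 : ℝ → CMetric n} (h : RiemFam 𝒢 I U) (i j : Fin n) :
    ContDiffOn ℝ ∞ (fun q : ℝ × Coord n => (𝒢 q.1 q.2)⁻¹ i j) (I ×ˢ U) :=
  CurvatureFlow.contDiffOn_inv (A := fun q : ℝ × Coord n => 𝒢 q.1 q.2) h.smooth
    (fun q hq => (h.posDef q.1 hq.1 q.2 hq.2).det_pos.ne') i j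

lemma RiemFam.contDiffOn_christoffel {𝒢 : ℝ → CMetric n} (h : RiemFam 𝒢 I U) (k i j : Fin n) :
    ContDiffOn ℝ ∞ (fun q : ℝ × Coord n => christoffel (𝒢 q.1) k i j q.2) (I ×ˢ U) := by
  have hp := fun i j k => contDiffOn_partialDeriv (f := fun t y => 𝒢 t y i j) h.uniqueDiff h.isOpen
    (h.smooth i j) k
  simp only [christoffel]
  exact contDiffOn_const.mul (ContDiffOn.sum fun l _ => (h.contDiffOn_inv k l).mul
    (((hp _ _ _).add (hp _ _ _)).sub (hp _ _ _)))

lemma contDiffOn_gcov {𝒢 : ℝ → CMetric n} (h : RiemFam 𝒢 I U) {T : ℝ → TField n ι}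
    (hT : ∀ c, ContDiffOn ℝ ∞ (fun q : ℝ × Coord n => T q.1 q.2 c) (I ×ˢ U)) (c : Option ι → Fin n) :
    ContDiffOn ℝ ∞ (fun q : ℝ × Coord n => gcov (𝒢 q.1) (T q.1) q.2 c) (I ×ˢ U) := by
  simp only [gcov, cov, pd, der, Pi.sub_apply]
  exact (contDiffOn_partialDeriv (f := fun t y => T t y _) h.uniqueDiff h.isOpen (hT _) _).sub
    (ContDiffOn.sum fun l _ => ContDiffOn.sum fun a _ =>
      (h.contDiffOn_christoffel _ _ _).mul (hT _))

end Smooth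

/-! ### Differentiation rules -/

lemma partialDeriv_add {f g : Coord n → ℝ} {y : Coord n} (i : Fin n)
    (hf : DifferentiableAt ℝ f y) (hg : DifferentiableAt ℝ g y) :
    partialDeriv i (fun z => f z + g z) y = partialDeriv i f y + partialDeriv i g y := by
  simp [partialDeriv, fderiv_fun_add hf hg]

lemma partialDeriv_sub {f g : Coord n → ℝ} {y : Coord n} (i : Fin n)
    (hf : DifferentiableAt ℝ f y) (hg : DifferentiableAt ℝ g y) :
    partialDeriv i (fun z => f z - g z) y = partialDeriv i f y - partialDeriv i g y := by
  simp [partialDeriv, fderiv_fun_sub hf hg]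

lemma partialDeriv_mul {f g : Coord n → ℝ} {y : Coord n} (i : Fin n)
    (hf : DifferentiableAt ℝ f y) (hg : DifferentiableAt ℝ g y) :
    partialDeriv i (fun z => f z * g z) y
      = partialDeriv i f y * g y + f y * partialDeriv i g y := by
  simp [partialDeriv, fderiv_fun_mul hf hg]; ring

lemma partialDeriv_const (i : Fin n) (r : ℝ) (y : Coord n) :
    partialDeriv i (fun _ => r) y = 0 := by
  simp [partialDeriv]

lemma partialDeriv_const_mul {f : Coord n → ℝ} {y : Coord n} (i : Fin n) (r : ℝ)
    (hf : DifferentiableAt ℝ f y) :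
    partialDeriv i (fun z => r * f z) y = r * partialDeriv i f y := by
  rw [partialDeriv_mul i (differentiableAt_const r) hf, partialDeriv_const]; ring

lemma partialDeriv_sum {α : Type*} (s : Finset α) {f : α → Coord n → ℝ} {y : Coord n} (i : Fin n)
    (hf : ∀ a ∈ s, DifferentiableAt ℝ (f a) y) :
    partialDeriv i (fun z => ∑ a ∈ s, f a z) y = ∑ a ∈ s, partialDeriv i (f a) y := by
  simp [partialDeriv, fderiv_fun_sum hf]

lemma partialDeriv_prod {α : Type*} [DecidableEq α] (s : Finset α) {f : α → Coord n → ℝ}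
    {y : Coord n} (i : Fin n) (hf : ∀ a ∈ s, DifferentiableAt ℝ (f a) y) :
    partialDeriv i (fun z => ∏ a ∈ s, f a z) y
      = ∑ a ∈ s, partialDeriv i (f a) y * ∏ b ∈ s.erase a, f b y := by
  have h := HasFDerivAt.finsetProd (u := s) (g := f) (x := y)
    (fun a ha => (hf a ha).hasFDerivAt)
  simp [partialDeriv, h.fderiv, mul_comm]

lemma Filter.EventuallyEq.partialDeriv_eq {f g : Coord n → ℝ} {y : Coord n}
    (h : f =ᶠ[nhds y] g) (i : Fin n) : partialDeriv i f y = partialDeriv i g y := by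
  rw [partialDeriv, h.fderiv_eq, partialDeriv]

/-- Symmetry of second derivatives. -/
lemma partialDeriv_comm {f : Coord n → ℝ} {U : Set (Coord n)} (hU : IsOpen U)
    (hf : ContDiffOn ℝ ∞ f U) {y : Coord n} (hy : y ∈ U) (i j : Fin n) :
    partialDeriv i (partialDeriv j f) y = partialDeriv j (partialDeriv i f) y := by
  have hd : ContDiffAt ℝ ∞ f y := hf.contDiffAt (hU.mem_nhds hy)
  have hs : IsSymmSndFDerivAt ℝ f y := hd.isSymmSndFDerivAt (by
    simp only [minSmoothness_of_isRCLikeNormedField]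
    exact WithTop.coe_le_coe.2 (le_top (a := (2 : ℕ∞))))
  have hdf : DifferentiableAt ℝ (fderiv ℝ f) y :=
    (hd.fderiv_right (m := ∞) (by simp)).differentiableAt (by simp)
  have h : ∀ i j : Fin n, partialDeriv i (partialDeriv j f) y
      = fderiv ℝ (fderiv ℝ f) y (EuclideanSpace.single i 1) (EuclideanSpace.single j 1) := by
    intro i j
    have : partialDeriv j f = fun z => fderiv ℝ f z (EuclideanSpace.single j 1) := rfl
    rw [partialDeriv, this, fderiv_clm_apply hdf (differentiableAt_const _)]
    simp
  rw [h, h]; exact hs _ _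

/-- The Jacobian matrix. -/
def Jac (φ : Coord n → Coord n) (y : Coord n) : Mat n :=
  Matrix.of fun a i => partialDeriv i (fun z => φ z a) y

lemma fderiv_apply_coord {φ : Coord n → Coord n} {y : Coord n} (hφ : DifferentiableAt ℝ φ y)
    (v : Coord n) (a : Fin n) : fderiv ℝ (fun z => φ z a) y v = (fderiv ℝ φ y v) a := by
  have h := ((EuclideanSpace.proj (𝕜 := ℝ) a).hasFDerivAt (x := φ y)).comp y hφ.hasFDerivAt
  have e : (fun z => φ z a) = (EuclideanSpace.proj (𝕜 := ℝ) a) ∘ φ := rfl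
  rw [e, h.fderiv]; rfl

lemma fderiv_single {φ : Coord n → Coord n} {y : Coord n} (hφ : DifferentiableAt ℝ φ y)
    (i : Fin n) : fderiv ℝ φ y (EuclideanSpace.single i 1)
      = ∑ a, Jac φ y a i • EuclideanSpace.single a (1 : ℝ) := by
  ext b
  simp [Jac, partialDeriv, fderiv_apply_coord hφ, Finset.sum_apply, Pi.single_apply]

lemma partialDeriv_comp {f : Coord n → ℝ} {φ : Coord n → Coord n} {y : Coord n}
    (hf : DifferentiableAt ℝ f (φ y)) (hφ : DifferentiableAt ℝ φ y) (i : Fin n) :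
    partialDeriv i (fun z => f (φ z)) y = ∑ a, Jac φ y a i * partialDeriv a f (φ y) := by
  have h := hf.hasFDerivAt.comp y hφ.hasFDerivAt
  have e : (fun z => f (φ z)) = f ∘ φ := rfl
  rw [partialDeriv, e, h.fderiv, ContinuousLinearMap.comp_apply, fderiv_single hφ, map_sum]
  simp [partialDeriv]

end Calculus

/-! ### Change of coordinates -/

section Pullback

open Function Matrix

variable {n : ℕ} {ι κ : Type} [Fintype ι] [DecidableEq ι] [Fintype κ] [DecidableEq κ]

/-- `φ` is a smooth map from `W` to `U` with invertible differential. -/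
structure LDiffeo (φ : Coord n → Coord n) (W U : Set (Coord n)) : Prop where
  isOpen : IsOpen W
  smooth : ContDiffOn ℝ ∞ φ W
  mapsTo : Set.MapsTo φ W U
  isUnit : ∀ z ∈ W, IsUnit (Jac φ z).det

/-- Pullback of a metric. -/
def pullG (φ : Coord n → Coord n) (G : CMetric n) : CMetric n :=
  fun z => (Jac φ z)ᵀ * G (φ z) * Jac φ z

/-- Pullback of a tensor field. -/
def pullT (φ : Coord n → Coord n) (T : TField n ι) : TField n ι :=
  fun z => act (Jac φ z) (T (φ z))

namespace LDiffeo

variable {φ : Coord n → Coord n} {W U : Set (Coord n)}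

lemma differentiableAt (h : LDiffeo φ W U) {z : Coord n} (hz : z ∈ W) :
    DifferentiableAt ℝ φ z :=
  (h.smooth.contDiffAt (h.isOpen.mem_nhds hz)).differentiableAt (by simp)

lemma contDiffOn_coord (h : LDiffeo φ W U) (a : Fin n) : ContDiffOn ℝ ∞ (fun z => φ z a) W :=
  (EuclideanSpace.proj (𝕜 := ℝ) a).contDiff.comp_contDiffOn h.smooth

lemma contDiffOn_Jac (h : LDiffeo φ W U) (a i : Fin n) :
    ContDiffOn ℝ ∞ (fun z => Jac φ z a i) W := by
  have h1 := contDiffOn_partialDeriv (f := fun _ z => φ z a) (I := Set.univ) (U := W)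
    uniqueDiffOn_univ h.isOpen
    ((h.contDiffOn_coord a).comp contDiff_snd.contDiffOn (fun _ hq => hq.2)) i
  exact contDiffOn_slice (f := fun _ z => partialDeriv i (fun z => φ z a) z) h1 (Set.mem_univ 0)

lemma Jac_differentiableAt (h : LDiffeo φ W U) {z : Coord n} (hz : z ∈ W) (a i : Fin n) :
    DifferentiableAt ℝ (fun z => Jac φ z a i) z :=
  ((h.contDiffOn_Jac a i).contDiffAt (h.isOpen.mem_nhds hz)).differentiableAt (by simp)

lemma Jac_symm (h : LDiffeo φ W U) {z : Coord n} (hz : z ∈ W) (a i j : Fin n) :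
    partialDeriv i (fun z => Jac φ z a j) z = partialDeriv j (fun z => Jac φ z a i) z :=
  partialDeriv_comm h.isOpen (h.contDiffOn_coord a) hz i j

lemma comp_differentiableAt (h : LDiffeo φ W U) {f : Coord n → ℝ} {z : Coord n} (hz : z ∈ W)
    (hf : DifferentiableAt ℝ f (φ z)) : DifferentiableAt ℝ (fun z => f (φ z)) z :=
  hf.comp z (h.differentiableAt hz)

end LDiffeo

lemma RiemOn.differentiableAt {G : CMetric n} {U : Set (Coord n)} (h : RiemOn G U) {y : Coord n}
    (hy : y ∈ U) (i j : Fin n) : DifferentiableAt ℝ (fun y => G y i j) y :=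
  ((h.smooth i j).contDiffAt (h.isOpen.mem_nhds hy)).differentiableAt (by simp)

lemma LDiffeo.riemOn {φ : Coord n → Coord n} {W U : Set (Coord n)} (h : LDiffeo φ W U)
    {G : CMetric n} (hG : RiemOn G U) : RiemOn (pullG φ G) W where
  isOpen := h.isOpen
  smooth i j := by
    simp only [pullG, Matrix.mul_apply, Matrix.transpose_apply]
    exact ContDiffOn.sum fun k _ => (ContDiffOn.sum fun l _ => (h.contDiffOn_Jac _ _).mul
      ((hG.smooth _ _).comp h.smooth h.mapsTo)).mul (h.contDiffOn_Jac _ _)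
  posDef z hz := by
    have := (hG.posDef _ (h.mapsTo hz)).conjTranspose_mul_mul_same (B := Jac φ z)
      (Matrix.mulVec_injective_iff_isUnit.2 ((Matrix.isUnit_iff_isUnit_det _).2 (h.isUnit z hz)))
    rwa [Matrix.conjTranspose_eq_transpose_of_trivial] at this

lemma pullG_inv {φ : Coord n → Coord n} {W U : Set (Coord n)} (h : LDiffeo φ W U)
    (G : CMetric n) {z : Coord n} (hz : z ∈ W) :
    Jac φ z * (pullG φ G z)⁻¹ * (Jac φ z)ᵀ = (G (φ z))⁻¹ := by
  have hJ := h.isUnit z hz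
  have hJt : IsUnit ((Jac φ z)ᵀ).det := by rwa [Matrix.det_transpose]
  rw [pullG, Matrix.mul_inv_rev, Matrix.mul_inv_rev, Matrix.mul_assoc, Matrix.mul_assoc,
    Matrix.nonsing_inv_mul_cancel_right _ _ hJt, Matrix.mul_nonsing_inv_cancel_left _ _ hJ]

/-- Partial derivatives of the Jacobian matrix. -/
def dJac (φ : Coord n → Coord n) (i : Fin n) (z : Coord n) : Mat n :=
  Matrix.of fun a j => partialDeriv i (fun z => Jac φ z a j) z

/-- Christoffel symbols of the first kind. -/
def chrL (G : CMetric n) (i : Fin n) (y : Coord n) : Mat n :=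
  Matrix.of fun l j => (1 / 2) * (partialDeriv i (fun z => G z j l) y
    + partialDeriv j (fun z => G z i l) y - partialDeriv l (fun z => G z i j) y)

lemma chrM_eq (G : CMetric n) (i : Fin n) (y : Coord n) : chrM G i y = (G y)⁻¹ * chrL G i y := by
  ext a b
  simp only [chrM, chrL, christoffel, Matrix.of_apply, Matrix.mul_apply, Finset.mul_sum]
  exact Finset.sum_congr rfl fun l _ => by ring

lemma partialDeriv_pullG {φ : Coord n → Coord n} {W U : Set (Coord n)} (h : LDiffeo φ W U)
    {G : CMetric n} (hG : RiemOn G U) {z : Coord n} (hz : z ∈ W) (i j l : Fin n) :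
    partialDeriv i (fun z => pullG φ G z j l) z
      = ((Jac φ z)ᵀ * G (φ z) * dJac φ i z) l j + ((Jac φ z)ᵀ * G (φ z) * dJac φ i z) j l
        + ∑ a, ∑ b, ∑ c, Jac φ z a i * Jac φ z b j * Jac φ z c l
            * partialDeriv a (fun y => G y b c) (φ z) := by
  have hJ := fun a i => h.Jac_differentiableAt hz a i
  have hg := fun a b => hG.differentiableAt (h.mapsTo hz) a b
  have hgc := fun a b => h.comp_differentiableAt hz (hg a b)
  have e1 : (fun z => pullG φ G z j l)
      = fun z => ∑ c, ∑ b, Jac φ z b j * G (φ z) b c * Jac φ z c l := by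
    funext z; simp [pullG, Matrix.mul_apply, Finset.sum_mul]
  rw [e1, partialDeriv_sum _ _ (fun c _ => DifferentiableAt.fun_sum
    fun b _ => ((hJ b j).fun_mul (hgc b c)).fun_mul (hJ c l))]
  have e2 : ∀ c, partialDeriv i (fun z => ∑ b, Jac φ z b j * G (φ z) b c * Jac φ z c l) z
      = ∑ b, (dJac φ i z b j * G (φ z) b c * Jac φ z c l
        + Jac φ z b j * G (φ z) b c * dJac φ i z c l
        + ∑ a, Jac φ z a i * Jac φ z b j * Jac φ z c l
            * partialDeriv a (fun y => G y b c) (φ z)) := by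
    intro c
    rw [partialDeriv_sum _ _ (fun b _ => ((hJ b j).fun_mul (hgc b c)).fun_mul (hJ c l))]
    refine Finset.sum_congr rfl fun b _ => ?_
    rw [partialDeriv_mul i ((hJ b j).fun_mul (hgc b c)) (hJ c l), partialDeriv_mul i (hJ b j) (hgc b c),
      partialDeriv_comp (hg b c) (h.differentiableAt hz)]
    simp only [dJac, Matrix.of_apply, Finset.mul_sum, add_mul, Finset.sum_mul]
    have : ∀ A B C D : ℝ, A = D → A + B + C = A + C + B := by intros; ring
    rw [add_right_comm]
    congr 1
    exact Finset.sum_congr rfl fun a _ => by ring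
  simp only [e2, Finset.sum_add_distrib]
  congr 1
  · congr 1
    · simp only [Matrix.mul_apply, Matrix.transpose_apply, Finset.sum_mul]
      rw [Finset.sum_comm]
      refine Finset.sum_congr rfl fun b _ => Finset.sum_congr rfl fun c _ => ?_
      rw [hG.symm (h.mapsTo hz) b c]; ring
    · simp only [Matrix.mul_apply, Matrix.transpose_apply, Finset.sum_mul]
  · rw [Finset.sum_comm' (t' := Finset.univ) (s' := fun _ => Finset.univ) (by simp)]
    rw [Finset.sum_comm]
    conv_rhs => rw [Finset.sum_comm]
    conv_rhs => enter [2, b]; rw [Finset.sum_comm]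
    rw [Finset.sum_comm]

lemma sum3_swap {α : Type*} [Fintype α] (F : α → α → α → ℝ) :
    ∑ a, ∑ b, ∑ c, F a b c = ∑ b, ∑ a, ∑ c, F a b c := Finset.sum_comm

/-- The Koszul combination contains six terms with second derivatives of `φ`. By symmetry of second
derivatives four of them cancel and the other two merge into the inhomogeneous term. -/
lemma chrL_pullG {φ : Coord n → Coord n} {W U : Set (Coord n)} (h : LDiffeo φ W U)
    {G : CMetric n} (hG : RiemOn G U) {z : Coord n} (hz : z ∈ W) (i : Fin n) :
    chrL (pullG φ G) i z = (Jac φ z)ᵀ * G (φ z) * dJac φ i z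
      + ∑ a, Jac φ z a i • ((Jac φ z)ᵀ * chrL G a (φ z) * Jac φ z) := by
  have hs : ∀ l i j, ((Jac φ z)ᵀ * G (φ z) * dJac φ i z) l j
      = ((Jac φ z)ᵀ * G (φ z) * dJac φ j z) l i := by
    intro l i j
    simp only [Matrix.mul_apply]
    refine Finset.sum_congr rfl fun b _ => ?_
    rw [dJac, dJac, Matrix.of_apply, Matrix.of_apply, h.Jac_symm hz]
  have hS : ∀ l j, (∑ a, Jac φ z a i • ((Jac φ z)ᵀ * chrL G a (φ z) * Jac φ z)) l j
      = ∑ a, ∑ b, ∑ c, Jac φ z a i * Jac φ z b j * Jac φ z c l * chrL G a (φ z) c b := by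
    intro l j
    simp only [Matrix.sum_apply, Matrix.smul_apply, Matrix.mul_apply, Matrix.transpose_apply,
      smul_eq_mul, Finset.mul_sum, Finset.sum_mul]
    exact Finset.sum_congr rfl fun a _ => Finset.sum_congr rfl fun b _ =>
      Finset.sum_congr rfl fun c _ => by ring
  ext l j
  rw [Matrix.add_apply, hS]
  simp only [chrL, Matrix.of_apply]
  rw [partialDeriv_pullG h hG hz, partialDeriv_pullG h hG hz, partialDeriv_pullG h hG hz]
  rw [hs j l i, hs l j i, hs i j l]
  have q2 : ∑ a, ∑ b, ∑ c, Jac φ z a j * Jac φ z b i * Jac φ z c l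
        * partialDeriv a (fun y => G y b c) (φ z)
      = ∑ a, ∑ b, ∑ c, Jac φ z a i * Jac φ z b j * Jac φ z c l
        * partialDeriv b (fun y => G y a c) (φ z) := by
    rw [sum3_swap]
    exact Finset.sum_congr rfl fun a _ => Finset.sum_congr rfl fun b _ =>
      Finset.sum_congr rfl fun c _ => by ring
  have q3 : ∑ a, ∑ b, ∑ c, Jac φ z a l * Jac φ z b i * Jac φ z c j
        * partialDeriv a (fun y => G y b c) (φ z)
      = ∑ a, ∑ b, ∑ c, Jac φ z a i * Jac φ z b j * Jac φ z c l
        * partialDeriv c (fun y => G y a b) (φ z) := by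
    rw [sum3_swap]
    refine Finset.sum_congr rfl fun a _ => ?_
    rw [Finset.sum_comm]
    exact Finset.sum_congr rfl fun b _ => Finset.sum_congr rfl fun c _ => by ring
  rw [q2, q3]
  have e : ∀ A B C X Y Z S : ℝ, S = (1 / 2) * (X + Y - Z) →
      1 / 2 * (B + A + X + (B + C + Y) - (A + C + Z)) = B + S := by
    intros A B C X Y Z S hS; rw [hS]; ring
  apply e
  simp only [← Finset.sum_add_distrib, ← Finset.sum_sub_distrib, Finset.mul_sum]
  exact Finset.sum_congr rfl fun a _ => Finset.sum_congr rfl fun b _ =>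
      Finset.sum_congr rfl fun c _ => by ring

/-- The transformation law of the Christoffel symbols. -/
lemma chrM_pullG {φ : Coord n → Coord n} {W U : Set (Coord n)} (h : LDiffeo φ W U)
    {G : CMetric n} (hG : RiemOn G U) {z : Coord n} (hz : z ∈ W) (i : Fin n) :
    chrM (pullG φ G) i z = (Jac φ z)⁻¹ * dJac φ i z
      + ∑ a, Jac φ z a i • ((Jac φ z)⁻¹ * chrM G a (φ z) * Jac φ z) := by
  have hJt : IsUnit ((Jac φ z)ᵀ).det := by
    rw [Matrix.det_transpose]; exact h.isUnit z hz
  have hg := hG.isUnit_det (h.mapsTo hz)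
  have key : ∀ A : Mat n, (pullG φ G z)⁻¹ * ((Jac φ z)ᵀ * A) = (Jac φ z)⁻¹ * ((G (φ z))⁻¹ * A) := by
    intro A
    rw [pullG, Matrix.mul_inv_rev, Matrix.mul_inv_rev, Matrix.mul_assoc, Matrix.mul_assoc,
      Matrix.nonsing_inv_mul_cancel_left _ _ hJt]
  rw [chrM_eq, chrL_pullG h hG hz, Matrix.mul_add, Matrix.mul_assoc, key,
    Matrix.nonsing_inv_mul_cancel_left _ _ hg, Matrix.mul_sum]
  congr 1
  refine Finset.sum_congr rfl fun a _ => ?_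
  rw [Matrix.mul_smul, Matrix.mul_assoc, key, chrM_eq]
  simp only [Matrix.mul_assoc]

lemma pd_pullT {φ : Coord n → Coord n} {W U : Set (Coord n)} (h : LDiffeo φ W U)
    {T : TField n ι} {z : Coord n} (hz : z ∈ W)
    (hT : ∀ c, DifferentiableAt ℝ (fun y => T y c) (φ z)) (i : Fin n) :
    pd i (pullT φ T) z = actD (Jac φ z) (dJac φ i z) (T (φ z))
      + ∑ b, Jac φ z b i • act (Jac φ z) (pd b T (φ z)) := by
  have hJ := fun a i => h.Jac_differentiableAt hz a i
  have hTc := fun c => h.comp_differentiableAt hz (hT c)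
  funext c
  simp only [pd, pullT, act, actD, Pi.add_apply, Finset.sum_apply, Pi.smul_apply, smul_eq_mul]
  have hp : ∀ d : ι → Fin n, DifferentiableAt ℝ (fun z => ∏ l, Jac φ z (d l) (c l)) z :=
    fun d => (HasFDerivAt.finsetProd (u := Finset.univ) (g := fun l z => Jac φ z (d l) (c l))
      (fun l _ => (hJ (d l) (c l)).hasFDerivAt)).differentiableAt
  rw [partialDeriv_sum _ _ (fun d _ => (hp d).fun_mul (hTc d))]
  simp only [Finset.mul_sum]
  conv_rhs => rw [Finset.sum_comm' (s := Finset.univ) (t := fun _ => Finset.univ)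
    (t' := Finset.univ) (s' := fun _ => Finset.univ) (by simp)]
  rw [← Finset.sum_add_distrib]
  refine Finset.sum_congr rfl fun d _ => ?_
  rw [partialDeriv_mul i (hp d) (hTc d), partialDeriv_prod _ _ (fun l _ => hJ _ _),
    partialDeriv_comp (hT d) (h.differentiableAt hz)]
  simp only [dJac, Matrix.of_apply, Finset.mul_sum]
  congr 1
  exact Finset.sum_congr rfl fun b _ => by ring

/-- Covariance of the covariant derivative. -/
lemma cov_pull {φ : Coord n → Coord n} {W U : Set (Coord n)} (h : LDiffeo φ W U)
    {G : CMetric n} (hG : RiemOn G U) {T : TField n ι} {z : Coord n} (hz : z ∈ W)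
    (hT : ∀ c, DifferentiableAt ℝ (fun y => T y c) (φ z)) (i : Fin n) :
    cov (pullG φ G) i (pullT φ T) z = ∑ b, Jac φ z b i • act (Jac φ z) (cov G b T (φ z)) := by
  have hJ := h.isUnit z hz
  -- The inhomogeneous part of the Christoffel symbols acts as `actD` in the direction `dJac`, which
  -- is exactly the term that comes from differentiating the Jacobian in the pullback.
  rw [cov, pd_pullT h hz hT, chrM_pullG h hG hz, der_add_left, pullT, der_act,
    Matrix.mul_nonsing_inv_cancel_left _ _ hJ, der_sum_left]
  simp only [der_smul_left, cov, act_sub, smul_sub, Finset.sum_sub_distrib, act_der_conj _ _ hJ]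
  abel

lemma gcov_pull {φ : Coord n → Coord n} {W U : Set (Coord n)} (h : LDiffeo φ W U)
    {G : CMetric n} (hG : RiemOn G U) {T : TField n ι} {z : Coord n} (hz : z ∈ W)
    (hT : ∀ c, DifferentiableAt ℝ (fun y => T y c) (φ z)) :
    gcov (pullG φ G) (pullT φ T) z = act (Jac φ z) (gcov G T (φ z)) := by
  funext c
  conv_lhs => rw [← oc_eta c]
  conv_rhs => rw [← oc_eta c, act_oc]
  rw [gcov_oc, cov_pull h hG hz hT]
  simp only [Finset.sum_apply, Pi.smul_apply, smul_eq_mul]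
  rfl

end Pullback

/-! ### One-dimensional product rules -/

section Rules

open Function Matrix

variable {n : ℕ} {ι κ : Type} [Fintype ι] [DecidableEq ι] [Fintype κ] [DecidableEq κ]

lemma hasDerivAt_ip {H : ℝ → Mat n} {H' : Mat n} {s t : ℝ → Comp n ι} {s' t' : Comp n ι} {x : ℝ}
    (hH : ∀ i j, HasDerivAt (fun r => H r i j) (H' i j) x)
    (hs : ∀ c, HasDerivAt (fun r => s r c) (s' c) x)
    (ht : ∀ c, HasDerivAt (fun r => t r c) (t' c) x) :
    HasDerivAt (fun r => ip (H r) (s r) (t r))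
      (ipD (H x) H' (s x) (t x) + ip (H x) s' (t x) + ip (H x) (s x) t') x := by
  have hp : ∀ c d : ι → Fin n, HasDerivAt (fun r => ∏ l, H r (c l) (d l))
      (∑ l, H' (c l) (d l) * ∏ m ∈ Finset.univ.erase l, H x (c m) (d m)) x := by
    intro c d
    have := HasDerivAt.fun_finsetProd (u := Finset.univ) (f := fun l r => H r (c l) (d l))
      (f' := fun l => H' (c l) (d l)) (x := x) (fun l _ => hH (c l) (d l))
    simpa [mul_comm] using this
  have h := HasDerivAt.fun_sum (u := Finset.univ) fun c _ => HasDerivAt.fun_sum (u := Finset.univ)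
    fun d _ => (hp c d).fun_mul ((hs c).fun_mul (ht d))
  refine h.congr_deriv ?_
  simp only [ip, ipD, ← Finset.sum_add_distrib]
  exact Finset.sum_congr rfl fun c _ => Finset.sum_congr rfl fun d _ => by ring

lemma differentiableAt_inv {A : ℝ → Mat n} {x : ℝ}
    (hA : ∀ i j, DifferentiableAt ℝ (fun r => A r i j) x) (h0 : (A x).det ≠ 0) (i j : Fin n) :
    DifferentiableAt ℝ (fun r => (A r)⁻¹ i j) x := by
  have h1 : ContDiffOn ℝ ∞ (fun B : Fin n → Fin n → ℝ => (Matrix.of B)⁻¹ i j)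
      {B | (Matrix.of B).det ≠ 0} :=
    contDiffOn_inv (A := fun B : Fin n → Fin n → ℝ => Matrix.of B)
      (fun i j => by
        have : ContDiff ℝ ∞ (fun B : Fin n → Fin n → ℝ => B i j) :=
          (contDiff_apply ℝ ℝ j).comp (contDiff_apply ℝ (Fin n → ℝ) i)
        exact this.contDiffOn) (fun _ h => h) i j
  have ho : IsOpen {B : Fin n → Fin n → ℝ | (Matrix.of B).det ≠ 0} := by
    refine isOpen_ne_fun ?_ continuous_const
    exact Continuous.matrix_det (continuous_id)
  have h2 : DifferentiableAt ℝ (fun B : Fin n → Fin n → ℝ => (Matrix.of B)⁻¹ i j) (A x) :=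
    (h1.contDiffAt (ho.mem_nhds h0)).differentiableAt (by simp)
  have h3 : DifferentiableAt ℝ (fun r => (A r : Fin n → Fin n → ℝ)) x :=
    differentiableAt_pi.2 fun i => differentiableAt_pi.2 fun j => hA i j
  exact h2.comp x h3

/-- Differentiability is already known, so the value of the derivative is forced by differentiating
`A A⁻¹ = 1`. -/
lemma hasDerivAt_inv {A : ℝ → Mat n} {A' : Mat n} {x : ℝ}
    (hA : ∀ i j, HasDerivAt (fun r => A r i j) (A' i j) x) (h0 : (A x).det ≠ 0) (i j : Fin n) :
    HasDerivAt (fun r => (A r)⁻¹ i j) ((-((A x)⁻¹ * A' * (A x)⁻¹)) i j) x := by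
  have hB := fun i j => (differentiableAt_inv (fun i j => (hA i j).differentiableAt) h0 i j).hasDerivAt
  set B' : Mat n := Matrix.of fun i j => deriv (fun r => (A r)⁻¹ i j) x with hB'
  have hdet : ∀ᶠ r in nhds x, (A r).det ≠ 0 := by
    have hc : ContinuousAt (fun r => (A r).det) x := by
      simp only [Matrix.det_apply']
      exact tendsto_finsetSum _ fun σ _ => tendsto_const_nhds.mul
        (tendsto_finsetProd _ fun i _ => (hA _ _).continuousAt)
    exact hc.eventually_ne h0
  have h1 : A' * (A x)⁻¹ + A x * B' = 0 := by
    ext i j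
    have h := HasDerivAt.fun_sum (u := Finset.univ) fun k _ => (hA i k).fun_mul (hB k j)
    have e : (fun r => ∑ k, A r i k * (A r)⁻¹ k j) =ᶠ[nhds x] fun _ => (1 : Mat n) i j := by
      filter_upwards [hdet] with r hr
      rw [← Matrix.mul_apply, Matrix.mul_nonsing_inv _ hr.isUnit]
    have h' := (h.congr_of_eventuallyEq e.symm).unique (hasDerivAt_const x ((1 : Mat n) i j))
    simpa [Matrix.mul_apply, Matrix.add_apply, Finset.sum_add_distrib, hB'] using h'
  have h2 : B' = -((A x)⁻¹ * A' * (A x)⁻¹) := by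
    have h3 : A x * B' = -(A' * (A x)⁻¹) := by
      rw [← sub_eq_zero, sub_neg_eq_add, add_comm]; exact h1
    have h4 := congrArg (fun M => (A x)⁻¹ * M) h3
    simp only [Matrix.nonsing_inv_mul_cancel_left _ _ h0.isUnit] at h4
    rw [h4, Matrix.mul_neg, Matrix.mul_assoc]
  rw [← h2]
  exact hB i j

/-- The line through `y` in the direction `e_i`. -/
def lineAt (y : Coord n) (i : Fin n) (s : ℝ) : Coord n := y + s • EuclideanSpace.single i (1 : ℝ)

@[simp] lemma lineAt_zero (y : Coord n) (i : Fin n) : lineAt y i 0 = y := by simp [lineAt]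

lemma hasDerivAt_line {f : Coord n → ℝ} {y : Coord n} (hf : DifferentiableAt ℝ f y) (i : Fin n) :
    HasDerivAt (fun s => f (lineAt y i s)) (partialDeriv i f y) 0 := by
  have h1 : HasDerivAt (lineAt y i) (EuclideanSpace.single i (1 : ℝ)) 0 := by
    have h := ((hasDerivAt_id (0 : ℝ)).smul_const
      (EuclideanSpace.single i (1 : ℝ) : Coord n)).const_add y
    rw [one_smul] at h
    exact h
  have h2 : HasFDerivAt f (fderiv ℝ f y) (lineAt y i 0) := by simpa using hf.hasFDerivAt
  exact h2.comp_hasDerivAt 0 h1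

/-- Partial derivatives of a matrix-valued function. -/
def pdM (i : Fin n) (A : Coord n → Mat n) (y : Coord n) : Mat n :=
  Matrix.of fun a b => partialDeriv i (fun z => A z a b) y

/-- Differentiability of a matrix-valued function, entry by entry. -/
def DiffM (A : Coord n → Mat n) (y : Coord n) : Prop :=
  ∀ a b, DifferentiableAt ℝ (fun z => A z a b) y

lemma DiffM.mul {A B : Coord n → Mat n} {y : Coord n} (hA : DiffM A y) (hB : DiffM B y) :
    DiffM (fun z => A z * B z) y := by
  intro a b
  simp only [Matrix.mul_apply]
  exact DifferentiableAt.fun_sum fun k _ => (hA a k).fun_mul (hB k b)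

lemma pdM_mul (i : Fin n) {A B : Coord n → Mat n} {y : Coord n} (hA : DiffM A y)
    (hB : DiffM B y) :
    pdM i (fun z => A z * B z) y = pdM i A y * B y + A y * pdM i B y := by
  ext a b
  simp only [pdM, Matrix.of_apply, Matrix.add_apply, Matrix.mul_apply]
  rw [partialDeriv_sum _ _ (fun k _ => (hA a k).fun_mul (hB k b)), ← Finset.sum_add_distrib]
  exact Finset.sum_congr rfl fun k _ => partialDeriv_mul i (hA a k) (hB k b)

lemma pdM_add (i : Fin n) {A B : Coord n → Mat n} {y : Coord n} (hA : DiffM A y)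
    (hB : DiffM B y) : pdM i (fun z => A z + B z) y = pdM i A y + pdM i B y := by
  ext a b; exact partialDeriv_add i (hA a b) (hB a b)

lemma pdM_sub (i : Fin n) {A B : Coord n → Mat n} {y : Coord n} (hA : DiffM A y)
    (hB : DiffM B y) : pdM i (fun z => A z - B z) y = pdM i A y - pdM i B y := by
  ext a b; exact partialDeriv_sub i (hA a b) (hB a b)

/-! ### Derivatives of the metric -/

lemma RiemOn.diffM {G : CMetric n} {U : Set (Coord n)} (h : RiemOn G U) {y : Coord n}
    (hy : y ∈ U) : DiffM G y := fun a b => h.differentiableAt hy a b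

lemma mul_chrM {G : CMetric n} {U : Set (Coord n)} (h : RiemOn G U) {y : Coord n}
    (hy : y ∈ U) (i : Fin n) : G y * chrM G i y = chrL G i y := by
  rw [chrM_eq, Matrix.mul_nonsing_inv_cancel_left _ _ (h.isUnit_det hy)]

lemma RiemOn.eventually_mem {G : CMetric n} {U : Set (Coord n)} (h : RiemOn G U) {y : Coord n}
    (hy : y ∈ U) : ∀ᶠ z in nhds y, z ∈ U := h.isOpen.mem_nhds hy

lemma RiemOn.partialDeriv_symm {G : CMetric n} {U : Set (Coord n)} (h : RiemOn G U) {y : Coord n}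
    (hy : y ∈ U) (k i j : Fin n) :
    partialDeriv k (fun z => G z i j) y = partialDeriv k (fun z => G z j i) y :=
  Filter.EventuallyEq.partialDeriv_eq ((h.eventually_mem hy).mono fun _ hz => h.symm hz i j) k

/-- Compatibility of the Levi-Civita connection with the metric. -/
lemma pdM_metric {G : CMetric n} {U : Set (Coord n)} (h : RiemOn G U) {y : Coord n}
    (hy : y ∈ U) (i : Fin n) :
    pdM i G y = (chrM G i y)ᵀ * G y + G y * chrM G i y := by
  have e : (chrM G i y)ᵀ * G y = (chrL G i y)ᵀ := by
    rw [← mul_chrM h hy, Matrix.transpose_mul, h.transpose hy]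
  rw [e, mul_chrM h hy]
  ext a b
  simp only [pdM, chrL, Matrix.of_apply, Matrix.add_apply, Matrix.transpose_apply]
  rw [h.partialDeriv_symm hy i b a, h.partialDeriv_symm hy b i a, h.partialDeriv_symm hy a i b]
  ring

lemma RiemOn.contDiffOn_inv {G : CMetric n} {U : Set (Coord n)} (h : RiemOn G U) (i j : Fin n) :
    ContDiffOn ℝ ∞ (fun y => (G y)⁻¹ i j) U :=
  CurvatureFlow.contDiffOn_inv h.smooth (fun _ hq => (h.posDef _ hq).det_pos.ne') i j

lemma RiemOn.diffM_inv {G : CMetric n} {U : Set (Coord n)} (h : RiemOn G U) {y : Coord n}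
    (hy : y ∈ U) : DiffM (fun z => (G z)⁻¹) y := fun a b =>
  ((h.contDiffOn_inv a b).contDiffAt (h.isOpen.mem_nhds hy)).differentiableAt (by simp)

lemma pdM_inv {G : CMetric n} {U : Set (Coord n)} (h : RiemOn G U) {y : Coord n}
    (hy : y ∈ U) (i : Fin n) :
    pdM i (fun z => (G z)⁻¹) y = -(chrM G i y * (G y)⁻¹) - (G y)⁻¹ * (chrM G i y)ᵀ := by
  have h1 : pdM i (fun z => (G z)⁻¹) y = -((G y)⁻¹ * pdM i G y * (G y)⁻¹) := by
    ext a b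
    have h2 := hasDerivAt_inv (A := fun s => G (lineAt y i s)) (A' := pdM i G y) (x := 0)
      (fun a b => hasDerivAt_line (h.differentiableAt hy a b) i)
      (by simpa using (h.posDef y hy).det_pos.ne') a b
    have h3 := hasDerivAt_line (h.diffM_inv hy a b) i
    have h4 := h3.unique h2
    simp only [lineAt_zero] at h4
    exact h4
  rw [h1, pdM_metric h hy, Matrix.mul_add, Matrix.add_mul,
    Matrix.nonsing_inv_mul_cancel_left _ _ (h.isUnit_det hy), ← Matrix.mul_assoc,
    Matrix.mul_nonsing_inv_cancel_right _ _ (h.isUnit_det hy)]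
  abel

/-- Metric compatibility for the scalar product of tensors. -/
lemma partialDeriv_ip {G : CMetric n} {U : Set (Coord n)} (h : RiemOn G U) {y : Coord n}
    (hy : y ∈ U) {S T : TField n ι} (hS : ∀ c, DifferentiableAt ℝ (fun z => S z c) y)
    (hT : ∀ c, DifferentiableAt ℝ (fun z => T z c) y) (i : Fin n) :
    partialDeriv i (fun z => ip (G z)⁻¹ (S z) (T z)) y
      = ip (G y)⁻¹ (cov G i S y) (T y) + ip (G y)⁻¹ (S y) (cov G i T y) := by
  have h1 := hasDerivAt_ip (x := 0) (H := fun s => (G (lineAt y i s))⁻¹)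
    (H' := pdM i (fun z => (G z)⁻¹) y) (s := fun s => S (lineAt y i s))
    (t := fun s => T (lineAt y i s)) (s' := pd i S y) (t' := pd i T y)
    (fun a b => hasDerivAt_line (h.diffM_inv hy a b) i) (fun c => hasDerivAt_line (hS c) i)
    (fun c => hasDerivAt_line (hT c) i)
  have hd : DifferentiableAt ℝ (fun z => ip (G z)⁻¹ (S z) (T z)) y := by
    simp only [ip]
    exact DifferentiableAt.fun_sum fun c _ => DifferentiableAt.fun_sum fun d _ =>
      ((HasFDerivAt.finsetProd (u := Finset.univ) (g := fun l z => (G z)⁻¹ (c l) (d l))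
        (fun l _ => (h.diffM_inv hy (c l) (d l)).hasFDerivAt)).differentiableAt).fun_mul
        ((hS c).fun_mul (hT d))
  have h2 := (hasDerivAt_line hd i).unique h1
  rw [h2, pdM_inv h hy]
  simp only [lineAt_zero, sub_eq_add_neg, ipD_add, ipD_neg, cov, ip_add_left, ip_add_right,
    ip_neg_left, ip_neg_right, ip_der_left, ip_der_right]
  ring

/-! ### Algebraic rules for covariant derivatives -/

lemma der_mulC (A : Mat n) (s : Comp n ι) (t : Comp n κ) :
    der A (mulC s t) = mulC (der A s) t + mulC s (der A t) := by
  funext c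
  simp only [der, mulC, Fintype.sum_sum_type, Pi.add_apply, Finset.sum_mul, Finset.mul_sum]
  have e1 : ∀ (l : ι) (a : Fin n), update c (Sum.inl l) a ∘ Sum.inl = update (c ∘ Sum.inl) l a :=
    fun l a => by funext x; simp [update, Sum.inl_injective.eq_iff]
  have e2 : ∀ (l : ι) (a : Fin n), update c (Sum.inl l) a ∘ Sum.inr = (c ∘ Sum.inr) :=
    fun l a => by funext x; simp [update]
  have e3 : ∀ (l : κ) (a : Fin n), update c (Sum.inr l) a ∘ Sum.inr = update (c ∘ Sum.inr) l a :=
    fun l a => by funext x; simp [update, Sum.inr_injective.eq_iff]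
  have e4 : ∀ (l : κ) (a : Fin n), update c (Sum.inr l) a ∘ Sum.inl = (c ∘ Sum.inl) :=
    fun l a => by funext x; simp [update]
  simp only [e1, e2, e3, e4]
  congr 1
  · exact Finset.sum_congr rfl fun l _ => Finset.sum_congr rfl fun a _ => by simp; ring
  · exact Finset.sum_congr rfl fun l _ => Finset.sum_congr rfl fun a _ => by simp; ring

lemma der_relabC (A : Mat n) {f : ι → κ} (hf : Bijective f) (t : Comp n ι) :
    der A (relabC f t) = relabC f (der A t) := by
  funext c
  simp only [der, relabC]
  rw [← Function.Bijective.sum_comp hf]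
  refine Finset.sum_congr rfl fun l _ => Finset.sum_congr rfl fun a _ => ?_
  congr 2
  funext x
  by_cases hx : x = l
  · subst hx; simp
  · simp [hx, hf.1.ne hx]

lemma der_oc (A : Mat n) (t : Comp n (Option ι)) (i : Fin n) (c : ι → Fin n) :
    der A t (oc i c) = ∑ a, A a i * t (oc a c) + der A (fun d => t (oc i d)) c := by
  simp only [der, Fintype.sum_option, update_oc_none, update_oc_some, oc_none, oc_some]

lemma cov_mulC (G : CMetric n) {S : TField n ι} {T : TField n κ} {y : Coord n}
    (hS : ∀ c, DifferentiableAt ℝ (fun z => S z c) y)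
    (hT : ∀ c, DifferentiableAt ℝ (fun z => T z c) y) (i : Fin n) :
    cov G i (fun z => mulC (S z) (T z)) y = mulC (cov G i S y) (T y) + mulC (S y) (cov G i T y) := by
  rw [cov, der_mulC]
  have : pd i (fun z => mulC (S z) (T z)) y = mulC (pd i S y) (T y) + mulC (S y) (pd i T y) := by
    funext c; exact partialDeriv_mul i (hS _) (hT _)
  rw [this]
  funext c
  simp only [cov, mulC, Pi.add_apply, Pi.sub_apply]
  ring

lemma cov_relabC (G : CMetric n) {f : ι → κ} (hf : Bijective f) (T : TField n ι) (y : Coord n)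
    (i : Fin n) : cov G i (fun z => relabC f (T z)) y = relabC f (cov G i T y) := by
  rw [cov, der_relabC _ hf]; rfl

lemma cov_add (G : CMetric n) {S T : TField n ι} {y : Coord n}
    (hS : ∀ c, DifferentiableAt ℝ (fun z => S z c) y)
    (hT : ∀ c, DifferentiableAt ℝ (fun z => T z c) y) (i : Fin n) :
    cov G i (fun z => S z + T z) y = cov G i S y + cov G i T y := by
  have : pd i (fun z => S z + T z) y = pd i S y + pd i T y := by
    funext c; exact partialDeriv_add i (hS c) (hT c)
  rw [cov, this, der_add_right, cov, cov]; abel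

lemma cov_smul (G : CMetric n) {T : TField n ι} {y : Coord n} (r : ℝ)
    (hT : ∀ c, DifferentiableAt ℝ (fun z => T z c) y) (i : Fin n) :
    cov G i (fun z => r • T z) y = r • cov G i T y := by
  have : pd i (fun z => r • T z) y = r • pd i T y := by
    funext c; exact partialDeriv_const_mul i r (hT c)
  rw [cov, this, der_smul_right, cov, smul_sub]

/-- For `A` the connection matrix and `H` the inverse metric, the correction `A * H + H * Aᵀ` is
minus the derivative of `H` (`pdM_inv`). This cancellation is why contractions are parallel. -/
lemma der_trcC (A H : Mat n) (t : Comp n (Option (Option ι))) (c : ι → Fin n) :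
    ∑ a, ∑ b, H a b * der A t (oc a (oc b c))
      = der A (trcC H t) c + ∑ a, ∑ b, (A * H + H * Aᵀ) a b * t (oc a (oc b c)) := by
  simp only [der_oc, mul_add, Finset.sum_add_distrib]
  have h3 : ∑ a, ∑ b, H a b * der A (fun d => t (oc a (oc b d))) c = der A (trcC H t) c := by
    simp only [der, trcC, Finset.mul_sum]
    have : ∀ F : Fin n → Fin n → ι → Fin n → ℝ,
        ∑ a, ∑ b, ∑ l, ∑ e, F a b l e = ∑ l, ∑ e, ∑ a, ∑ b, F a b l e := by
      intro F
      calc _ = ∑ a, ∑ l, ∑ e, ∑ b, F a b l e := by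
            refine Finset.sum_congr rfl fun a _ => ?_
            rw [Finset.sum_comm]
            exact Finset.sum_congr rfl fun l _ => Finset.sum_comm
        _ = _ := by
            rw [Finset.sum_comm]
            exact Finset.sum_congr rfl fun l _ => Finset.sum_comm
    rw [this]
    exact Finset.sum_congr rfl fun a _ => Finset.sum_congr rfl fun b _ =>
      Finset.sum_congr rfl fun a _ => Finset.sum_congr rfl fun b _ => by ring
  have h1 : ∑ a, ∑ b, H a b * ∑ e, A e a * t (oc e (oc b c))
      = ∑ a, ∑ b, (A * H) a b * t (oc a (oc b c)) := by
    simp only [Matrix.mul_apply, Finset.mul_sum, Finset.sum_mul]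
    calc _ = ∑ b, ∑ a, ∑ e, H a b * (A e a * t (oc e (oc b c))) := Finset.sum_comm
      _ = ∑ b, ∑ e, ∑ a, H a b * (A e a * t (oc e (oc b c))) :=
          Finset.sum_congr rfl fun b _ => Finset.sum_comm
      _ = ∑ e, ∑ b, ∑ a, H a b * (A e a * t (oc e (oc b c))) := Finset.sum_comm
      _ = _ := Finset.sum_congr rfl fun b _ => Finset.sum_congr rfl fun c _ =>
          Finset.sum_congr rfl fun e _ => by ring
  have h2 : ∑ a, ∑ b, H a b * ∑ e, A e b * t (oc a (oc e c))
      = ∑ a, ∑ b, (H * Aᵀ) a b * t (oc a (oc b c)) := by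
    simp only [Matrix.mul_apply, Finset.mul_sum, Finset.sum_mul, Matrix.transpose_apply]
    refine Finset.sum_congr rfl fun a _ => ?_
    rw [Finset.sum_comm]
    exact Finset.sum_congr rfl fun c _ => Finset.sum_congr rfl fun e _ => by ring
  rw [h3, h2, h1]
  simp only [Matrix.add_apply, add_mul, Finset.sum_add_distrib]
  ring

/-- Contractions commute with covariant derivatives. -/
lemma cov_trcC {G : CMetric n} {U : Set (Coord n)} (h : RiemOn G U) {y : Coord n}
    (hy : y ∈ U) {T : TField n (Option (Option ι))}
    (hT : ∀ c, DifferentiableAt ℝ (fun z => T z c) y) (i : Fin n) :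
    cov G i (fun z => trcC (G z)⁻¹ (T z)) y = trcC (G y)⁻¹ (cov G i T y) := by
  funext c
  have h1 : pd i (fun z => trcC (G z)⁻¹ (T z)) y c
      = ∑ a, ∑ b, (pdM i (fun z => (G z)⁻¹) y a b * T y (oc a (oc b c))
        + (G y)⁻¹ a b * pd i T y (oc a (oc b c))) := by
    simp only [pd, trcC]
    rw [partialDeriv_sum _ _ fun a _ => DifferentiableAt.fun_sum fun b _ =>
      (h.diffM_inv hy a b).fun_mul (hT _)]
    refine Finset.sum_congr rfl fun a _ => ?_
    rw [partialDeriv_sum _ _ fun b _ => (h.diffM_inv hy a b).fun_mul (hT _)]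
    exact Finset.sum_congr rfl fun b _ => partialDeriv_mul i (h.diffM_inv hy a b) (hT _)
  have h2 := der_trcC (chrM G i y) (G y)⁻¹ (T y) c
  simp only [cov, Pi.sub_apply, trcC, mul_sub, Finset.sum_sub_distrib]
  rw [h1, h2, pdM_inv h hy]
  simp only [Matrix.sub_apply, Matrix.neg_apply, Matrix.add_apply, add_mul, sub_mul, neg_mul,
    Finset.sum_add_distrib, Finset.sum_sub_distrib, Finset.sum_neg_distrib]
  have e : der (chrM G i y) (fun c => ∑ a, ∑ b, (G y)⁻¹ a b * T y (oc a (oc b c))) c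
    = der (chrM G i y) (trcC (G y)⁻¹ (T y)) c := rfl
  simp only [← e]
  ring

lemma chrM_congr {G G' : CMetric n} {y : Coord n} (h : G =ᶠ[nhds y] G') (i : Fin n) :
    chrM G i y = chrM G' i y := by
  have h1 : ∀ k a b, partialDeriv k (fun z => G z a b) y = partialDeriv k (fun z => G' z a b) y :=
    fun k a b => Filter.EventuallyEq.partialDeriv_eq (h.mono fun z hz => by simp only [hz]) k
  rw [chrM_eq, chrM_eq, h.eq_of_nhds]
  congr 1
  ext a b
  simp only [chrL, Matrix.of_apply, h1]

lemma cov_congr {G G' : CMetric n} {T T' : TField n ι} {y : Coord n} (h : G =ᶠ[nhds y] G')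
    (hT : T =ᶠ[nhds y] T') (i : Fin n) : cov G i T y = cov G' i T' y := by
  rw [cov, cov, chrM_congr h, hT.eq_of_nhds]
  congr 1
  funext c
  exact Filter.EventuallyEq.partialDeriv_eq (hT.mono fun z hz => by simp only [hz]) i

lemma gcov_congr {G G' : CMetric n} {T T' : TField n ι} {y : Coord n} (h : G =ᶠ[nhds y] G')
    (hT : T =ᶠ[nhds y] T') : gcov G T y = gcov G' T' y := by
  funext c; simp only [gcov, cov_congr h hT]

end Rules

/-! ### Curvature -/

section Curvature

open Function Matrix

variable {n : ℕ} {ι κ : Type} [Fintype ι] [DecidableEq ι] [Fintype κ] [DecidableEq κ]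

/-- The curvature endomorphism `R(∂_i, ∂_j)`. -/
def curvM (G : CMetric n) (i j : Fin n) (y : Coord n) : Mat n :=
  pdM i (chrM G j) y - pdM j (chrM G i) y + (chrM G i y * chrM G j y - chrM G j y * chrM G i y)

lemma riem_eq (G : CMetric n) (y : Coord n) (c : Fin 4 → Fin n) :
    riem G y c = (G y * curvM G (c 0) (c 1) y) (c 2) (c 3) := by
  simp only [riem, Matrix.mul_apply, curvM, Matrix.add_apply, Matrix.sub_apply, pdM,
    Matrix.of_apply, chrM, Finset.sum_sub_distrib]

lemma RiemOn.contDiffOn_christoffel {G : CMetric n} {U : Set (Coord n)} (h : RiemOn G U)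
    (k i j : Fin n) : ContDiffOn ℝ ∞ (christoffel G k i j) U :=
  contDiffOn_slice (f := fun _ => christoffel G k i j) (h.fam.contDiffOn_christoffel k i j)
    (Set.mem_univ (0 : ℝ))

lemma contDiffOn_partialDeriv' {f : Coord n → ℝ} {U : Set (Coord n)} (hU : IsOpen U)
    (hf : ContDiffOn ℝ ∞ f U) (i : Fin n) : ContDiffOn ℝ ∞ (partialDeriv i f) U :=
  contDiffOn_slice (f := fun _ => partialDeriv i f) (contDiffOn_partialDeriv (f := fun _ => f)
    uniqueDiffOn_univ hU (hf.comp contDiff_snd.contDiffOn (fun _ hq => hq.2)) i)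
    (Set.mem_univ (0 : ℝ))

lemma contDiffOn_gcov' {G : CMetric n} {U : Set (Coord n)} (h : RiemOn G U) {T : TField n ι}
    (hT : ∀ c, ContDiffOn ℝ ∞ (fun y => T y c) U) (c : Option ι → Fin n) :
    ContDiffOn ℝ ∞ (fun y => gcov G T y c) U :=
  contDiffOn_slice (f := fun _ y => gcov G T y c) (contDiffOn_gcov h.fam (T := fun _ => T)
    (fun c => (hT c).comp contDiff_snd.contDiffOn (fun _ hq => hq.2)) c) (Set.mem_univ (0 : ℝ))

lemma ContDiffOn.diffAt {f : Coord n → ℝ} {U : Set (Coord n)} (hU : IsOpen U)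
    (hf : ContDiffOn ℝ ∞ f U) {y : Coord n} (hy : y ∈ U) : DifferentiableAt ℝ f y :=
  (hf.contDiffAt (hU.mem_nhds hy)).differentiableAt (by simp)

lemma RiemOn.diffM_chrM {G : CMetric n} {U : Set (Coord n)} (h : RiemOn G U) {y : Coord n}
    (hy : y ∈ U) (i : Fin n) : DiffM (chrM G i) y := fun a b =>
  ContDiffOn.diffAt h.isOpen (h.contDiffOn_christoffel a i b) hy

lemma RiemOn.diffM_pdM_chrM {G : CMetric n} {U : Set (Coord n)} (h : RiemOn G U) {y : Coord n}
    (hy : y ∈ U) (i j : Fin n) : DiffM (pdM j (chrM G i)) y := fun a b =>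
  ContDiffOn.diffAt h.isOpen
    (contDiffOn_partialDeriv' h.isOpen (h.contDiffOn_christoffel a i b) j) hy

lemma pd_der {A : Coord n → Mat n} {T : TField n ι} {y : Coord n} (hA : DiffM A y)
    (hT : ∀ c, DifferentiableAt ℝ (fun z => T z c) y) (i : Fin n) :
    pd i (fun z => der (A z) (T z)) y = der (pdM i A y) (T y) + der (A y) (pd i T y) := by
  funext c
  simp only [pd, der, Pi.add_apply]
  rw [partialDeriv_sum _ _ fun l _ => DifferentiableAt.fun_sum fun b _ => (hA _ _).fun_mul (hT _),
    ← Finset.sum_add_distrib]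
  refine Finset.sum_congr rfl fun l _ => ?_
  rw [partialDeriv_sum _ _ fun b _ => (hA _ _).fun_mul (hT _), ← Finset.sum_add_distrib]
  exact Finset.sum_congr rfl fun b _ => partialDeriv_mul i (hA _ _) (hT _)

lemma diffAt_der {A : Coord n → Mat n} {T : TField n ι} {y : Coord n} (hA : DiffM A y)
    (hT : ∀ c, DifferentiableAt ℝ (fun z => T z c) y) (c : ι → Fin n) :
    DifferentiableAt ℝ (fun z => der (A z) (T z) c) y :=
  DifferentiableAt.fun_sum fun _ _ => DifferentiableAt.fun_sum fun _ _ => (hA _ _).fun_mul (hT _)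

lemma RiemOn.christoffel_symm {G : CMetric n} {U : Set (Coord n)} (h : RiemOn G U) {y : Coord n}
    (hy : y ∈ U) (k i j : Fin n) : christoffel G k i j y = christoffel G k j i y := by
  simp only [christoffel]
  congr 1
  refine Finset.sum_congr rfl fun l _ => ?_
  rw [h.partialDeriv_symm hy l i j]
  ring

/-- The Ricci identity. -/
lemma ricci_identity {G : CMetric n} {U : Set (Coord n)} (h : RiemOn G U) {y : Coord n}
    (hy : y ∈ U) {T : TField n ι} (hT : ∀ c, ContDiffOn ℝ ∞ (fun y => T y c) U)
    (i j : Fin n) (c : ι → Fin n) :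
    gcov G (gcov G T) y (oc i (oc j c)) - gcov G (gcov G T) y (oc j (oc i c))
      = -der (curvM G i j y) (T y) c := by
  have hTd : ∀ c, DifferentiableAt ℝ (fun y => T y c) y := fun c => ContDiffOn.diffAt h.isOpen (hT c) hy
  have hpd : ∀ k c, DifferentiableAt ℝ (fun y => pd k T y c) y := fun k c =>
    ContDiffOn.diffAt h.isOpen (contDiffOn_partialDeriv' h.isOpen (hT c) k) hy
  -- Antisymmetrizing this expansion in `i` and `j` leaves only the derivatives of the connection
  -- matrices and the commutator of their actions, which `der_comm` turns into the quadratic part of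
  -- `curvM`.
  have key : ∀ i j, gcov G (gcov G T) y (oc i (oc j c)) = pd i (pd j T) y c
      - der (pdM i (chrM G j) y) (T y) c - der (chrM G j y) (pd i T y) c
      - (∑ a, christoffel G a i j y * cov G a T y c)
      - der (chrM G i y) (pd j T y) c + der (chrM G i y) (der (chrM G j y) (T y)) c := by
    intro i j
    rw [gcov_oc, cov, Pi.sub_apply, der_oc]
    have e1 : pd i (gcov G T) y (oc j c) = pd i (pd j T) y c
      - (der (pdM i (chrM G j) y) (T y) c + der (chrM G j y) (pd i T y) c) := by
      have := pd_der (h.diffM_chrM hy j) hTd i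
      have := congrFun this c
      simp only [Pi.add_apply] at this
      rw [← this]
      exact partialDeriv_sub i (hpd j c) (diffAt_der (h.diffM_chrM hy j) hTd c)
    have e2 : (fun d => gcov G T y (oc j d)) = pd j T y - der (chrM G j y) (T y) := rfl
    rw [e1, e2, der_sub_right, Pi.sub_apply]
    simp only [gcov_oc]
    simp only [chrM, Matrix.of_apply]
    ring
  have hc := congrFun (der_comm (chrM G i y) (chrM G j y) (T y)) c
  have hsymm : pd i (pd j T) y c = pd j (pd i T) y c := partialDeriv_comm h.isOpen (hT c) hy i j
  have hG : ∀ a, christoffel G a i j y = christoffel G a j i y := fun a => h.christoffel_symm hy a i j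
  rw [key, key, hsymm, curvM, der_add_left, der_sub_left, der_sub_left]
  rw [der_sub_left] at hc
  simp only [hG, Pi.add_apply, Pi.sub_apply] at hc ⊢
  linarith

/-! ### Symmetries of the curvature tensor -/

lemma curvM_antisymm (G : CMetric n) (i j : Fin n) (y : Coord n) :
    curvM G i j y = -curvM G j i y := by
  simp only [curvM]; abel

lemma riem_antisymm_left (G : CMetric n) (y : Coord n) (i j k l : Fin n) :
    riem G y ![i, j, k, l] = -riem G y ![j, i, k, l] := by
  simp only [riem_eq]
  change (G y * curvM G i j y) k l = -(G y * curvM G j i y) k l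
  rw [curvM_antisymm, Matrix.mul_neg, Matrix.neg_apply]

lemma riem_bianchi {G : CMetric n} {U : Set (Coord n)} (h : RiemOn G U) {y : Coord n}
    (hy : y ∈ U) (i j k l : Fin n) :
    riem G y ![i, j, k, l] + riem G y ![j, l, k, i] + riem G y ![l, i, k, j] = 0 := by
  have h1 : ∀ p i j k, partialDeriv k (christoffel G p i j) y = partialDeriv k (christoffel G p j i) y :=
    fun p i j k => Filter.EventuallyEq.partialDeriv_eq
      ((h.eventually_mem hy).mono fun z hz => h.christoffel_symm hz p i j) k
  have key : ∀ p, curvM G i j y p l + curvM G j l y p i + curvM G l i y p j = 0 := by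
    intro p
    simp only [curvM, Matrix.add_apply, Matrix.sub_apply, pdM, chrM, Matrix.of_apply,
      Matrix.mul_apply]
    have h2 : ∀ p i j k, partialDeriv k (fun z => christoffel G p i j z) y
        = partialDeriv k (christoffel G p i j) y := fun _ _ _ _ => rfl
    simp only [h2, h1 p j l, h1 p l i, h1 p j i, h.christoffel_symm hy _ j i,
      h.christoffel_symm hy _ l i, h.christoffel_symm hy _ l j]
    ring
  simp only [riem_eq]
  change (G y * curvM G i j y) k l + (G y * curvM G j l y) k i + (G y * curvM G l i y) k j = 0
  simp only [Matrix.mul_apply, ← Finset.sum_add_distrib, ← mul_add, key, mul_zero,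
    Finset.sum_const_zero]

/-- The metric as a tensor field. -/
def metT (G : CMetric n) : TField n (Fin 2) := fun y c => G y (c 0) (c 1)

lemma RiemOn.contDiffOn_metT {G : CMetric n} {U : Set (Coord n)} (h : RiemOn G U)
    (c : Fin 2 → Fin n) : ContDiffOn ℝ ∞ (fun y => metT G y c) U := h.smooth _ _

lemma der_metT (G : CMetric n) (y : Coord n) (A : Mat n) (c : Fin 2 → Fin n) :
    der A (metT G y) c = (Aᵀ * G y + G y * A) (c 0) (c 1) := by
  simp only [der, metT, Fin.sum_univ_two, Matrix.add_apply, Matrix.mul_apply,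
    Matrix.transpose_apply]
  simp [update, mul_comm]

lemma cov_metT {G : CMetric n} {U : Set (Coord n)} (h : RiemOn G U) {y : Coord n}
    (hy : y ∈ U) (i : Fin n) : cov G i (metT G) y = 0 := by
  funext c
  rw [cov, Pi.sub_apply, der_metT, ← pdM_metric h hy]
  simp [pd, metT, pdM]

lemma gcov_metT {G : CMetric n} {U : Set (Coord n)} (h : RiemOn G U) {y : Coord n}
    (hy : y ∈ U) : gcov G (metT G) y = 0 := by
  funext c; simp [gcov, cov_metT h hy]

lemma gcov_zero (G : CMetric n) (y : Coord n) : gcov G (fun _ => (0 : Comp n ι)) y = 0 := by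
  funext c; simp [gcov, cov, pd, der, partialDeriv_const]

/-- This is the Ricci identity applied to the metric, whose covariant derivatives vanish. -/
lemma riem_antisymm_right {G : CMetric n} {U : Set (Coord n)} (h : RiemOn G U) {y : Coord n}
    (hy : y ∈ U) (i j k l : Fin n) : riem G y ![i, j, k, l] = -riem G y ![i, j, l, k] := by
  have h1 := ricci_identity h hy (T := metT G) h.contDiffOn_metT i j ![k, l]
  have h0 : gcov G (metT G) =ᶠ[nhds y] fun _ => 0 := (h.eventually_mem hy).mono
    fun z hz => gcov_metT h hz
  rw [gcov_congr (Filter.EventuallyEq.refl _ G) h0, gcov_zero, der_metT] at h1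
  simp only [Matrix.add_apply, Pi.zero_apply] at h1
  have e : ((curvM G i j y)ᵀ * G y) k l = (G y * curvM G i j y) l k := by
    rw [← Matrix.transpose_apply (G y * curvM G i j y), Matrix.transpose_mul, h.transpose hy]
  simp only [riem_eq]
  change (G y * curvM G i j y) k l = -(G y * curvM G i j y) l k
  change 0 - 0 = -(((curvM G i j y)ᵀ * G y) k l + (G y * curvM G i j y) k l) at h1
  rw [e] at h1
  linarith

/-- The classical linear combination of four instances of the first Bianchi identity with the two
antisymmetries. -/
lemma riem_pair_symm {G : CMetric n} {U : Set (Coord n)} (h : RiemOn G U) {y : Coord n}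
    (hy : y ∈ U) (i j k l : Fin n) : riem G y ![i, j, k, l] = riem G y ![k, l, i, j] := by
  have b := fun i j k l => riem_bianchi h hy i j k l
  have a := fun i j k l => riem_antisymm_left G y i j k l
  have r := fun i j k l => riem_antisymm_right h hy i j k l
  linarith [b i j k l, b j k l i, b k l i j, b l i j k, a i j k l, a j k l i, a k l i j, a l i j k,
    r i j k l, r j k l i, r k l i j, r l i j k, a j l k i, a l i k j, a k i l j, a i j l k, a l j i k,
    a j k i l, a i k j l, a k l j i, r j l k i, r l i k j, r k i l j, r i j l k, r l j i k,
    r j k i l, r i k j l, r k l j i]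

/-- The differential Bianchi identity, for the derivatives of the curvature endomorphisms. -/
lemma curvM_bianchi {G : CMetric n} {U : Set (Coord n)} (h : RiemOn G U) {y : Coord n}
    (hy : y ∈ U) (i j k : Fin n) :
    (pdM i (curvM G j k) y + (chrM G i y * curvM G j k y - curvM G j k y * chrM G i y))
    + (pdM j (curvM G k i) y + (chrM G j y * curvM G k i y - curvM G k i y * chrM G j y))
    + (pdM k (curvM G i j) y + (chrM G k y * curvM G i j y - curvM G i j y * chrM G k y)) = 0 := by
  have hc := fun i => h.diffM_chrM hy i
  have hp := fun i j => h.diffM_pdM_chrM hy i j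
  have key : ∀ i j k, pdM i (curvM G j k) y = pdM i (pdM j (chrM G k)) y - pdM i (pdM k (chrM G j)) y
      + ((pdM i (chrM G j) y * chrM G k y + chrM G j y * pdM i (chrM G k) y)
        - (pdM i (chrM G k) y * chrM G j y + chrM G k y * pdM i (chrM G j) y)) := by
    intro i j k
    have hd1 : DiffM (fun z => pdM j (chrM G k) z - pdM k (chrM G j) z) y := fun a b =>
      (hp k j a b).fun_sub (hp j k a b)
    have hd2 : DiffM (fun z => chrM G j z * chrM G k z - chrM G k z * chrM G j z) y := fun a b =>
      ((hc j).mul (hc k) a b).fun_sub ((hc k).mul (hc j) a b)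
    have := pdM_add i hd1 hd2
    rw [pdM_sub i (hp k j) (hp j k), pdM_sub i ((hc j).mul (hc k)) ((hc k).mul (hc j)),
      pdM_mul i (hc j) (hc k), pdM_mul i (hc k) (hc j)] at this
    exact this
  have hs : ∀ i j k, pdM i (pdM j (chrM G k)) y = pdM j (pdM i (chrM G k)) y := by
    intro i j k
    ext a b
    exact partialDeriv_comm h.isOpen (h.contDiffOn_christoffel a k b) hy i j
  -- The second derivatives of the connection cancel by symmetry. What remains is an identity
  -- between noncommutative polynomials in the connection matrices and their first derivatives,
  -- whose cubic part is the Jacobi identity.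
  rw [key, key, key, hs i j k, hs i k j, hs j k i]
  simp only [curvM]
  noncomm_ring

end Curvature

/-! ### Tensors depending naturally on a metric -/

section Natural

open Function Matrix

variable {n : ℕ} {ι κ : Type} [Fintype ι] [DecidableEq ι] [Fintype κ] [DecidableEq κ]

/-! ### The differential Bianchi identity -/

lemma cov_riem {G : CMetric n} {U : Set (Coord n)} (h : RiemOn G U) {y : Coord n}
    (hy : y ∈ U) (k i j p l : Fin n) :
    cov G k (riem G) y ![i, j, p, l]
      = (G y * (pdM k (curvM G i j) y
          + (chrM G k y * curvM G i j y - curvM G i j y * chrM G k y))) p l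
        - ∑ a, christoffel G a k i y * riem G y ![a, j, p, l]
        - ∑ a, christoffel G a k j y * riem G y ![i, a, p, l] := by
  have hd : DiffM (curvM G i j) y := fun a b =>
    (((h.diffM_pdM_chrM hy j i) a b).fun_sub ((h.diffM_pdM_chrM hy i j) a b)).fun_add
      (((h.diffM_chrM hy i).mul (h.diffM_chrM hy j) a b).fun_sub
        ((h.diffM_chrM hy j).mul (h.diffM_chrM hy i) a b))
  have e1 : pd k (riem G) y ![i, j, p, l] = (pdM k G y * curvM G i j y
      + G y * pdM k (curvM G i j) y) p l := by
    rw [← pdM_mul k (h.diffM hy) hd]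
    simp only [pd, riem_eq]
    rfl
  have e2 : der (chrM G k y) (riem G y) ![i, j, p, l]
      = ∑ a, christoffel G a k i y * riem G y ![a, j, p, l]
        + ∑ a, christoffel G a k j y * riem G y ![i, a, p, l]
        + ((chrM G k y)ᵀ * (G y * curvM G i j y)) p l
        + (G y * curvM G i j y * chrM G k y) p l := by
    have u0 : ∀ a, update ![i, j, p, l] 0 a = ![a, j, p, l] := fun a => by
      funext x; fin_cases x <;> rfl
    have u1 : ∀ a, update ![i, j, p, l] 1 a = ![i, a, p, l] := fun a => by
      funext x; fin_cases x <;> rfl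
    have u2 : ∀ a, update ![i, j, p, l] 2 a = ![i, j, a, l] := fun a => by
      funext x; fin_cases x <;> rfl
    have u3 : ∀ a, update ![i, j, p, l] 3 a = ![i, j, p, a] := fun a => by
      funext x; fin_cases x <;> rfl
    have t2 : ((chrM G k y)ᵀ * (G y * curvM G i j y)) p l
        = ∑ a, chrM G k y a p * riem G y ![i, j, a, l] := by
      rw [Matrix.mul_apply]
      exact Finset.sum_congr rfl fun a _ => by rw [riem_eq]; rfl
    have t3 : (G y * curvM G i j y * chrM G k y) p l
        = ∑ a, chrM G k y a l * riem G y ![i, j, p, a] := by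
      rw [Matrix.mul_apply]
      exact Finset.sum_congr rfl fun a _ => by rw [riem_eq, mul_comm]; rfl
    simp only [der, Fin.sum_univ_four, u0, u1, u2, u3, t2, t3]
    rfl
  rw [cov, Pi.sub_apply, e1, e2, pdM_metric h hy]
  simp only [Matrix.add_mul, Matrix.mul_add, Matrix.mul_sub, Matrix.add_apply, Matrix.sub_apply,
    Matrix.mul_assoc]
  ring

/-- The endomorphism parts cancel by `curvM_bianchi`. The connection terms on the first two slots
cancel in pairs in the cyclic sum, since the Christoffel symbols are symmetric and `Rm` is
antisymmetric there. -/
lemma cov_riem_bianchi {G : CMetric n} {U : Set (Coord n)} (h : RiemOn G U) {y : Coord n}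
    (hy : y ∈ U) (i j k p l : Fin n) :
    cov G i (riem G) y ![j, k, p, l] + cov G j (riem G) y ![k, i, p, l]
      + cov G k (riem G) y ![i, j, p, l] = 0 := by
  have hb := congrArg (fun M : Mat n => (G y * M) p l) (curvM_bianchi h hy i j k)
  simp only [Matrix.mul_zero, Matrix.mul_add, Matrix.add_apply, Matrix.zero_apply] at hb
  rw [cov_riem h hy, cov_riem h hy, cov_riem h hy]
  simp only [Matrix.mul_add, Matrix.add_apply]
  have hs : ∀ i j k, ∑ a, christoffel G a i j y * riem G y ![a, k, p, l]
      = -∑ a, christoffel G a j i y * riem G y ![k, a, p, l] := by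
    intro i j k
    rw [← Finset.sum_neg_distrib]
    refine Finset.sum_congr rfl fun a _ => ?_
    rw [h.christoffel_symm hy, riem_antisymm_left]; ring
  rw [hs i j k, hs j k i, hs k i j]
  linarith

/-! ### Covariance of the curvature -/

lemma gcov_gcov_pull {φ : Coord n → Coord n} {W U : Set (Coord n)} (h : LDiffeo φ W U)
    {G : CMetric n} (hG : RiemOn G U) {T : TField n ι} {z : Coord n} (hz : z ∈ W)
    (hT : ∀ c, ContDiffOn ℝ ∞ (fun y => T y c) U) :
    gcov (pullG φ G) (gcov (pullG φ G) (pullT φ T)) z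
      = act (Jac φ z) (gcov G (gcov G T) (φ z)) := by
  have h1 : gcov (pullG φ G) (pullT φ T) =ᶠ[nhds z] pullT φ (gcov G T) := by
    filter_upwards [h.isOpen.mem_nhds hz] with w hw
    exact gcov_pull h hG hw fun c => ContDiffOn.diffAt hG.isOpen (hT c) (h.mapsTo hw)
  rw [gcov_congr (Filter.EventuallyEq.refl _ _) h1]
  exact gcov_pull h hG hz fun c => ContDiffOn.diffAt hG.isOpen (contDiffOn_gcov' hG hT c)
    (h.mapsTo hz)

lemma eq_of_der_eq {A B : Mat n} (h : ∀ t : Comp n Unit, der A t = der B t) : A = B := by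
  ext a l
  have := congrFun (h fun c => if c () = a then 1 else 0) (fun _ => l)
  simpa [der, update] using this

/-- Instead of differentiating the transformation law of the Christoffel symbols, the curvature is
recovered from the Ricci identity: second covariant derivatives of a covector field with constant
components are covariant, and a matrix is determined by its action on covectors (`eq_of_der_eq`). -/
lemma curvM_pull {φ : Coord n → Coord n} {W U : Set (Coord n)} (h : LDiffeo φ W U)
    {G : CMetric n} (hG : RiemOn G U) {z : Coord n} (hz : z ∈ W) (i j : Fin n) :
    curvM (pullG φ G) i j z = ∑ a, ∑ b, (Jac φ z a i * Jac φ z b j) •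
      ((Jac φ z)⁻¹ * curvM G a b (φ z) * Jac φ z) := by
  have hJ := h.isUnit z hz
  have hW := h.riemOn hG
  refine eq_of_der_eq fun t' => ?_
  obtain ⟨t, rfl⟩ : ∃ t : Comp n Unit, act (Jac φ z) t = t' :=
    ⟨act (Jac φ z)⁻¹ t', by rw [act_act, Matrix.nonsing_inv_mul _ hJ, act_one]⟩
  have hT : ∀ c, ContDiffOn ℝ ∞ (fun _ : Coord n => t c) U := fun c => contDiffOn_const
  have hp : ∀ c, ContDiffOn ℝ ∞ (fun y => pullT φ (fun _ => t) y c) W := by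
    intro c
    simp only [pullT, act]
    exact ContDiffOn.sum fun d _ => (contDiffOn_prod fun l _ => h.contDiffOn_Jac _ _).mul
      contDiffOn_const
  funext c
  have h1 := ricci_identity hW hz hp i j c
  rw [gcov_gcov_pull h hG hz hT] at h1
  simp only [act_oc] at h1
  have h2 : ∀ i j, ∑ b, Jac φ z b i * ∑ a, Jac φ z a j *
      act (Jac φ z) (fun d => gcov G (gcov G fun _ => t) (φ z) (oc b (oc a d))) c
      = ∑ b, ∑ a, Jac φ z b i * Jac φ z a j *
      act (Jac φ z) (fun d => gcov G (gcov G fun _ => t) (φ z) (oc b (oc a d))) c := by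
    intro i j; simp only [Finset.mul_sum, mul_assoc]
  have h3 : (∑ b, ∑ a, Jac φ z b j * Jac φ z a i *
      act (Jac φ z) (fun d => gcov G (gcov G fun _ => t) (φ z) (oc b (oc a d))) c)
      = ∑ b, ∑ a, Jac φ z b i * Jac φ z a j *
      act (Jac φ z) (fun d => gcov G (gcov G fun _ => t) (φ z) (oc a (oc b d))) c := by
    rw [Finset.sum_comm]
    exact Finset.sum_congr rfl fun b _ => Finset.sum_congr rfl fun a _ => by ring
  rw [h2, h2, h3, ← Finset.sum_sub_distrib] at h1
  simp only [← Finset.sum_sub_distrib, ← mul_sub] at h1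
  have h4 : ∀ a b, act (Jac φ z) (fun d => gcov G (gcov G fun _ => t) (φ z) (oc a (oc b d))) c
      - act (Jac φ z) (fun d => gcov G (gcov G fun _ => t) (φ z) (oc b (oc a d))) c
      = -der ((Jac φ z)⁻¹ * curvM G a b (φ z) * Jac φ z) (act (Jac φ z) t) c := by
    intro a b
    rw [← act_der_conj _ _ hJ, ← Pi.sub_apply, ← act_sub]
    have : (fun d => gcov G (gcov G fun _ => t) (φ z) (oc a (oc b d)))
        - (fun d => gcov G (gcov G fun _ => t) (φ z) (oc b (oc a d)))
        = (-1 : ℝ) • der (curvM G a b (φ z)) t := by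
      funext d
      have := ricci_identity hG (h.mapsTo hz) hT a b d
      simpa using this
    rw [this, act_smul]; simp
  simp only [h4] at h1
  have h5 : der (curvM (pullG φ G) i j z) (act (Jac φ z) t) c
      = ∑ a, ∑ b, Jac φ z a i * Jac φ z b j *
        der ((Jac φ z)⁻¹ * curvM G a b (φ z) * Jac φ z) (act (Jac φ z) t) c := by
    have h6 : der (curvM (pullG φ G) i j z) (act (Jac φ z) t) c
      = der (curvM (pullG φ G) i j z) (pullT φ (fun _ => t) z) c := rfl
    rw [h6, ← neg_inj, ← h1]
    simp only [mul_neg, Finset.sum_neg_distrib]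
  rw [h5]
  simp only [der_sum_left, der_smul_left, Finset.sum_apply, Pi.smul_apply, smul_eq_mul]

lemma sum_vecCons {m : ℕ} (f : (Fin (m + 1) → Fin n) → ℝ) :
    ∑ c, f c = ∑ a, ∑ c : Fin m → Fin n, f (vecCons a c) := by
  rw [← Fintype.sum_prod_type']
  refine (Fintype.sum_equiv (Equiv.mk (fun p : Fin n × (Fin m → Fin n) => vecCons p.1 p.2)
    (fun c => (vecHead c, vecTail c)) (fun p => by simp) (fun c => by simp)) _ _
    (fun p => rfl)).symm

lemma act_vecCons {m : ℕ} (J : Mat n) (t : Comp n (Fin (m + 1))) (a : Fin n)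
    (c : Fin m → Fin n) :
    act J t (vecCons a c) = ∑ b, J b a * act J (fun d => t (vecCons b d)) c := by
  simp only [act, sum_vecCons, Fin.prod_univ_succ, Matrix.cons_val_zero, Matrix.cons_val_succ,
    Finset.mul_sum, mul_assoc]

lemma act_empty (J : Mat n) (t : Comp n (Fin 0)) (c : Fin 0 → Fin n) : act J t c = t c := by
  simp [act, Subsingleton.elim default c]

lemma riem_pull {φ : Coord n → Coord n} {W U : Set (Coord n)} (h : LDiffeo φ W U)
    {G : CMetric n} (hG : RiemOn G U) {z : Coord n} (hz : z ∈ W) :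
    riem (pullG φ G) z = act (Jac φ z) (riem G (φ z)) := by
  have hJ := h.isUnit z hz
  funext c
  obtain ⟨i, j, k, l, rfl⟩ : ∃ i j k l, c = ![i, j, k, l] :=
    ⟨c 0, c 1, c 2, c 3, by funext x; fin_cases x <;> rfl⟩
  simp only [act_vecCons, act_empty, riem_eq]
  change (pullG φ G z * curvM (pullG φ G) i j z) k l = ∑ a, Jac φ z a i * ∑ b, Jac φ z b j *
    ∑ p, Jac φ z p k * ∑ q, Jac φ z q l * (G (φ z) * curvM G a b (φ z)) p q
  have e : ∀ a b, (∑ p, Jac φ z p k * ∑ q, Jac φ z q l * (G (φ z) * curvM G a b (φ z)) p q)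
      = ((Jac φ z)ᵀ * (G (φ z) * curvM G a b (φ z)) * Jac φ z) k l := by
    intro a b
    simp only [Matrix.mul_assoc ((Jac φ z)ᵀ)]
    rw [Matrix.mul_apply]
    refine Finset.sum_congr rfl fun p _ => ?_
    rw [Matrix.mul_apply, Matrix.transpose_apply]
    congr 1
    exact Finset.sum_congr rfl fun q _ => mul_comm _ _
  simp only [e]
  rw [curvM_pull h hG hz, pullG]
  simp only [Matrix.mul_smul, Matrix.sum_apply, Matrix.smul_apply, smul_eq_mul, Finset.mul_sum]
  refine Finset.sum_congr rfl fun a _ => Finset.sum_congr rfl fun b _ => ?_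
  simp only [Matrix.mul_assoc]
  rw [Matrix.mul_nonsing_inv_cancel_left _ _ hJ, mul_assoc]

/-! ### Natural tensors -/

/-- A tensor field depending naturally on a Riemannian metric. -/
structure IsNat (F : CMetric n → TField n ι) : Prop where
  congr : ∀ {G G' : CMetric n} {y : Coord n}, G =ᶠ[nhds y] G' → F G y = F G' y
  smooth : ∀ {𝒢 : ℝ → CMetric n} {I : Set ℝ} {U : Set (Coord n)}, RiemFam 𝒢 I U →
    ∀ c, ContDiffOn ℝ ∞ (fun q : ℝ × Coord n => F (𝒢 q.1) q.2 c) (I ×ˢ U)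
  pull : ∀ {G : CMetric n} {φ : Coord n → Coord n} {W U : Set (Coord n)}, LDiffeo φ W U →
    RiemOn G U → ∀ z ∈ W, F (pullG φ G) z = act (Jac φ z) (F G (φ z))

/-- A smooth function depending naturally on a Riemannian metric. -/
structure IsNatFun (f : CMetric n → Coord n → ℝ) : Prop where
  congr : ∀ {G G' : CMetric n} {y : Coord n}, G =ᶠ[nhds y] G' → f G y = f G' y
  smooth : ∀ {𝒢 : ℝ → CMetric n} {I : Set ℝ} {U : Set (Coord n)}, RiemFam 𝒢 I U →
    ContDiffOn ℝ ∞ (fun q : ℝ × Coord n => f (𝒢 q.1) q.2) (I ×ˢ U)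
  pull : ∀ {G : CMetric n} {φ : Coord n → Coord n} {W U : Set (Coord n)}, LDiffeo φ W U →
    RiemOn G U → ∀ z ∈ W, f (pullG φ G) z = f G (φ z)

/-- A continuous function depending naturally on a Riemannian metric. -/
structure IsNatCont (f : CMetric n → Coord n → ℝ) : Prop where
  congr : ∀ {G G' : CMetric n} {y : Coord n}, G =ᶠ[nhds y] G' → f G y = f G' y
  cont : ∀ {𝒢 : ℝ → CMetric n} {I : Set ℝ} {U : Set (Coord n)}, RiemFam 𝒢 I U →
    ContinuousOn (fun q : ℝ × Coord n => f (𝒢 q.1) q.2) (I ×ˢ U)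
  pull : ∀ {G : CMetric n} {φ : Coord n → Coord n} {W U : Set (Coord n)}, LDiffeo φ W U →
    RiemOn G U → ∀ z ∈ W, f (pullG φ G) z = f G (φ z)

lemma IsNatFun.isNatCont {f : CMetric n → Coord n → ℝ} (h : IsNatFun f) : IsNatCont f :=
  ⟨h.congr, fun hG => (h.smooth hG).continuousOn, h.pull⟩

namespace IsNat

variable {F F' : CMetric n → TField n ι} {E : CMetric n → TField n κ}

lemma contDiffOn (h : IsNat F) {G : CMetric n} {U : Set (Coord n)} (hG : RiemOn G U)
    (c : ι → Fin n) : ContDiffOn ℝ ∞ (fun y => F G y c) U :=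
  contDiffOn_slice (f := fun _ y => F G y c) (h.smooth hG.fam c) (Set.mem_univ (0 : ℝ))

lemma diffAt (h : IsNat F) {G : CMetric n} {U : Set (Coord n)} (hG : RiemOn G U) {y : Coord n}
    (hy : y ∈ U) (c : ι → Fin n) : DifferentiableAt ℝ (fun y => F G y c) y :=
  ContDiffOn.diffAt hG.isOpen (h.contDiffOn hG c) hy

lemma eventuallyEq (h : IsNat F) {G G' : CMetric n} {y : Coord n} (hG : G =ᶠ[nhds y] G') :
    F G =ᶠ[nhds y] F G' := hG.eventuallyEq_nhds.mono fun _ hz => h.congr hz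

lemma gcov (h : IsNat F) : IsNat (fun G => gcov G (F G)) where
  congr hG := gcov_congr hG (h.eventuallyEq hG)
  smooth hG c := contDiffOn_gcov hG (T := fun t => F _) (h.smooth hG) c
  pull {G φ W U} hφ hG z hz := by
    have : F (pullG φ G) =ᶠ[nhds z] pullT φ (F G) := by
      filter_upwards [hφ.isOpen.mem_nhds hz] with w hw using h.pull hφ hG w hw
    rw [gcov_congr (Filter.EventuallyEq.refl _ _) this]
    exact gcov_pull hφ hG hz (h.diffAt hG (hφ.mapsTo hz))

lemma mulC (h : IsNat F) (h' : IsNat E) : IsNat (fun G y => mulC (F G y) (E G y)) where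
  congr hG := by rw [h.congr hG, h'.congr hG]
  smooth hG c := (h.smooth hG _).mul (h'.smooth hG _)
  pull hφ hG z hz := by rw [h.pull hφ hG z hz, h'.pull hφ hG z hz, act_mulC]

lemma relabC {f : ι → κ} (hf : Bijective f) (h : IsNat F) :
    IsNat (fun G y => relabC f (F G y)) where
  congr hG := by rw [h.congr hG]
  smooth hG c := h.smooth hG _
  pull hφ hG z hz := by rw [h.pull hφ hG z hz, act_relabC _ hf]

lemma trcC {F : CMetric n → TField n (Option (Option ι))} (h : IsNat F) :
    IsNat (fun G y => trcC (G y)⁻¹ (F G y)) where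
  congr hG := by rw [h.congr hG, hG.eq_of_nhds]
  smooth hG c := ContDiffOn.sum fun a _ => ContDiffOn.sum fun b _ =>
    (hG.contDiffOn_inv a b).mul (h.smooth hG _)
  pull hφ hG z hz := by
    rw [h.pull hφ hG z hz, trcC_act, pullG_inv hφ _ hz]

lemma add (h : IsNat F) (h' : IsNat F') : IsNat (fun G y => F G y + F' G y) where
  congr hG := by rw [h.congr hG, h'.congr hG]
  smooth hG c := (h.smooth hG _).add (h'.smooth hG _)
  pull hφ hG z hz := by rw [h.pull hφ hG z hz, h'.pull hφ hG z hz, act_add]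

lemma smul (r : ℝ) (h : IsNat F) : IsNat (fun G y => r • F G y) where
  congr hG := by rw [h.congr hG]
  smooth hG c := contDiffOn_const.mul (h.smooth hG _)
  pull hφ hG z hz := by rw [h.pull hφ hG z hz, act_smul]

lemma sub (h : IsNat F) (h' : IsNat F') : IsNat (fun G y => F G y - F' G y) where
  congr hG := by rw [h.congr hG, h'.congr hG]
  smooth hG c := (h.smooth hG _).sub (h'.smooth hG _)
  pull hφ hG z hz := by rw [h.pull hφ hG z hz, h'.pull hφ hG z hz, act_sub]

lemma funMul {f : CMetric n → Coord n → ℝ} (hf : IsNatFun f) (h : IsNat F) :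
    IsNat (fun G y => f G y • F G y) where
  congr hG := by rw [h.congr hG, hf.congr hG]
  smooth hG c := (hf.smooth hG).mul (h.smooth hG _)
  pull hφ hG z hz := by rw [h.pull hφ hG z hz, hf.pull hφ hG z hz, act_smul]

lemma zero : IsNat (fun (_ : CMetric n) (_ : Coord n) => (0 : Comp n ι)) where
  congr _ := rfl
  smooth _ _ := contDiffOn_const
  pull _ _ z hz := by funext c; simp [act]

lemma ip (h : IsNat F) (h' : IsNat F') : IsNatFun (fun G y => ip (G y)⁻¹ (F G y) (F' G y)) where
  congr hG := by rw [h.congr hG, h'.congr hG, hG.eq_of_nhds]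
  smooth hG := ContDiffOn.sum fun c _ => ContDiffOn.sum fun d _ =>
    (contDiffOn_prod fun l _ => hG.contDiffOn_inv _ _).mul ((h.smooth hG _).mul (h'.smooth hG _))
  pull hφ hG z hz := by
    rw [h.pull hφ hG z hz, h'.pull hφ hG z hz, ip_act, pullG_inv hφ _ hz]

lemma riem : IsNat (riem (n := n)) where
  congr {G G' y} hG := by
    have h1 : ∀ i, chrM G i =ᶠ[nhds y] chrM G' i := fun i =>
      hG.eventuallyEq_nhds.mono fun _ hz => chrM_congr hz i
    have h2 : ∀ i j, pdM i (chrM G j) y = pdM i (chrM G' j) y := by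
      intro i j; ext a b
      exact Filter.EventuallyEq.partialDeriv_eq ((h1 j).mono fun z hz => by simp only [hz]) i
    funext c
    rw [riem_eq, riem_eq, curvM, curvM, h2, h2, (h1 _).eq_of_nhds, (h1 _).eq_of_nhds,
      hG.eq_of_nhds]
  smooth {𝒢 I U} hG c := by
    have hp := fun a i b k => contDiffOn_partialDeriv
      (f := fun t y => christoffel (𝒢 t) a i b y) hG.uniqueDiff hG.isOpen
      (hG.contDiffOn_christoffel a i b) k
    have hc := fun a i b => hG.contDiffOn_christoffel a i b
    exact ContDiffOn.sum fun p _ => (hG.smooth _ _).mul (((hp _ _ _ _).sub (hp _ _ _ _)).add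
      (ContDiffOn.sum fun q _ => ((hc _ _ _).mul (hc _ _ _)).sub ((hc _ _ _).mul (hc _ _ _))))
  pull hφ hG z hz := riem_pull hφ hG hz

lemma metT : IsNat (metT (n := n)) where
  congr hG := by funext c; simp only [CurvatureFlow.metT, hG.eq_of_nhds]
  smooth hG c := hG.smooth _ _
  pull {G φ W U} hφ hG z hz := by
    funext c
    obtain ⟨i, j, rfl⟩ : ∃ i j, c = ![i, j] := ⟨c 0, c 1, by funext x; fin_cases x <;> rfl⟩
    simp only [act_vecCons, act_empty]
    change (pullG φ G z) i j = ∑ a, Jac φ z a i * ∑ b, Jac φ z b j * G (φ z) a b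
    rw [pullG, Matrix.mul_assoc, Matrix.mul_apply]
    refine Finset.sum_congr rfl fun a _ => ?_
    rw [Matrix.mul_apply, Matrix.transpose_apply]
    congr 1
    exact Finset.sum_congr rfl fun b _ => mul_comm _ _

end IsNat

end Natural

/-! ### Weights and orders of natural tensors -/

section Control

open Function Matrix

variable {n : ℕ} {ι κ : Type} [Fintype ι] [DecidableEq ι] [Fintype κ] [DecidableEq κ]

/-! ### Tensors controlled by the curvature -/

/-- `|∇^j Rm|`, the norm being the full contraction. -/
def rmN (j : ℕ) (G : CMetric n) (y : Coord n) : ℝ :=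
  nrm (G y)⁻¹ (iterCovDeriv G (riem G) j y)

/-- The function `∑_{i ≤ ℓ} |∇^i Rm|^{1/(i+2)}`, of weight one. -/
def rmScale (ℓ : ℕ) (G : CMetric n) (y : Coord n) : ℝ :=
  ∑ i ∈ Finset.range (ℓ + 1), rmN i G y ^ (1 / ((i : ℝ) + 2))

lemma rmN_nonneg (j : ℕ) (G : CMetric n) (y : Coord n) : 0 ≤ rmN j G y := nrm_nonneg _ _

lemma rmScale_nonneg (ℓ : ℕ) (G : CMetric n) (y : Coord n) : 0 ≤ rmScale ℓ G y :=
  Finset.sum_nonneg fun i _ => Real.rpow_nonneg (rmN_nonneg i G y) _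

lemma rmScale_mono {ℓ ℓ' : ℕ} (h : ℓ ≤ ℓ') (G : CMetric n) (y : Coord n) :
    rmScale ℓ G y ≤ rmScale ℓ' G y :=
  Finset.sum_le_sum_of_subset_of_nonneg (Finset.range_mono (by omega))
    fun i _ _ => Real.rpow_nonneg (rmN_nonneg i G y) _

lemma rmN_le_rmScale_pow (j : ℕ) (G : CMetric n) (y : Coord n) :
    rmN j G y ≤ rmScale j G y ^ (j + 2) := by
  have h1 : rmN j G y ^ (1 / ((j : ℝ) + 2)) ≤ rmScale j G y :=
    Finset.single_le_sum (f := fun i : ℕ => rmN i G y ^ (1 / ((i : ℝ) + 2)))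
      (fun i _ => Real.rpow_nonneg (rmN_nonneg i G y) _) (Finset.self_mem_range_succ j)
  calc rmN j G y = (rmN j G y ^ (1 / ((j : ℝ) + 2))) ^ (j + 2) := by
        rw [← Real.rpow_natCast, ← Real.rpow_mul (rmN_nonneg j G y)]
        push_cast
        rw [one_div_mul_cancel (by positivity), Real.rpow_one]
    _ ≤ _ := pow_le_pow_left₀ (Real.rpow_nonneg (rmN_nonneg j G y) _) h1 _

/-- A tensor bounded by the power `s` of the curvature scale of order `ℓ`. -/
def Bd (s ℓ : ℕ) (F : CMetric n → TField n ι) : Prop :=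
  ∃ C : ℝ, 0 ≤ C ∧ ∀ G U, RiemOn G U → ∀ y ∈ U, nrm (G y)⁻¹ (F G y) ≤ C * rmScale ℓ G y ^ s

/-- A tensor of weight `s` and order `ℓ`, together with its first `k` covariant derivatives. -/
def CtlK : ℕ → {ι : Type} → [Fintype ι] → [DecidableEq ι] → ℕ → ℕ →
    (CMetric n → TField n ι) → Prop
  | 0, _, _, _, s, ℓ, F => Bd s ℓ F
  | k + 1, _, _, _, s, ℓ, F => Bd s ℓ F ∧ CtlK k (s + 1) (ℓ + 1) (fun G => gcov G (F G))

/-- A natural tensor whose derivatives are all bounded in terms of the curvature, of weight `s`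
and order `ℓ`. -/
def Ctl (s ℓ : ℕ) (F : CMetric n → TField n ι) : Prop := IsNat F ∧ ∀ k, CtlK k s ℓ F

lemma RiemOn.inv_posDef {G : CMetric n} {U : Set (Coord n)} (h : RiemOn G U) {y : Coord n}
    (hy : y ∈ U) : ((G y)⁻¹).PosDef := (h.posDef y hy).inv

/-- Two tensors depending on a metric agree for all Riemannian metrics. -/
def REq (F F' : CMetric n → TField n ι) : Prop :=
  ∀ G U, RiemOn G U → ∀ y ∈ U, F G y = F' G y

omit [Fintype ι] [DecidableEq ι] in
lemma REq.symm {F F' : CMetric n → TField n ι} (h : REq F F') : REq F' F :=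
  fun G U hG y hy => (h G U hG y hy).symm

omit [Fintype ι] [DecidableEq ι] in
lemma REq.trans {F F' F'' : CMetric n → TField n ι} (h : REq F F') (h' : REq F' F'') :
    REq F F'' := fun G U hG y hy => (h G U hG y hy).trans (h' G U hG y hy)

lemma REq.gcov {F F' : CMetric n → TField n ι} (h : REq F F') :
    REq (fun G => gcov G (F G)) (fun G => gcov G (F' G)) := fun G U hG _ hy =>
  gcov_congr (Filter.EventuallyEq.refl _ _) ((hG.eventually_mem hy).mono fun z hz => h G U hG z hz)

lemma Bd.congr {s ℓ : ℕ} {F F' : CMetric n → TField n ι} (h : Bd s ℓ F) (e : REq F F') :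
    Bd s ℓ F' := by
  obtain ⟨C, hC, h⟩ := h
  exact ⟨C, hC, fun G U hG y hy => by rw [← e G U hG y hy]; exact h G U hG y hy⟩

lemma CtlK.congr {k : ℕ} : ∀ {ι : Type} [Fintype ι] [DecidableEq ι] {s ℓ : ℕ}
    {F F' : CMetric n → TField n ι}, CtlK k s ℓ F → REq F F' → CtlK k s ℓ F' := by
  induction k with
  | zero => intro ι _ _ s ℓ F F' h e; exact Bd.congr h e
  | succ k ih => intro ι _ _ s ℓ F F' h e; exact ⟨h.1.congr e, ih h.2 e.gcov⟩

lemma Bd.mono {s ℓ ℓ' : ℕ} {F : CMetric n → TField n ι} (h : Bd s ℓ F) (hl : ℓ ≤ ℓ') :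
    Bd s ℓ' F := by
  obtain ⟨C, hC, h⟩ := h
  refine ⟨C, hC, fun G U hG y hy => (h G U hG y hy).trans ?_⟩
  have := rmScale_mono hl G y
  have := rmScale_nonneg ℓ G y
  gcongr

lemma CtlK.mono {k : ℕ} : ∀ {ι : Type} [Fintype ι] [DecidableEq ι] {s ℓ ℓ' : ℕ}
    {F : CMetric n → TField n ι}, CtlK k s ℓ F → ℓ ≤ ℓ' → CtlK k s ℓ' F := by
  induction k with
  | zero => intro ι _ _ s ℓ ℓ' F h e; exact Bd.mono h e
  | succ k ih => intro ι _ _ s ℓ ℓ' F h e; exact ⟨h.1.mono e, ih h.2 (by omega)⟩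

lemma CtlK.bd {k : ℕ} {s ℓ : ℕ} {F : CMetric n → TField n ι} (h : CtlK k s ℓ F) : Bd s ℓ F := by
  cases k with
  | zero => exact h
  | succ k => exact h.1

lemma CtlK.of_succ {k : ℕ} : ∀ {ι : Type} [Fintype ι] [DecidableEq ι] {s ℓ : ℕ}
    {F : CMetric n → TField n ι}, CtlK (k + 1) s ℓ F → CtlK k s ℓ F := by
  induction k with
  | zero => intro ι _ _ s ℓ F h; exact h.1
  | succ k ih => intro ι _ _ s ℓ F h; exact ⟨h.1, ih h.2⟩

lemma gcov_relabC (G : CMetric n) {f : ι → κ} (hf : Bijective f) (T : TField n ι) (y : Coord n) :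
    gcov G (fun z => relabC f (T z)) y = relabC (Option.map f) (gcov G T y) := by
  funext c
  simp only [gcov, cov_relabC G hf]
  rfl

omit [Fintype ι] [DecidableEq ι] [Fintype κ] [DecidableEq κ] in
lemma option_map_bijective {f : ι → κ} (hf : Bijective f) : Bijective (Option.map f) :=
  (Equiv.optionCongr (Equiv.ofBijective f hf)).bijective

lemma Bd.relabC {s ℓ : ℕ} {F : CMetric n → TField n ι} (h : Bd s ℓ F) {f : ι → κ}
    (hf : Bijective f) : Bd s ℓ (fun G y => relabC f (F G y)) := by
  obtain ⟨C, hC, h⟩ := h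
  exact ⟨C, hC, fun G U hG y hy => by rw [nrm_relabC _ hf]; exact h G U hG y hy⟩

lemma CtlK.relabC {k : ℕ} : ∀ {ι κ : Type} [Fintype ι] [DecidableEq ι] [Fintype κ] [DecidableEq κ]
    {s ℓ : ℕ} {F : CMetric n → TField n ι} {f : ι → κ}, CtlK k s ℓ F → Bijective f →
    CtlK k s ℓ (fun G y => relabC f (F G y)) := by
  induction k with
  | zero => intro ι κ _ _ _ _ s ℓ F f h hf; exact Bd.relabC h hf
  | succ k ih =>
    intro ι κ _ _ _ _ s ℓ F f h hf
    refine ⟨h.1.relabC hf, (ih h.2 (option_map_bijective hf)).congr ?_⟩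
    exact fun G U hG y hy => (gcov_relabC G hf _ y).symm

lemma Bd.add {s ℓ : ℕ} {F F' : CMetric n → TField n ι} (h : Bd s ℓ F) (h' : Bd s ℓ F') :
    Bd s ℓ (fun G y => F G y + F' G y) := by
  obtain ⟨C, hC, h⟩ := h
  obtain ⟨C', hC', h'⟩ := h'
  refine ⟨C + C', by positivity, fun G U hG y hy => (nrm_add_le (hG.inv_posDef hy) _ _).trans ?_⟩
  rw [add_mul]
  exact add_le_add (h G U hG y hy) (h' G U hG y hy)

lemma gcov_add (G : CMetric n) {S T : TField n ι} {y : Coord n}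
    (hS : ∀ c, DifferentiableAt ℝ (fun z => S z c) y)
    (hT : ∀ c, DifferentiableAt ℝ (fun z => T z c) y) :
    gcov G (fun z => S z + T z) y = gcov G S y + gcov G T y := by
  funext c; simp only [gcov, cov_add G hS hT, Pi.add_apply]

lemma gcov_smul (G : CMetric n) {T : TField n ι} {y : Coord n} (r : ℝ)
    (hT : ∀ c, DifferentiableAt ℝ (fun z => T z c) y) :
    gcov G (fun z => r • T z) y = r • gcov G T y := by
  funext c; simp only [gcov, cov_smul G r hT, Pi.smul_apply]

lemma CtlK.add {k : ℕ} : ∀ {ι : Type} [Fintype ι] [DecidableEq ι] {s ℓ : ℕ}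
    {F F' : CMetric n → TField n ι}, IsNat F → IsNat F' → CtlK k s ℓ F → CtlK k s ℓ F' →
    CtlK k s ℓ (fun G y => F G y + F' G y) := by
  induction k with
  | zero => intro ι _ _ s ℓ F F' _ _ h h'; exact Bd.add h h'
  | succ k ih =>
    intro ι _ _ s ℓ F F' hn hn' h h'
    refine ⟨h.1.add h'.1, (ih hn.gcov hn'.gcov h.2 h'.2).congr ?_⟩
    exact fun G U hG y hy => (gcov_add G (hn.diffAt hG hy) (hn'.diffAt hG hy)).symm

lemma Bd.smul {s ℓ : ℕ} {F : CMetric n → TField n ι} (h : Bd s ℓ F) (r : ℝ) :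
    Bd s ℓ (fun G y => r • F G y) := by
  obtain ⟨C, hC, h⟩ := h
  refine ⟨|r| * C, by positivity, fun G U hG y hy => ?_⟩
  rw [nrm_smul, mul_assoc]
  exact mul_le_mul_of_nonneg_left (h G U hG y hy) (abs_nonneg r)

lemma CtlK.smul {k : ℕ} : ∀ {ι : Type} [Fintype ι] [DecidableEq ι] {s ℓ : ℕ}
    {F : CMetric n → TField n ι} (r : ℝ), IsNat F → CtlK k s ℓ F →
    CtlK k s ℓ (fun G y => r • F G y) := by
  induction k with
  | zero => intro ι _ _ s ℓ F r _ h; exact Bd.smul h r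
  | succ k ih =>
    intro ι _ _ s ℓ F r hn h
    refine ⟨h.1.smul r, (ih r hn.gcov h.2).congr ?_⟩
    exact fun G U hG y hy => (gcov_smul G r (hn.diffAt hG hy)).symm

lemma Bd.trcC {s ℓ : ℕ} {F : CMetric n → TField n (Option (Option ι))} (h : Bd s ℓ F) :
    Bd s ℓ (fun G y => trcC (G y)⁻¹ (F G y)) := by
  obtain ⟨C, hC, h⟩ := h
  refine ⟨Real.sqrt n * C, by positivity, fun G U hG y hy =>
    (nrm_trcC_le (hG.inv_posDef hy) _).trans ?_⟩
  rw [mul_assoc]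
  exact mul_le_mul_of_nonneg_left (h G U hG y hy) (Real.sqrt_nonneg _)

/-- The permutation of slots that moves the first slot behind the next two. -/
def rot3 : Option (Option (Option ι)) → Option (Option (Option ι))
  | none => some (some none)
  | some none => none
  | some (some none) => some none
  | some (some (some x)) => some (some (some x))

omit [Fintype ι] [DecidableEq ι] in
lemma rot3_bijective : Bijective (rot3 (ι := ι)) := by
  refine bijective_iff_has_inverse.2 ⟨fun o => match o with
    | none => some none
    | some none => some (some none)
    | some (some none) => none
    | some (some (some x)) => some (some (some x)), ?_, ?_⟩ <;>
  · rintro (_ | _ | _ | x) <;> rfl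

omit [Fintype ι] [DecidableEq ι] in
lemma oc_comp_rot3 (a b i : Fin n) (c : ι → Fin n) :
    oc a (oc b (oc i c)) ∘ rot3 = oc i (oc a (oc b c)) := by
  funext o; rcases o with (_ | _ | _ | x) <;> rfl

lemma gcov_trcC {G : CMetric n} {U : Set (Coord n)} (h : RiemOn G U) {y : Coord n}
    (hy : y ∈ U) {T : TField n (Option (Option ι))}
    (hT : ∀ c, DifferentiableAt ℝ (fun z => T z c) y) :
    gcov G (fun z => trcC (G z)⁻¹ (T z)) y = trcC (G y)⁻¹ (relabC rot3 (gcov G T y)) := by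
  funext c
  simp only [gcov, cov_trcC h hy hT]
  simp only [trcC, relabC]
  rw [← oc_eta c]
  simp only [oc_comp_rot3, oc_none, oc_comp_some, gcov_oc]

lemma CtlK.trcC {k : ℕ} : ∀ {ι : Type} [Fintype ι] [DecidableEq ι] {s ℓ : ℕ}
    {F : CMetric n → TField n (Option (Option ι))}, IsNat F → CtlK k s ℓ F →
    CtlK k s ℓ (fun G y => trcC (G y)⁻¹ (F G y)) := by
  induction k with
  | zero => intro ι _ _ s ℓ F _ h; exact Bd.trcC h
  | succ k ih =>
    intro ι _ _ s ℓ F hn h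
    refine ⟨h.1.trcC, (ih (hn.gcov.relabC rot3_bijective) (h.2.relabC rot3_bijective)).congr ?_⟩
    exact fun G U hG y hy => (gcov_trcC hG hy (hn.diffAt hG hy)).symm

lemma Bd.mulC {s ℓ s' : ℕ} {F : CMetric n → TField n ι} {E : CMetric n → TField n κ}
    (h : Bd s ℓ F) (h' : Bd s' ℓ E) : Bd (s + s') ℓ (fun G y => mulC (F G y) (E G y)) := by
  obtain ⟨C, hC, h⟩ := h
  obtain ⟨C', hC', h'⟩ := h'
  refine ⟨C * C', by positivity, fun G U hG y hy => ?_⟩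
  rw [nrm_mulC (hG.inv_posDef hy), pow_add]
  calc _ ≤ (C * rmScale ℓ G y ^ s) * (C' * rmScale ℓ G y ^ s') :=
        mul_le_mul (h G U hG y hy) (h' G U hG y hy) (nrm_nonneg _ _)
          (mul_nonneg hC (pow_nonneg (rmScale_nonneg _ _ _) _))
    _ = _ := by ring

/-- Slots of a product whose first factor has been differentiated. -/
def mulSlotL : Option ι ⊕ κ → Option (ι ⊕ κ)
  | .inl none => none
  | .inl (some i) => some (.inl i)
  | .inr k => some (.inr k)

/-- Slots of a product whose second factor has been differentiated. -/
def mulSlotR : ι ⊕ Option κ → Option (ι ⊕ κ)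
  | .inl i => some (.inl i)
  | .inr none => none
  | .inr (some k) => some (.inr k)

omit [Fintype ι] [DecidableEq ι] [Fintype κ] [DecidableEq κ] in
lemma mulSlotL_bijective : Bijective (mulSlotL (ι := ι) (κ := κ)) := by
  refine bijective_iff_has_inverse.2 ⟨fun o => match o with
    | none => .inl none
    | some (.inl i) => .inl (some i)
    | some (.inr k) => .inr k, ?_, ?_⟩
  · rintro ((_ | _) | _) <;> rfl
  · rintro (_ | _ | _) <;> rfl

omit [Fintype ι] [DecidableEq ι] [Fintype κ] [DecidableEq κ] in
lemma mulSlotR_bijective : Bijective (mulSlotR (ι := ι) (κ := κ)) := by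
  refine bijective_iff_has_inverse.2 ⟨fun o => match o with
    | none => .inr none
    | some (.inl i) => .inl i
    | some (.inr k) => .inr (some k), ?_, ?_⟩
  · rintro (_ | _ | _) <;> rfl
  · rintro (_ | _ | _) <;> rfl

lemma gcov_mulC (G : CMetric n) {S : TField n ι} {T : TField n κ} {y : Coord n}
    (hS : ∀ c, DifferentiableAt ℝ (fun z => S z c) y)
    (hT : ∀ c, DifferentiableAt ℝ (fun z => T z c) y) :
    gcov G (fun z => mulC (S z) (T z)) y
      = relabC mulSlotL (mulC (gcov G S y) (T y)) + relabC mulSlotR (mulC (S y) (gcov G T y)) := by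
  funext c
  simp only [gcov, cov_mulC G hS hT]
  rfl

/-- By the Leibniz rule one derivative falls on one factor at a time. The other factor then has a
derivative to spare (`of_succ`) and is regarded as being of the higher order `ℓ + 1`. -/
lemma CtlK.mulC {k : ℕ} : ∀ {ι κ : Type} [Fintype ι] [DecidableEq ι] [Fintype κ] [DecidableEq κ]
    {s ℓ s' : ℕ} {F : CMetric n → TField n ι} {E : CMetric n → TField n κ}, IsNat F → IsNat E →
    CtlK k s ℓ F → CtlK k s' ℓ E → CtlK k (s + s') ℓ (fun G y => mulC (F G y) (E G y)) := by
  induction k with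
  | zero => intro ι κ _ _ _ _ s ℓ s' F E _ _ h h'; exact Bd.mulC h h'
  | succ k ih =>
    intro ι κ _ _ _ _ s ℓ s' F E hn hn' h h'
    refine ⟨h.1.mulC h'.1, ?_⟩
    have h1 := (ih hn.gcov hn' h.2 ((of_succ h').mono (Nat.le_succ ℓ))).relabC
      (f := mulSlotL) mulSlotL_bijective
    have h2 := (ih hn hn'.gcov ((of_succ h).mono (Nat.le_succ ℓ)) h'.2).relabC
      (f := mulSlotR) mulSlotR_bijective
    rw [add_right_comm] at h1
    rw [← add_assoc] at h2
    refine (CtlK.add ((hn.gcov.mulC hn').relabC mulSlotL_bijective)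
      ((hn.mulC hn'.gcov).relabC mulSlotR_bijective) h1 h2).congr ?_
    exact fun G U hG y hy => (gcov_mulC G (hn.diffAt hG hy) (hn'.diffAt hG hy)).symm

namespace Ctl

variable {s ℓ s' ℓ' : ℕ} {F F' : CMetric n → TField n ι} {E : CMetric n → TField n κ}

lemma bd (h : Ctl s ℓ F) : Bd s ℓ F := (h.2 0).bd

lemma mono (h : Ctl s ℓ F) (hl : ℓ ≤ ℓ') : Ctl s ℓ' F := ⟨h.1, fun k => (h.2 k).mono hl⟩

lemma congr (h : Ctl s ℓ F) (hn : IsNat F') (e : REq F F') : Ctl s ℓ F' :=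
  ⟨hn, fun k => (h.2 k).congr e⟩

lemma gcov (h : Ctl s ℓ F) : Ctl (s + 1) (ℓ + 1) (fun G => gcov G (F G)) :=
  ⟨h.1.gcov, fun k => (h.2 (k + 1)).2⟩

lemma relabC {f : ι → κ} (h : Ctl s ℓ F) (hf : Bijective f) :
    Ctl s ℓ (fun G y => relabC f (F G y)) :=
  ⟨h.1.relabC hf, fun k => (h.2 k).relabC hf⟩

lemma add (h : Ctl s ℓ F) (h' : Ctl s ℓ F') : Ctl s ℓ (fun G y => F G y + F' G y) :=
  ⟨h.1.add h'.1, fun k => (h.2 k).add h.1 h'.1 (h'.2 k)⟩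

lemma smul (r : ℝ) (h : Ctl s ℓ F) : Ctl s ℓ (fun G y => r • F G y) :=
  ⟨h.1.smul r, fun k => (h.2 k).smul r h.1⟩

lemma neg (h : Ctl s ℓ F) : Ctl s ℓ (fun G y => -F G y) := by
  simpa using h.smul (-1)

lemma sub (h : Ctl s ℓ F) (h' : Ctl s ℓ F') : Ctl s ℓ (fun G y => F G y - F' G y) := by
  simpa [sub_eq_add_neg] using h.add h'.neg

lemma trcC {F : CMetric n → TField n (Option (Option ι))} (h : Ctl s ℓ F) :
    Ctl s ℓ (fun G y => trcC (G y)⁻¹ (F G y)) :=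
  ⟨h.1.trcC, fun k => (h.2 k).trcC h.1⟩

lemma mulC (h : Ctl s ℓ F) (h' : Ctl s' ℓ' E) :
    Ctl (s + s') (max ℓ ℓ') (fun G y => mulC (F G y) (E G y)) :=
  ⟨h.1.mulC h'.1, fun k => CtlK.mulC h.1 h'.1 ((h.2 k).mono (le_max_left _ _))
    ((h'.2 k).mono (le_max_right _ _))⟩

lemma zero : Ctl s ℓ (fun (_ : CMetric n) (_ : Coord n) => (0 : Comp n ι)) := by
  refine ⟨IsNat.zero, fun k => ?_⟩
  have hb : ∀ {ι : Type} [Fintype ι] [DecidableEq ι] (s ℓ : ℕ),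
      Bd s ℓ (fun (_ : CMetric n) (_ : Coord n) => (0 : Comp n ι)) := fun s ℓ =>
    ⟨0, le_rfl, fun G U _ y _ => by simp [nrm, ip]⟩
  induction k generalizing ι s ℓ with
  | zero => exact hb s ℓ
  | succ k ih => exact ⟨hb s ℓ, ih.congr fun G U _ y _ => (gcov_zero G y).symm⟩

lemma sum {α : Type*} (t : Finset α) {F : α → CMetric n → TField n ι}
    (h : ∀ i ∈ t, Ctl s ℓ (F i)) : Ctl s ℓ (fun G y => ∑ i ∈ t, F i G y) := by
  classical
  induction t using Finset.induction_on with
  | empty => simpa using zero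
  | insert a t ha ih =>
    simp only [Finset.sum_insert ha]
    exact (h a (Finset.mem_insert_self _ _)).add
      (ih fun i hi => h i (Finset.mem_insert_of_mem hi))

lemma of_parallel (hn : IsNat F) (hb : Bd 0 0 F) (h0 : REq (fun G => CurvatureFlow.gcov G (F G))
    (fun _ _ => 0)) : Ctl 0 0 F := by
  refine ⟨hn, fun k => ?_⟩
  cases k with
  | zero => exact hb
  | succ k => exact ⟨hb, (zero.2 k).congr h0.symm⟩

/-- The metric is parallel, so only its norm has to be bounded. In an orthonormal frame its
components are those of the identity matrix, hence at most one in absolute value. -/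
lemma metT : Ctl 0 0 (metT (n := n)) := by
  refine of_parallel IsNat.metT ?_ fun G U hG y hy => gcov_metT hG hy
  refine ⟨Real.sqrt (Fintype.card (Fin 2 → Fin n)), Real.sqrt_nonneg _, fun G U hG y hy => ?_⟩
  rw [pow_zero, mul_one]
  refine Real.sqrt_le_sqrt ?_
  obtain ⟨J, hJ, h⟩ := posDef_eq_mul_transpose (hG.inv_posDef hy)
  rw [h, ip_mul_transpose]
  have hJt : IsUnit (Jᵀ).det := by rwa [Matrix.det_transpose]
  have h1 : Jᵀ * (G y * J) = 1 := by
    have h2 : G y = (Jᵀ)⁻¹ * J⁻¹ := by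
      rw [← Matrix.mul_inv_rev, ← h, Matrix.nonsing_inv_nonsing_inv _ (hG.isUnit_det hy)]
    rw [h2, Matrix.mul_assoc, Matrix.nonsing_inv_mul _ hJ, Matrix.mul_one,
      Matrix.mul_nonsing_inv _ hJt]
  have h3 : ∀ c, act J (CurvatureFlow.metT G y) c = (1 : Mat n) (c 0) (c 1) := by
    intro c
    obtain ⟨i, j, rfl⟩ : ∃ i j, c = ![i, j] := ⟨c 0, c 1, by funext x; fin_cases x <;> rfl⟩
    rw [← h1]
    simp only [act_vecCons, act_empty]
    change ∑ a, J a i * ∑ b, J b j * G y a b = (Jᵀ * (G y * J)) i j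
    rw [Matrix.mul_apply]
    refine Finset.sum_congr rfl fun a _ => ?_
    rw [Matrix.mul_apply, Matrix.transpose_apply]
    congr 1
    exact Finset.sum_congr rfl fun b _ => mul_comm _ _
  have h4 : ∀ c, act J (CurvatureFlow.metT G y) c * act J (CurvatureFlow.metT G y) c ≤ 1 := by
    intro c
    rw [h3, Matrix.one_apply]
    split_ifs <;> norm_num
  refine (Finset.sum_le_sum fun c _ => h4 c).trans ?_
  simp

end Ctl

lemma gcov_eq_relabC_covDeriv {m : ℕ} (G : CMetric n) (T : CTensor n m) (y : Coord n) :
    gcov G T y = relabC (finSuccEquiv m) (covDeriv G T y) := by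
  funext c
  rw [covDeriv_eq_relabC]
  simp only [relabC]
  congr 1
  funext o
  cases o <;> simp [optFin]

lemma IsNat.iterCovDeriv {m : ℕ} {F : CMetric n → CTensor n m} (h : IsNat F) (k : ℕ) :
    IsNat (fun G => iterCovDeriv G (F G) k) := by
  induction k with
  | zero => exact h
  | succ k ih => exact IsNat.relabC (f := optFin _) (optFin_bijective _) ih.gcov

/-- The exponents in `rmScale` are chosen so that `∇^j Rm` has weight `j + 2` and order `j`. The
induction treats all `j` at once because the derivative of `∇^j Rm` is `∇^{j+1} Rm` up to
relabelling. -/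
lemma Ctl.riem : Ctl 2 0 (riem (n := n)) := by
  refine ⟨IsNat.riem, fun k => ?_⟩
  have hb : ∀ j, Bd (n := n) (j + 2) j (fun G => iterCovDeriv G (CurvatureFlow.riem G) j) :=
    fun j => ⟨1, zero_le_one, fun G U _ y _ => by rw [one_mul]; exact rmN_le_rmScale_pow j G y⟩
  have key : ∀ j, CtlK (n := n) k (j + 2) j (fun G => iterCovDeriv G (CurvatureFlow.riem G) j) := by
    induction k with
    | zero => exact hb
    | succ k ih =>
      intro j
      refine ⟨hb j, ?_⟩
      have h1 := (ih (j + 1)).relabC (finSuccEquiv (4 + j)).bijective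
      rw [add_right_comm] at h1
      exact h1.congr fun G U _ y _ => (gcov_eq_relabC_covDeriv G _ y).symm
  exact key 0

end Control

/-! ### Commutators of derivatives and universal quadratic expressions -/

section Commutators

open Function Matrix

variable {n : ℕ} {ι κ : Type} [Fintype ι] [DecidableEq ι] [Fintype κ] [DecidableEq κ]

/-- Exchange of the first two slots. -/
def swapO : Option (Option ι) → Option (Option ι)
  | none => some none
  | some none => none
  | some (some x) => some (some x)

omit [Fintype ι] [DecidableEq ι] in
lemma swapO_involutive : Involutive (swapO (ι := ι)) := by
  rintro (_ | _ | x) <;> rfl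

omit [Fintype ι] [DecidableEq ι] in
lemma swapO_bijective : Bijective (swapO (ι := ι)) := swapO_involutive.bijective

omit [Fintype ι] [DecidableEq ι] in
@[simp] lemma oc_comp_swapO (a b : Fin n) (c : ι → Fin n) :
    oc a (oc b c) ∘ swapO = oc b (oc a c) := by
  funext o; rcases o with (_ | _ | x) <;> rfl

omit [Fintype ι] [DecidableEq ι] [Fintype κ] [DecidableEq κ] in
@[simp] lemma oc_comp_map (f : ι → κ) (a : Fin n) (c : κ → Fin n) :
    oc a c ∘ Option.map f = oc a (c ∘ f) := by
  funext o; cases o <;> rfl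

/-! ### The action of a tensor on another one by derivations -/

/-- The derivation of `t` induced by `X`, seen as a tensor with values in endomorphisms. -/
def derC (H : Mat n) (X : Comp n (Option (Option κ))) (t : Comp n ι) : Comp n (κ ⊕ ι) :=
  fun c => der (Matrix.of fun a b => ∑ k, H a k * X (oc k (oc b (c ∘ Sum.inl)))) t (c ∘ Sum.inr)

/-- The slots of the product underlying the `l`-th term of `derC`. -/
def derSlot (l : ι) : Option (Option κ) ⊕ ι → Option (Option (κ ⊕ ι))
  | .inl none => some none
  | .inl (some none) => some (some (.inr l))
  | .inl (some (some x)) => some (some (.inl x))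
  | .inr m => if m = l then none else some (some (.inr m))

omit [Fintype ι] [Fintype κ] [DecidableEq κ] in
lemma derSlot_bijective (l : ι) : Bijective (derSlot (κ := κ) l) := by
  constructor
  · rintro ((_ | _ | x) | m) ((_ | _ | x') | m') h <;> simp only [derSlot] at h <;>
      (try split_ifs at h) <;> simp_all
  · rintro (_ | _ | x | m)
    · exact ⟨.inr l, by simp [derSlot]⟩
    · exact ⟨.inl none, rfl⟩
    · exact ⟨.inl (some (some x)), rfl⟩
    · by_cases h : m = l
      · exact ⟨.inl (some none), by simp [derSlot, h]⟩
      · exact ⟨.inr m, by simp [derSlot, h]⟩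

omit [Fintype κ] [DecidableEq κ] in
lemma derC_eq (H : Mat n) (X : Comp n (Option (Option κ))) (t : Comp n ι) :
    derC H X t = ∑ l, trcC H (relabC (derSlot l) (mulC X t)) := by
  funext c
  simp only [derC, der, Finset.sum_apply, trcC, relabC, mulC, Matrix.of_apply, Finset.sum_mul]
  refine Finset.sum_congr rfl fun l _ => Finset.sum_congr rfl fun a _ =>
    Finset.sum_congr rfl fun k _ => ?_
  have e1 : (oc a (oc k c) ∘ derSlot l) ∘ Sum.inl = oc k (oc (c (Sum.inr l)) (c ∘ Sum.inl)) := by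
    funext o; rcases o with (_ | _ | x) <;> rfl
  have e2 : (oc a (oc k c) ∘ derSlot (κ := κ) l) ∘ Sum.inr = update (c ∘ Sum.inr) l a := by
    funext m
    by_cases h : m = l
    · subst h; simp [derSlot]
    · simp [derSlot, h]
  rw [e1, e2, mul_assoc]; rfl

lemma Ctl.derC {s s' ℓ ℓ' : ℕ} {X : CMetric n → TField n (Option (Option κ))}
    {F : CMetric n → TField n ι} (hX : Ctl s ℓ X) (hF : Ctl s' ℓ' F) :
    Ctl (s + s') (max ℓ ℓ') (fun G y => derC (G y)⁻¹ (X G y) (F G y)) := by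
  simp only [derC_eq]
  exact Ctl.sum _ fun l _ => ((hX.mulC hF).relabC (derSlot_bijective l)).trcC

/-! ### Commutators of covariant derivatives -/

/-- The curvature tensor as a tensor with the slots of its endomorphism part in front. -/
def riemEnd (G : CMetric n) : TField n (Option (Option (Fin 2))) :=
  fun y c => riem G y ![c (some (some 0)), c (some (some 1)), c none, c (some none)]

/-- The slots of `riemEnd`. -/
def riemEndSlot : Fin 4 → Option (Option (Fin 2)) :=
  ![some (some 0), some (some 1), none, some none]

lemma riemEndSlot_bijective : Bijective riemEndSlot := by
  constructor
  · decide
  · rintro (_ | _ | x)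
    · exact ⟨2, rfl⟩
    · exact ⟨3, rfl⟩
    · fin_cases x
      · exact ⟨0, rfl⟩
      · exact ⟨1, rfl⟩

lemma Ctl.riemEnd : Ctl 2 0 (riemEnd (n := n)) := by
  have := Ctl.riem (n := n).relabC riemEndSlot_bijective
  have e : CurvatureFlow.riemEnd (n := n) = fun G y => CurvatureFlow.relabC riemEndSlot (CurvatureFlow.riem G y) := by
    funext G y c
    simp only [CurvatureFlow.riemEnd, CurvatureFlow.relabC]
    congr 1
    funext x; fin_cases x <;> rfl
  rw [e]; exact this

lemma curvM_eq {G : CMetric n} {U : Set (Coord n)} (h : RiemOn G U) {y : Coord n}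
    (hy : y ∈ U) (i j a l : Fin n) :
    curvM G i j y a l = ∑ k, (G y)⁻¹ a k * riem G y ![i, j, k, l] := by
  have : curvM G i j y = (G y)⁻¹ * (G y * curvM G i j y) :=
    (Matrix.nonsing_inv_mul_cancel_left _ _ (h.isUnit_det hy)).symm
  rw [this, Matrix.mul_apply]
  exact Finset.sum_congr rfl fun k _ => by rw [riem_eq]; rfl

/-- The slots `(i, j)` of the commutator `[∇_i, ∇_j]`. -/
def commSlot : Fin 2 ⊕ ι → Option (Option ι)
  | .inl 0 => none
  | .inl 1 => some none
  | .inr x => some (some x)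

omit [Fintype ι] [DecidableEq ι] in
lemma commSlot_bijective : Bijective (commSlot (ι := ι)) := by
  constructor
  · rintro (a | x) (b | x') h
    · fin_cases a <;> fin_cases b <;> simp_all [commSlot]
    · fin_cases a <;> simp_all [commSlot]
    · fin_cases b <;> simp_all [commSlot]
    · simp_all [commSlot]
  · rintro (_ | _ | x)
    · exact ⟨.inl 0, rfl⟩
    · exact ⟨.inl 1, rfl⟩
    · exact ⟨.inr x, rfl⟩

/-- The commutator of covariant derivatives. -/
def comm (G : CMetric n) (T : TField n ι) : TField n (Option (Option ι)) :=
  fun y => gcov G (gcov G T) y - relabC swapO (gcov G (gcov G T) y)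

lemma comm_apply (G : CMetric n) (T : TField n ι) (y : Coord n) (i j : Fin n) (c : ι → Fin n) :
    comm G T y (oc i (oc j c)) = gcov G (gcov G T) y (oc i (oc j c))
      - gcov G (gcov G T) y (oc j (oc i c)) := by
  simp [comm, relabC]

lemma IsNat.comm {F : CMetric n → TField n ι} (h : IsNat F) : IsNat (fun G => comm G (F G)) :=
  h.gcov.gcov.sub (h.gcov.gcov.relabC swapO_bijective)

/-- By the Ricci identity the commutator is an action of the curvature on `F G`: the weight rises by
two, as for any second derivative, but the order does not rise. This gain makes every reordering of
derivatives harmless in the energy estimates. -/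
lemma Ctl.comm {s ℓ : ℕ} {F : CMetric n → TField n ι} (h : Ctl s ℓ F) :
    Ctl (s + 2) ℓ (fun G => comm G (F G)) := by
  have h1 := ((Ctl.riemEnd.derC h).relabC commSlot_bijective).neg
  rw [add_comm 2 s, Nat.zero_max] at h1
  refine h1.congr h.1.comm fun G U hG y hy => ?_
  funext c
  obtain ⟨i, j, c, rfl⟩ : ∃ i j d, c = oc i (oc j d) :=
    ⟨c none, c (some none), c ∘ some ∘ some, by funext o; rcases o with (_ | _ | x) <;> rfl⟩
  rw [comm_apply, ricci_identity hG hy (h.1.contDiffOn hG)]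
  simp only [Pi.neg_apply, CurvatureFlow.relabC, CurvatureFlow.derC]
  have e2 : (oc i (oc j c) ∘ commSlot) ∘ Sum.inr = c := rfl
  rw [e2]
  congr 2
  ext a b
  rw [curvM_eq hG hy]
  rfl

/-! ### Universal quadratic expressions -/

/-- The slots of a tensor before the contraction of its first pair. -/
def pairSlot (k : ℕ) : κ ⊕ (Fin (k + 1) × Fin 2) → Option (Option (κ ⊕ (Fin k × Fin 2)))
  | .inl x => some (some (.inl x))
  | .inr (s, e) => Fin.cases (if e = 0 then none else some none)
      (fun s' => some (some (.inr (s', e)))) s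

omit [Fintype κ] [DecidableEq κ] in
lemma pairSlot_bijective (k : ℕ) : Bijective (pairSlot (κ := κ) k) := by
  refine bijective_iff_has_inverse.2 ⟨fun o => match o with
    | none => .inr (0, 0)
    | some none => .inr (0, 1)
    | some (some (.inl x)) => .inl x
    | some (some (.inr (s, e))) => .inr (s.succ, e), ?_, ?_⟩
  · rintro (x | ⟨s, e⟩)
    · rfl
    · refine Fin.cases ?_ (fun s' => ?_) s
      · fin_cases e <;> rfl
      · rfl
  · rintro (_ | _ | x | ⟨s, e⟩) <;> rfl

/-- Contraction of `k` pairs of slots. -/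
def trPairs (k : ℕ) (H : Mat n) (t : Comp n (κ ⊕ (Fin k × Fin 2))) : Comp n κ :=
  fun c => ∑ d : Fin k × Fin 2 → Fin n, t (Sum.elim c d) * ∏ s, H (d (s, 0)) (d (s, 1))

omit [Fintype κ] [DecidableEq κ] in
lemma trPairs_zero (H : Mat n) (t : Comp n (κ ⊕ (Fin 0 × Fin 2))) :
    trPairs 0 H t = relabC (Equiv.sumEmpty κ (Fin 0 × Fin 2)) t := by
  funext c
  simp only [trPairs, relabC]
  rw [Fintype.sum_unique]
  simp only [Finset.univ_eq_empty, Finset.prod_empty, mul_one]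
  congr 1
  funext x
  rcases x with x | ⟨s, _⟩
  · rfl
  · exact s.elim0

omit [Fintype κ] [DecidableEq κ] in
lemma trPairs_succ (k : ℕ) (H : Mat n) (t : Comp n (κ ⊕ (Fin (k + 1) × Fin 2))) :
    trPairs (k + 1) H t = trPairs k H (trcC H (relabC (pairSlot k) t)) := by
  funext c
  simp only [trPairs, trcC, relabC, Finset.sum_mul]
  rw [Finset.sum_comm]
  simp only [Finset.sum_comm (s := Finset.univ (α := Fin k × Fin 2 → Fin n))]
  rw [← Fintype.sum_prod_type', ← Fintype.sum_prod_type']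
  refine (Fintype.sum_equiv (Equiv.mk
    (fun p : (Fin n × Fin n) × (Fin k × Fin 2 → Fin n) => fun x : Fin (k + 1) × Fin 2 =>
      Fin.cases (motive := fun _ => Fin n) (if x.2 = 0 then p.1.1 else p.1.2)
        (fun s => p.2 (s, x.2)) x.1)
    (fun d => ((d (0, 0), d (0, 1)), fun x => d (x.1.succ, x.2))) ?_ ?_) _ _ ?_).symm
  · intro p; simp
  · intro d
    funext ⟨s, e⟩
    refine Fin.cases ?_ (fun s' => ?_) s
    · fin_cases e <;> simp
    · simp
  · intro p
    simp only [Equiv.coe_fn_mk, Fin.prod_univ_succ, Fin.cases_zero, Fin.cases_succ, if_true,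
      one_ne_zero, if_false]
    rw [mul_comm (H _ _) (t _), mul_assoc]
    congr 2
    funext x
    rcases x with x | ⟨s, e⟩
    · rfl
    · refine Fin.cases ?_ (fun s' => ?_) s
      · fin_cases e <;> rfl
      · rfl

lemma Ctl.trPairs (k : ℕ) {s ℓ : ℕ} {F : CMetric n → TField n (κ ⊕ (Fin k × Fin 2))}
    (h : Ctl s ℓ F) : Ctl s ℓ (fun G y => trPairs k (G y)⁻¹ (F G y)) := by
  induction k with
  | zero =>
    simp only [trPairs_zero]
    exact h.relabC (Equiv.bijective _)
  | succ k ih =>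
    simp only [trPairs_succ]
    exact ih (h.relabC (pairSlot_bijective k)).trcC

/-- The constant `1`, as a tensor without slots. -/
lemma Ctl.one [IsEmpty ι] : Ctl 0 0 (fun (_ : CMetric n) (_ : Coord n) => (1 : Comp n ι)) := by
  refine Ctl.of_parallel ⟨fun _ => rfl, fun _ _ => contDiffOn_const, fun _ _ z _ => ?_⟩
    ⟨1, zero_le_one, fun G U _ y _ => ?_⟩ fun G U _ y _ => ?_
  · funext c; simp [act]
  · simp [nrm, ip]
  · funext c; simp [CurvatureFlow.gcov, cov, pd, der, partialDeriv_const]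

/-- The slots of a product of pairs. -/
def prodSlot (p m : ℕ) : Fin m ⊕ (Fin p × Fin m) → Fin (p + 1) × Fin m
  | .inl e => (0, e)
  | .inr (r, e) => (r.succ, e)

lemma prodSlot_bijective (p m : ℕ) : Bijective (prodSlot p m) := by
  constructor
  · rintro (e | ⟨r, e⟩) (e' | ⟨r', e'⟩) h <;> simp [prodSlot, Fin.succ_ne_zero] at h ⊢
    · exact h
    · exact absurd h.1 (Fin.succ_ne_zero r').symm
    · exact h
  · rintro ⟨s, e⟩
    refine Fin.cases ⟨.inl e, rfl⟩ (fun r => ⟨.inr (r, e), rfl⟩) s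

lemma Ctl.prod {m s ℓ : ℕ} {F : CMetric n → TField n (Fin m)} (h : Ctl s ℓ F) (p : ℕ) :
    Ctl (s * p) ℓ (fun G y (c : Fin p × Fin m → Fin n) => ∏ r, F G y fun e => c (r, e)) := by
  induction p with
  | zero =>
    have := (Ctl.one (n := n) (ι := Fin 0 × Fin m)).mono (Nat.zero_le ℓ)
    simp only [Nat.mul_zero, Finset.univ_eq_empty, Finset.prod_empty]
    exact this
  | succ p ih =>
    have h1 := (h.mulC ih).relabC (prodSlot_bijective p m)
    rw [max_self, ← mul_one_add, add_comm 1 p] at h1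
    have e : (fun G y (c : Fin (p + 1) × Fin m → Fin n) => ∏ r, F G y fun e => c (r, e))
        = fun G y => CurvatureFlow.relabC (prodSlot p m) (CurvatureFlow.mulC (F G y)
          fun c => ∏ r, F G y fun e => c (r, e)) := by
      funext G y c
      rw [Fin.prod_univ_succ]; rfl
    rw [e]; exact h1

/-- The quadratic expressions `Rm * Rm` as tensors. -/
def starT (τ : StarTerm) (G : CMetric n) : TField n (Fin 2) :=
  fun y c => τ.eval G y (c 0) (c 1)

/-- A contraction scheme multiplies two factors `Rm`, of weight two each, with parallel factors `g`,
then relabels and contracts the slots in pairs. -/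
lemma Ctl.starT (τ : StarTerm) : Ctl 4 0 (starT (n := n) τ) := by
  have h1 := (((Ctl.riem (n := n).prod 2).mulC (Ctl.metT.prod τ.p)).relabC
    τ.slot.symm.bijective).trPairs (τ.p + 3)
  simp only [zero_mul, max_self] at h1
  have e : CurvatureFlow.starT (n := n) τ = fun G y => CurvatureFlow.trPairs (τ.p + 3) (G y)⁻¹
      (CurvatureFlow.relabC τ.slot.symm (CurvatureFlow.mulC
        (fun c : Fin 2 × Fin 4 → Fin n => ∏ r, CurvatureFlow.riem G y fun e => c (r, e))
        (fun c : Fin τ.p × Fin 2 → Fin n => ∏ r, CurvatureFlow.metT G y fun e => c (r, e)))) := by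
    funext G y c
    simp only [CurvatureFlow.starT, StarTerm.eval, CurvatureFlow.trPairs]
    rw [← sum_comp_bij τ.slot.symm.bijective, sum_sumType]
    -- The condition in `StarTerm.eval` freezes the two free indices, so a single value of them
    -- contributes to the sum.
    rw [Finset.sum_eq_single c]
    · refine Finset.sum_congr rfl fun d _ => ?_
      simp only [Function.comp_apply, Equiv.symm_apply_apply, Sum.elim_inl, Sum.elim_inr, true_and, if_true]
      rfl
    · intro c' _ hc'
      refine Finset.sum_eq_zero fun d _ => if_neg ?_
      simp only [Function.comp_apply, Equiv.symm_apply_apply, Sum.elim_inl]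
      rintro ⟨h0, h1⟩
      exact hc' (by funext x; fin_cases x <;> assumption)
    · simp
  rw [e]; exact h1

end Commutators

/-! ### Natural functions, divergences and abstract integrals -/

section Functionals

open Function Matrix

variable {n : ℕ} {ι κ : Type} [Fintype ι] [DecidableEq ι] [Fintype κ] [DecidableEq κ]

/-! ### Natural functions -/

namespace IsNatCont

variable {f f' : CMetric n → Coord n → ℝ}

lemma const (r : ℝ) : IsNatCont (fun (_ : CMetric n) (_ : Coord n) => r) :=
  ⟨fun _ => rfl, fun _ => continuousOn_const, fun _ _ _ _ => rfl⟩

lemma add (h : IsNatCont f) (h' : IsNatCont f') : IsNatCont (fun G y => f G y + f' G y) :=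
  ⟨fun e => by rw [h.congr e, h'.congr e], fun hG => (h.cont hG).add (h'.cont hG),
    fun hφ hG z hz => by rw [h.pull hφ hG z hz, h'.pull hφ hG z hz]⟩

lemma mul (h : IsNatCont f) (h' : IsNatCont f') : IsNatCont (fun G y => f G y * f' G y) :=
  ⟨fun e => by rw [h.congr e, h'.congr e], fun hG => (h.cont hG).mul (h'.cont hG),
    fun hφ hG z hz => by rw [h.pull hφ hG z hz, h'.pull hφ hG z hz]⟩

lemma comp {φ : ℝ → ℝ} (hφ : Continuous φ) (h : IsNatCont f) : IsNatCont (fun G y => φ (f G y)) :=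
  ⟨fun e => by rw [h.congr e], fun hG => hφ.comp_continuousOn (h.cont hG),
    fun hφ hG z hz => by rw [h.pull hφ hG z hz]⟩

lemma smul (r : ℝ) (h : IsNatCont f) : IsNatCont (fun G y => r * f G y) := (const r).mul h

lemma neg (h : IsNatCont f) : IsNatCont (fun G y => -f G y) := h.comp continuous_neg

lemma sub (h : IsNatCont f) (h' : IsNatCont f') : IsNatCont (fun G y => f G y - f' G y) := by
  simpa only [sub_eq_add_neg] using h.add h'.neg

lemma pow (k : ℕ) (h : IsNatCont f) : IsNatCont (fun G y => f G y ^ k) :=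
  h.comp (continuous_pow k)

lemma rpow {r : ℝ} (hr : 0 ≤ r) (h : IsNatCont f) : IsNatCont (fun G y => f G y ^ r) :=
  h.comp (Real.continuous_rpow_const hr)

lemma nrm {F : CMetric n → TField n ι} (h : IsNat F) :
    IsNatCont (fun G y => nrm (G y)⁻¹ (F G y)) :=
  (h.ip h).isNatCont.comp Real.continuous_sqrt

lemma rmN (j : ℕ) : IsNatCont (rmN (n := n) j) := nrm (IsNat.riem.iterCovDeriv j)

lemma sum {α : Type*} (s : Finset α) {f : α → CMetric n → Coord n → ℝ}
    (h : ∀ i ∈ s, IsNatCont (f i)) : IsNatCont (fun G y => ∑ i ∈ s, f i G y) := by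
  classical
  induction s using Finset.induction_on with
  | empty => simpa using const 0
  | insert a s ha ih =>
    simp only [Finset.sum_insert ha]
    exact (h a (Finset.mem_insert_self _ _)).add
      (ih fun i hi => h i (Finset.mem_insert_of_mem hi))

end IsNatCont

/-! ### Divergences -/

/-- The divergence of a tensor field with respect to its first slot. -/
def divT (G : CMetric n) (Y : TField n (Option ι)) : TField n ι :=
  fun y => trcC (G y)⁻¹ (gcov G Y y)

lemma IsNat.divT {F : CMetric n → TField n (Option ι)} (h : IsNat F) :
    IsNat (fun G => divT G (F G)) := h.gcov.trcC

lemma Ctl.divT {s ℓ : ℕ} {F : CMetric n → TField n (Option ι)} (h : Ctl s ℓ F) :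
    Ctl (s + 1) (ℓ + 1) (fun G => divT G (F G)) := h.gcov.trcC

lemma ip_sum_right {α : Type*} (H : Mat n) (s : Comp n ι) (a : Finset α) (f : α → Comp n ι) :
    ip H s (∑ b ∈ a, f b) = ∑ b ∈ a, ip H s (f b) :=
  map_sum (AddMonoidHom.mk' (fun t => ip H s t) fun a b => ip_add_right H s a b) f a

/-- The contraction of `s` with the last slots of `t`, a `1`-form. -/
def ipForm (H : Mat n) (s : Comp n ι) (t : Comp n (Option ι)) : Comp n (Option (Fin 0)) :=
  fun c => ip H s fun d => t (oc (c none) d)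

lemma IsNat.ipForm {F : CMetric n → TField n ι} {E : CMetric n → TField n (Option ι)}
    (h : IsNat F) (h' : IsNat E) : IsNat (fun G y => ipForm (G y)⁻¹ (F G y) (E G y)) where
  congr hG := by rw [h.congr hG, h'.congr hG, hG.eq_of_nhds]
  smooth hG c := ContDiffOn.sum fun c _ => ContDiffOn.sum fun d _ =>
    (contDiffOn_prod fun l _ => hG.contDiffOn_inv _ _).mul ((h.smooth hG _).mul (h'.smooth hG _))
  pull {G φ W U} hφ hG z hz := by
    funext c
    obtain ⟨i, c, rfl⟩ : ∃ i d, c = oc i d := ⟨c none, c ∘ some, (oc_eta c).symm⟩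
    rw [h.pull hφ hG z hz, h'.pull hφ hG z hz, act_oc]
    simp only [CurvatureFlow.ipForm, oc_none, act_empty]
    have h1 : (fun d => act (Jac φ z) (E G (φ z)) (oc i d))
        = ∑ b, Jac φ z b i • act (Jac φ z) (fun d => E G (φ z) (oc b d)) := by
      funext d; rw [act_oc]; simp
    rw [h1, ip_sum_right]
    refine Finset.sum_congr rfl fun b _ => ?_
    rw [ip_smul_right, ip_act, pullG_inv hφ G hz]

lemma cov_ipForm {G : CMetric n} {U : Set (Coord n)} (h : RiemOn G U) {y : Coord n} (hy : y ∈ U)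
    {S : TField n ι} {T : TField n (Option ι)} (hS : ∀ c, DifferentiableAt ℝ (fun z => S z c) y)
    (hT : ∀ c, DifferentiableAt ℝ (fun z => T z c) y) (k i : Fin n) (c : Fin 0 → Fin n) :
    cov G k (fun z => ipForm (G z)⁻¹ (S z) (T z)) y (oc i c)
      = ip (G y)⁻¹ (cov G k S y) (fun d => T y (oc i d))
        + ip (G y)⁻¹ (S y) (fun d => cov G k T y (oc i d)) := by
  have h1 := partialDeriv_ip h hy hS (T := fun z d => T z (oc i d)) (fun d => hT _) k
  have h2 : (fun d => cov G k T y (oc i d)) = cov G k (fun z d => T z (oc i d)) y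
      - ∑ a, chrM G k y a i • (fun d => T y (oc a d)) := by
    funext d
    simp only [cov, Pi.sub_apply, der_oc, Finset.sum_apply, Pi.smul_apply, smul_eq_mul, pd]
    ring
  rw [h2, ip_sub_right, ip_sum_right, ← add_sub_assoc, ← h1]
  rw [cov, Pi.sub_apply, der_oc]
  simp [der, ipForm, pd, ip_smul_right]

/-- The product rule behind integration by parts: the left side has zero integral. -/
lemma divT_ipForm {G : CMetric n} {U : Set (Coord n)} (h : RiemOn G U) {y : Coord n} (hy : y ∈ U)
    {S : TField n ι} {T : TField n (Option ι)} (hS : ∀ c, DifferentiableAt ℝ (fun z => S z c) y)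
    (hT : ∀ c, DifferentiableAt ℝ (fun z => T z c) y) (c : Fin 0 → Fin n) :
    divT G (fun z => ipForm (G z)⁻¹ (S z) (T z)) y c
      = ip (G y)⁻¹ (gcov G S y) (T y) + ip (G y)⁻¹ (S y) (divT G T y) := by
  have h2 : divT G T y = ∑ a, ∑ b, (G y)⁻¹ a b • (fun d => cov G a T y (oc b d)) := by
    funext d
    simp [divT, trcC, gcov_oc]
  rw [h2]
  simp only [ip_sum_right, ip_smul_right]
  rw [ip_oc]
  simp only [divT, trcC, gcov_oc, cov_ipForm h hy hS hT, mul_add, Finset.sum_add_distrib]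

/-! ### Invariant integrals -/

variable (n) in
/-- An integral over natural functions, such as the integral over a compact Riemannian
manifold. -/
structure CInt where
  toFun : (CMetric n → Coord n → ℝ) → ℝ
  map_add : ∀ f f' : CMetric n → Coord n → ℝ, IsNatCont f → IsNatCont f' →
    toFun (fun G y => f G y + f' G y) = toFun f + toFun f'
  map_smul : ∀ (r : ℝ) (f : CMetric n → Coord n → ℝ), IsNatCont f →
    toFun (fun G y => r * f G y) = r * toFun f
  mono : ∀ f f' : CMetric n → Coord n → ℝ, IsNatCont f → IsNatCont f' →
    (∀ G U, RiemOn G U → ∀ y ∈ U, f G y ≤ f' G y) → toFun f ≤ toFun f'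
  map_div : ∀ X : CMetric n → TField n (Option (Fin 0)), IsNat X →
    toFun (fun G y => divT G (X G) y Fin.elim0) = 0

instance : CoeFun (CInt n) (fun _ => (CMetric n → Coord n → ℝ) → ℝ) := ⟨CInt.toFun⟩

namespace CInt

variable (𝓘 : CInt n) {f f' : CMetric n → Coord n → ℝ}

lemma map_congr (hf : IsNatCont f) (hf' : IsNatCont f')
    (h : ∀ G U, RiemOn G U → ∀ y ∈ U, f G y = f' G y) : 𝓘 f = 𝓘 f' :=
  le_antisymm (𝓘.mono _ _ hf hf' fun G U hG y hy => (h G U hG y hy).le)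
    (𝓘.mono _ _ hf' hf fun G U hG y hy => (h G U hG y hy).ge)

lemma map_neg (hf : IsNatCont f) : 𝓘 (fun G y => -f G y) = -𝓘 f := by
  have := 𝓘.map_smul (-1) f hf
  simpa using this

lemma map_sub (hf : IsNatCont f) (hf' : IsNatCont f') :
    𝓘 (fun G y => f G y - f' G y) = 𝓘 f - 𝓘 f' := by
  have := 𝓘.map_add f _ hf hf'.neg
  rw [𝓘.map_neg hf'] at this
  simpa only [sub_eq_add_neg] using this

lemma map_zero : 𝓘 (fun _ _ => 0) = 0 := by
  have := 𝓘.map_smul 0 _ (IsNatCont.const 0)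
  simpa using this

lemma nonneg (hf : IsNatCont f) (h : ∀ G U, RiemOn G U → ∀ y ∈ U, 0 ≤ f G y) : 0 ≤ 𝓘 f := by
  rw [← 𝓘.map_zero]
  exact 𝓘.mono _ _ (IsNatCont.const 0) hf h

lemma map_sum {α : Type*} (s : Finset α) {f : α → CMetric n → Coord n → ℝ}
    (h : ∀ i ∈ s, IsNatCont (f i)) : 𝓘 (fun G y => ∑ i ∈ s, f i G y) = ∑ i ∈ s, 𝓘 (f i) := by
  classical
  induction s using Finset.induction_on with
  | empty => simpa using 𝓘.map_zero
  | insert a s ha ih =>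
    have hs : ∀ i ∈ s, IsNatCont (f i) := fun i hi => h i (Finset.mem_insert_of_mem hi)
    have h1 := 𝓘.map_add _ _ (h a (Finset.mem_insert_self _ _)) (IsNatCont.sum s hs)
    simp only [Finset.sum_insert ha]
    rw [h1, ih hs]

end CInt

end Functionals

/-! ### Interpolation between the curvature and its top derivative -/

section Interpolation

open Function Matrix

variable {n : ℕ} {ι κ : Type} [Fintype ι] [DecidableEq ι] [Fintype κ] [DecidableEq κ]

/-! ### Interpolation inequalities -/

/-- Young's inequality for monomials. -/
lemma exists_monomial_le {α β γ : ℕ} (hα : 1 ≤ α) {η : ℝ} (hη : 0 < η) :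
    ∃ C : ℝ, 0 ≤ C ∧ ∀ r p z : ℝ, 0 ≤ r → 0 ≤ p → 0 ≤ z →
      r ^ α * (p ^ β * z ^ γ) ≤ η * (p ^ (α + β + γ) + z ^ (α + β + γ)) + C * r ^ (α + β + γ) := by
  set θ := min η 1 with hθ
  have hθ0 : 0 < θ := lt_min hη one_pos
  refine ⟨(1 / θ) ^ (β + γ), by positivity, fun r p z hr hp hz => ?_⟩
  set M := max p z with hM
  have hM0 : 0 ≤ M := le_max_of_le_left hp
  have h1 : p ^ β * z ^ γ ≤ M ^ (β + γ) := by
    rw [pow_add]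
    exact mul_le_mul (pow_le_pow_left₀ hp (le_max_left _ _) _)
      (pow_le_pow_left₀ hz (le_max_right _ _) _) (by positivity) (by positivity)
  have h2 : M ^ (α + β + γ) ≤ p ^ (α + β + γ) + z ^ (α + β + γ) := by
    rcases max_choice p z with h | h <;> rw [hM, h]
    · exact le_add_of_nonneg_right (by positivity)
    · exact le_add_of_nonneg_left (by positivity)
  -- Either `r` is small compared with `M`, and `r ^ α ≤ η * M ^ α` because `θ ≤ 1` and `1 ≤ α`; or
  -- `M ≤ r / θ`, and the whole monomial is bounded by a multiple of a power of `r`.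
  rcases le_total r (θ * M) with h | h
  · have h3 : r ^ α ≤ η * M ^ α := by
      calc r ^ α ≤ (θ * M) ^ α := pow_le_pow_left₀ hr h _
        _ = θ ^ α * M ^ α := mul_pow _ _ _
        _ ≤ η * M ^ α := by
          have : θ ^ α ≤ θ := pow_le_of_le_one hθ0.le (min_le_right _ _) (by omega)
          exact mul_le_mul_of_nonneg_right (this.trans (min_le_left _ _)) (by positivity)
    calc r ^ α * (p ^ β * z ^ γ) ≤ (η * M ^ α) * M ^ (β + γ) :=
          mul_le_mul h3 h1 (by positivity) (by positivity)
      _ = η * M ^ (α + β + γ) := by rw [add_assoc, pow_add]; ring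
      _ ≤ η * (p ^ (α + β + γ) + z ^ (α + β + γ)) := mul_le_mul_of_nonneg_left h2 hη.le
      _ ≤ _ := le_add_of_nonneg_right (by positivity)
  · have h3 : M ≤ 1 / θ * r := by
      rw [one_div, ← div_eq_inv_mul, le_div_iff₀ hθ0, mul_comm]; exact h
    calc r ^ α * (p ^ β * z ^ γ) ≤ r ^ α * (1 / θ * r) ^ (β + γ) := by
          gcongr
          exact h1.trans (pow_le_pow_left₀ hM0 h3 _)
      _ = (1 / θ) ^ (β + γ) * r ^ (α + β + γ) := by rw [mul_pow, add_assoc, pow_add r α]; ring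
      _ ≤ _ := le_add_of_nonneg_left (by positivity)

/-- Follows by comparing `ε` with `v / 4`. It absorbs the error made below by regularizing `w` into
`v = w + ε`. -/
lemma mul_rpow_le_add {s ε v : ℝ} (hs : 1 ≤ s) (hε : 0 < ε) (hv : 0 < v) :
    ε * v ^ (s - 1) ≤ 1 / 4 * v ^ s + 4 ^ (s - 1) * ε ^ s := by
  have e : ∀ x : ℝ, 0 < x → x ^ s = x * x ^ (s - 1) := fun x hx => by
    rw [← Real.rpow_one_add' hx.le (by linarith)]; congr 1; ring
  rcases le_total ε (v / 4) with h | h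
  · rw [e v hv]
    have : 0 ≤ (4 : ℝ) ^ (s - 1) * ε ^ s := by positivity
    have := mul_le_mul_of_nonneg_right h (Real.rpow_nonneg hv.le (s - 1))
    linarith
  · have h1 : v ^ (s - 1) ≤ (4 * ε) ^ (s - 1) :=
      Real.rpow_le_rpow hv.le (by linarith) (by linarith)
    rw [Real.mul_rpow (by norm_num) hε.le] at h1
    rw [e ε hε]
    have : 0 ≤ 1 / 4 * v ^ s := by positivity
    have := mul_le_mul_of_nonneg_left h1 hε.le
    linarith

lemma ip_elim0 (H : Mat n) (s t : Comp n (Fin 0)) : ip H s t = s Fin.elim0 * t Fin.elim0 := by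
  simp only [ip, Fintype.sum_unique, Finset.univ_eq_empty, Finset.prod_empty, one_mul]
  congr 2

/-- By duality, the square of the norm of `P = ipForm H s t` is the pairing of `t` with `P ⊗ s`.
Cauchy–Schwarz then allows division by the norm of `P`. -/
lemma nrm_ipForm_le {H : Mat n} (hH : H.PosDef) (s : Comp n ι) (t : Comp n (Option ι)) :
    nrm H (ipForm H s t) ≤ nrm H s * nrm H t := by
  set P := ipForm H s t with hP
  let u : Comp n (Option ι) := fun c => P (oc (c none) Fin.elim0) * s (c ∘ some)
  have h1 : ip H P P = ip H u t := by
    rw [ip_oc, ip_oc]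
    refine Finset.sum_congr rfl fun a _ => Finset.sum_congr rfl fun b _ => ?_
    have : (fun c => u (oc a c)) = P (oc a Fin.elim0) • s := by
      funext c; simp [u]
    rw [this, ip_smul_left, ip_elim0]
    rfl
  have h2 : ip H u u = ip H P P * ip H s s := by
    rw [ip_oc, ip_oc, Finset.sum_mul]
    refine Finset.sum_congr rfl fun a _ => ?_
    rw [Finset.sum_mul]
    refine Finset.sum_congr rfl fun b _ => ?_
    have : ∀ a, (fun c => u (oc a c)) = P (oc a Fin.elim0) • s := by
      intro a; funext c; simp [u]
    rw [this, this, ip_smul_left, ip_smul_right, ip_elim0]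
    ring
  have h3 : nrm H u = nrm H P * nrm H s := by
    rw [nrm, h2, Real.sqrt_mul (ip_self_nonneg hH _)]; rfl
  have h4 := (le_abs_self _).trans (abs_ip_le hH u t)
  rw [← h1, ← nrm_sq hH, h3] at h4
  rcases (nrm_nonneg H P).eq_or_lt with h | h
  · rw [← h]; exact mul_nonneg (nrm_nonneg _ _) (nrm_nonneg _ _)
  · nlinarith

lemma divT_funMul (G : CMetric n) {φ : Coord n → ℝ} {T : TField n (Option (Fin 0))} {y : Coord n}
    (hφ : DifferentiableAt ℝ φ y) (hT : ∀ c, DifferentiableAt ℝ (fun z => T z c) y) :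
    divT G (fun z => φ z • T z) y Fin.elim0
      = (∑ a, ∑ b, (G y)⁻¹ a b * (partialDeriv a φ y * T y (oc b Fin.elim0)))
        + φ y * divT G T y Fin.elim0 := by
  have h : ∀ a c, cov G a (fun z => φ z • T z) y c
      = partialDeriv a φ y * T y c + φ y * cov G a T y c := by
    intro a c
    have e : partialDeriv a (fun z => φ z * T z c) y
        = partialDeriv a φ y * T y c + φ y * partialDeriv a (fun z => T z c) y :=
      partialDeriv_mul a hφ (hT c)
    simp only [cov, pd, Pi.sub_apply, Pi.smul_apply, smul_eq_mul, der_smul_right, e]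
    ring
  simp only [divT, trcC, gcov_oc, h, mul_add, Finset.sum_add_distrib, Finset.mul_sum]
  congr 1
  exact Finset.sum_congr rfl fun a _ => Finset.sum_congr rfl fun b _ => by ring

lemma nrm_gcov_iterCovDeriv {G : CMetric n} (j : ℕ) (y : Coord n) :
    nrm (G y)⁻¹ (gcov G (iterCovDeriv G (riem G) j) y) = rmN (j + 1) G y := by
  rw [gcov_eq_relabC_covDeriv, nrm_relabC _ (Equiv.bijective _)]
  rfl

lemma nrm_gcov_gcov_iterCovDeriv {G : CMetric n} (j : ℕ) (y : Coord n) :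
    nrm (G y)⁻¹ (gcov G (gcov G (iterCovDeriv G (riem G) j)) y) = rmN (j + 2) G y := by
  have : gcov G (iterCovDeriv G (riem G) j)
      = fun z => relabC (finSuccEquiv (4 + j)) (iterCovDeriv G (riem G) (j + 1) z) := by
    funext z; rw [gcov_eq_relabC_covDeriv]; rfl
  rw [this, gcov_relabC _ (Equiv.bijective _),
    nrm_relabC _ (option_map_bijective (Equiv.bijective _)), nrm_gcov_iterCovDeriv]

/-- The power of `|∇^j Rm|` of weight `2 q + 4`. -/
def rmPow (q j : ℕ) (G : CMetric n) (y : Coord n) : ℝ := rmN j G y ^ ((2 * q + 4) / ((j : ℝ) + 2))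

lemma IsNatCont.rmPow (q j : ℕ) : IsNatCont (rmPow (n := n) q j) :=
  (IsNatCont.rmN j).rpow (by positivity)

lemma rmPow_nonneg (q j : ℕ) (G : CMetric n) (y : Coord n) : 0 ≤ rmPow q j G y :=
  Real.rpow_nonneg (rmN_nonneg _ _ _) _

lemma rmPow_self (q : ℕ) (G : CMetric n) (y : Coord n) : rmPow q q G y = rmN q G y ^ 2 := by
  have : ((2 * q + 4) / ((q : ℝ) + 2)) = (2 : ℕ) := by push_cast; field_simp; ring
  rw [rmPow, this, Real.rpow_natCast]

lemma rmPow_zero (q : ℕ) (G : CMetric n) (y : Coord n) : rmPow q 0 G y = rmN 0 G y ^ (q + 2) := by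
  have : ((2 * q + 4) / (((0 : ℕ) : ℝ) + 2)) = (q + 2 : ℕ) := by push_cast; field_simp; ring
  rw [rmPow, this, Real.rpow_natCast]

lemma rmPow_eq (q j : ℕ) (G : CMetric n) (y : Coord n) :
    rmPow q j G y = (rmN j G y ^ (1 / ((j : ℝ) + 2))) ^ (2 * q + 4) := by
  rw [rmPow, ← Real.rpow_natCast, ← Real.rpow_mul (rmN_nonneg _ _ _)]
  congr 1; push_cast; ring

lemma rmN_eq (j : ℕ) (G : CMetric n) (y : Coord n) :
    rmN j G y = (rmN j G y ^ (1 / ((j : ℝ) + 2))) ^ (j + 2) := by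
  rw [← Real.rpow_natCast, ← Real.rpow_mul (rmN_nonneg _ _ _)]
  push_cast
  rw [one_div_mul_cancel (by positivity), Real.rpow_one]

/-- The pointwise inequality behind the interpolation, before Young's inequality. -/
lemma le_divT_rpow {G : CMetric n} {U : Set (Coord n)} (hG : RiemOn G U) {y : Coord n} (hy : y ∈ U)
    {A : TField n ι} (hdA : ∀ c, DifferentiableAt ℝ (fun z => A z c) y)
    (hdB : ∀ c, DifferentiableAt ℝ (fun z => gcov G A z c) y) {w : Coord n → ℝ}
    (hw : w = fun z => ip (G z)⁻¹ (gcov G A z) (gcov G A z)) (hdw : DifferentiableAt ℝ w y)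
    (hdW : ∀ c, DifferentiableAt ℝ (fun z => ipForm (G z)⁻¹ (A z) (gcov G A z) c) y)
    {s ε : ℝ} (hs : 1 < s) (hε : 0 < ε) :
    (w y + ε) ^ (s - 1) * w y ≤ divT G (fun z => (w z + ε) ^ (s - 1) •
      ipForm (G z)⁻¹ (A z) (gcov G A z)) y Fin.elim0 + (√n + 2 * (s - 1)) * ((w y + ε) ^ (s - 1) *
        (nrm (G y)⁻¹ (A y) * nrm (G y)⁻¹ (gcov G (gcov G A) y))) := by
  have hH := hG.inv_posDef hy
  have hwx : w y = nrm (G y)⁻¹ (gcov G A y) ^ 2 := by rw [nrm_sq hH, hw]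
  have hv0 : 0 < w y + ε := by rw [hwx]; positivity
  -- The shift by `ε` keeps the base of the real power away from zero, so the power is
  -- differentiable even where `w` vanishes.
  have hφ := (hdw.hasFDerivAt.add_const ε).rpow_const (p := s - 1) (Or.inl hv0.ne')
  have hpd : ∀ a, partialDeriv a (fun z => (w z + ε) ^ (s - 1)) y = (s - 1) *
      (w y + ε) ^ (s - 1 - 1) * (2 * ip (G y)⁻¹ (gcov G A y) (cov G a (gcov G A) y)) := by
    intro a
    have h1 := partialDeriv_ip hG hy hdB hdB a
    rw [ip_symm hH (cov G a _ y), ← two_mul, ← hw] at h1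
    rw [partialDeriv, hφ.fderiv, ← h1]
    rfl
  have hdiv := divT_funMul G hφ.differentiableAt hdW
  rw [divT_ipForm hG hy hdA hdB] at hdiv
  have hsum : (∑ a, ∑ b, (G y)⁻¹ a b * (partialDeriv a (fun z => (w z + ε) ^ (s - 1)) y *
      ipForm (G y)⁻¹ (A y) (gcov G A y) (oc b Fin.elim0)))
      = 2 * (s - 1) * (w y + ε) ^ (s - 1 - 1) * ip (G y)⁻¹
        (ipForm (G y)⁻¹ (gcov G A y) (gcov G (gcov G A) y)) (ipForm (G y)⁻¹ (A y) (gcov G A y)) := by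
    rw [ip_oc]
    simp only [Finset.mul_sum]
    refine Finset.sum_congr rfl fun a _ => Finset.sum_congr rfl fun b _ => ?_
    rw [hpd, ip_elim0]
    simp only [ipForm, oc_none, gcov_oc]
    ring
  rw [hsum] at hdiv
  have ewy : ip (G y)⁻¹ (gcov G A y) (gcov G A y) = w y := by rw [hw]
  rw [ewy] at hdiv
  have b1 := abs_le.1 ((abs_ip_le hH (ipForm (G y)⁻¹ (gcov G A y) (gcov G (gcov G A) y))
    (ipForm (G y)⁻¹ (A y) (gcov G A y))).trans (mul_le_mul (nrm_ipForm_le hH _ _)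
      (nrm_ipForm_le hH _ _) (nrm_nonneg _ _) (mul_nonneg (nrm_nonneg _ _) (nrm_nonneg _ _))))
  have b2 := abs_le.1 ((abs_ip_le hH (A y) (divT G (gcov G A) y)).trans
    (mul_le_mul_of_nonneg_left (nrm_trcC_le hH _) (nrm_nonneg _ _)))
  rw [hdiv]
  have p0 : 0 ≤ nrm (G y)⁻¹ (A y) := nrm_nonneg _ _
  have p2 : 0 ≤ nrm (G y)⁻¹ (gcov G (gcov G A) y) := nrm_nonneg _ _
  generalize nrm (G y)⁻¹ (A y) = x₀ at *
  generalize nrm (G y)⁻¹ (gcov G A y) = x₁ at *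
  generalize nrm (G y)⁻¹ (gcov G (gcov G A) y) = x₂ at *
  generalize ip (G y)⁻¹ (ipForm (G y)⁻¹ (gcov G A y) (gcov G (gcov G A) y))
    (ipForm (G y)⁻¹ (A y) (gcov G A y)) = I₁ at *
  generalize ip (G y)⁻¹ (A y) (divT G (gcov G A) y) = I₂ at *
  generalize w y = W at *
  have hvσ : 0 < (W + ε) ^ (s - 1) := Real.rpow_pos_of_pos hv0 _
  have hvσ' : 0 < (W + ε) ^ (s - 1 - 1) := Real.rpow_pos_of_pos hv0 _
  have ev : (W + ε) ^ (s - 1) = (W + ε) * (W + ε) ^ (s - 1 - 1) := by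
    rw [← Real.rpow_one_add' hv0.le (by linarith)]; congr 1; ring
  -- `|I₁|` is at most `x₁² x₀ x₂ = W x₀ x₂`, and `W ≤ W + ε` restores the exponent `s - 1`.
  have c1 : -(2 * (s - 1) * ((W + ε) ^ (s - 1) * (x₀ * x₂)))
      ≤ 2 * (s - 1) * (W + ε) ^ (s - 1 - 1) * I₁ := by
    have hk : 0 ≤ 2 * (s - 1) * (W + ε) ^ (s - 1 - 1) := by
      have : 0 < s - 1 := by linarith
      positivity
    have d1 := mul_le_mul_of_nonneg_left b1.1 hk
    have d2 : 2 * (s - 1) * (W + ε) ^ (s - 1 - 1) * (x₁ * x₂ * (x₀ * x₁))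
        ≤ 2 * (s - 1) * ((W + ε) ^ (s - 1) * (x₀ * x₂)) := by
      have : 2 * (s - 1) * (W + ε) ^ (s - 1 - 1) * (x₁ * x₂ * (x₀ * x₁))
          = 2 * (s - 1) * (W + ε) ^ (s - 1 - 1) * (x₀ * x₂) * W := by rw [hwx]; ring
      rw [this, ev]
      have := mul_nonneg (mul_nonneg hk (mul_nonneg p0 p2)) hε.le
      linarith
    linarith
  have c2 := mul_le_mul_of_nonneg_left b2.1 hvσ.le
  linarith

lemma IsNatFun.diffAt {f : CMetric n → Coord n → ℝ} (h : IsNatFun f) {G : CMetric n}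
    {U : Set (Coord n)} (hG : RiemOn G U) {y : Coord n} (hy : y ∈ U) :
    DifferentiableAt ℝ (f G) y :=
  ContDiffOn.diffAt hG.isOpen (contDiffOn_slice (f := fun _ y => f G y)
    (h.smooth hG.fam) (Set.mem_univ (0 : ℝ))) hy

/-- The pointwise inequality behind the interpolation. -/
lemma exists_divT_le_of_nrm {F : CMetric n → TField n ι} (hF : IsNat F) (q i : ℕ) (hi : i + 1 < q)
    (hF0 : ∀ G y, nrm (G y)⁻¹ (F G y) = rmN i G y)
    (hF1 : ∀ G y, nrm (G y)⁻¹ (gcov G (F G) y) = rmN (i + 1) G y)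
    (hF2 : ∀ G y, nrm (G y)⁻¹ (gcov G (gcov G (F G)) y) = rmN (i + 2) G y)
    {δ : ℝ} (hδ : 0 < δ) :
    ∃ C : ℝ, 0 ≤ C ∧ ∀ ε : ℝ, 0 < ε → ∃ X : CMetric n → TField n (Option (Fin 0)), IsNat X ∧
      ∀ G U, RiemOn G U → ∀ y ∈ U, rmPow q (i + 1) G y ≤ 2 * divT G (X G) y Fin.elim0
        + (δ * rmPow q (i + 2) G y + (C * rmPow q i G y
        + C * ε ^ (((q : ℝ) + 2) / (i + 3)))) := by
  -- The exponent for which `w ^ s`, with `w = |∇^{i+1} Rm|²`, is the power `rmPow q (i + 1)`.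
  set s : ℝ := ((q : ℝ) + 2) / (i + 3) with hs
  have hs1 : 1 < s := by
    rw [hs, one_lt_div (by positivity)]
    have : (i : ℝ) + 1 < q := by exact_mod_cast hi
    linarith
  set K : ℝ := Real.sqrt n + 2 * (s - 1) with hK
  have hK0 : 0 < K := by have := Real.sqrt_nonneg (n : ℝ); nlinarith
  -- Young's inequality for `x₀ v^(s-1) x₂`, written in terms of the quantities `x₀^(1/(i+2))`,
  -- `v^(1/(2(i+3)))` and `x₂^(1/(i+4))`; the three exponents add up to `2 q + 4`. The value of `η`
  -- leaves at most a quarter of `v ^ s` and `δ / 2` of the higher term.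
  obtain ⟨C, hC0, hC⟩ := exists_monomial_le (α := i + 2) (β := 2 * (q - i - 1)) (γ := i + 4)
    (by omega) (η := min (1 / 4) (δ / 2) / K) (by positivity)
  have eN : i + 2 + 2 * (q - i - 1) + (i + 4) = 2 * q + 4 := by omega
  rw [eN] at hC
  refine ⟨max (2 * (K * C)) (2 * 4 ^ (s - 1)), by positivity, fun ε hε => ?_⟩
  have hwN := hF.gcov.ip hF.gcov
  have hφN : IsNatFun (n := n) fun G y =>
      (ip (G y)⁻¹ (gcov G (F G) y) (gcov G (F G) y) + ε) ^ (s - 1) := by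
    refine ⟨fun e => by rw [hwN.congr e], fun {𝒢 I U} hG => ?_, fun hφ hG z hz => by
      rw [hwN.pull hφ hG z hz]⟩
    refine ((hwN.smooth hG).add contDiffOn_const).rpow_const_of_ne fun p hp => ?_
    have := ip_self_nonneg (hG.posDef p.1 hp.1 p.2 hp.2).inv
      (gcov (𝒢 p.1) (F (𝒢 p.1)) p.2)
    positivity
  -- The field is `(w + ε)^(s-1) ⟨A, ∇A⟩` with `w = |∇A|²`. Young's inequality and the
  -- regularization each use up a quarter of `v ^ s`; absorbing this half on the left produces the
  -- factor `2` in front of the divergence.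
  refine ⟨_, (hF.ipForm hF.gcov).funMul hφN, fun G U hG y hy => ?_⟩
  have hH := hG.inv_posDef hy
  have hdA := hF.diffAt hG hy
  have hdB := hF.gcov.diffAt hG hy
  set w : Coord n → ℝ := fun z => ip (G z)⁻¹ (gcov G (F G) z) (gcov G (F G) z) with hw
  have hwx : w y = rmN (i + 1) G y ^ 2 := by
    rw [← hF1, nrm_sq hH]
  have hw0 : 0 ≤ w y := by rw [hwx]; positivity
  have hv0 : 0 < w y + ε := by linarith
  have hdw : DifferentiableAt ℝ w y := hwN.diffAt hG hy
  have hmain := le_divT_rpow hG hy hdA hdB hw hdw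
    (fun c => (hF.ipForm hF.gcov).diffAt hG hy c) hs1 hε
  rw [hF0, hF2] at hmain
  set v := w y + ε with hv
  set x₀ := rmN i G y with hx₀
  set x₂ := rmN (i + 2) G y with hx₂
  change v ^ (s - 1) * w y ≤ _ + K * (v ^ (s - 1) * (x₀ * x₂)) at hmain
  have p0 : 0 ≤ x₀ := rmN_nonneg _ _ _
  have p2 : 0 ≤ x₂ := rmN_nonneg _ _ _
  have ev' : v ^ s = v * v ^ (s - 1) := by
    rw [← Real.rpow_one_add' hv0.le (by linarith)]; congr 1; ring
  have hy1 := hC (x₀ ^ (1 / ((i : ℝ) + 2))) (v ^ (1 / (2 * ((i : ℝ) + 3))))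
    (x₂ ^ (1 / ((i : ℝ) + 4))) (by positivity) (by positivity) (by positivity)
  have e0 : x₀ = (x₀ ^ (1 / ((i : ℝ) + 2))) ^ (i + 2) := rmN_eq _ _ _
  have e2 : x₂ = (x₂ ^ (1 / ((i : ℝ) + 4))) ^ (i + 4) := by
    have := rmN_eq (i + 2) G y
    push_cast at this
    rw [show (i : ℝ) + 2 + 2 = i + 4 by ring] at this
    exact this
  have e1 : (v ^ (1 / (2 * ((i : ℝ) + 3)))) ^ (2 * q + 4) = v ^ s := by
    rw [← Real.rpow_natCast, ← Real.rpow_mul hv0.le]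
    congr 1; push_cast; rw [hs]; field_simp; ring
  have e1' : (v ^ (1 / (2 * ((i : ℝ) + 3)))) ^ (2 * (q - i - 1)) = v ^ (s - 1) := by
    rw [← Real.rpow_natCast, ← Real.rpow_mul hv0.le]
    congr 1
    rw [Nat.sub_sub, Nat.cast_mul, Nat.cast_sub hi.le, hs]
    push_cast
    field_simp
    ring
  have f0 : (x₀ ^ (1 / ((i : ℝ) + 2))) ^ (2 * q + 4) = rmPow q i G y := (rmPow_eq _ _ _ _).symm
  have f2 : (x₂ ^ (1 / ((i : ℝ) + 4))) ^ (2 * q + 4) = rmPow q (i + 2) G y := by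
    rw [rmPow_eq]; push_cast; rw [show (i : ℝ) + 2 + 2 = i + 4 by ring]
  rw [← e0, ← e2, e1, e1', f0, f2] at hy1
  have f1 : rmPow q (i + 1) G y ≤ v ^ s := by
    have : rmPow q (i + 1) G y = w y ^ s := by
      rw [hwx, rmPow, ← Real.rpow_natCast, ← Real.rpow_mul (rmN_nonneg _ _ _)]
      congr 1; push_cast; rw [hs]; field_simp; ring
    rw [this]
    exact Real.rpow_le_rpow hw0 (by linarith) (by linarith)
  have hy2 := mul_rpow_le_add hs1.le hε hv0
  have q0 := rmPow_nonneg q i G y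
  have q2 := rmPow_nonneg q (i + 2) G y
  have hvs : 0 ≤ v ^ s := Real.rpow_nonneg hv0.le _
  have hεs : 0 ≤ ε ^ s := Real.rpow_nonneg hε.le _
  have hy3 := mul_le_mul_of_nonneg_left hy1 hK0.le
  have hη : K * (min (1 / 4) (δ / 2) / K) = min (1 / 4) (δ / 2) := by field_simp
  have m1 := mul_le_mul_of_nonneg_right (min_le_left (1 / 4) (δ / 2)) hvs
  have m2 := mul_le_mul_of_nonneg_right (min_le_right (1 / 4) (δ / 2)) q2
  have hy4 : K * (v ^ (s - 1) * (x₀ * x₂)) ≤ 1 / 4 * v ^ s + δ / 2 * rmPow q (i + 2) G y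
      + K * C * rmPow q i G y := by
    calc K * (v ^ (s - 1) * (x₀ * x₂)) = K * (x₀ * (v ^ (s - 1) * x₂)) := by ring
      _ ≤ _ := hy3
      _ = K * (min (1 / 4) (δ / 2) / K) * (v ^ s + rmPow q (i + 2) G y)
          + K * C * rmPow q i G y := by ring
      _ ≤ _ := by rw [hη]; linarith
  have n1 := mul_le_mul_of_nonneg_right (le_max_left (2 * (K * C)) (2 * 4 ^ (s - 1))) q0
  have n2 := mul_le_mul_of_nonneg_right (le_max_right (2 * (K * C)) (2 * 4 ^ (s - 1))) hεs
  have hz : v ^ s = v ^ (s - 1) * w y + ε * v ^ (s - 1) := by rw [ev', hv]; ring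
  linarith

lemma exists_divT_le (q i : ℕ) (hi : i + 1 < q) {δ : ℝ} (hδ : 0 < δ) :
    ∃ C : ℝ, 0 ≤ C ∧ ∀ ε : ℝ, 0 < ε → ∃ X : CMetric n → TField n (Option (Fin 0)), IsNat X ∧
      ∀ G U, RiemOn G U → ∀ y ∈ U, rmPow q (i + 1) G y ≤ 2 * divT G (X G) y Fin.elim0
        + (δ * rmPow q (i + 2) G y + (C * rmPow q i G y
        + C * ε ^ (((q : ℝ) + 2) / (i + 3)))) :=
  exists_divT_le_of_nrm (IsNat.riem.iterCovDeriv i) q i hi (fun _ _ => rfl)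
    (fun _ _ => nrm_gcov_iterCovDeriv _ _) (fun _ _ => nrm_gcov_gcov_iterCovDeriv _ _) hδ

/-- Integration removes the divergence. The constant `C` does not depend on `ε`, so letting `ε` tend
to zero removes the regularization. -/
lemma CInt.exists_rmPow_succ_le (q i : ℕ) (hi : i + 1 < q) {δ : ℝ} (hδ : 0 < δ) :
    ∃ C : ℝ, 0 ≤ C ∧ ∀ 𝓘 : CInt n,
      𝓘 (rmPow q (i + 1)) ≤ δ * 𝓘 (rmPow q (i + 2)) + C * 𝓘 (rmPow q i) := by
  obtain ⟨C, hC, h⟩ := exists_divT_le (n := n) q i hi hδ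
  refine ⟨C, hC, fun 𝓘 => ?_⟩
  set s : ℝ := ((q : ℝ) + 2) / (i + 3) with hs
  have key : ∀ ε : ℝ, 0 < ε → 𝓘 (rmPow q (i + 1)) ≤ (δ * 𝓘 (rmPow q (i + 2))
      + C * 𝓘 (rmPow q i)) + C * 𝓘 (fun _ _ => 1) * ε ^ s := by
    intro ε hε
    obtain ⟨X, hX, h⟩ := h ε hε
    have hd : IsNatCont (fun G y => divT G (X G) y Fin.elim0) := by
      refine ⟨fun e => by rw [hX.divT.congr e], fun hG => (hX.divT.smooth hG _).continuousOn,
        fun hφ hG z hz => ?_⟩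
      rw [hX.divT.pull hφ hG z hz, act_empty]
    have c0 := (IsNatCont.rmPow (n := n) q i).smul C
    have c2 := (IsNatCont.rmPow (n := n) q (i + 2)).smul δ
    have c3 := IsNatCont.const (n := n) (C * ε ^ s)
    have h1 := 𝓘.mono _ _ (IsNatCont.rmPow q (i + 1)) ((hd.smul 2).add (c2.add (c0.add c3))) h
    rw [𝓘.map_add _ _ (hd.smul 2) (c2.add (c0.add c3)), 𝓘.map_add _ _ c2 (c0.add c3),
      𝓘.map_add _ _ c0 c3, 𝓘.map_smul _ _ hd, 𝓘.map_div X hX, 𝓘.map_smul _ _ (IsNatCont.rmPow q i),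
      𝓘.map_smul _ _ (IsNatCont.rmPow q (i + 2))] at h1
    have h2 := 𝓘.map_smul (C * ε ^ s) _ (IsNatCont.const 1)
    simp only [mul_one] at h2
    rw [h2] at h1
    linarith
  have hs0 : 0 < s := by positivity
  have hlim : Filter.Tendsto (fun ε : ℝ => (δ * 𝓘 (rmPow q (i + 2)) + C * 𝓘 (rmPow q i))
      + C * 𝓘 (fun _ _ => 1) * ε ^ s) (nhdsWithin 0 (Set.Ioi 0))
      (nhds ((δ * 𝓘 (rmPow q (i + 2)) + C * 𝓘 (rmPow q i)) + C * 𝓘 (fun _ _ => 1) * 0)) := by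
    refine tendsto_const_nhds.add (tendsto_const_nhds.mul ?_)
    have := (Real.continuous_rpow_const hs0.le).tendsto 0
    rw [Real.zero_rpow hs0.ne'] at this
    exact this.mono_left nhdsWithin_le_nhds
  rw [mul_zero, add_zero] at hlim
  exact ge_of_tendsto hlim (Filter.eventually_of_mem self_mem_nhdsWithin fun ε hε => key ε hε)

lemma CInt.rmPow_nonneg (𝓘 : CInt n) (q j : ℕ) : 0 ≤ 𝓘 (rmPow q j) :=
  𝓘.nonneg (IsNatCont.rmPow q j) fun G _ _ y _ => CurvatureFlow.rmPow_nonneg q j G y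

/-- Induction on `i`: the lower term `rmPow q i` given by `CInt.exists_rmPow_succ_le` is bounded by
the induction hypothesis, which returns the left side with a small coefficient. -/
lemma CInt.exists_rmPow_le_succ (q i : ℕ) (hi : i < q) {δ : ℝ} (hδ : 0 < δ) :
    ∃ C : ℝ, 0 ≤ C ∧ ∀ 𝓘 : CInt n,
      𝓘 (rmPow q i) ≤ δ * 𝓘 (rmPow q (i + 1)) + C * 𝓘 (rmPow q 0) := by
  induction i generalizing δ with
  | zero =>
    refine ⟨1, zero_le_one, fun 𝓘 => ?_⟩
    have := mul_nonneg hδ.le (𝓘.rmPow_nonneg q (0 + 1))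
    linarith
  | succ i ih =>
    obtain ⟨C, hC, h⟩ := CInt.exists_rmPow_succ_le (n := n) q i hi (half_pos hδ)
    -- After multiplication by `C` this coefficient is at most `1 / 2`, so the term is absorbed on
    -- the left; hence `δ / 2` on the line before.
    obtain ⟨C', hC', h'⟩ := ih (by omega) (δ := 1 / (2 * (C + 1))) (by positivity)
    refine ⟨2 * (C * C'), by positivity, fun 𝓘 => ?_⟩
    have h1 := h 𝓘
    have h2 := mul_le_mul_of_nonneg_left (h' 𝓘) hC
    have h3 : C * (1 / (2 * (C + 1)) * 𝓘 (rmPow q (i + 1))) ≤ 1 / 2 * 𝓘 (rmPow q (i + 1)) := by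
      rw [← mul_assoc]
      refine mul_le_mul_of_nonneg_right ?_ (𝓘.rmPow_nonneg q (i + 1))
      rw [mul_one_div, div_le_div_iff₀ (by positivity) (by norm_num)]
      linarith
    rw [mul_add] at h2
    linarith

/-- Interpolation between `|∇^q Rm|` and `|Rm|`. -/
lemma CInt.exists_rmPow_le (q i : ℕ) (hi : i < q) {δ : ℝ} (hδ : 0 < δ) :
    ∃ C : ℝ, 0 ≤ C ∧ ∀ 𝓘 : CInt n, 𝓘 (rmPow q i) ≤ δ * 𝓘 (rmPow q q) + C * 𝓘 (rmPow q 0) := by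
  -- Induction on the gap between `i` and `q`, climbing one derivative at a time. Only the first
  -- step needs the small constant `δ`.
  obtain ⟨d, hd⟩ : ∃ d, q = i + 1 + d := ⟨q - (i + 1), by omega⟩
  induction d generalizing i δ with
  | zero =>
    obtain ⟨C, hC, h⟩ := CInt.exists_rmPow_le_succ (n := n) q i hi hδ
    rw [add_zero] at hd
    exact ⟨C, hC, by rw [← hd] at h; exact h⟩
  | succ d ih =>
    obtain ⟨C, hC, h⟩ := CInt.exists_rmPow_le_succ (n := n) q i hi hδ
    obtain ⟨C', hC', h'⟩ := ih (i + 1) (by omega) (δ := 1) one_pos (by omega)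
    refine ⟨δ * C' + C, by positivity, fun 𝓘 => (h 𝓘).trans ?_⟩
    have := mul_le_mul_of_nonneg_left (h' 𝓘) hδ.le
    linarith

end Interpolation

/-! ### Negligible integrands and integration by parts -/

section Negligible

open Function Matrix

variable {n : ℕ} {ι κ : Type} [Fintype ι] [DecidableEq ι] [Fintype κ] [DecidableEq κ]

/-! ### Negligible integrands -/

/-- A function whose integral is bounded by a small multiple of `∫ |∇^q Rm|²` and a multiple of
`∫ |Rm|^{q+2}`. -/
structure Negl (q : ℕ) (f : CMetric n → Coord n → ℝ) : Prop where
  nat : IsNatCont f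
  bound : ∀ ε : ℝ, 0 < ε → ∃ C : ℝ, 0 ≤ C ∧ ∀ 𝓘 : CInt n,
    |𝓘 f| ≤ ε * 𝓘 (rmPow q q) + C * 𝓘 (rmPow q 0)

namespace Negl

variable {q : ℕ} {f f' : CMetric n → Coord n → ℝ}

lemma congr (h : Negl q f) (hf' : IsNatCont f')
    (e : ∀ G U, RiemOn G U → ∀ y ∈ U, f G y = f' G y) : Negl q f' := by
  refine ⟨hf', fun ε hε => ?_⟩
  obtain ⟨C, hC, hb⟩ := h.bound ε hε
  exact ⟨C, hC, fun 𝓘 => by rw [← 𝓘.map_congr h.nat hf' e]; exact hb 𝓘⟩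

lemma add (h : Negl q f) (h' : Negl q f') : Negl q (fun G y => f G y + f' G y) := by
  refine ⟨h.nat.add h'.nat, fun ε hε => ?_⟩
  obtain ⟨C, hC, hb⟩ := h.bound (ε / 2) (half_pos hε)
  obtain ⟨C', hC', hb'⟩ := h'.bound (ε / 2) (half_pos hε)
  refine ⟨C + C', by positivity, fun 𝓘 => ?_⟩
  rw [𝓘.map_add _ _ h.nat h'.nat]
  have := abs_add_le (𝓘 f) (𝓘 f')
  have := hb 𝓘
  have := hb' 𝓘
  linarith

lemma smul (r : ℝ) (h : Negl q f) : Negl q (fun G y => r * f G y) := by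
  refine ⟨h.nat.smul r, fun ε hε => ?_⟩
  obtain ⟨C, hC, hb⟩ := h.bound (ε / (|r| + 1)) (by positivity)
  refine ⟨|r| * C, by positivity, fun 𝓘 => ?_⟩
  rw [𝓘.map_smul _ _ h.nat, abs_mul]
  have h1 := mul_le_mul_of_nonneg_left (hb 𝓘) (abs_nonneg r)
  have h2 : |r| * (ε / (|r| + 1)) ≤ ε := by
    rw [mul_div_assoc', div_le_iff₀ (by positivity)]
    nlinarith [abs_nonneg r]
  have := mul_le_mul_of_nonneg_right h2 (𝓘.rmPow_nonneg q q)
  linarith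

lemma neg (h : Negl q f) : Negl q (fun G y => -f G y) := by simpa using h.smul (-1)

lemma sub (h : Negl q f) (h' : Negl q f') : Negl q (fun G y => f G y - f' G y) := by
  simpa [sub_eq_add_neg] using h.add h'.neg

lemma of_eq_zero (hf : IsNatCont f) (h : ∀ 𝓘 : CInt n, 𝓘 f = 0) : Negl q f := by
  refine ⟨hf, fun ε hε => ⟨0, le_rfl, fun 𝓘 => ?_⟩⟩
  rw [h 𝓘, abs_zero, zero_mul, add_zero]
  exact mul_nonneg hε.le (𝓘.rmPow_nonneg q q)

end Negl

lemma CInt.exists_sum_rmPow_le (q : ℕ) {δ : ℝ} (hδ : 0 < δ) :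
    ∃ C : ℝ, 0 ≤ C ∧ ∀ 𝓘 : CInt n, ∑ j ∈ Finset.range q, 𝓘 (rmPow q j)
      ≤ δ * 𝓘 (rmPow q q) + C * 𝓘 (rmPow q 0) := by
  have key : ∀ p ≤ q, ∀ δ : ℝ, 0 < δ → ∃ C : ℝ, 0 ≤ C ∧ ∀ 𝓘 : CInt n,
      ∑ j ∈ Finset.range p, 𝓘 (rmPow q j) ≤ δ * 𝓘 (rmPow q q) + C * 𝓘 (rmPow q 0) := by
    intro p
    induction p with
    | zero =>
      intro _ δ hδ
      refine ⟨0, le_rfl, fun 𝓘 => ?_⟩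
      rw [Finset.sum_range_zero, zero_mul, add_zero]
      exact mul_nonneg hδ.le (𝓘.rmPow_nonneg q q)
    | succ p ih =>
      intro hp δ hδ
      obtain ⟨C, hC, hb⟩ := ih (by omega) (δ / 2) (half_pos hδ)
      obtain ⟨C', hC', hb'⟩ := CInt.exists_rmPow_le (n := n) q p (by omega) (half_pos hδ)
      refine ⟨C + C', by positivity, fun 𝓘 => ?_⟩
      rw [Finset.sum_range_succ]
      have := hb 𝓘
      have := hb' 𝓘
      linarith
  exact key q le_rfl δ hδ

/-- Convexity of the power `2 q + 4`, applied to a sum of `ℓ + 1` nonnegative terms. -/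
lemma rmScale_pow_le (q ℓ : ℕ) (G : CMetric n) (y : Coord n) :
    rmScale ℓ G y ^ (2 * q + 4)
      ≤ ((ℓ : ℝ) + 1) ^ (2 * q + 3) * ∑ j ∈ Finset.range (ℓ + 1), rmPow q j G y := by
  have h := pow_sum_div_card_le_sum_pow (s := Finset.range (ℓ + 1))
    (f := fun i : ℕ => rmN i G y ^ (1 / ((i : ℝ) + 2)))
    (fun i _ => Real.rpow_nonneg (rmN_nonneg i G y) _) (2 * q + 3)
  rw [Finset.card_range, div_le_iff₀ (by positivity)] at h
  simp only [rmPow_eq]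
  push_cast at h
  rw [mul_comm (_ ^ _)]
  exact h

/-- A function of weight `2 q + 4`, with a factor of lower order, is negligible. -/
lemma Negl.of_abs_le {q a b : ℕ} (hq : 1 ≤ q) (ha : 1 ≤ a) (hab : a + b = 2 * q + 4)
    {f : CMetric n → Coord n → ℝ} (hf : IsNatCont f) {C : ℝ} (hC : 0 ≤ C)
    (h : ∀ G U, RiemOn G U → ∀ y ∈ U, |f G y| ≤ C * (rmScale (q - 1) G y ^ a * rmScale q G y ^ b)) :
    Negl q f := by
  refine ⟨hf, fun ε hε => ?_⟩
  set K : ℝ := ((q : ℝ) + 1) ^ (2 * q + 3) with hK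
  set K' : ℝ := (((q - 1 : ℕ) : ℝ) + 1) ^ (2 * q + 3) with hK'
  -- Since `1 ≤ a`, Young's inequality separates the factor of lower order. The scale of order `q`
  -- gets a small coefficient; the scale of order `q - 1` gets a large one, but it only involves
  -- `|∇^j Rm|` with `j < q`, to which interpolation applies.
  obtain ⟨L, hL, hb⟩ := exists_monomial_le (β := b) (γ := 0) ha
    (η := ε / (2 * (C * K + 1))) (by positivity)
  rw [add_zero, hab] at hb
  set η := ε / (2 * (C * K + 1)) with hη
  set R : ℝ := C * η * K + C * L * K' with hR
  have hη0 : 0 < η := by positivity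
  have hR0 : 0 ≤ R := by positivity
  have hηK : C * η * K ≤ ε / 2 := by
    rw [hη, show C * (ε / (2 * (C * K + 1))) * K = ε / 2 * (C * K / (C * K + 1)) by
      field_simp]
    refine mul_le_of_le_one_right (by positivity) ?_
    rw [div_le_one (by positivity)]
    linarith
  obtain ⟨L', hL', hb'⟩ := CInt.exists_sum_rmPow_le (n := n) q (δ := ε / (2 * (R + 1)))
    (by positivity)
  refine ⟨R * L', by positivity, fun 𝓘 => ?_⟩
  have hcs : IsNatCont (n := n) (fun G y => ∑ j ∈ Finset.range q, rmPow q j G y) :=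
    IsNatCont.sum _ fun j _ => IsNatCont.rmPow q j
  have hg := ((IsNatCont.rmPow (n := n) q q).smul (C * η * K)).add (hcs.smul R)
  have hpt : ∀ G U, RiemOn G U → ∀ y ∈ U, |f G y| ≤ C * η * K * rmPow q q G y
      + R * ∑ j ∈ Finset.range q, rmPow q j G y := by
    intro G U hG y hy
    have h1 := hb (rmScale (q - 1) G y) (rmScale q G y) 0 (rmScale_nonneg _ _ _)
      (rmScale_nonneg _ _ _) le_rfl
    rw [pow_zero, mul_one, zero_pow (by omega), add_zero] at h1
    have h2 := rmScale_pow_le q q G y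
    have h3 := rmScale_pow_le q (q - 1) G y
    rw [Nat.sub_add_cancel hq] at h3
    rw [Finset.sum_range_succ] at h2
    calc |f G y| ≤ C * (η * rmScale q G y ^ (2 * q + 4) + L * rmScale (q - 1) G y ^ (2 * q + 4)) :=
          (h G U hG y hy).trans (mul_le_mul_of_nonneg_left h1 hC)
      _ ≤ C * (η * (K * (∑ j ∈ Finset.range q, rmPow q j G y + rmPow q q G y))
          + L * (K' * ∑ j ∈ Finset.range q, rmPow q j G y)) := by gcongr
      _ = _ := by rw [hR]; ring
  have h1 := 𝓘.mono _ _ hf hg fun G U hG y hy => (le_abs_self _).trans (hpt G U hG y hy)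
  have h2 := 𝓘.mono _ _ hf.neg hg fun G U hG y hy => (neg_le_abs _).trans (hpt G U hG y hy)
  rw [𝓘.map_neg hf] at h2
  rw [𝓘.map_add _ _ ((IsNatCont.rmPow (n := n) q q).smul (C * η * K)) (hcs.smul R),
    𝓘.map_smul _ _ (IsNatCont.rmPow q q), 𝓘.map_smul _ _ hcs,
    𝓘.map_sum _ fun j _ => IsNatCont.rmPow q j] at h1 h2
  have h3 := mul_le_mul_of_nonneg_left (hb' 𝓘) hR0
  have p := 𝓘.rmPow_nonneg q q
  have h4 : R * (ε / (2 * (R + 1))) ≤ ε / 2 := by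
    rw [show R * (ε / (2 * (R + 1))) = ε / 2 * (R / (R + 1)) by field_simp]
    refine mul_le_of_le_one_right (by positivity) ?_
    rw [div_le_one (by positivity)]
    linarith
  have h5 := mul_le_mul_of_nonneg_right h4 p
  have h6 := mul_le_mul_of_nonneg_right hηK p
  rw [abs_le]
  constructor <;> linarith

/-! ### Integration by parts -/

/-- The product `⟨∇^m X, ∇^m Y⟩`. -/
def ipJet : ℕ → {ι : Type} → [Fintype ι] → [DecidableEq ι] →
    (CMetric n → TField n ι) → (CMetric n → TField n ι) → CMetric n → Coord n → ℝ
  | 0, _, _, _, X, Y => fun G y => ip (G y)⁻¹ (X G y) (Y G y)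
  | m + 1, _, _, _, X, Y => ipJet m (fun G => gcov G (X G)) (fun G => gcov G (Y G))

lemma isNatFun_ipJet (m : ℕ) : ∀ {ι : Type} [Fintype ι] [DecidableEq ι]
    {X Y : CMetric n → TField n ι}, IsNat X → IsNat Y → IsNatFun (ipJet m X Y) := by
  induction m with
  | zero => intro ι _ _ X Y hX hY; exact hX.ip hY
  | succ m ih => intro ι _ _ X Y hX hY; exact ih hX.gcov hY.gcov

lemma isNatCont_ipJet (m : ℕ) {X Y : CMetric n → TField n ι} (hX : IsNat X) (hY : IsNat Y) :
    IsNatCont (ipJet m X Y) := (isNatFun_ipJet m hX hY).isNatCont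

lemma ipJet_congr (m : ℕ) : ∀ {ι : Type} [Fintype ι] [DecidableEq ι]
    {X X' Y Y' : CMetric n → TField n ι}, REq X X' → REq Y Y' →
    ∀ G U, RiemOn G U → ∀ y ∈ U, ipJet m X Y G y = ipJet m X' Y' G y := by
  induction m with
  | zero =>
    intro ι _ _ X X' Y Y' h h' G U hG y hy
    simp only [ipJet, h G U hG y hy, h' G U hG y hy]
  | succ m ih => intro ι _ _ X X' Y Y' h h'; exact ih h.gcov h'.gcov

lemma ipJet_add_left (m : ℕ) : ∀ {ι : Type} [Fintype ι] [DecidableEq ι]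
    {X X' Y : CMetric n → TField n ι}, IsNat X → IsNat X' →
    ∀ G U, RiemOn G U → ∀ y ∈ U,
      ipJet m (fun G y => X G y + X' G y) Y G y = ipJet m X Y G y + ipJet m X' Y G y := by
  induction m with
  | zero => intro ι _ _ X X' Y _ _ G U _ y _; simp only [ipJet, ip_add_left]
  | succ m ih =>
    intro ι _ _ X X' Y h h' G U hG y hy
    simp only [ipJet]
    rw [← ih h.gcov h'.gcov G U hG y hy]
    refine ipJet_congr m (fun G U hG y hy => ?_) (fun G U hG y hy => rfl) G U hG y hy
    exact gcov_add G (h.diffAt hG hy) (h'.diffAt hG hy)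

lemma ipJet_smul_left (m : ℕ) (r : ℝ) : ∀ {ι : Type} [Fintype ι] [DecidableEq ι]
    {X Y : CMetric n → TField n ι}, IsNat X → ∀ G U, RiemOn G U → ∀ y ∈ U,
      ipJet m (fun G y => r • X G y) Y G y = r * ipJet m X Y G y := by
  induction m with
  | zero => intro ι _ _ X Y _ G U _ y _; simp only [ipJet, ip_smul_left]
  | succ m ih =>
    intro ι _ _ X Y h G U hG y hy
    simp only [ipJet]
    rw [← ih h.gcov G U hG y hy]
    refine ipJet_congr m (fun G U hG y hy => ?_) (fun G U hG y hy => rfl) G U hG y hy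
    exact gcov_smul G r (h.diffAt hG hy)

lemma ipJet_symm (m : ℕ) : ∀ {ι : Type} [Fintype ι] [DecidableEq ι]
    {X Y : CMetric n → TField n ι} (G : CMetric n) (U : Set (Coord n)), RiemOn G U → ∀ y ∈ U,
      ipJet m X Y G y = ipJet m Y X G y := by
  induction m with
  | zero => intro ι _ _ X Y G U hG y hy; exact ip_symm (hG.inv_posDef hy) _ _
  | succ m ih => intro ι _ _ X Y G U hG y hy; exact ih G U hG y hy

lemma ipJet_add_right (m : ℕ) {X Y Y' : CMetric n → TField n ι} (h : IsNat Y) (h' : IsNat Y')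
    (G : CMetric n) (U : Set (Coord n)) (hG : RiemOn G U) (y : Coord n) (hy : y ∈ U) :
    ipJet m X (fun G y => Y G y + Y' G y) G y = ipJet m X Y G y + ipJet m X Y' G y := by
  rw [ipJet_symm m G U hG y hy, ipJet_add_left m h h' G U hG y hy, ipJet_symm m G U hG y hy,
    ipJet_symm m (X := Y') G U hG y hy]

lemma ipJet_smul_right (m : ℕ) (r : ℝ) {X Y : CMetric n → TField n ι} (h : IsNat Y)
    (G : CMetric n) (U : Set (Coord n)) (hG : RiemOn G U) (y : Coord n) (hy : y ∈ U) :
    ipJet m X (fun G y => r • Y G y) G y = r * ipJet m X Y G y := by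
  rw [ipJet_symm m G U hG y hy, ipJet_smul_left m r h G U hG y hy, ipJet_symm m G U hG y hy]

lemma ipJet_sub_left (m : ℕ) {X X' Y : CMetric n → TField n ι} (h : IsNat X) (h' : IsNat X')
    (G : CMetric n) (U : Set (Coord n)) (hG : RiemOn G U) (y : Coord n) (hy : y ∈ U) :
    ipJet m (fun G y => X G y - X' G y) Y G y = ipJet m X Y G y - ipJet m X' Y G y := by
  have h1 := ipJet_add_left m (Y := Y) h (h'.smul (-1)) G U hG y hy
  rw [ipJet_smul_left m _ h' G U hG y hy] at h1
  simp only [neg_smul, one_smul, ← sub_eq_add_neg, neg_mul, one_mul] at h1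
  exact h1

lemma ipJet_sub_right (m : ℕ) {X Y Y' : CMetric n → TField n ι} (h : IsNat Y) (h' : IsNat Y')
    (G : CMetric n) (U : Set (Coord n)) (hG : RiemOn G U) (y : Coord n) (hy : y ∈ U) :
    ipJet m X (fun G y => Y G y - Y' G y) G y = ipJet m X Y G y - ipJet m X Y' G y := by
  rw [ipJet_symm m G U hG y hy, ipJet_sub_left m h h' G U hG y hy, ipJet_symm m G U hG y hy,
    ipJet_symm m (X := Y') G U hG y hy]

lemma ipJet_relabC (m : ℕ) : ∀ {ι κ : Type} [Fintype ι] [DecidableEq ι] [Fintype κ] [DecidableEq κ]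
    {X Y : CMetric n → TField n ι} {f : ι → κ}, Bijective f → ∀ G y,
      ipJet m (fun G y => relabC f (X G y)) (fun G y => relabC f (Y G y)) G y
        = ipJet m X Y G y := by
  induction m with
  | zero => intro ι κ _ _ _ _ X Y f hf G y; exact ip_relabC _ hf _ _
  | succ m ih =>
    intro ι κ _ _ _ _ X Y f hf G y
    simp only [ipJet]
    rw [← ih (option_map_bijective hf)]
    congr 1
    all_goals
      funext G y
      exact gcov_relabC G hf _ y

/-- Products of total weight `2 q + 4` and of orders at most `q`, not both equal to `q`, are
negligible. -/
lemma negl_ipJet {q a b α β m : ℕ} {E Z : CMetric n → TField n ι} (hE : Ctl a α E) (hZ : Ctl b β Z)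
    (hw : a + b + 2 * m = 2 * q + 4) (hα : α + m + 1 ≤ q) (hβ : β + m ≤ q) (ha : 1 ≤ a) :
    Negl q (ipJet m E Z) := by
  induction m generalizing ι a b α β with
  | zero =>
    obtain ⟨C, hC, h⟩ := hE.bd
    obtain ⟨C', hC', h'⟩ := hZ.bd
    refine Negl.of_abs_le (b := b) (by omega) ha (by omega) (isNatCont_ipJet 0 hE.1 hZ.1)
      (C := C * C') (by positivity) fun G U hG y hy => ?_
    refine (abs_ip_le (hG.inv_posDef hy) _ _).trans ?_
    have e1 := rmScale_mono (show α ≤ q - 1 by omega) G y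
    have e2 := rmScale_mono (show β ≤ q by omega) G y
    have p1 := rmScale_nonneg α G y
    have p2 := rmScale_nonneg β G y
    calc _ ≤ (C * rmScale (q - 1) G y ^ a) * (C' * rmScale q G y ^ b) := by
          refine mul_le_mul ((h G U hG y hy).trans ?_) ((h' G U hG y hy).trans ?_)
            (nrm_nonneg _ _) (mul_nonneg hC (pow_nonneg (rmScale_nonneg _ _ _) _)) <;> gcongr
      _ = _ := by ring
  | succ m ih => exact ih hE.gcov hZ.gcov (by omega) (by omega) (by omega) (by omega)

/-- Products of total weight `2 q + 4` and of orders at most `q`, not both equal to `q`, are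
negligible. -/
lemma negl_ipJet' {q a b α β m : ℕ} {E Z : CMetric n → TField n ι} (hE : Ctl a α E)
    (hZ : Ctl b β Z) (hw : a + b + 2 * m = 2 * q + 4) (hα : α + m ≤ q) (hβ : β + m + 1 ≤ q)
    (hb : 1 ≤ b) : Negl q (ipJet m E Z) :=
  (negl_ipJet hZ hE (by omega) hβ hα hb).congr (isNatCont_ipJet m hE.1 hZ.1)
    fun G U hG y hy => ipJet_symm m G U hG y hy

omit [Fintype ι] [DecidableEq ι] in
lemma relabC_swapO_swapO (t : Comp n (Option (Option ι))) :
    relabC swapO (relabC swapO t) = t := by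
  funext c
  simp only [relabC]
  congr 1
  funext o
  simp [swapO_involutive o]

/-- The commutator of the divergence and the covariant derivative. -/
lemma divT_swap_eq {Y : CMetric n → TField n (Option ι)} (hY : IsNat Y) :
    REq (fun G => divT G (fun y => relabC swapO (gcov G (Y G) y)))
      (fun G y => gcov G (divT G (Y G)) y
        + trcC (G y)⁻¹ (relabC (Option.map swapO) (comm G (Y G) y))) := by
  intro G U hG y hy
  have h1 : gcov G (divT G (Y G)) y = trcC (G y)⁻¹ (relabC rot3 (gcov G (gcov G (Y G)) y)) :=
    gcov_trcC hG hy (hY.gcov.diffAt hG hy)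
  funext c
  obtain ⟨i, c, rfl⟩ : ∃ i d, c = oc i d := ⟨c none, c ∘ some, (oc_eta c).symm⟩
  simp only [Pi.add_apply, h1]
  simp only [divT, gcov_relabC G swapO_bijective, trcC]
  rw [← Finset.sum_add_distrib]
  refine Finset.sum_congr rfl fun a _ => ?_
  rw [← Finset.sum_add_distrib]
  refine Finset.sum_congr rfl fun b _ => ?_
  rw [← mul_add]
  simp only [relabC, oc_comp_map, oc_comp_swapO, oc_comp_rot3, comm_apply]
  ring

lemma ipJet_zero_ibp (X : CMetric n → TField n ι) (Y : CMetric n → TField n (Option ι))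
    (hX : IsNat X) (hY : IsNat Y) (𝓘 : CInt n) :
    𝓘 (fun G y => ipJet 0 (fun G => gcov G (X G)) Y G y + ipJet 0 X (fun G => divT G (Y G)) G y)
      = 0 := by
  have hW := hX.ipForm hY
  have hd : IsNatCont (fun G y => divT G (fun y => ipForm (G y)⁻¹ (X G y) (Y G y)) y Fin.elim0) := by
    refine ⟨fun e => by rw [hW.divT.congr e], fun hG => (hW.divT.smooth hG _).continuousOn,
      fun hφ hG z hz => ?_⟩
    rw [hW.divT.pull hφ hG z hz, act_empty]
  rw [← 𝓘.map_div _ hW]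
  refine 𝓘.map_congr ((isNatCont_ipJet 0 hX.gcov hY).add (isNatCont_ipJet 0 hX hY.divT)) hd
    fun G U hG y hy => ?_
  rw [divT_ipForm hG hy (hX.diffAt hG hy) (hY.diffAt hG hy)]
  rfl

/-- Integration by parts, up to negligible terms. -/
lemma negl_ibp {q m : ℕ} : ∀ {ι : Type} [Fintype ι] [DecidableEq ι] {s s' ℓ ℓ' : ℕ}
    {X : CMetric n → TField n ι} {Y : CMetric n → TField n (Option ι)},
    Ctl s ℓ X → Ctl s' ℓ' Y → s + 1 + s' + 2 * m = 2 * q + 4 → ℓ + m ≤ q → ℓ' + m ≤ q → 1 ≤ s →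
    1 ≤ s' → Negl q (fun G y => ipJet m (fun G => gcov G (X G)) Y G y
      + ipJet m X (fun G => divT G (Y G)) G y) := by
  induction m with
  | zero =>
    intro ι _ _ s s' ℓ ℓ' X Y hX hY _ _ _ _ _
    exact Negl.of_eq_zero ((isNatCont_ipJet 0 hX.1.gcov hY.1).add
      (isNatCont_ipJet 0 hX.1 hY.1.divT)) (ipJet_zero_ibp X Y hX.1 hY.1)
  | succ m ih =>
    intro ι _ _ s s' ℓ ℓ' X Y hX hY hw hℓ hℓ' hs hs'
    -- The derivative to be integrated by parts is the inner one. Exchanging the two front slots in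
    -- both factors brings it outside, so that the induction hypothesis applies to `∇X` and the
    -- swapped `∇Y`. The commutators that arise are the negligible terms `n2` and `n3`.
    have hY' := hY.gcov.relabC swapO_bijective
    have n1 := ih hX.gcov hY' (by omega) (by omega) (by omega) (by omega) (by omega)
    have n2 := negl_ipJet (q := q) (m := m) hX.comm hY' (by omega) (by omega) (by omega) (by omega)
    have hK := (hY.comm.relabC (option_map_bijective swapO_bijective)).trcC
    have n3 := negl_ipJet' (q := q) (m := m) hX.gcov hK (by omega) (by omega) (by omega) (by omega)
    refine ((n1.sub n2).sub n3).congr ((isNatCont_ipJet (m + 1) hX.1.gcov hY.1).add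
      (isNatCont_ipJet (m + 1) hX.1 hY.1.divT)) fun G U hG y hy => ?_
    have e1 : ipJet (m + 1) (fun G => gcov G (X G)) Y G y
        = ipJet m (fun G y => relabC swapO (gcov G (gcov G (X G)) y))
          (fun G y => relabC swapO (gcov G (Y G) y)) G y :=
      (ipJet_relabC m swapO_bijective G y).symm
    have e2 := ipJet_sub_left m (Y := fun G y => relabC swapO (gcov G (Y G) y)) hX.1.gcov.gcov
      (hX.1.gcov.gcov.relabC swapO_bijective) G U hG y hy
    have e3 := ipJet_add_right m (X := fun G => gcov G (X G)) hY.1.divT.gcov hK.1 G U hG y hy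
    have e4 := ipJet_congr m (X := fun G => gcov G (X G)) (fun G U hG y hy => rfl)
      (divT_swap_eq hY.1) G U hG y hy
    rw [e1]
    change _ = _ + ipJet m (fun G => gcov G (X G)) (fun G => gcov G (divT G (Y G))) G y
    rw [e4, e3]
    change ipJet m (fun G => comm G (X G)) _ G y = _ at e2
    rw [e2]
    ring

/-- Integration by parts when the first factor has too many derivatives, up to negligible terms. -/
lemma negl_ibp' {q m : ℕ} : ∀ {ι : Type} [Fintype ι] [DecidableEq ι] {s s' ℓ ℓ' : ℕ}
    {X : CMetric n → TField n ι} {Y : CMetric n → TField n (Option ι)},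
    Ctl s ℓ X → Ctl s' ℓ' Y → s + 1 + s' + 2 * m = 2 * q + 4 → ℓ + m ≤ q + 1 → ℓ' + m + 1 ≤ q →
    1 ≤ s → 1 ≤ s' → Negl q (fun G y => ipJet m (fun G => gcov G (X G)) Y G y
      + ipJet m X (fun G => divT G (Y G)) G y) := by
  induction m with
  | zero =>
    intro ι _ _ s s' ℓ ℓ' X Y hX hY _ _ _ _ _
    exact Negl.of_eq_zero ((isNatCont_ipJet 0 hX.1.gcov hY.1).add
      (isNatCont_ipJet 0 hX.1 hY.1.divT)) (ipJet_zero_ibp X Y hX.1 hY.1)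
  | succ m ih =>
    intro ι _ _ s s' ℓ ℓ' X Y hX hY hw hℓ hℓ' hs hs'
    have hY' := hY.gcov.relabC swapO_bijective
    have n1 := ih hX.gcov hY' (by omega) (by omega) (by omega) (by omega) (by omega)
    have n2 := negl_ipJet' (q := q) (m := m) hX.comm hY' (by omega) (by omega) (by omega) (by omega)
    have hK := (hY.comm.relabC (option_map_bijective swapO_bijective)).trcC
    -- Here `∇X` with its `m` further derivatives may have order `q + 1`, so its product with `K` is
    -- not covered directly. One derivative is moved from `∇X` to `K` first, and the result is
    -- negligible by `n4`.
    have n3 := negl_ibp (q := q) (m := m) hX hK (by omega) (by omega) (by omega) (by omega)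
      (by omega)
    have n4 := negl_ipJet' (q := q) (m := m) hX hK.divT (by omega) (by omega) (by omega) (by omega)
    refine ((n1.sub n2).sub (n3.sub n4)).congr ((isNatCont_ipJet (m + 1) hX.1.gcov hY.1).add
      (isNatCont_ipJet (m + 1) hX.1 hY.1.divT)) fun G U hG y hy => ?_
    have e1 : ipJet (m + 1) (fun G => gcov G (X G)) Y G y
        = ipJet m (fun G y => relabC swapO (gcov G (gcov G (X G)) y))
          (fun G y => relabC swapO (gcov G (Y G) y)) G y :=
      (ipJet_relabC m swapO_bijective G y).symm
    have e2 := ipJet_sub_left m (Y := fun G y => relabC swapO (gcov G (Y G) y)) hX.1.gcov.gcov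
      (hX.1.gcov.gcov.relabC swapO_bijective) G U hG y hy
    have e3 := ipJet_add_right m (X := fun G => gcov G (X G)) hY.1.divT.gcov hK.1 G U hG y hy
    have e4 := ipJet_congr m (X := fun G => gcov G (X G)) (fun G U hG y hy => rfl)
      (divT_swap_eq hY.1) G U hG y hy
    rw [e1]
    change _ = _ + ipJet m (fun G => gcov G (X G)) (fun G => gcov G (divT G (Y G))) G y
    rw [e4, e3]
    change ipJet m (fun G => comm G (X G)) _ G y = _ at e2
    rw [e2]
    ring

end Negligible

/-! ### Calculus modulo lower order tensors and negligible functions -/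

section Congruences

open Function Matrix

variable {n : ℕ} {ι κ : Type} [Fintype ι] [DecidableEq ι] [Fintype κ] [DecidableEq κ]

/-! ### Congruences modulo lower order terms -/

/-- Two natural tensors differ by a tensor of weight `s` and order `ℓ`. -/
structure CEq (s ℓ : ℕ) (X X' : CMetric n → TField n ι) : Prop where
  left : IsNat X
  right : IsNat X'
  ctl : Ctl s ℓ (fun G y => X G y - X' G y)

namespace CEq

variable {s ℓ : ℕ} {X X' X'' Y Y' : CMetric n → TField n ι}

lemma of_rEq (h : IsNat X) (h' : IsNat X') (e : REq X X') : CEq s ℓ X X' :=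
  ⟨h, h', Ctl.zero.congr (h.sub h') fun G U hG y hy => (sub_eq_zero.2 (e G U hG y hy)).symm⟩

lemma of_ctl (h : Ctl s ℓ (fun G y => X G y - X' G y)) (hX' : IsNat X') : CEq s ℓ X X' := by
  refine ⟨?_, hX', h⟩
  simpa using h.1.add hX'

lemma zero_iff : CEq s ℓ X (fun _ _ => 0) ↔ Ctl s ℓ X :=
  ⟨fun h => by simpa using h.ctl, fun h => of_ctl (by simpa using h) IsNat.zero⟩

lemma symm (h : CEq s ℓ X X') : CEq s ℓ X' X :=
  ⟨h.right, h.left, by simpa using h.ctl.neg⟩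

lemma trans (h : CEq s ℓ X X') (h' : CEq s ℓ X' X'') : CEq s ℓ X X'' :=
  ⟨h.left, h'.right, by simpa using h.ctl.add h'.ctl⟩

lemma add (h : CEq s ℓ X X') (h' : CEq s ℓ Y Y') :
    CEq s ℓ (fun G y => X G y + Y G y) (fun G y => X' G y + Y' G y) :=
  ⟨h.left.add h'.left, h.right.add h'.right, by
    simpa only [add_sub_add_comm] using h.ctl.add h'.ctl⟩

lemma smul (r : ℝ) (h : CEq s ℓ X X') : CEq s ℓ (fun G y => r • X G y) (fun G y => r • X' G y) :=
  ⟨h.left.smul r, h.right.smul r, by simpa only [smul_sub] using h.ctl.smul r⟩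

lemma neg (h : CEq s ℓ X X') : CEq s ℓ (fun G y => -X G y) (fun G y => -X' G y) := by
  simpa using h.smul (-1)

lemma sub (h : CEq s ℓ X X') (h' : CEq s ℓ Y Y') :
    CEq s ℓ (fun G y => X G y - Y G y) (fun G y => X' G y - Y' G y) := by
  simpa [sub_eq_add_neg] using h.add h'.neg

lemma relabC {f : ι → κ} (hf : Bijective f) (h : CEq s ℓ X X') :
    CEq s ℓ (fun G y => relabC f (X G y)) (fun G y => relabC f (X' G y)) :=
  ⟨h.left.relabC hf, h.right.relabC hf, h.ctl.relabC hf⟩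

lemma gcov (h : CEq s ℓ X X') :
    CEq (s + 1) (ℓ + 1) (fun G => gcov G (X G)) (fun G => gcov G (X' G)) := by
  refine ⟨h.left.gcov, h.right.gcov, h.ctl.gcov.congr (h.left.gcov.sub h.right.gcov)
    fun G U hG y hy => ?_⟩
  have e1 := gcov_add G (h.left.diffAt hG hy) ((h.right.smul (-1)).diffAt hG hy)
  have e2 := gcov_smul G (-1) (h.right.diffAt hG hy)
  rw [e2] at e1
  simpa [sub_eq_add_neg] using e1

lemma trcC {X X' : CMetric n → TField n (Option (Option ι))} (h : CEq s ℓ X X') :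
    CEq s ℓ (fun G y => trcC (G y)⁻¹ (X G y)) (fun G y => trcC (G y)⁻¹ (X' G y)) := by
  refine ⟨h.left.trcC, h.right.trcC, h.ctl.trcC.congr (h.left.trcC.sub h.right.trcC)
    fun G U hG y hy => ?_⟩
  funext c
  simp [CurvatureFlow.trcC, mul_sub, Finset.sum_sub_distrib]

lemma divT {X X' : CMetric n → TField n (Option ι)} (h : CEq s ℓ X X') :
    CEq (s + 1) (ℓ + 1) (fun G => divT G (X G)) (fun G => divT G (X' G)) := h.gcov.trcC

end CEq

lemma REq.divT {X X' : CMetric n → TField n (Option ι)} (h : REq X X') :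
    REq (fun G => divT G (X G)) (fun G => divT G (X' G)) := fun G U hG y hy => by
  simp only [CurvatureFlow.divT, h.gcov G U hG y hy]

lemma divT_relabC {f : ι → κ} (hf : Bijective f) (G : CMetric n) (X : TField n (Option ι))
    (y : Coord n) :
    divT G (fun y => relabC (Option.map f) (X y)) y = relabC f (divT G X y) := by
  funext c
  simp only [divT, gcov_relabC G (option_map_bijective hf), trcC, relabC, oc_comp_map]

lemma divT_swap_ceq {s ℓ : ℕ} {Y : CMetric n → TField n (Option ι)} (hY : Ctl s ℓ Y) :
    CEq (s + 2) ℓ (fun G => divT G (fun y => relabC swapO (gcov G (Y G) y)))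
      (fun G => gcov G (divT G (Y G))) := by
  have h1 := hY.1.gcov.relabC swapO_bijective
  refine ⟨h1.divT, hY.1.divT.gcov, ?_⟩
  refine (hY.comm.relabC (option_map_bijective swapO_bijective)).trcC.congr
    (h1.divT.sub hY.1.divT.gcov) fun G U hG y hy => ?_
  have := divT_swap_eq hY.1 G U hG y hy
  simp only at this
  rw [this, add_sub_cancel_left]

lemma divT_divT_apply {Y : CMetric n → TField n (Option (Option ι))} (hY : IsNat Y)
    {G : CMetric n} {U : Set (Coord n)} (hG : RiemOn G U) {y : Coord n} (hy : y ∈ U)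
    (c : ι → Fin n) : divT G (divT G (Y G)) y c = ∑ a, ∑ b, ∑ a', ∑ b', (G y)⁻¹ a b *
      ((G y)⁻¹ a' b' * gcov G (gcov G (Y G)) y (oc a (oc a' (oc b' (oc b c))))) := by
  have e1 : gcov G (divT G (Y G)) y = trcC (G y)⁻¹ (relabC rot3 (gcov G (gcov G (Y G)) y)) :=
    gcov_trcC hG hy (hY.gcov.diffAt hG hy)
  rw [divT, e1]
  simp only [trcC, relabC, oc_comp_rot3, Finset.mul_sum]

lemma sum_pair_comm (F : Fin n → Fin n → Fin n → Fin n → ℝ) :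
    ∑ a, ∑ b, ∑ a', ∑ b', F a b a' b' = ∑ a, ∑ b, ∑ a', ∑ b', F a' b' a b := by
  have := Finset.sum_comm (s := Finset.univ) (t := Finset.univ)
    (f := fun (p p' : Fin n × Fin n) => F p.1 p.2 p'.1 p'.2)
  simpa only [Fintype.sum_prod_type] using this

/-- Divergences commute modulo lower order terms. -/
lemma divT_divT_swap_ceq {s ℓ : ℕ} {Y : CMetric n → TField n (Option (Option ι))}
    (hY : Ctl s ℓ Y) :
    CEq (s + 2) ℓ (fun G => divT G (divT G (Y G)))
      (fun G => divT G (divT G (fun y => relabC swapO (Y G y)))) := by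
  have hY' := hY.1.relabC swapO_bijective
  refine ⟨hY.1.divT.divT, hY'.divT.divT, ?_⟩
  refine (hY.comm.relabC (option_map_bijective swapO_bijective)).trcC.trcC.neg.congr
    (hY.1.divT.divT.sub hY'.divT.divT) fun G U hG y hy => ?_
  have e3 : gcov G (gcov G (fun y => relabC swapO (Y G y))) y
      = relabC (Option.map (Option.map swapO)) (gcov G (gcov G (Y G)) y) := by
    have : gcov G (fun y => relabC swapO (Y G y))
        = fun y => relabC (Option.map swapO) (gcov G (Y G) y) := by
      funext y; exact gcov_relabC G swapO_bijective _ _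
    rw [this, gcov_relabC G (option_map_bijective swapO_bijective)]
  funext c
  simp only [Pi.sub_apply, Pi.neg_apply]
  rw [divT_divT_apply hY.1 hG hy, divT_divT_apply hY' hG hy]
  have e5 : trcC (G y)⁻¹ (trcC (G y)⁻¹ (relabC (Option.map swapO) (comm G (Y G) y))) c
      = (∑ a, ∑ b, ∑ a', ∑ b', (G y)⁻¹ a b *
          ((G y)⁻¹ a' b' * gcov G (gcov G (Y G)) y (oc a' (oc a (oc b' (oc b c))))))
        - ∑ a, ∑ b, ∑ a', ∑ b', (G y)⁻¹ a b *
          ((G y)⁻¹ a' b' * gcov G (gcov G (Y G)) y (oc a (oc a' (oc b' (oc b c))))) := by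
    simp only [trcC, relabC, oc_comp_map, oc_comp_swapO, comm_apply, mul_sub,
      Finset.sum_sub_distrib, Finset.mul_sum]
  have e6 : ∀ a b a' b', relabC (Option.map (Option.map swapO)) (gcov G (gcov G (Y G)) y)
      (oc a (oc a' (oc b' (oc b c)))) = gcov G (gcov G (Y G)) y (oc a (oc a' (oc b (oc b' c)))) := by
    intro a b a' b'
    simp only [relabC, oc_comp_map, oc_comp_swapO]
  rw [e5, e3]
  simp only [e6]
  rw [sum_pair_comm (fun a b a' b' => (G y)⁻¹ a b *
          ((G y)⁻¹ a' b' * gcov G (gcov G (Y G)) y (oc a (oc a' (oc b (oc b' c)))))), neg_sub]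
  refine congrArg (fun x => _ - x) ?_
  exact Finset.sum_congr rfl fun a _ => Finset.sum_congr rfl fun b _ =>
    Finset.sum_congr rfl fun a' _ => Finset.sum_congr rfl fun b' _ => by
      rw [← mul_assoc, ← mul_assoc, mul_comm ((G y)⁻¹ a b)]

/-- Two functions differ by a negligible one. -/
structure NEq (q : ℕ) (f f' : CMetric n → Coord n → ℝ) : Prop where
  left : IsNatCont f
  right : IsNatCont f'
  negl : Negl q (fun G y => f G y - f' G y)

namespace NEq

variable {q : ℕ} {f f' f'' k k' : CMetric n → Coord n → ℝ}

lemma of_eq (h : IsNatCont f) (h' : IsNatCont f')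
    (e : ∀ G U, RiemOn G U → ∀ y ∈ U, f G y = f' G y) : NEq q f f' :=
  ⟨h, h', (Negl.of_eq_zero (IsNatCont.const 0) fun 𝓘 => 𝓘.map_zero).congr (h.sub h')
    fun G U hG y hy => by rw [e G U hG y hy, sub_self]⟩

lemma trans (h : NEq q f f') (h' : NEq q f' f'') : NEq q f f'' :=
  ⟨h.left, h'.right, by simpa using h.negl.add h'.negl⟩

lemma add (h : NEq q f f') (h' : NEq q k k') :
    NEq q (fun G y => f G y + k G y) (fun G y => f' G y + k' G y) :=
  ⟨h.left.add h'.left, h.right.add h'.right, by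
    simpa only [add_sub_add_comm] using h.negl.add h'.negl⟩

lemma smul (r : ℝ) (h : NEq q f f') : NEq q (fun G y => r * f G y) (fun G y => r * f' G y) :=
  ⟨h.left.smul r, h.right.smul r, by simpa only [mul_sub] using h.negl.smul r⟩

lemma of_negl (h : Negl q f) : NEq q f (fun _ _ => 0) :=
  ⟨h.nat, IsNatCont.const 0, by simpa using h⟩

end NEq

variable {m s s' ℓ ℓ' : ℕ}

/-- For `q = m + 2` the total weight is `2 q + 4 = 2 m + 8`. The `m` derivatives on each side
account for `2 m`, so the weights of the two factors must add up to `8`; the top order is `2`. -/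
lemma neq_ipJet_left {a b α β : ℕ} {X X' Y : CMetric n → TField n ι} (h : CEq a α X X')
    (hY : Ctl b β Y) (hw : a + b = 8) (hα : α ≤ 1) (hβ : β ≤ 2) (ha : 1 ≤ a) :
    NEq (m + 2) (ipJet m X Y) (ipJet m X' Y) :=
  ⟨isNatCont_ipJet m h.left hY.1, isNatCont_ipJet m h.right hY.1,
    (negl_ipJet (q := m + 2) (m := m) h.ctl hY (by omega) (by omega) (by omega) ha).congr
      ((isNatCont_ipJet m h.left hY.1).sub (isNatCont_ipJet m h.right hY.1))
      fun G U hG y hy => ipJet_sub_left m h.left h.right G U hG y hy⟩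

lemma neq_ipJet_comm {X Y : CMetric n → TField n ι} (hX : IsNat X) (hY : IsNat Y) {q : ℕ} :
    NEq q (ipJet m X Y) (ipJet m Y X) :=
  NEq.of_eq (isNatCont_ipJet m hX hY) (isNatCont_ipJet m hY hX)
    fun G U hG y hy => ipJet_symm m G U hG y hy

lemma neq_ipJet_right {a b α β : ℕ} {X Y Y' : CMetric n → TField n ι} (h : CEq a α Y Y')
    (hX : Ctl b β X) (hw : a + b = 8) (hα : α ≤ 1) (hβ : β ≤ 2) (ha : 1 ≤ a) :
    NEq (m + 2) (ipJet m X Y) (ipJet m X Y') :=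
  ((neq_ipJet_comm hX.1 h.left).trans (neq_ipJet_left h hX hw hα hβ ha)).trans
    (neq_ipJet_comm h.right hX.1)

lemma neq_ibp {X : CMetric n → TField n ι} {Y : CMetric n → TField n (Option ι)} (hX : Ctl s ℓ X)
    (hY : Ctl s' ℓ' Y) (hw : s + s' = 7) (hℓ : ℓ ≤ 2) (hℓ' : ℓ' ≤ 2) (hs : 1 ≤ s) (hs' : 1 ≤ s') :
    NEq (m + 2) (ipJet m (fun G => gcov G (X G)) Y)
      (fun G y => -1 * ipJet m X (fun G => divT G (Y G)) G y) := by
  have h1 := isNatCont_ipJet m hX.1.gcov hY.1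
  have h2 := (isNatCont_ipJet m hX.1 hY.1.divT).smul (-1)
  refine ⟨h1, h2, (negl_ibp (q := m + 2) (m := m) hX hY (by omega) (by omega) (by omega) hs
    hs').congr (h1.sub h2) fun G U _ y _ => by ring⟩

/-- The variant for a first factor of order three, needed for the derivative of `P(g)`, which itself
has order two. -/
lemma neq_ibp' {X : CMetric n → TField n ι} {Y : CMetric n → TField n (Option ι)} (hX : Ctl s ℓ X)
    (hY : Ctl s' ℓ' Y) (hw : s + s' = 7) (hℓ : ℓ ≤ 3) (hℓ' : ℓ' ≤ 1) (hs : 1 ≤ s) (hs' : 1 ≤ s') :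
    NEq (m + 2) (ipJet m (fun G => gcov G (X G)) Y)
      (fun G y => -1 * ipJet m X (fun G => divT G (Y G)) G y) := by
  have h1 := isNatCont_ipJet m hX.1.gcov hY.1
  have h2 := (isNatCont_ipJet m hX.1 hY.1.divT).smul (-1)
  refine ⟨h1, h2, (negl_ibp' (q := m + 2) (m := m) hX hY (by omega) (by omega) (by omega) hs
    hs').congr (h1.sub h2) fun G U _ y _ => by ring⟩

/-- The full second covariant derivative is controlled by the Laplacian. -/
lemma neq_hess {X : CMetric n → TField n ι} (hX : Ctl 2 0 X) :
    NEq (m + 2) (ipJet m (fun G => gcov G (gcov G (X G))) (fun G => gcov G (gcov G (X G))))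
      (ipJet m (fun G => divT G (gcov G (X G))) (fun G => divT G (gcov G (X G)))) := by
  -- Modulo lower order, `div ∇∇X` is the covariant derivative of `div ∇X`: the two inner
  -- derivatives are exchanged, and then the divergence and the remaining derivative. With `e1`, two
  -- integrations by parts turn `∫ |∇∇X|²` into the square of the Laplacian.
  have e1 : CEq 5 1 (fun G => divT G (gcov G (gcov G (X G))))
      (fun G => gcov G (divT G (gcov G (X G)))) := by
    have h1 : CEq 4 0 (fun G => gcov G (gcov G (X G)))
        (fun G y => relabC swapO (gcov G (gcov G (X G)) y)) :=
      CEq.of_ctl hX.comm (hX.1.gcov.gcov.relabC swapO_bijective)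
    exact h1.divT.trans (divT_swap_ceq hX.gcov)
  have n1 := neq_ibp (m := m) hX.gcov hX.gcov.gcov (by norm_num) (by norm_num) (by norm_num)
    (by norm_num) (by norm_num)
  have n2 := (neq_ipJet_right (m := m) e1 hX.gcov (by norm_num) (by norm_num) (by norm_num)
    (by norm_num)).trans (neq_ipJet_comm hX.1.gcov hX.1.gcov.divT.gcov)
  have n3 := neq_ibp (m := m) hX.gcov.divT hX.gcov (by norm_num) (by norm_num) (by norm_num)
    (by norm_num) (by norm_num)
  have n4 := n1.trans ((n2.trans n3).smul (-1))
  simpa using n4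

/-! ### Products with the metric -/

/-- The product of the metric with a tensor. -/
def metMul (A : Mat n) (t : Comp n ι) : Comp n (Option (Option ι)) :=
  fun c => A (c none) (c (some none)) * t (c ∘ some ∘ some)

omit [Fintype ι] [DecidableEq ι] in
lemma metMul_oc (A : Mat n) (t : Comp n ι) (a b : Fin n) (c : ι → Fin n) :
    metMul A t (oc a (oc b c)) = A a b * t c := rfl

lemma Ctl.metMul {X : CMetric n → TField n ι} (h : Ctl s ℓ X) :
    Ctl s ℓ (fun G y => metMul (G y) (X G y)) := by
  have := (Ctl.metT.mulC h).relabC commSlot_bijective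
  rwa [zero_add, Nat.zero_max] at this

lemma relabC_gcov_metMul {X : CMetric n → TField n ι} (hX : IsNat X) :
    REq (fun G y => relabC rot3 (gcov G (fun y => metMul (G y) (X G y)) y))
      (fun G y => metMul (G y) (gcov G (X G) y)) := by
  intro G U hG y hy
  have h1 : gcov G (fun y => metMul (G y) (X G y)) y
      = relabC (Option.map commSlot) (gcov G (fun y => mulC (metT G y) (X G y)) y) :=
    gcov_relabC G commSlot_bijective (fun y => mulC (metT G y) (X G y)) y
  have h2 := gcov_mulC G (S := metT G) (T := X G) (IsNat.metT.diffAt hG hy) (hX.diffAt hG hy)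
  have h3 := gcov_metT hG hy
  rw [h3] at h2
  simp only [h1, h2]
  funext c
  obtain ⟨a, b, i, c, rfl⟩ : ∃ a b i d, c = oc a (oc b (oc i d)) :=
    ⟨c none, c (some none), c (some (some none)), c ∘ some ∘ some ∘ some, by
      funext o; rcases o with (_ | _ | _ | x) <;> rfl⟩
  simp only [relabC, Pi.add_apply, mulC, Pi.zero_apply, zero_mul, zero_add, oc_comp_rot3]
  rfl

lemma ip_metMul {A : Mat n} (hA : IsUnit A.det) (hs : Aᵀ = A) (s : Comp n ι)
    (t : Comp n (Option (Option ι))) : ip A⁻¹ (metMul A s) t = ip A⁻¹ s (trcC A⁻¹ t) := by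
  have h1 : trcC A⁻¹ t = ∑ a, ∑ b, A⁻¹ a b • fun c => t (oc a (oc b c)) := by
    funext c; simp [trcC]
  rw [h1]
  simp only [ip_sum_right, ip_smul_right]
  rw [ip_oc]
  simp only [ip_oc (A⁻¹) (fun c => metMul A s (oc _ c)), metMul_oc]
  have h2 : ∀ a a', (ip A⁻¹ (fun c => A a a' * s c)) = fun t => A a a' * ip A⁻¹ s t := by
    intro a a'; funext t; exact ip_smul_left _ _ _ _
  simp only [h2]
  rw [Finset.sum_comm]
  refine Finset.sum_congr rfl fun b _ => ?_
  simp only [Finset.mul_sum]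
  rw [Finset.sum_congr rfl fun a _ => Finset.sum_comm, Finset.sum_comm]
  refine Finset.sum_congr rfl fun b' _ => ?_
  have h3 : ∑ a, ∑ a', A⁻¹ a b * (A⁻¹ a' b' * A a a') = A⁻¹ b b' := by
    have e : (A⁻¹)ᵀ * A * A⁻¹ = A⁻¹ := by
      rw [Matrix.transpose_nonsing_inv, hs, Matrix.nonsing_inv_mul _ hA, Matrix.one_mul]
    have := congrFun (congrFun e b) b'
    rw [← this]
    simp only [Matrix.mul_apply, Finset.sum_mul, Matrix.transpose_apply]
    rw [Finset.sum_comm]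
    exact Finset.sum_congr rfl fun a _ => Finset.sum_congr rfl fun a' _ => by ring
  rw [← h3, Finset.sum_mul]
  refine Finset.sum_congr rfl fun a _ => ?_
  rw [Finset.sum_mul]
  exact Finset.sum_congr rfl fun a' _ => by ring

/-- Multiplication by the metric is adjoint to the trace. As the metric is parallel, both operations
commute with covariant derivatives up to moving slots. -/
lemma ipJet_metMul (m : ℕ) : ∀ {ι : Type} [Fintype ι] [DecidableEq ι]
    {X : CMetric n → TField n ι} {Y : CMetric n → TField n (Option (Option ι))},
    IsNat X → IsNat Y → ∀ G U, RiemOn G U → ∀ y ∈ U,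
    ipJet m (fun G y => metMul (G y) (X G y)) Y G y
      = ipJet m X (fun G y => trcC (G y)⁻¹ (Y G y)) G y := by
  induction m with
  | zero =>
    intro ι _ _ X Y hX hY G U hG y hy
    exact ip_metMul (hG.isUnit_det hy) (hG.transpose hy) _ _
  | succ m ih =>
    intro ι _ _ X Y hX hY G U hG y hy
    have h1 := ih hX.gcov (hY.gcov.relabC rot3_bijective) G U hG y hy
    rw [ipJet_congr m (relabC_gcov_metMul hX).symm (fun _ _ _ _ _ => rfl) G U hG y hy,
      ipJet_relabC m rot3_bijective] at h1
    simp only [ipJet]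
    rw [h1]
    refine ipJet_congr m (fun _ _ _ _ _ => rfl) (fun G U hG y hy => ?_) G U hG y hy
    exact (gcov_trcC hG hy (hY.diffAt hG hy)).symm

end Congruences

/-! ### Divergences and Laplacians of the curvature tensor -/

section Curvature

open Function Matrix

variable {n : ℕ} {ι κ : Type} [Fintype ι] [DecidableEq ι] [Fintype κ] [DecidableEq κ]

/-! ### The curvature tensor and its divergences -/

/-- The slots of a `2`-tensor. -/
abbrev Two : Type := Option (Option (Fin 0))

/-- The slots of a `4`-tensor. -/
abbrev Four : Type := Option (Option Two)

/-- The components with indices `i j k l`. -/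
abbrev oc4 (i j k l : Fin n) : Four → Fin n := oc i (oc j (oc k (oc l Fin.elim0)))

lemma exists_oc4 (c : Four → Fin n) : ∃ i j k l, c = oc4 i j k l :=
  ⟨c none, c (some none), c (some (some none)), c (some (some (some none))), by
    funext o; rcases o with (_ | _ | _ | _ | x) <;> first | rfl | exact x.elim0⟩

lemma exists_oc2 (c : Two → Fin n) : ∃ i j, c = oc i (oc j Fin.elim0) :=
  ⟨c none, c (some none), by
    funext o; rcases o with (_ | _ | x) <;> first | rfl | exact x.elim0⟩

/-- The substitution of slots of a `4`-tensor. -/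
def perm4 (a b c d : Four) : Four → Four
  | none => a
  | some none => b
  | some (some none) => c
  | some (some (some none)) => d

lemma oc4_comp_perm4 (x : Four → Fin n) (a b c d : Four) :
    x ∘ perm4 a b c d = oc4 (x a) (x b) (x c) (x d) := by
  funext o; rcases o with (_ | _ | _ | _ | x) <;> first | rfl | exact x.elim0

/-- The slots of the curvature tensor. -/
def rmSlot : Fin 4 → Four := ![none, some none, some (some none), some (some (some none))]

lemma rmSlot_bijective : Bijective rmSlot := by decide

lemma oc4_comp_rmSlot (i j k l : Fin n) : oc4 i j k l ∘ rmSlot = ![i, j, k, l] := by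
  funext x; fin_cases x <;> rfl

/-- The curvature tensor, with nested slots. -/
def rmT (G : CMetric n) : TField n Four := fun y => relabC rmSlot (riem G y)

lemma rmT_apply (G : CMetric n) (y : Coord n) (i j k l : Fin n) :
    rmT G y (oc4 i j k l) = riem G y ![i, j, k, l] := by
  rw [rmT, relabC, oc4_comp_rmSlot]

lemma ctl_rmT : Ctl 2 0 (rmT (n := n)) := Ctl.riem.relabC rmSlot_bijective

lemma gcov_neg' {X : CMetric n → TField n ι} (hX : IsNat X) :
    REq (fun G => gcov G (fun y => -X G y)) (fun G y => -gcov G (X G) y) := fun G U hG y hy => by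
  have := gcov_smul G (-1) (hX.diffAt hG hy)
  simpa using this

lemma divT_sub {X Y : CMetric n → TField n (Option ι)} (hX : IsNat X) (hY : IsNat Y) :
    REq (fun G => divT G (fun y => X G y - Y G y)) (fun G y => divT G (X G) y - divT G (Y G) y) := by
  intro G U hG y hy
  have e1 := gcov_add G (hX.diffAt hG hy) ((hY.smul (-1)).diffAt hG hy)
  have e2 := gcov_smul G (-1) (hY.diffAt hG hy)
  rw [e2] at e1
  simp only [neg_smul, one_smul, ← sub_eq_add_neg] at e1
  funext c
  simp only [divT, e1, trcC, Pi.sub_apply, mul_sub, Finset.sum_sub_distrib]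

lemma divT_smul (r : ℝ) {X : CMetric n → TField n (Option ι)} (hX : IsNat X) :
    REq (fun G => divT G (fun y => r • X G y)) (fun G y => r • divT G (X G) y) := by
  intro G U hG y hy
  funext c
  simp only [divT, gcov_smul G r (hX.diffAt hG hy), trcC, Pi.smul_apply, smul_eq_mul,
    Finset.mul_sum]
  exact Finset.sum_congr rfl fun a _ => Finset.sum_congr rfl fun b _ => by ring

lemma rmT_swap : REq (n := n) (fun G y => relabC swapO (rmT G y)) (fun G y => -rmT G y) := by
  intro G U hG y hy
  funext c
  obtain ⟨i, j, k, l, rfl⟩ := exists_oc4 c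
  simp only [relabC, oc_comp_swapO, Pi.neg_apply, rmT_apply]
  exact riem_antisymm_left G y j i k l

lemma rmT_pair : REq (n := n) (fun G y => relabC (perm4 (some (some none)) (some (some (some none)))
    none (some none)) (rmT G y)) rmT := by
  intro G U hG y hy
  funext c
  obtain ⟨i, j, k, l, rfl⟩ := exists_oc4 c
  simp only [relabC, oc4_comp_perm4, oc_none, oc_some, rmT_apply]
  exact riem_pair_symm hG hy k l i j

section Pointwise

variable {G : CMetric n} {U : Set (Coord n)} (hG : RiemOn G U) {y : Coord n} (hy : y ∈ U)

include hG hy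

lemma gcov_rmT_swap (i a b c d : Fin n) :
    gcov G (rmT G) y (oc i (oc4 b a c d)) = -gcov G (rmT G) y (oc i (oc4 a b c d)) := by
  have h1 := congrFun ((rmT_swap.gcov.trans (gcov_neg' ctl_rmT.1)) G U hG y hy) (oc i (oc4 a b c d))
  simp only [gcov_relabC G swapO_bijective (rmT G)] at h1
  simpa only [relabC, oc_comp_map, oc_comp_swapO, Pi.neg_apply] using h1

lemma gcov_rmT_pair (i a b c d : Fin n) :
    gcov G (rmT G) y (oc i (oc4 c d a b)) = gcov G (rmT G) y (oc i (oc4 a b c d)) := by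
  have h1 := congrFun (rmT_pair.gcov G U hG y hy) (oc i (oc4 a b c d))
  simp only [gcov_relabC G (show Bijective (perm4 (some (some none)) (some (some (some none)))
    none (some none)) by decide) (rmT G)] at h1
  simpa only [relabC, oc_comp_map, oc4_comp_perm4, oc_none, oc_some] using h1

lemma gcov_rmT_bianchi (i j k a b : Fin n) :
    gcov G (rmT G) y (oc i (oc4 j k a b)) + gcov G (rmT G) y (oc j (oc4 k i a b))
      + gcov G (rmT G) y (oc k (oc4 i j a b)) = 0 := by
  have h : ∀ i j k l m, gcov G (rmT G) y (oc i (oc4 j k l m)) = cov G i (riem G) y ![j, k, l, m] := by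
    intro i j k l m
    rw [gcov_oc]
    change cov G i (fun z => relabC rmSlot (riem G z)) y (oc4 j k l m) = _
    rw [cov_relabC G rmSlot_bijective, relabC, oc4_comp_rmSlot]
  simp only [h]
  exact cov_riem_bianchi hG hy i j k a b

end Pointwise

/-- The divergence `∇^α Rm_{αjkl}`. -/
def divRm (G : CMetric n) : TField n (Option Two) := divT G (rmT G)

/-- The divergence `∇^α Rm_{αjkl}`, with slots `k j l`. -/
def divRm' (G : CMetric n) : TField n (Option Two) := fun y => relabC swapO (divRm G y)

/-- The double divergence `∇^k ∇^α Rm_{αjkl}`. -/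
def ddRm (G : CMetric n) : TField n Two := divT G (divRm' G)

lemma ctl_divRm : Ctl 3 1 (divRm (n := n)) := ctl_rmT.divT

lemma ctl_divRm' : Ctl 3 1 (divRm' (n := n)) := ctl_divRm.relabC swapO_bijective

lemma ctl_ddRm : Ctl 4 2 (ddRm (n := n)) := ctl_divRm'.divT

lemma divRm'_eq (G : CMetric n) :
    divRm' G = divT G (fun y => relabC (Option.map swapO) (rmT G y)) := by
  funext y; rw [divT_relabC swapO_bijective]; rfl

/-- `∇^j ∇^α Rm_{αjkl}` is of lower order. -/
lemma ctl_divT_divRm : Ctl 4 0 (fun G : CMetric n => divT G (divRm G)) := by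
  -- Exchanging the first two slots of `Rm` changes the double divergence only by a lower order
  -- term, because divergences commute modulo lower order, but it also changes its sign. Twice the
  -- double divergence is therefore of lower order, whence the factor `1 / 2` below.
  have h1 := divT_divT_swap_ceq (ctl_rmT (n := n))
  have h2 : REq (n := n) (fun G => divT G (divT G fun y => relabC swapO (rmT G y)))
      (fun G y => (-1 : ℝ) • divT G (divT G (rmT G)) y) := by
    have e : REq (n := n) (fun G y => -rmT G y) (fun G y => (-1 : ℝ) • rmT G y) :=
      fun G U _ y _ => by simp
    exact ((rmT_swap.trans e).divT.trans (divT_smul (-1) ctl_rmT.1)).divT.trans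
      (divT_smul (-1) ctl_rmT.1.divT)
  have h3 := (h1.trans (CEq.of_rEq h1.right (ctl_rmT.1.divT.divT.smul (-1)) h2)).ctl.smul (1 / 2)
  refine h3.congr ctl_rmT.1.divT.divT fun G U _ y _ => ?_
  simp only [neg_smul, one_smul, sub_neg_eq_add, divRm, ← two_smul ℝ, smul_smul]
  norm_num

/-- The double divergence is symmetric modulo lower order terms. -/
lemma ddRm_symm : CEq 4 0 (ddRm (n := n)) (fun G y => relabC swapO (ddRm G y)) := by
  have h1 := divT_divT_swap_ceq
    ((ctl_rmT (n := n)).relabC (option_map_bijective swapO_bijective))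
  have e0 : ∀ G : CMetric n, divT G (divT G fun y => relabC (Option.map swapO) (rmT G y))
      = ddRm G := fun G => by rw [ddRm, divRm'_eq]
  simp only [e0] at h1
  refine h1.trans (CEq.of_rEq h1.right (ctl_ddRm.1.relabC swapO_bijective) ?_)
  -- By pair symmetry, exchanging the two slots to be contracted amounts to exchanging the two free
  -- ones.
  have e1 : REq (n := n) (fun G y => relabC swapO (relabC (Option.map swapO) (rmT G y)))
      (fun G y => relabC (Option.map (Option.map swapO)) (relabC (Option.map swapO) (rmT G y))) := by
    refine fun G U hG y hy => ?_
    funext c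
    obtain ⟨i, j, k, l, rfl⟩ := exists_oc4 c
    have := congrFun (rmT_pair G U hG y hy) (oc4 i l j k)
    simp only [relabC, oc4_comp_perm4, oc_none, oc_some] at this
    simp only [relabC, oc_comp_map, oc_comp_swapO]
    exact this
  refine e1.divT.divT.trans fun G U hG y hy => ?_
  have e2 : (divT G fun y => relabC (Option.map (Option.map swapO))
      (relabC (Option.map swapO) (rmT G y))) = fun y => relabC (Option.map swapO) (divRm' G y) := by
    funext y; rw [divT_relabC (option_map_bijective swapO_bijective), divRm'_eq]
  simp only [e2]
  exact divT_relabC swapO_bijective G _ y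

/-- `∇^j ∇^k ∇^α Rm_{αjkl}` is of lower order. -/
lemma ctl_divT_ddRm : Ctl 5 1 (fun G : CMetric n => divT G (ddRm G)) := by
  -- Commuting the two outer divergences puts the inner one on the slot `j` of `∇^α Rm_{αjkl}`,
  -- where `ctl_divT_divRm` applies.
  have h1 := divT_divT_swap_ceq (ctl_divRm' (n := n))
  have e : ∀ G : CMetric n, (fun y => relabC swapO (divRm' G y)) = divRm G := fun G => by
    funext y; exact relabC_swapO_swapO _
  simp only [e] at h1
  have h2 := h1.trans (CEq.zero_iff.2 (ctl_divT_divRm (n := n)).divT)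
  exact CEq.zero_iff.1 h2

/-- The Laplacian of the curvature tensor. -/
lemma box_rmT : CEq (n := n) 4 0 (fun G => divT G (gcov G (rmT G)))
    (fun G y => gcov G (divRm G) y - relabC swapO (gcov G (divRm G) y)) := by
  have hM := ctl_rmT (n := n).gcov.1.relabC swapO_bijective
  have hM' := hM.relabC (f := Option.map swapO) (option_map_bijective swapO_bijective)
  have h1 := divT_swap_ceq (ctl_rmT (n := n))
  have h2 := h1.sub (h1.relabC swapO_bijective)
  refine CEq.trans (CEq.of_rEq ctl_rmT.1.gcov.divT h2.left ?_) h2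
  -- The second Bianchi identity exchanges the derivative slot with the slots of the first pair.
  -- After taking the divergence, each term is a derivative of `divRm` up to a commutator.
  have e1 : REq (n := n) (fun G => gcov G (rmT G)) (fun G y => relabC swapO (gcov G (rmT G) y)
      - relabC (Option.map swapO) (relabC swapO (gcov G (rmT G) y))) := by
    refine fun G U hG y hy => ?_
    funext c
    obtain ⟨e, c, rfl⟩ : ∃ e d, c = oc e d := ⟨c none, c ∘ some, (oc_eta c).symm⟩
    obtain ⟨i, j, k, l, rfl⟩ := exists_oc4 c
    simp only [Pi.sub_apply, relabC, oc_comp_map, oc_comp_swapO]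
    have b := gcov_rmT_bianchi hG hy e i j k l
    have a := gcov_rmT_swap hG hy i j e k l
    linarith
  refine (e1.divT.trans (divT_sub hM hM')).trans fun G U hG y hy => ?_
  simp only [divT_relabC swapO_bijective]

/-- The Laplacian of the divergence of the curvature tensor. -/
lemma box_divRm : CEq (n := n) 5 1 (fun G => divT G (gcov G (divRm G)))
    (fun G y => relabC swapO (gcov G (ddRm G) y)
      - relabC (Option.map swapO) (relabC swapO (gcov G (ddRm G) y))) := by
  set f₁ : Four → Four := perm4 (some (some none)) (some none) none (some (some (some none)))
    with hf₁
  set f₂ : Four → Four := perm4 (some (some (some none))) (some none) none (some (some none))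
    with hf₂
  have b₁ : Bijective f₁ := by rw [hf₁]; decide
  have b₂ : Bijective f₂ := by rw [hf₂]; decide
  have hM := ctl_rmT (n := n).gcov.1.relabC swapO_bijective
  have hM₁ := hM.relabC (f := Option.map f₁) (option_map_bijective b₁)
  have hM₂ := hM.relabC (f := Option.map f₂) (option_map_bijective b₂)
  -- The second Bianchi identity on the last pair of slots, available through pair symmetry. It
  -- passes to `divRm` by taking a divergence in the first slot of `Rm`, and a second divergence
  -- then gives the Laplacian of `divRm`.
  have e1 : REq (n := n) (fun G y => relabC swapO (gcov G (rmT G) y))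
      (fun G y => relabC (Option.map f₁) (relabC swapO (gcov G (rmT G) y))
        - relabC (Option.map f₂) (relabC swapO (gcov G (rmT G) y))) := by
    refine fun G U hG y hy => ?_
    funext c
    obtain ⟨e, c, rfl⟩ : ∃ e d, c = oc e d := ⟨c none, c ∘ some, (oc_eta c).symm⟩
    obtain ⟨i, j, k, l, rfl⟩ := exists_oc4 c
    simp only [Pi.sub_apply, relabC, oc_comp_map, hf₁, hf₂, oc4_comp_perm4, oc_none, oc_some,
      oc_comp_swapO]
    have b := gcov_rmT_bianchi hG hy i k l e j
    have a := gcov_rmT_swap hG hy k i l e j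
    have p := fun i a b c d => gcov_rmT_pair hG hy i a b c d
    rw [p i e j k l] at b
    rw [p k e j i l, p k e j l i] at a
    rw [p k e j l i, p l e j i k] at b
    linarith
  have h1 := divT_swap_ceq (ctl_rmT (n := n))
  have h2 : CEq (n := n) 4 0 (fun G => gcov G (divRm G))
      (fun G y => relabC f₁ (gcov G (divRm G) y) - relabC f₂ (gcov G (divRm G) y)) := by
    refine h1.symm.trans ?_
    have h3 := (h1.relabC b₁).sub (h1.relabC b₂)
    refine CEq.trans (CEq.of_rEq h1.left h3.left ?_) h3
    refine (e1.divT.trans (divT_sub hM₁ hM₂)).trans fun G U hG y hy => ?_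
    simp only [divT_relabC b₁, divT_relabC b₂]
  have hW := divT_swap_ceq (ctl_divRm' (n := n))
  have h3 := (hW.relabC swapO_bijective).sub ((hW.relabC swapO_bijective).relabC
    (option_map_bijective swapO_bijective))
  have hK := ctl_divRm' (n := n).gcov.1.relabC swapO_bijective
  have hK₁ := hK.relabC (f := Option.map swapO) (option_map_bijective swapO_bijective)
  have hK₂ := hK₁.relabC (f := Option.map (Option.map swapO))
    (option_map_bijective (option_map_bijective swapO_bijective))
  refine (h2.divT.trans (CEq.of_rEq h2.right.divT h3.left ?_)).trans h3
  have e2 : REq (n := n)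
      (fun G y => relabC f₁ (gcov G (divRm G) y) - relabC f₂ (gcov G (divRm G) y))
      (fun G y => relabC (Option.map swapO) (relabC swapO (gcov G (divRm' G) y))
        - relabC (Option.map (Option.map swapO))
          (relabC (Option.map swapO) (relabC swapO (gcov G (divRm' G) y)))) := by
    refine fun G U hG y hy => ?_
    have : gcov G (divRm' G) y = relabC (Option.map swapO) (gcov G (divRm G) y) :=
      gcov_relabC G swapO_bijective _ y
    simp only [this]
    funext c
    obtain ⟨i, j, k, l, rfl⟩ := exists_oc4 c
    simp only [Pi.sub_apply, relabC, oc_comp_map, hf₁, hf₂, oc4_comp_perm4, oc_none, oc_some,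
      oc_comp_swapO]
  refine (e2.divT.trans (divT_sub hK₁ hK₂)).trans fun G U hG y hy => ?_
  simp only [divT_relabC swapO_bijective, divT_relabC (option_map_bijective swapO_bijective)]

end Curvature

/-! ### The top order energy in terms of the double divergence -/

section Coercivity

open Function Matrix

variable {n : ℕ} {ι κ : Type} [Fintype ι] [DecidableEq ι] [Fintype κ] [DecidableEq κ] {m : ℕ}

/-! ### The energy of the double divergence -/

lemma rmT_swap_right : REq (n := n)
    (fun G y => relabC (Option.map (Option.map swapO)) (rmT G y)) (fun G y => -rmT G y) := by
  intro G U hG y hy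
  funext c
  obtain ⟨i, j, k, l, rfl⟩ := exists_oc4 c
  simp only [relabC, oc_comp_map, oc_comp_swapO, Pi.neg_apply, rmT_apply]
  exact riem_antisymm_right hG hy i j l k

lemma divRm_swap_right : REq (n := n) (fun G y => (-1 : ℝ) • divRm G y)
    (fun G y => relabC (Option.map swapO) (divRm G y)) := by
  have e : REq (n := n) (fun G y => relabC (Option.map (Option.map swapO)) (rmT G y))
      (fun G y => (-1 : ℝ) • rmT G y) := rmT_swap_right.trans fun G U _ y _ => by simp
  refine ((e.divT.trans (divT_smul (-1) ctl_rmT.1)).symm).trans fun G U _ y _ => ?_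
  exact divT_relabC (option_map_bijective swapO_bijective) G _ y

/-- Integration by parts gives `-∫ ⟨D, div ∇D⟩` for `D = divRm`, and `box_divRm` replaces `div ∇D`
by an antisymmetrized derivative of `ddRm`. The two terms contribute equally because `D` is
antisymmetric in its last two slots, and a final integration by parts turns `⟨D, ∇ ddRm⟩` into
`-|ddRm|²`. -/
lemma neq_divRm : NEq (n := n) (m + 2)
    (ipJet m (fun G => gcov G (divRm G)) (fun G => gcov G (divRm G)))
    (fun G y => 2 * ipJet m ddRm ddRm G y) := by
  have hS := (ctl_ddRm (n := n)).1.gcov.relabC swapO_bijective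
  have hS' := hS.relabC (f := Option.map swapO) (option_map_bijective swapO_bijective)
  have n1 := neq_ibp (m := m) (ctl_divRm (n := n)) ctl_divRm.gcov (by norm_num) (by norm_num)
    (by norm_num) (by norm_num) (by norm_num)
  have n2 := neq_ipJet_right (m := m) box_divRm (ctl_divRm (n := n)) (by norm_num) (by norm_num)
    (by norm_num) (by norm_num)
  have n3 : NEq (n := n) (m + 2) (ipJet m divRm (fun G y => relabC swapO (gcov G (ddRm G) y)
      - relabC (Option.map swapO) (relabC swapO (gcov G (ddRm G) y))))
      (fun G y => 2 * ipJet m (fun G => gcov G (ddRm G)) divRm' G y) := by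
    refine NEq.of_eq n2.right ((isNatCont_ipJet m ctl_ddRm.1.gcov ctl_divRm'.1).smul 2)
      fun G U hG y hy => ?_
    have e1 : ipJet m divRm (fun G y => relabC swapO (gcov G (ddRm G) y)) G y
        = ipJet m (fun G => gcov G (ddRm G)) divRm' G y := by
      rw [← ipJet_relabC m swapO_bijective, ipJet_symm m G U hG y hy]
      simp only [relabC_swapO_swapO]
      rfl
    have e2 : ipJet m divRm (fun G y => relabC (Option.map swapO)
        (relabC swapO (gcov G (ddRm G) y))) G y
        = -1 * ipJet m (fun G => gcov G (ddRm G)) divRm' G y := by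
      have e3 : REq (n := n) divRm (fun G y => relabC (Option.map swapO) ((-1 : ℝ) • divRm G y)) := by
        intro G U hG y hy
        have := divRm_swap_right G U hG y hy
        simp only [this]
        funext c
        simp only [relabC]
        congr 1
        funext o
        rcases o with _ | o
        · rfl
        · simp [swapO_involutive o]
      rw [ipJet_congr m e3 (fun _ _ _ _ _ => rfl) G U hG y hy,
        ipJet_relabC m (option_map_bijective swapO_bijective),
        ipJet_smul_left m _ ctl_divRm.1 G U hG y hy, e1]
    rw [ipJet_sub_right m hS hS' G U hG y hy, e1, e2]
    ring
  have n4 := neq_ibp (m := m) (ctl_ddRm (n := n)) ctl_divRm' (by norm_num) (by norm_num)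
    (by norm_num) (by norm_num) (by norm_num)
  have n5 := n1.trans (((n2.trans n3).trans (n4.smul 2)).smul (-1))
  refine n5.trans (NEq.of_eq n5.right ((isNatCont_ipJet m ctl_ddRm.1 ctl_ddRm.1).smul 2)
    fun G U hG y hy => ?_)
  change _ * (_ * (_ * ipJet m ddRm ddRm G y)) = _
  ring

/-- The top order energy is controlled by the double divergence. -/
lemma neq_rmT : NEq (n := n) (m + 2)
    (ipJet m (fun G => gcov G (gcov G (rmT G))) (fun G => gcov G (gcov G (rmT G))))
    (fun G y => 4 * ipJet m ddRm ddRm G y) := by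
  have hD := (ctl_divRm (n := n)).gcov
  have hS := hD.relabC swapO_bijective
  have hZ := hD.sub hS
  have hB := (ctl_rmT (n := n)).gcov.divT
  have n1 := neq_hess (m := m) (ctl_rmT (n := n))
  have n2 := (neq_ipJet_left (m := m) box_rmT hB (by norm_num) (by norm_num) (by norm_num)
    (by norm_num)).trans (neq_ipJet_right (m := m) box_rmT hZ (by norm_num) (by norm_num)
    (by norm_num) (by norm_num))
  -- Expansion of the square of `∇D - swap ∇D` with `D = divRm`: the two square terms agree, and the
  -- cross term will turn out to be negligible. With the factor `2` of `neq_divRm` this gives the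
  -- factor `4`.
  have n3 : NEq (n := n) (m + 2) (ipJet m
      (fun G y => gcov G (divRm G) y - relabC swapO (gcov G (divRm G) y))
      (fun G y => gcov G (divRm G) y - relabC swapO (gcov G (divRm G) y)))
      (fun G y => 2 * ipJet m (fun G => gcov G (divRm G)) (fun G => gcov G (divRm G)) G y
        + -2 * ipJet m (fun G => gcov G (divRm G))
          (fun G y => relabC swapO (gcov G (divRm G) y)) G y) := by
    refine NEq.of_eq n2.right (((isNatCont_ipJet m hD.1 hD.1).smul 2).add
      ((isNatCont_ipJet m hD.1 hS.1).smul (-2))) fun G U hG y hy => ?_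
    rw [ipJet_sub_left m hD.1 hS.1 G U hG y hy, ipJet_sub_right m hD.1 hS.1 G U hG y hy,
      ipJet_sub_right m hD.1 hS.1 G U hG y hy, ipJet_relabC m swapO_bijective,
      ipJet_symm m (X := fun G y => relabC swapO (gcov G (divRm G) y)) G U hG y hy]
    ring
  have n4 := neq_ibp (m := m) (ctl_divRm (n := n)) hS (by norm_num) (by norm_num)
    (by norm_num) (by norm_num) (by norm_num)
  -- After integration by parts the cross term pairs `D` with `div (swap ∇D)`. This is `∇ (div D)`
  -- modulo lower order, and `div D` is itself of lower order.
  have hE : Ctl (n := n) 5 1 (fun G => divT G (fun y => relabC swapO (gcov G (divRm G) y))) :=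
    CEq.zero_iff.1 ((divT_swap_ceq (ctl_divRm (n := n))).trans
      (CEq.zero_iff.2 (ctl_divT_divRm (n := n)).gcov))
  have n5 : NEq (n := n) (m + 2) _ _ := NEq.of_negl (negl_ipJet (q := m + 2) (m := m)
    (ctl_divRm (n := n)) hE (by omega) (by omega) (by omega) (by omega))
  have n6 := n3.trans ((neq_divRm.smul 2).add ((n4.trans (n5.smul (-1))).smul (-2)))
  have n7 := (n1.trans n2).trans n6
  refine n7.trans (NEq.of_eq n7.right ((isNatCont_ipJet m ctl_ddRm.1 ctl_ddRm.1).smul 4)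
    fun G U hG y hy => ?_)
  ring

/-! ### The scalar curvature -/

lemma scal_eq (G : CMetric n) : scal G = fun y => trcC (G y)⁻¹ (trcC (G y)⁻¹
    (relabC (perm4 (some (some none)) none (some (some (some none))) (some none)) (rmT G y))) := by
  funext y c
  have h : ∀ i j k l, oc i (oc j (oc k (oc l c))) = oc4 i j k l := fun i j k l => by
    rw [Subsingleton.elim c Fin.elim0]
  simp only [scal, trcC, relabC, h, oc4_comp_perm4, oc_none, oc_some, rmT_apply, Finset.mul_sum,
    mul_assoc]
  exact Finset.sum_congr rfl fun a _ => Finset.sum_comm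

lemma ctl_scal : Ctl (n := n) 2 0 scal := by
  have := (((ctl_rmT (n := n)).relabC (f := perm4 (some (some none)) none
    (some (some (some none))) (some none)) (by decide)).trcC).trcC
  rwa [← funext scal_eq] at this

/-- The Laplacian of the scalar curvature. -/
def boxScal (G : CMetric n) : TField n (Fin 0) := divT G (gcov G (scal G))

lemma ctl_boxScal : Ctl (n := n) 4 2 boxScal := ctl_scal.gcov.divT

lemma gcov_scal {G : CMetric n} {U : Set (Coord n)} (hG : RiemOn G U) {y : Coord n} (hy : y ∈ U)
    (i : Fin n) : gcov G (scal G) y (oc i Fin.elim0) = ∑ a, ∑ b, ∑ c, ∑ d, (G y)⁻¹ a b *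
      ((G y)⁻¹ c d * gcov G (rmT G) y (oc i (oc4 a c b d))) := by
  set f : Four → Four := perm4 (some (some none)) none (some (some (some none))) (some none) with hf
  have hb : Bijective f := by rw [hf]; decide
  have hP := (ctl_rmT (n := n)).1.relabC hb
  have e1 : gcov G (fun z => trcC (G z)⁻¹ (trcC (G z)⁻¹ (relabC f (rmT G z)))) y
      = trcC (G y)⁻¹ (relabC rot3 (gcov G (fun z => trcC (G z)⁻¹ (relabC f (rmT G z))) y)) :=
    gcov_trcC hG hy (hP.trcC.diffAt hG hy)
  have e2 : gcov G (fun z => trcC (G z)⁻¹ (relabC f (rmT G z))) y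
      = trcC (G y)⁻¹ (relabC rot3 (gcov G (fun z => relabC f (rmT G z)) y)) :=
    gcov_trcC hG hy (hP.diffAt hG hy)
  rw [scal_eq, ← hf, e1, e2, gcov_relabC G hb]
  simp only [trcC, relabC, oc_comp_rot3, oc_comp_map, hf, oc4_comp_perm4, oc_none, oc_some,
    Finset.mul_sum]

/-- The contracted Bianchi identity. -/
lemma contracted_bianchi {G : CMetric n} {U : Set (Coord n)} (hG : RiemOn G U) {y : Coord n}
    (hy : y ∈ U) : gcov G (scal G) y
      = (2 : ℝ) • trcC (G y)⁻¹ (relabC rot3 (divRm' G y)) := by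
  funext c
  obtain ⟨i, c, rfl⟩ : ∃ i d, c = oc i d := ⟨c none, c ∘ some, (oc_eta c).symm⟩
  rw [Subsingleton.elim c Fin.elim0, gcov_scal hG hy]
  have hs : ∀ a b, (G y)⁻¹ a b = (G y)⁻¹ b a := fun a b =>
    (congrFun (congrFun (hG.inv_transpose hy) a) b).symm
  set F : Fin n → Fin n → Fin n → Fin n → ℝ := fun a b c d => (G y)⁻¹ a b *
      ((G y)⁻¹ c d * gcov G (rmT G) y (oc c (oc4 d a i b))) with hF
  have hv : trcC (G y)⁻¹ (relabC rot3 (divRm' G y)) (oc i Fin.elim0)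
      = ∑ a, ∑ b, ∑ c, ∑ d, F a b c d := by
    simp only [trcC, relabC, oc_comp_rot3, divRm', oc_comp_swapO, divRm, divT, Finset.mul_sum, hF]
  -- The second Bianchi identity in `i`, `a`, `c` writes the derivative as a sum of two divergence
  -- terms. They have the same sum over all indices, which accounts for the factor `2`.
  have h2 : ∀ a b c d, (G y)⁻¹ a b * ((G y)⁻¹ c d * gcov G (rmT G) y (oc i (oc4 a c b d)))
      = F d c a b + F b a c d := by
    intro a b c d
    have b1 := gcov_rmT_bianchi hG hy i a c b d
    have p1 := gcov_rmT_pair hG hy a b d c i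
    have p2 := gcov_rmT_pair hG hy c b d i a
    have p3 := gcov_rmT_pair hG hy a b d i c
    have p4 := gcov_rmT_pair hG hy c d b i a
    have s1 := gcov_rmT_swap hG hy a i c b d
    have s2 := gcov_rmT_swap hG hy c d b i a
    have e : gcov G (rmT G) y (oc i (oc4 a c b d)) = gcov G (rmT G) y (oc a (oc4 b d i c))
        + gcov G (rmT G) y (oc c (oc4 d b i a)) := by linarith
    simp only [hF]
    rw [e, hs d c, hs b a]
    ring
  simp only [h2, Finset.sum_add_distrib, Pi.smul_apply, smul_eq_mul, hv]
  have h3 : ∑ a, ∑ b, ∑ c, ∑ d, F d c a b = ∑ a, ∑ b, ∑ c, ∑ d, F a b c d := by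
    rw [sum_pair_comm]
    rw [Finset.sum_comm]
  have h4 : ∑ a, ∑ b, ∑ c, ∑ d, F b a c d = ∑ a, ∑ b, ∑ c, ∑ d, F a b c d := Finset.sum_comm
  rw [h3, h4]
  ring

/-- The divergence of the contracted Bianchi identity, since the trace commutes with the outer
divergence. -/
lemma trcC_ddRm : REq (n := n) (fun G y => trcC (G y)⁻¹ (ddRm G y))
    (fun G y => (1 / 2 : ℝ) • boxScal G y) := by
  have hW := (ctl_divRm' (n := n)).1.relabC rot3_bijective
  have e1 : REq (n := n) (fun G y => (1 / 2 : ℝ) • gcov G (scal G) y)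
      (fun G y => trcC (G y)⁻¹ (relabC rot3 (divRm' G y))) := by
    intro G U hG y hy
    simp only [contracted_bianchi hG hy, smul_smul]
    norm_num
  refine REq.trans ?_ ((divT_smul (1 / 2) ctl_scal.1.gcov).symm.trans e1.divT).symm
  intro G U hG y hy
  have e2 : gcov G (fun y => trcC (G y)⁻¹ (relabC rot3 (divRm' G y))) y
      = trcC (G y)⁻¹ (relabC rot3 (gcov G (fun y => relabC rot3 (divRm' G y)) y)) :=
    gcov_trcC hG hy (hW.diffAt hG hy)
  funext c
  simp only [divT, e2, gcov_relabC G (rot3_bijective (ι := Fin 0)), ddRm]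
  simp only [trcC, relabC, oc_comp_rot3, oc_comp_map, Finset.mul_sum]
  rw [sum_pair_comm]
  exact Finset.sum_congr rfl fun a _ => Finset.sum_congr rfl fun b _ =>
    Finset.sum_congr rfl fun a' _ => Finset.sum_congr rfl fun b' _ => mul_left_comm _ _ _

/-- One integration by parts leads to `div ddRm`, which is of lower order (`ctl_divT_ddRm`). This is
why the coefficient `b` of the flow does not matter. -/
lemma neq_hessScal_ddRm : NEq (n := n) (m + 2)
    (ipJet m (fun G => gcov G (gcov G (scal G))) ddRm) (fun _ _ => 0) := by
  have n1 := neq_ibp (m := m) (ctl_scal (n := n)).gcov ctl_ddRm (by norm_num) (by norm_num)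
    (by norm_num) (by norm_num) (by norm_num)
  have n2 := NEq.of_negl (negl_ipJet (q := m + 2) (m := m) (ctl_scal (n := n)).gcov ctl_divT_ddRm
    (by omega) (by omega) (by omega) (by omega))
  simpa using n1.trans (n2.smul (-1))

lemma neq_metMul_ddRm : NEq (n := n) (m + 2)
    (ipJet m (fun G y => metMul (G y) (boxScal G y)) ddRm)
    (fun G y => 1 / 2 * ipJet m boxScal boxScal G y) := by
  refine NEq.of_eq (isNatCont_ipJet m ctl_boxScal.metMul.1 ctl_ddRm.1)
    ((isNatCont_ipJet m ctl_boxScal.1 ctl_boxScal.1).smul _) fun G U hG y hy => ?_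
  rw [ipJet_metMul m ctl_boxScal.1 ctl_ddRm.1 G U hG y hy,
    ipJet_congr m (fun _ _ _ _ _ => rfl) trcC_ddRm G U hG y hy,
    ipJet_smul_right m _ ctl_boxScal.1 G U hG y hy]

lemma ipJet_metMul_hess {G : CMetric n} {U : Set (Coord n)} (hG : RiemOn G U) {y : Coord n}
    (hy : y ∈ U) : ipJet m (fun G y => metMul (G y) (boxScal G y))
      (fun G => gcov G (gcov G (scal G))) G y = ipJet m boxScal boxScal G y :=
  ipJet_metMul m ctl_boxScal.1 ctl_scal.1.gcov.gcov G U hG y hy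

lemma ipJet_metMul_metMul {G : CMetric n} {U : Set (Coord n)} (hG : RiemOn G U) {y : Coord n}
    (hy : y ∈ U) : ipJet m (fun G y => metMul (G y) (boxScal G y))
      (fun G y => metMul (G y) (boxScal G y)) G y = n * ipJet m boxScal boxScal G y := by
  rw [ipJet_metMul m ctl_boxScal.1 ctl_boxScal.metMul.1 G U hG y hy,
    ← ipJet_smul_right m _ ctl_boxScal.1 G U hG y hy]
  refine ipJet_congr m (fun _ _ _ _ _ => rfl) (fun G U hG y hy => ?_) G U hG y hy
  funext c
  simp only [trcC, metMul_oc, Pi.smul_apply, smul_eq_mul, ← mul_assoc, ← Finset.sum_mul]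
  congr 1
  have h : ∀ a, ∑ b, (G y)⁻¹ a b * G y a b = 1 := by
    intro a
    have := congrFun (congrFun (Matrix.nonsing_inv_mul _ (hG.isUnit_det hy)) a) a
    rw [Matrix.mul_apply, Matrix.one_apply_eq] at this
    rw [← this]
    exact Finset.sum_congr rfl fun b _ => by rw [hG.symm hy a b]
  simp [h]

/-- The trace inequality for the double divergence. -/
lemma neq_trace (r : ℝ) : NEq (n := n) (m + 2)
    (ipJet m (fun G y => ddRm G y + r • (gcov G (gcov G (scal G)) y
        - metMul (G y) (boxScal G y)))
      (fun G y => ddRm G y + r • (gcov G (gcov G (scal G)) y - metMul (G y) (boxScal G y))))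
    (fun G y => ipJet m ddRm ddRm G y
      + (r ^ 2 * (n - 1) - r) * ipJet m boxScal boxScal G y) := by
  have hT := (ctl_ddRm (n := n)).1
  have hH := (ctl_scal (n := n)).1.gcov.gcov
  have hM := (ctl_boxScal (n := n)).metMul.1
  have hU := (hH.sub hM).smul r
  have n1 : NEq (n := n) (m + 2) (ipJet m (fun G y => ddRm G y + r • (gcov G (gcov G (scal G)) y
      - metMul (G y) (boxScal G y)))
      (fun G y => ddRm G y + r • (gcov G (gcov G (scal G)) y - metMul (G y) (boxScal G y))))
      (fun G y => (ipJet m ddRm ddRm G y + (2 * r) *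
        ipJet m (fun G => gcov G (gcov G (scal G))) ddRm G y) + ((-2 * r) *
        ipJet m (fun G y => metMul (G y) (boxScal G y)) ddRm G y + (r ^ 2 *
        ipJet m (fun G => gcov G (gcov G (scal G))) (fun G => gcov G (gcov G (scal G))) G y
        + r ^ 2 * (n - 2) * ipJet m boxScal boxScal G y)) ) := by
    refine NEq.of_eq (isNatCont_ipJet m (hT.add hU) (hT.add hU))
      (((isNatCont_ipJet m hT hT).add ((isNatCont_ipJet m hH hT).smul _)).add
      (((isNatCont_ipJet m hM hT).smul _).add (((isNatCont_ipJet m hH hH).smul _).add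
      ((isNatCont_ipJet m ctl_boxScal.1 ctl_boxScal.1).smul _)))) fun G U hG y hy => ?_
    rw [ipJet_add_left m hT hU G U hG y hy, ipJet_add_right m hT hU G U hG y hy,
      ipJet_add_right m hT hU G U hG y hy, ipJet_symm m (X := ddRm) (Y := fun G y => r • _) G U hG y hy,
      ipJet_smul_left m r (hH.sub hM) G U hG y hy, ipJet_smul_left m r (hH.sub hM) G U hG y hy,
      ipJet_smul_right m r (hH.sub hM) G U hG y hy, ipJet_sub_left m hH hM G U hG y hy,
      ipJet_sub_left m hH hM G U hG y hy, ipJet_sub_right m hH hM G U hG y hy,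
      ipJet_sub_right m hH hM G U hG y hy, ipJet_metMul_metMul hG hy, ipJet_metMul_hess hG hy,
      ipJet_symm m (X := fun G => gcov G (gcov G (scal G)))
        (Y := fun G y => metMul (G y) (boxScal G y)) G U hG y hy, ipJet_metMul_hess hG hy]
    ring
  have hc := isNatCont_ipJet m (ctl_boxScal (n := n)).1 ctl_boxScal.1
  have hd := isNatCont_ipJet m hT hT
  -- The Hessian is orthogonal to `ddRm` modulo negligible terms, the metric term pairs with `ddRm`
  -- to give half the square of `boxScal`, and `neq_hess` replaces the square of the Hessian by that
  -- of `boxScal`, which turns `n - 2` into `n - 1`.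
  have n2 := ((NEq.of_eq (q := m + 2) hd hd fun _ _ _ _ _ => rfl).add
    (neq_hessScal_ddRm.smul (2 * r))).add ((neq_metMul_ddRm.smul (-2 * r)).add
    (((neq_hess ctl_scal).smul (r ^ 2)).add ((NEq.of_eq (q := m + 2) hc hc
      fun _ _ _ _ _ => rfl).smul (r ^ 2 * (n - 2)))))
  have n3 := n1.trans n2
  refine n3.trans (NEq.of_eq n3.right (hd.add (hc.smul _)) fun G U hG y hy => ?_)
  change _ + _ * 0 + (_ * (1 / 2 * _) + (_ * ipJet m boxScal boxScal G y + _)) = _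
  ring

end Coercivity

/-! ### The linearized flow and the dissipation inequality -/

section Dissipation

open Function Matrix

variable {n : ℕ} {ι κ : Type} [Fintype ι] [DecidableEq ι] [Fintype κ] [DecidableEq κ] {m : ℕ}

/-! ### The flow operator -/

/-- The tensor `P(g)`. -/
def flowT (P : FlowOperator) (G : CMetric n) : TField n Two :=
  fun y c => P.eval G y (c none) (c (some none))

/-- The slots of a `2`-tensor. -/
def twoSlot : Fin 2 → Two := ![none, some none]

lemma twoSlot_bijective : Bijective twoSlot := by decide

lemma ctl_quad (L : List (ℝ × StarTerm)) : Ctl (n := n) 4 0 (fun G y (c : Two → Fin n) =>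
    (L.map fun q => q.1 * q.2.eval G y (c none) (c (some none))).sum) := by
  induction L with
  | nil => exact Ctl.zero
  | cons q L ih =>
    have h := ((Ctl.starT (n := n) q.2).relabC twoSlot_bijective).smul q.1
    exact h.add ih

lemma gcov_gcov_rmT (G : CMetric n) (y : Coord n) (a b i j k l : Fin n) :
    gcov G (gcov G (rmT G)) y (oc a (oc b (oc4 i j k l)))
      = iterCovDeriv G (riem G) 2 y ![a, b, i, j, k, l] := by
  set f : Fin 5 → Option Four := Option.map rmSlot ∘ finSuccEquiv 4 with hf
  have hb : Bijective f := (option_map_bijective rmSlot_bijective).comp (Equiv.bijective _)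
  have e1 : gcov G (rmT G) = fun z => relabC f (covDeriv G (riem G) z) := by
    funext z
    have : gcov G (rmT G) z = relabC (Option.map rmSlot) (gcov G (riem G) z) :=
      gcov_relabC G rmSlot_bijective _ z
    rw [this, gcov_eq_relabC_covDeriv]
    rfl
  rw [e1, gcov_oc, cov_relabC G hb, relabC]
  change _ = covDeriv G (covDeriv G (riem G)) y _
  rw [covDeriv_eq_cov]
  congr 1
  funext x
  fin_cases x <;> rfl

lemma gcov_gcov_scal (G : CMetric n) (y : Coord n) (i j : Fin n) :
    gcov G (gcov G (scal G)) y (oc i (oc j Fin.elim0)) = hessScal G y i j := by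
  have e1 : gcov G (scal G) = fun z => relabC (finSuccEquiv 0) (covDeriv G (scal G) z) := by
    funext z
    exact gcov_eq_relabC_covDeriv G (scal G) z
  rw [e1, gcov_oc, cov_relabC G (Equiv.bijective _), relabC]
  change _ = covDeriv G (covDeriv G (scal G)) y _
  rw [covDeriv_eq_cov]
  congr 1
  funext x
  fin_cases x
  rfl

/-- The free indices are transposed by the use of pair symmetry. The transposition is harmless, as
`ddRm` is symmetric modulo lower order. -/
lemma divDivRiem_eq {G : CMetric n} {U : Set (Coord n)} (hG : RiemOn G U) {y : Coord n}
    (hy : y ∈ U) (i j : Fin n) : divDivRiem G y i j = ddRm G y (oc j (oc i Fin.elim0)) := by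
  have hY := (ctl_rmT (n := n)).1.relabC (option_map_bijective swapO_bijective)
  have e0 : ddRm G = divT G (divT G fun y => relabC (Option.map swapO) (rmT G y)) := by
    rw [ddRm, divRm'_eq]
  have e1 : gcov G (gcov G (fun y => relabC (Option.map swapO) (rmT G y))) y
      = relabC (Option.map (Option.map (Option.map swapO))) (gcov G (gcov G (rmT G)) y) := by
    have : gcov G (fun y => relabC (Option.map swapO) (rmT G y))
        = fun y => relabC (Option.map (Option.map swapO)) (gcov G (rmT G) y) := by
      funext y; exact gcov_relabC G (option_map_bijective swapO_bijective) _ _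
    rw [this, gcov_relabC G (option_map_bijective (option_map_bijective swapO_bijective))]
  have e2 : ∀ a b i j k l, gcov G (gcov G (rmT G)) y (oc a (oc b (oc4 i j k l)))
      = gcov G (gcov G (rmT G)) y (oc a (oc b (oc4 k l i j))) := by
    intro a b i j k l
    have hp : Bijective (perm4 (some (some none)) (some (some (some none))) none (some none)) := by
      decide
    have h1 := congrFun (rmT_pair.gcov.gcov G U hG y hy) (oc a (oc b (oc4 i j k l)))
    have h2 : gcov G (fun y => relabC (perm4 (some (some none)) (some (some (some none))) none
        (some none)) (rmT G y)) = fun y => relabC (Option.map (perm4 (some (some none))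
        (some (some (some none))) none (some none))) (gcov G (rmT G) y) := by
      funext y; exact gcov_relabC G hp _ _
    simp only [h2, gcov_relabC G (option_map_bijective hp)] at h1
    simpa only [relabC, oc_comp_map, oc4_comp_perm4, oc_none, oc_some] using h1.symm
  rw [e0, divT_divT_apply hY hG hy, e1]
  simp only [relabC, oc_comp_map, oc_comp_swapO, divDivRiem, ← gcov_gcov_rmT]
  have h3 : ∀ a b a' b', (G y)⁻¹ a b * ((G y)⁻¹ a' b' *
      gcov G (gcov G (rmT G)) y (oc a (oc a' (oc4 b' j b i))))
      = (G y)⁻¹ b a * (G y)⁻¹ b' a' * gcov G (gcov G (rmT G)) y (oc a (oc a' (oc4 b i b' j))) := by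
    intro a b a' b'
    rw [e2 a a' b' j b i, ← congrFun (congrFun (hG.inv_transpose hy) a) b,
      ← congrFun (congrFun (hG.inv_transpose hy) a') b', Matrix.transpose_apply,
      Matrix.transpose_apply]
    ring
  refine Eq.symm ((Finset.sum_congr rfl fun a _ => Finset.sum_congr rfl fun b _ =>
    Finset.sum_congr rfl fun a' _ => Finset.sum_congr rfl fun b' _ => h3 a b a' b').trans ?_)
  rw [Finset.sum_comm]
  refine Finset.sum_congr rfl fun α _ => ?_
  rw [Finset.sum_congr rfl fun γ _ => Finset.sum_comm, Finset.sum_comm]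

lemma flowT_eq (P : FlowOperator) : REq (n := n) (flowT P) (fun G y =>
    ((relabC swapO (ddRm G y) + (-P.a) • metMul (G y) (boxScal G y))
      + P.b • gcov G (gcov G (scal G)) y) + fun c =>
        (P.quad.map fun q => q.1 * q.2.eval G y (c none) (c (some none))).sum) := by
  intro G U hG y hy
  funext c
  obtain ⟨i, j, rfl⟩ := exists_oc2 c
  simp only [flowT, FlowOperator.eval, Pi.add_apply, Pi.smul_apply, smul_eq_mul, relabC,
    oc_comp_swapO, metMul_oc, gcov_gcov_scal, oc_none, oc_some, divDivRiem_eq hG hy]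
  have : lapScal G y = -boxScal G y Fin.elim0 := by
    simp only [lapScal, boxScal, divT, trcC, gcov_gcov_scal]
  rw [this]
  ring

lemma ctl_flowT_main (P : FlowOperator) : Ctl (n := n) 4 2 (fun G y =>
    (relabC swapO (ddRm G y) + (-P.a) • metMul (G y) (boxScal G y))
      + P.b • gcov G (gcov G (scal G)) y) :=
  ((ctl_ddRm.relabC swapO_bijective).add (ctl_boxScal.metMul.smul (-P.a))).add
    (ctl_scal.gcov.gcov.smul P.b)

/-- Smoothness and covariance only concern Riemannian metrics and pass along `REq`. Locality is
required for arbitrary component functions `G`, so it is a separate hypothesis. -/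
lemma IsNat.of_rEq {F F' : CMetric n → TField n ι} (h : IsNat F') (e : REq F F')
    (hc : ∀ {G G' : CMetric n} {y : Coord n}, G =ᶠ[nhds y] G' → F G y = F G' y) : IsNat F where
  congr := hc
  smooth {𝒢 I U} hG c := (h.smooth hG c).congr fun p hp => by
    rw [e _ _ (hG.riemOn hp.1) p.2 hp.2]
  pull hφ hG z hz := by
    rw [e _ _ (hφ.riemOn hG) z hz, e _ _ hG _ (hφ.mapsTo hz), h.pull hφ hG z hz]

lemma isNat_flowT (P : FlowOperator) : IsNat (n := n) (flowT P) := by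
  refine ((ctl_flowT_main P).1.add (ctl_quad P.quad).1).of_rEq (flowT_eq P) fun {G G' y} e => ?_
  have h1 : ∀ q : StarTerm, ∀ i j, q.eval G y i j = q.eval G' y i j := fun q i j =>
    congrFun ((Ctl.starT q).1.congr e) ![i, j]
  have h2 := (IsNat.riem (n := n).iterCovDeriv 2).congr e
  have h3 := (ctl_scal (n := n).1.iterCovDeriv 2).congr e
  have h4 := e.eq_of_nhds
  funext c
  simp only [flowT, FlowOperator.eval, divDivRiem, lapScal, hessScal, h1, h2, h3, h4]

lemma ctl_flowT (P : FlowOperator) : Ctl (n := n) 4 2 (flowT P) :=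
  ((ctl_flowT_main P).add ((ctl_quad P.quad).mono (by norm_num))).congr (isNat_flowT P)
    (flowT_eq P).symm

/-- The linearization of the curvature tensor, modulo lower order terms. -/
def linRm (h : CMetric n → TField n Two) (G : CMetric n) : TField n Four := fun y =>
  (-1 / 2 : ℝ) • (((relabC (perm4 none (some (some none)) (some none) (some (some (some none))))
      (gcov G (gcov G (h G)) y)
    + relabC (perm4 (some none) (some (some (some none))) none (some (some none)))
      (gcov G (gcov G (h G)) y))
    - relabC (perm4 none (some (some (some none))) (some none) (some (some none)))
      (gcov G (gcov G (h G)) y))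
    - relabC (perm4 (some none) (some (some none)) none (some (some (some none))))
      (gcov G (gcov G (h G)) y))

lemma Ctl.linRm {h : CMetric n → TField n Two} {s ℓ : ℕ} (hh : Ctl s ℓ h) :
    Ctl (s + 2) (ℓ + 2) (linRm h) :=
  ((((hh.gcov.gcov.relabC (by decide)).add (hh.gcov.gcov.relabC (by decide))).sub
    (hh.gcov.gcov.relabC (by decide))).sub (hh.gcov.gcov.relabC (by decide))).smul (-1 / 2)

/-- By the symmetries of `Rm` the four terms of `linRm` contribute equally, so the factor is `4 *
(-1 / 2)`. Two integrations by parts move both derivatives from `h` to `Rm` and produce `ddRm`; the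
first must be `neq_ibp'` because `∇h` may have order three. -/
lemma neq_linRm {h : CMetric n → TField n Two} (hh : Ctl 4 2 h) :
    NEq (m + 2) (ipJet m rmT (linRm h)) (fun G y => -2 * ipJet m h ddRm G y) := by
  have hY := (ctl_rmT (n := n)).relabC (option_map_bijective swapO_bijective)
  have hD := hh.1.gcov.gcov
  have n1 := neq_ibp' (m := m) hh.gcov hY (by norm_num) (by norm_num) (by norm_num) (by norm_num)
    (by norm_num)
  simp only [← divRm'_eq] at n1
  have n2 := neq_ibp (m := m) hh ctl_divRm' (by norm_num) (by norm_num) (by norm_num) (by norm_num)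
    (by norm_num)
  have n3 := (n1.trans (n2.smul (-1))).smul (-2)
  have key : ∀ p : Four → Four, Bijective p → ∀ r : ℝ,
      REq (n := n) rmT (fun G y => r • relabC p (relabC (Option.map swapO) (rmT G y))) →
      ∀ G U, RiemOn G U → ∀ y ∈ U, ipJet m rmT (fun G y => relabC p (gcov G (gcov G (h G)) y)) G y
        = r * ipJet m (fun G => gcov G (gcov G (h G)))
          (fun G y => relabC (Option.map swapO) (rmT G y)) G y := by
    intro p hp r e G U hG y hy
    rw [ipJet_congr m e (fun _ _ _ _ _ => rfl) G U hG y hy,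
      ipJet_smul_left m r (hY.1.relabC hp) G U hG y hy, ipJet_relabC m hp,
      ipJet_symm m G U hG y hy]
  have f1 : REq (n := n) rmT (fun G y => (1 : ℝ) • relabC (perm4 none (some (some none))
      (some none) (some (some (some none)))) (relabC (Option.map swapO) (rmT G y))) := by
    intro G U hG y hy
    funext c
    obtain ⟨i, j, k, l, rfl⟩ := exists_oc4 c
    simp only [relabC, Pi.smul_apply, oc4_comp_perm4, oc_comp_map, oc_comp_swapO, oc_none, oc_some,
      one_smul]
  have f2 : REq (n := n) rmT (fun G y => (1 : ℝ) • relabC (perm4 (some none)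
      (some (some (some none))) none (some (some none))) (relabC (Option.map swapO) (rmT G y))) := by
    intro G U hG y hy
    funext c
    obtain ⟨i, j, k, l, rfl⟩ := exists_oc4 c
    simp only [relabC, Pi.smul_apply, oc4_comp_perm4, oc_comp_map, oc_comp_swapO, oc_none, oc_some,
      one_smul, rmT_apply]
    rw [riem_antisymm_left, riem_antisymm_right hG hy, neg_neg]
  have f3 : REq (n := n) rmT (fun G y => (-1 : ℝ) • relabC (perm4 none (some (some (some none)))
      (some none) (some (some none))) (relabC (Option.map swapO) (rmT G y))) := by
    intro G U hG y hy
    funext c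
    obtain ⟨i, j, k, l, rfl⟩ := exists_oc4 c
    simp only [relabC, Pi.smul_apply, oc4_comp_perm4, oc_comp_map, oc_comp_swapO, oc_none, oc_some,
      rmT_apply]
    rw [riem_antisymm_right hG hy]
    simp
  have f4 : REq (n := n) rmT (fun G y => (-1 : ℝ) • relabC (perm4 (some none) (some (some none))
      none (some (some (some none)))) (relabC (Option.map swapO) (rmT G y))) := by
    intro G U hG y hy
    funext c
    obtain ⟨i, j, k, l, rfl⟩ := exists_oc4 c
    simp only [relabC, Pi.smul_apply, oc4_comp_perm4, oc_comp_map, oc_comp_swapO, oc_none, oc_some,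
      rmT_apply]
    rw [riem_antisymm_left]
    simp
  have g1 : Bijective (perm4 none (some (some none)) (some none) (some (some (some none)))) := by
    decide
  have g2 : Bijective (perm4 (some none) (some (some (some none))) none (some (some none))) := by
    decide
  have g3 : Bijective (perm4 none (some (some (some none))) (some none) (some (some none))) := by
    decide
  have g4 : Bijective (perm4 (some none) (some (some none)) none (some (some (some none)))) := by
    decide
  refine NEq.trans (NEq.of_eq (isNatCont_ipJet m ctl_rmT.1 hh.linRm.1) n3.left
    fun G U hG y hy => ?_) (n3.trans (NEq.of_eq n3.right
      ((isNatCont_ipJet m hh.1 ctl_ddRm.1).smul (-2)) fun G U hG y hy => ?_))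
  · have h1 := ipJet_smul_right m (-1 / 2) (X := rmT) ((((hD.relabC g1).add (hD.relabC g2)).sub
      (hD.relabC g3)).sub (hD.relabC g4)) G U hG y hy
    have h2 := ipJet_sub_right m (X := rmT) (((hD.relabC g1).add (hD.relabC g2)).sub
      (hD.relabC g3)) (hD.relabC g4) G U hG y hy
    have h3 := ipJet_sub_right m (X := rmT) ((hD.relabC g1).add (hD.relabC g2))
      (hD.relabC g3) G U hG y hy
    have h4 := ipJet_add_right m (X := rmT) (hD.relabC g1) (hD.relabC g2) G U hG y hy
    refine h1.trans ?_
    rw [h2, h3, h4, key _ g1 _ f1 G U hG y hy, key _ g2 _ f2 G U hG y hy,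
      key _ g3 _ f3 G U hG y hy, key _ g4 _ f4 G U hG y hy]
    ring
  · change _ * (_ * (_ * ipJet m h ddRm G y)) = _
    ring

/-- The quadratic terms of `P` are of lower order, the Hessian term is orthogonal to `ddRm`, and the
metric term only sees the trace of `ddRm`. Since `ΔR = -boxScal`, pairing `P(g)` with `ddRm` gives
`|ddRm|² - (a / 2) |boxScal|²`, to be multiplied by `-2`. -/
lemma neq_flowT (P : FlowOperator) : NEq (n := n) (m + 2) (ipJet m rmT (linRm (flowT P)))
    (fun G y => -2 * ipJet m ddRm ddRm G y + P.a * ipJet m boxScal boxScal G y) := by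
  have hT := (ctl_ddRm (n := n)).1
  have hS := hT.relabC swapO_bijective
  have hH := (ctl_scal (n := n)).1.gcov.gcov
  have hM := (ctl_boxScal (n := n)).metMul.1
  have e1 : CEq (n := n) 4 0 (flowT P) (fun G y =>
      (relabC swapO (ddRm G y) + (-P.a) • metMul (G y) (boxScal G y))
        + P.b • gcov G (gcov G (scal G)) y) := by
    refine ⟨isNat_flowT P, (ctl_flowT_main P).1, (ctl_quad P.quad).congr
      ((isNat_flowT P).sub (ctl_flowT_main P).1) fun G U hG y hy => ?_⟩
    simp only [flowT_eq P G U hG y hy]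
    rw [add_sub_cancel_left]
  have n1 := neq_linRm (m := m) (ctl_flowT (n := n) P)
  have n2 := neq_ipJet_left (m := m) e1 (ctl_ddRm (n := n)) (by norm_num) (by norm_num)
    (by norm_num) (by norm_num)
  have n3 : NEq (n := n) (m + 2) (ipJet m (fun G y =>
      (relabC swapO (ddRm G y) + (-P.a) • metMul (G y) (boxScal G y))
        + P.b • gcov G (gcov G (scal G)) y) ddRm)
      (fun G y => (ipJet m (fun G y => relabC swapO (ddRm G y)) ddRm G y
        + -P.a * ipJet m (fun G y => metMul (G y) (boxScal G y)) ddRm G y)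
        + P.b * ipJet m (fun G => gcov G (gcov G (scal G))) ddRm G y) := by
    refine NEq.of_eq n2.right (((isNatCont_ipJet m hS hT).add ((isNatCont_ipJet m hM hT).smul _)).add
      ((isNatCont_ipJet m hH hT).smul _)) fun G U hG y hy => ?_
    rw [ipJet_add_left m (hS.add (hM.smul _)) (hH.smul _) G U hG y hy,
      ipJet_add_left m hS (hM.smul _) G U hG y hy, ipJet_smul_left m _ hM G U hG y hy,
      ipJet_smul_left m _ hH G U hG y hy]
  have n4 := neq_ipJet_left (m := m) (ddRm_symm (n := n)).symm ctl_ddRm (by norm_num) (by norm_num)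
    (by norm_num) (by norm_num)
  have n5 := n1.trans (((n2.trans n3).trans ((n4.add (neq_metMul_ddRm.smul (-P.a))).add
    (neq_hessScal_ddRm.smul P.b))).smul (-2))
  refine n5.trans (NEq.of_eq n5.right (((isNatCont_ipJet m hT hT).smul _).add
    ((isNatCont_ipJet m ctl_boxScal.1 ctl_boxScal.1).smul _)) fun G U hG y hy => ?_)
  ring

lemma ipJet_iterCovDeriv (m j : ℕ) (G : CMetric n) (y : Coord n) :
    ipJet m (fun G => iterCovDeriv G (riem G) j) (fun G => iterCovDeriv G (riem G) j) G y
      = ip (G y)⁻¹ (iterCovDeriv G (riem G) (j + m) y) (iterCovDeriv G (riem G) (j + m) y) := by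
  induction m generalizing j with
  | zero => rfl
  | succ m ih =>
    have e : (fun G : CMetric n => gcov G (iterCovDeriv G (riem G) j))
        = fun G y => relabC (finSuccEquiv (4 + j)) (iterCovDeriv G (riem G) (j + 1) y) := by
      funext G y; rw [gcov_eq_relabC_covDeriv]; rfl
    simp only [ipJet]
    rw [e]
    have h1 := ipJet_relabC m (finSuccEquiv (4 + j)).bijective (X := fun G : CMetric n =>
      iterCovDeriv G (riem G) (j + 1)) (Y := fun G => iterCovDeriv G (riem G) (j + 1)) G y
    refine h1.trans ((ih (j + 1)).trans ?_)
    rw [show j + 1 + m = j + (m + 1) by ring]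

lemma ipJet_rmT {G : CMetric n} {U : Set (Coord n)} (hG : RiemOn G U) {y : Coord n} (hy : y ∈ U)
    (m : ℕ) : ipJet m rmT rmT G y = rmN m G y ^ 2 := by
  have h1 := ipJet_relabC m rmSlot_bijective (X := riem (n := n)) (Y := riem) G y
  refine h1.trans ((ipJet_iterCovDeriv m 0 G y).trans ?_)
  rw [Nat.zero_add, rmN, nrm_sq (hG.inv_posDef hy)]

lemma NEq.bound {q : ℕ} {f f' : CMetric n → Coord n → ℝ} (h : NEq q f f') {ε : ℝ} (hε : 0 < ε) :
    ∃ C : ℝ, 0 ≤ C ∧ ∀ 𝓘 : CInt n,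
      |𝓘 f - 𝓘 f'| ≤ ε * 𝓘 (rmPow q q) + C * 𝓘 (rmPow q 0) := by
  obtain ⟨C, hC, hb⟩ := h.negl.bound ε hε
  exact ⟨C, hC, fun 𝓘 => by rw [← 𝓘.map_sub h.left h.right]; exact hb 𝓘⟩

/-- The dissipation inequality. -/
theorem exists_dissipation (hn : 2 ≤ n) (P : FlowOperator) (hP : P.a < 1 / (2 * ((n : ℝ) - 1)))
    (m : ℕ) : ∃ c : ℝ, 0 < c ∧ ∃ C : ℝ, 0 ≤ C ∧ ∀ 𝓘 : CInt n,
      𝓘 (ipJet m rmT (linRm (flowT P)))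
        ≤ -c * 𝓘 (rmPow (m + 2) (m + 2)) + C * 𝓘 (rmPow (m + 2) 0) := by
  have hN : (0 : ℝ) < n - 1 := by
    have : (2 : ℝ) ≤ n := by exact_mod_cast hn
    linarith
  -- The square of `boxScal` has nonnegative integral, so `a` may be replaced by its positive part.
  -- The hypothesis on `a` is what makes `c₀` positive.
  set α : ℝ := max P.a 0 with hα
  set c₀ : ℝ := 2 * (1 - 2 * (n - 1) * α) with hc₀
  have hc : 0 < c₀ := by
    have : α < 1 / (2 * (n - 1)) := max_lt hP (by positivity)
    rw [lt_div_iff₀ (by positivity)] at this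
    nlinarith
  have hα0 : 0 ≤ α := le_max_right _ _
  -- An upper bound for the total coefficient with which the errors of the three congruences enter.
  -- Allowing `c₀ / (8 * K)` in each costs at most `c₀ / 8` out of the available dissipation `c₀ /
  -- 4`.
  set K : ℝ := c₀ + 1 + 4 * (n - 1) * α with hK
  have hK0 : 0 < K := by positivity
  obtain ⟨C₁, hC₁, h₁⟩ := (neq_flowT (n := n) (m := m) P).bound
    (ε := c₀ / (8 * K)) (by positivity)
  obtain ⟨C₂, hC₂, h₂⟩ := (neq_rmT (n := n) (m := m)).bound (ε := c₀ / (8 * K)) (by positivity)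
  -- This value of `r` minimizes `r ^ 2 * (n - 1) - r`, and the minimum is `-1 / (4 * (n - 1))`.
  obtain ⟨C₃, hC₃, h₃⟩ := (neq_trace (n := n) (m := m) (1 / (2 * (n - 1)))).bound
    (ε := c₀ / (8 * K)) (by positivity)
  refine ⟨c₀ / 8, by positivity, K * (C₁ + C₂ + C₃), by positivity, fun 𝓘 => ?_⟩
  have k₁ := (abs_le.1 (h₁ 𝓘)).2
  have k₂ := (abs_le.1 (h₂ 𝓘)).2
  have k₃ := (abs_le.1 (h₃ 𝓘)).2
  have hT := (ctl_ddRm (n := n)).1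
  have hB := (ctl_boxScal (n := n)).1
  have hTT := isNatCont_ipJet m hT hT
  have hBB := isNatCont_ipJet m hB hB
  have hnn : ∀ {ι : Type} [Fintype ι] [DecidableEq ι] {X : CMetric n → TField n ι}, IsNat X →
      0 ≤ 𝓘 (ipJet m X X) := by
    intro ι _ _ X hX
    refine 𝓘.nonneg (isNatCont_ipJet m hX hX) ?_
    clear * -
    induction m generalizing ι with
    | zero => exact fun G U hG y hy => ip_self_nonneg (hG.inv_posDef hy) _
    | succ m ih => exact fun G U hG y hy => ih G U hG y hy
  have p₁ := hnn (hT.add ((((ctl_scal (n := n)).1.gcov.gcov).sub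
    (ctl_boxScal (n := n)).metMul.1).smul (1 / (2 * (n - 1)))))
  have p₂ := hnn hT
  have p₃ := hnn hB
  have e₂ : 𝓘 (ipJet m (fun G => gcov G (gcov G (rmT G))) (fun G => gcov G (gcov G (rmT G))))
      = 𝓘 (rmPow (m + 2) (m + 2)) := by
    refine 𝓘.map_congr (isNatCont_ipJet m ctl_rmT.1.gcov.gcov ctl_rmT.1.gcov.gcov)
      (IsNatCont.rmPow _ _) fun G U hG y hy => ?_
    rw [rmPow_self]
    exact ipJet_rmT hG hy (m + 2)
  rw [𝓘.map_add _ _ (hTT.smul _) (hBB.smul _), 𝓘.map_smul _ _ hTT, 𝓘.map_smul _ _ hBB] at k₁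
  rw [e₂, 𝓘.map_smul _ _ hTT] at k₂
  rw [𝓘.map_add _ _ hTT (hBB.smul _), 𝓘.map_smul _ _ hBB] at k₃
  have q₀ := 𝓘.rmPow_nonneg (m + 2) 0
  have q₁ := 𝓘.rmPow_nonneg (m + 2) (m + 2)
  generalize 𝓘 (ipJet m rmT (linRm (flowT P))) = w at *
  generalize 𝓘 (ipJet m ddRm ddRm) = t at *
  generalize 𝓘 (ipJet m boxScal boxScal) = b at *
  generalize 𝓘 (rmPow (m + 2) (m + 2)) = I at *
  generalize 𝓘 (rmPow (m + 2) 0) = J at *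
  generalize hη : c₀ / (8 * K) = η at *
  have hηK : K * η = c₀ / 8 := by rw [← hη]; field_simp
  have k₃' : b ≤ 4 * (n - 1) * (t + (η * I + C₃ * J)) := by
    have e : (1 / (2 * ((n : ℝ) - 1))) ^ 2 * (n - 1) - 1 / (2 * (n - 1)) = -(1 / (4 * (n - 1))) := by
      field_simp; ring
    rw [e] at k₃
    have h5 : 1 / (4 * ((n : ℝ) - 1)) * b ≤ t + (η * I + C₃ * J) := by linarith
    rw [one_div_mul_eq_div, div_le_iff₀ (by positivity)] at h5
    linarith
  have h6 : P.a * b ≤ α * (4 * (n - 1) * (t + (η * I + C₃ * J))) :=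
    (mul_le_mul_of_nonneg_right (le_max_left _ _) p₃).trans (mul_le_mul_of_nonneg_left k₃' hα0)
  have h7 : c₀ * (I - (η * I + C₂ * J)) ≤ c₀ * (4 * t) := mul_le_mul_of_nonneg_left (by linarith) hc.le
  have h8 : 0 ≤ 4 * (n - 1) * α := by positivity
  have h9 : w ≤ -c₀ * t + (η * I + C₁ * J) + 4 * (n - 1) * α * (η * I + C₃ * J) := by
    rw [hc₀]; linarith
  have r1 : 0 ≤ c₀ * (C₁ * J) := by positivity
  have r2 : 0 ≤ c₀ * (C₃ * J) := by positivity
  have r3 : 0 ≤ 4 * (n - 1) * α * (C₁ * J) := by positivity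
  have r4 : 0 ≤ 4 * (n - 1) * α * (C₂ * J) := by positivity
  have r5 : 0 ≤ C₂ * J := by positivity
  have r6 : 0 ≤ C₃ * J := by positivity
  have r7 : 0 ≤ c₀ * (C₂ * J) := by positivity
  have r8 : 0 ≤ c₀ * (η * I) := by rw [← hη]; positivity
  have h10 : w ≤ -(c₀ / 4) * I + K * (η * I + (C₁ + C₂ + C₃) * J) := by
    rw [hK]; nlinarith
  rw [mul_add, ← mul_assoc, hηK] at h10
  linarith

end Dissipation

/-! ### Variation of the connection and of covariant derivatives -/

section Evolution

open Function Matrix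

variable {n : ℕ} {ι κ : Type} [Fintype ι] [DecidableEq ι] [Fintype κ] [DecidableEq κ]

/-! ### Evolution of tensors along a flow of metrics -/

/-- The matrix of components of a `2`-tensor. -/
def matT (T : TField n Two) : CMetric n := fun y => Matrix.of fun i j => T y (oc i (oc j Fin.elim0))

/-- A smooth family of metrics on `U` that solves `∂_t g = h(g)`. -/
structure FlowOn (h : CMetric n → TField n Two) (𝒢 : ℝ → CMetric n) (I : Set ℝ)
    (U : Set (Coord n)) : Prop extends RiemFam 𝒢 I U where
  evol : ∀ t, I ∈ nhds t → ∀ y ∈ U, ∀ i j,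
    HasDerivAt (fun s => 𝒢 s y i j) (matT (h (𝒢 t)) y i j) t

/-- `F'(g)` is the derivative of `F(g)` along the solutions of `∂_t g = h(g)`. -/
def FlowDer (h : CMetric n → TField n Two) (F F' : CMetric n → TField n ι) : Prop :=
  ∀ 𝒢 I U, FlowOn h 𝒢 I U → ∀ t, I ∈ nhds t → ∀ y ∈ U, ∀ c,
    HasDerivAt (fun s => F (𝒢 s) y c) (F' (𝒢 t) y c) t

/-- `f'(g) √(det g)` is the derivative of `f(g) √(det g)` along the solutions of `∂_t g = h(g)`. -/
def FlowDens (h : CMetric n → TField n Two) (f f' : CMetric n → Coord n → ℝ) : Prop :=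
  ∀ 𝒢 I U, FlowOn h 𝒢 I U → ∀ t, I ∈ nhds t → ∀ y ∈ U,
    HasDerivAt (fun s => f (𝒢 s) y * Real.sqrt (𝒢 s y).det)
      (f' (𝒢 t) y * Real.sqrt (𝒢 t y).det) t

/-- Differentiation in time commutes with differentiation in space. -/
lemma hasDerivAt_partialDeriv {f : ℝ → Coord n → ℝ} {I : Set ℝ} {U : Set (Coord n)}
    (hU : IsOpen U) (hf : ContDiffOn ℝ ∞ (fun q : ℝ × Coord n => f q.1 q.2) (I ×ˢ U)) {t : ℝ}
    (ht : I ∈ nhds t) {y : Coord n} (hy : y ∈ U) {f' : Coord n → ℝ}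
    (h : ∀ z ∈ U, HasDerivAt (fun s => f s z) (f' z) t) (i : Fin n) :
    HasDerivAt (fun s => partialDeriv i (f s) y) (partialDeriv i f' y) t := by
  set F : ℝ × Coord n → ℝ := fun q => f q.1 q.2 with hF
  have hn : ∀ z ∈ U, I ×ˢ U ∈ nhds (t, z) := fun z hz => prod_mem_nhds ht (hU.mem_nhds hz)
  have hd : ContDiffAt ℝ ∞ F (t, y) := hf.contDiffAt (hn y hy)
  have hs : IsSymmSndFDerivAt ℝ F (t, y) := hd.isSymmSndFDerivAt (by
    simp only [minSmoothness_of_isRCLikeNormedField]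
    exact WithTop.coe_le_coe.2 (le_top (a := (2 : ℕ∞))))
  have hdf : DifferentiableAt ℝ (fderiv ℝ F) (t, y) :=
    (hd.fderiv_right (m := ∞) (by simp)).differentiableAt (by simp)
  have hdF : ∀ q ∈ interior I ×ˢ U, HasFDerivAt F (fderiv ℝ F q) q := fun q hq =>
    ((hf.contDiffAt (prod_mem_nhds (mem_interior_iff_mem_nhds.1 hq.1)
      (hU.mem_nhds hq.2))).differentiableAt (by simp)).hasFDerivAt
  have e1 : ∀ᶠ s in nhds t, partialDeriv i (f s) y
      = fderiv ℝ F (s, y) (0, EuclideanSpace.single i 1) := by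
    filter_upwards [interior_mem_nhds.2 ht] with s hs
    have := (hdF (s, y) ⟨hs, hy⟩).comp y (hasFDerivAt_prodMk_right s y)
    have e : (F ∘ fun z => (s, z)) = f s := rfl
    rw [e] at this
    rw [partialDeriv, this.fderiv]
    simp
  have e2 : ∀ᶠ z in nhds y, f' z = fderiv ℝ F (t, z) (1, 0) := by
    filter_upwards [hU.mem_nhds hy] with z hz
    have := ((hdF (t, z) ⟨mem_interior_iff_mem_nhds.2 ht, hz⟩).comp_hasDerivAt t
      ((hasDerivAt_id t).prodMk (hasDerivAt_const t z)))
    exact (h z hz).unique this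
  have h1 : HasDerivAt (fun s => fderiv ℝ F (s, y) (0, EuclideanSpace.single i 1))
      (fderiv ℝ (fderiv ℝ F) (t, y) (1, 0) (0, EuclideanSpace.single i 1)) t := by
    have := hdf.hasFDerivAt.comp_hasDerivAt t ((hasDerivAt_id t).prodMk (hasDerivAt_const t y))
    exact this.clm_apply (hasDerivAt_const t _) |>.congr_deriv (by simp)
  have h2 : partialDeriv i f' y
      = fderiv ℝ (fderiv ℝ F) (t, y) (0, EuclideanSpace.single i 1) (1, 0) := by
    rw [Filter.EventuallyEq.partialDeriv_eq e2, partialDeriv]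
    have h3 := hdf.hasFDerivAt.comp y (hasFDerivAt_prodMk_right t y)
    have h4 := h3.clm_apply (hasFDerivAt_const ((1, 0) : ℝ × Coord n) y)
    have h5 := h4.fderiv
    simp only [Function.comp_apply] at h5
    rw [h5]
    simp
  rw [h2, ← hs.eq]
  exact h1.congr_of_eventuallyEq e1

lemma der_two (A : Mat n) (t : Comp n Two) (i j : Fin n) :
    der A t (oc i (oc j Fin.elim0)) = ∑ a, A a i * t (oc a (oc j Fin.elim0))
      + ∑ a, A a j * t (oc i (oc a Fin.elim0)) := by
  rw [der_oc, der_oc]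
  simp [der]

/-- The substitution of slots of a `3`-tensor. -/
def perm3 (a b c : Option Two) : Option Two → Option Two
  | none => a
  | some none => b
  | some (some none) => c

lemma oc_comp_perm3 (x : Option Two → Fin n) (a b c : Option Two) :
    x ∘ perm3 a b c = oc (x a) (oc (x b) (oc (x c) Fin.elim0)) := by
  funext o; rcases o with (_ | _ | _ | x) <;> first | rfl | exact x.elim0

/-- The derivative of the Christoffel symbols (with lower indices `k b i`) when the derivative of
the metric is `T`. -/
def kosz (G : CMetric n) (T : TField n Two) : TField n (Option Two) := fun y =>
  (1 / 2 : ℝ) • ((relabC (perm3 (some (some none)) (some none) none) (gcov G T y)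
    + relabC (perm3 (some none) (some (some none)) none) (gcov G T y))
    - relabC (perm3 none (some (some none)) (some none)) (gcov G T y))

lemma kosz_apply (G : CMetric n) (T : TField n Two) (y : Coord n) (k b i : Fin n) :
    kosz G T y (oc k (oc b (oc i Fin.elim0)))
      = 1 / 2 * (gcov G T y (oc i (oc b (oc k Fin.elim0)))
        + gcov G T y (oc b (oc i (oc k Fin.elim0))) - gcov G T y (oc k (oc i (oc b Fin.elim0)))) := by
  simp only [kosz, Pi.smul_apply, Pi.sub_apply, Pi.add_apply, relabC, oc_comp_perm3, oc_none,
    oc_some, smul_eq_mul]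

lemma Ctl.kosz {h : CMetric n → TField n Two} {s ℓ : ℕ} (hh : Ctl s ℓ h) :
    Ctl (s + 1) (ℓ + 1) (fun G => kosz G (h G)) :=
  (((hh.gcov.relabC (by decide)).add (hh.gcov.relabC (by decide))).sub
    (hh.gcov.relabC (by decide))).smul (1 / 2)

/-- The components of `kosz` as matrices. -/
def koszM (G : CMetric n) (T : TField n Two) (i : Fin n) (y : Coord n) : Mat n :=
  Matrix.of fun k b => kosz G T y (oc k (oc b (oc i Fin.elim0)))

/-- Replacing partial by covariant derivatives in the Koszul combination introduces six connection
terms. By symmetry of `T` and of the Christoffel symbols four cancel, and the other two merge into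
the subtracted product. -/
lemma chrL_sub_eq {G : CMetric n} {U : Set (Coord n)} (hG : RiemOn G U) {T : TField n Two}
    (hs : ∀ z ∈ U, ∀ i j, matT T z i j = matT T z j i) {y : Coord n} (hy : y ∈ U) (i : Fin n) :
    chrL (matT T) i y - matT T y * chrM G i y = koszM G T i y := by
  ext k b
  have hs' : ∀ i j, T y (oc i (oc j Fin.elim0)) = T y (oc j (oc i Fin.elim0)) := hs y hy
  have hsy : ∀ l i j, partialDeriv l (fun z => T z (oc i (oc j Fin.elim0))) y
      = partialDeriv l (fun z => T z (oc j (oc i Fin.elim0))) y := fun l i j =>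
    Filter.EventuallyEq.partialDeriv_eq ((hG.eventually_mem hy).mono fun z hz => hs z hz i j) l
  simp only [koszM, kosz_apply, gcov_oc, cov, Pi.sub_apply, pd, der_two, chrL, matT,
    Matrix.of_apply, Matrix.sub_apply, Matrix.mul_apply, chrM]
  have hc : ∀ a p q, christoffel G a p q y = christoffel G a q p y := hG.christoffel_symm hy
  have e1 : ∀ p q r, ∑ a, christoffel G a p q y * T y (oc r (oc a Fin.elim0))
      = ∑ a, christoffel G a p q y * T y (oc a (oc r Fin.elim0)) := fun p q r =>
    Finset.sum_congr rfl fun a _ => by rw [hs']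
  have e2 : ∀ p q r, ∑ a, T y (oc r (oc a Fin.elim0)) * christoffel G a p q y
      = ∑ a, christoffel G a p q y * T y (oc a (oc r Fin.elim0)) := fun p q r =>
    Finset.sum_congr rfl fun a _ => by rw [hs', mul_comm]
  have e3 : ∀ p q r, ∑ a, christoffel G a p q y * T y (oc a (oc r Fin.elim0))
      = ∑ a, christoffel G a q p y * T y (oc a (oc r Fin.elim0)) := fun p q r =>
    Finset.sum_congr rfl fun a _ => by rw [hc]
  rw [e1, e1, e1, e2, e3 b i k, e3 k i b, e3 k b i]
  ring

section Flow

variable {h : CMetric n → TField n Two} {𝒢 : ℝ → CMetric n} {I : Set ℝ} {U : Set (Coord n)}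
  {t : ℝ} {y : Coord n}

/-- Symmetry of `h` is not part of the assumptions; along a flow it is inherited from the metrics.
-/
lemma FlowOn.symm (hF : FlowOn h 𝒢 I U) (ht : I ∈ nhds t) (hy : y ∈ U) (i j : Fin n) :
    matT (h (𝒢 t)) y i j = matT (h (𝒢 t)) y j i := by
  refine (hF.evol t ht y hy i j).unique ((hF.evol t ht y hy j i).congr_of_eventuallyEq ?_)
  filter_upwards [ht] with s hs using (hF.riemOn hs).symm hy i j

lemma FlowOn.hasDerivAt_inv (hF : FlowOn h 𝒢 I U) (ht : I ∈ nhds t) (hy : y ∈ U) (i j : Fin n) :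
    HasDerivAt (fun s => (𝒢 s y)⁻¹ i j)
      ((-((𝒢 t y)⁻¹ * matT (h (𝒢 t)) y * (𝒢 t y)⁻¹)) i j) t :=
  CurvatureFlow.hasDerivAt_inv (A := fun s => 𝒢 s y) (hF.evol t ht y hy)
    (hF.posDef t (mem_of_mem_nhds ht) y hy).det_pos.ne' i j

lemma FlowOn.hasDerivAt_chrM (hF : FlowOn h 𝒢 I U) (ht : I ∈ nhds t) (hy : y ∈ U)
    (i a b : Fin n) :
    HasDerivAt (fun s => chrM (𝒢 s) i y a b)
      (((𝒢 t y)⁻¹ * koszM (𝒢 t) (h (𝒢 t)) i y) a b) t := by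
  have hG := hF.riemOn (mem_of_mem_nhds ht)
  have hp := fun l i j => hasDerivAt_partialDeriv (f := fun s z => 𝒢 s z i j) hF.isOpen
    (hF.smooth i j) ht hy (f' := fun z => matT (h (𝒢 t)) z i j)
    (fun z hz => hF.evol t ht z hz i j) l
  have hL : ∀ a b, HasDerivAt (fun s => chrL (𝒢 s) i y a b) (chrL (matT (h (𝒢 t))) i y a b) t :=
    fun a b => (((hp i b a).add (hp b i a)).sub (hp a i b)).const_mul (1 / 2)
  have h1 := HasDerivAt.fun_sum (u := Finset.univ) fun k _ =>
    (hF.hasDerivAt_inv ht hy a k).fun_mul (hL k b)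
  simp only [chrM_eq, Matrix.mul_apply (M := (𝒢 _ y)⁻¹)]
  refine h1.congr_deriv ?_
  rw [Finset.sum_add_distrib, ← Matrix.mul_apply, ← Matrix.mul_apply, ← Matrix.mul_apply,
    ← Matrix.add_apply, ← chrL_sub_eq hG (fun z hz => hF.symm ht hz) hy, Matrix.mul_sub,
    chrM_eq, Matrix.neg_mul, Matrix.mul_assoc, Matrix.mul_assoc, neg_add_eq_sub]

end Flow

/-- The action of `kosz` on a tensor. -/
def derK (h : CMetric n → TField n Two) (F : CMetric n → TField n ι) (G : CMetric n) :
    TField n (Option ι) := fun y =>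
  relabC (Sum.elim (fun o : Option (Fin 0) => o.elim none Fin.elim0) some)
    (derC (G y)⁻¹ (kosz G (h G) y) (F G y))

omit [Fintype ι] [DecidableEq ι] in
lemma derK_slot_bijective : Bijective
    (Sum.elim (fun o : Option (Fin 0) => o.elim none Fin.elim0) some : _ → Option ι) := by
  constructor
  · rintro ((_ | x) | a) ((_ | y) | b) h <;> first | rfl | exact x.elim0 | exact y.elim0 | simp_all
  · rintro (_ | a)
    exacts [⟨Sum.inl none, rfl⟩, ⟨Sum.inr a, rfl⟩]

lemma derK_oc (h : CMetric n → TField n Two) (F : CMetric n → TField n ι) (G : CMetric n)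
    (y : Coord n) (i : Fin n) (c : ι → Fin n) :
    derK h F G y (oc i c) = der ((G y)⁻¹ * koszM G (h G) i y) (F G y) c := by
  have e : (oc i c ∘ Sum.elim (fun o : Option (Fin 0) => o.elim none Fin.elim0) some) ∘ Sum.inl
      = oc i Fin.elim0 := by
    funext o; rcases o with (_ | x)
    exacts [rfl, x.elim0]
  simp only [derK, relabC, derC, e]
  rfl

lemma Ctl.derK {h : CMetric n → TField n Two} {F : CMetric n → TField n ι} {s ℓ s' ℓ' : ℕ}
    (hh : Ctl s ℓ h) (hF : Ctl s' ℓ' F) : Ctl (s + 1 + s') (max (ℓ + 1) ℓ') (derK h F) :=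
  (hh.kosz.derC hF).relabC derK_slot_bijective

/-- Time and space derivatives commute, so the only extra term comes from the variation of the
Christoffel symbols, which is the tensor `kosz` with an index raised. -/
lemma FlowDer.gcov {h : CMetric n → TField n Two} {F F' : CMetric n → TField n ι} (hF : IsNat F)
    (hd : FlowDer h F F') :
    FlowDer h (fun G => gcov G (F G)) (fun G y => gcov G (F' G) y - derK h F G y) := by
  intro 𝒢 I U hG t ht y hy c
  obtain ⟨i, c, rfl⟩ : ∃ i d, c = oc i d := ⟨c none, c ∘ some, (oc_eta c).symm⟩
  have h1 := hasDerivAt_partialDeriv (f := fun s z => F (𝒢 s) z c) hG.isOpen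
    (hF.smooth hG.toRiemFam c) ht hy (fun z hz => hd 𝒢 I U hG t ht z hz c) i
  have h2 := HasDerivAt.fun_sum (u := Finset.univ) fun l _ =>
    HasDerivAt.fun_sum (u := Finset.univ) fun a _ =>
      (hG.hasDerivAt_chrM ht hy i a (c l)).fun_mul (hd 𝒢 I U hG t ht y hy (update c l a))
  refine (h1.sub h2).congr_deriv ?_
  simp only [Pi.sub_apply, gcov_oc, derK_oc, cov, pd, der, Finset.sum_add_distrib]
  ring

end Evolution

/-! ### Variation of the curvature and of the energy densities -/

section Evolution

open Function Matrix

variable {n : ℕ} {ι κ : Type} [Fintype ι] [DecidableEq ι] [Fintype κ] [DecidableEq κ]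

/-! ### Evolution of the curvature tensor -/

lemma gcov_koszM (G : CMetric n) (h : CMetric n → TField n Two) (y : Coord n) (i j k l : Fin n) :
    gcov G (kosz G (h G)) y (oc i (oc k (oc l (oc j Fin.elim0))))
      = (pdM i (koszM G (h G) j) y - (chrM G i y)ᵀ * koszM G (h G) j y
          - koszM G (h G) j y * chrM G i y) k l
        - ∑ p, christoffel G p i j y * koszM G (h G) p y k l := by
  have h0 : ∀ (A : Mat n) (t : Comp n (Fin 0)), der A t Fin.elim0 = 0 := fun A t => by simp [der]
  simp only [gcov_oc, cov, Pi.sub_apply, pd, der_oc, h0, pdM, koszM, Matrix.of_apply,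
    Matrix.sub_apply, Matrix.mul_apply, Matrix.transpose_apply, chrM]
  simp only [mul_comm (kosz G (h G) y _)]
  ring

lemma gcov_sub {X Y : CMetric n → TField n ι} (hX : IsNat X) (hY : IsNat Y) :
    REq (fun G => gcov G (fun y => X G y - Y G y)) (fun G y => gcov G (X G) y - gcov G (Y G) y) := by
  intro G U hG y hy
  have e1 := gcov_add G (hX.diffAt hG hy) ((hY.smul (-1)).diffAt hG hy)
  rw [gcov_smul G (-1) (hY.diffAt hG hy)] at e1
  simpa only [neg_smul, one_smul, ← sub_eq_add_neg] using e1

lemma gcov_kosz {G : CMetric n} {U : Set (Coord n)} (hG : RiemOn G U)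
    {h : CMetric n → TField n Two} (hh : IsNat h) {y : Coord n} (hy : y ∈ U) (a k b i : Fin n) :
    gcov G (kosz G (h G)) y (oc a (oc k (oc b (oc i Fin.elim0))))
      = 1 / 2 * (gcov G (gcov G (h G)) y (oc4 a i b k)
        + gcov G (gcov G (h G)) y (oc4 a b i k) - gcov G (gcov G (h G)) y (oc4 a k i b)) := by
  have hD := hh.gcov
  have b1 : Bijective (perm3 (some (some none)) (some none) none) := by decide
  have b2 : Bijective (perm3 (some none) (some (some none)) none) := by decide
  have b3 : Bijective (perm3 none (some (some none)) (some none)) := by decide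
  have h1 := gcov_smul G (1 / 2) ((((hD.relabC b1).add (hD.relabC b2)).sub
    (hD.relabC b3)).diffAt hG hy)
  have h2 := gcov_sub ((hD.relabC b1).add (hD.relabC b2)) (hD.relabC b3) G U hG y hy
  have h3 := gcov_add G ((hD.relabC b1).diffAt hG hy) ((hD.relabC b2).diffAt hG hy)
  have e : gcov G (kosz G (h G)) y = _ := h1
  beta_reduce at h2
  rw [e, h2, h3, gcov_relabC G b1, gcov_relabC G b2, gcov_relabC G b3]
  simp only [Pi.smul_apply, Pi.sub_apply, Pi.add_apply, relabC, oc_comp_map, oc_comp_perm3, oc_none,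
    oc_some, smul_eq_mul]

/-- The slots of `h_{kp} Rm_{ijql}`, with `p` and `q` in front. -/
def mulRmSlot : Two ⊕ Four → Option (Option Four)
  | .inl none => some (some (some (some none)))
  | .inl (some none) => none
  | .inr none => some (some none)
  | .inr (some none) => some (some (some none))
  | .inr (some (some none)) => some none
  | .inr (some (some (some none))) => some (some (some (some (some none))))

lemma mulRmSlot_bijective : Bijective mulRmSlot := by
  constructor
  · rintro ((_ | _ | x) | (_ | _ | _ | _ | x)) ((_ | _ | y) | (_ | _ | _ | _ | y)) h <;>
      first | rfl | exact x.elim0 | exact y.elim0 | cases h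
  · rintro (_ | _ | _ | _ | _ | _ | x)
    exacts [⟨.inl (some none), rfl⟩, ⟨.inr (some (some none)), rfl⟩, ⟨.inr none, rfl⟩,
      ⟨.inr (some none), rfl⟩, ⟨.inl none, rfl⟩, ⟨.inr (some (some (some none))), rfl⟩, x.elim0]

/-- The lower order terms in the evolution of the curvature tensor. -/
def lowRm (h : CMetric n → TField n Two) (G : CMetric n) : TField n Four := fun y =>
  trcC (G y)⁻¹ (relabC mulRmSlot (mulC (h G y) (rmT G y)))
    + (1 / 2 : ℝ) • relabC (perm4 none (some none) (some (some (some none))) (some (some none)))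
      (comm G (h G) y)

lemma ctl_lowRm {h : CMetric n → TField n Two} (hh : Ctl 4 2 h) : Ctl 6 2 (lowRm h) :=
  (((hh.mulC ctl_rmT).relabC mulRmSlot_bijective).trcC).add ((hh.comm.relabC (by decide)).smul _)

lemma lowRm_apply {G : CMetric n} {U : Set (Coord n)} (hG : RiemOn G U) {y : Coord n} (hy : y ∈ U)
    (h : CMetric n → TField n Two) (i j k l : Fin n) :
    lowRm h G y (oc4 i j k l) = (matT (h G) y * curvM G i j y) k l
      + 1 / 2 * (gcov G (gcov G (h G)) y (oc4 i j l k) - gcov G (gcov G (h G)) y (oc4 j i l k)) := by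
  have e1 : ∀ p q, (oc p (oc q (oc4 i j k l)) ∘ mulRmSlot) ∘ Sum.inl = oc k (oc p Fin.elim0) := by
    intro p q; funext o; rcases o with (_ | _ | x) <;> first | rfl | exact x.elim0
  have e2 : ∀ p q, (oc p (oc q (oc4 i j k l)) ∘ mulRmSlot) ∘ Sum.inr = oc4 i j q l := by
    intro p q; funext o; rcases o with (_ | _ | _ | _ | x) <;> first | rfl | exact x.elim0
  simp only [lowRm, Pi.add_apply, Pi.smul_apply, trcC, relabC, mulC, e1, e2, rmT_apply,
    oc4_comp_perm4, oc_none, oc_some, smul_eq_mul, comm_apply, matT, Matrix.mul_apply,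
    Matrix.of_apply, curvM_eq hG hy, Finset.mul_sum]
  refine congrArg (· + _) (Finset.sum_congr rfl fun p _ => Finset.sum_congr rfl fun q _ => ?_)
  ring

lemma linRm_apply (h : CMetric n → TField n Two) (G : CMetric n) (y : Coord n) (i j k l : Fin n) :
    linRm h G y (oc4 i j k l) = -1 / 2 * (gcov G (gcov G (h G)) y (oc4 i k j l)
      + gcov G (gcov G (h G)) y (oc4 j l i k) - gcov G (gcov G (h G)) y (oc4 i l j k)
      - gcov G (gcov G (h G)) y (oc4 j k i l)) := by
  simp only [linRm, Pi.smul_apply, Pi.sub_apply, Pi.add_apply, relabC, oc4_comp_perm4, oc_none,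
    oc_some, smul_eq_mul]

/-- The derivative of the curvature tensor. -/
lemma flowDer_rmT {h : CMetric n → TField n Two} (hh : IsNat h) :
    FlowDer h rmT (fun G y => linRm h G y + lowRm h G y) := by
  intro 𝒢 I U hF t ht y hy c
  obtain ⟨i, j, k, l, rfl⟩ := exists_oc4 c
  have hG := hF.riemOn (mem_of_mem_nhds ht)
  have hH := hG.diffM_inv hy
  have hK : ∀ i, DiffM (koszM (𝒢 t) (h (𝒢 t)) i) y := fun i a b => by
    have := ((hh.gcov.relabC (f := perm3 (some (some none)) (some none) none) (by decide)).add
      (hh.gcov.relabC (f := perm3 (some none) (some (some none)) none) (by decide))).sub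
      (hh.gcov.relabC (f := perm3 none (some (some none)) (some none)) (by decide))
    exact (this.smul (1 / 2)).diffAt hG hy _
  have hc : ∀ i a b, HasDerivAt (fun s => chrM (𝒢 s) i y a b)
      (((𝒢 t y)⁻¹ * koszM (𝒢 t) (h (𝒢 t)) i y) a b) t := hF.hasDerivAt_chrM ht hy
  have hp : ∀ i j a b, HasDerivAt (fun s => pdM i (chrM (𝒢 s) j) y a b)
      (pdM i (fun z => (𝒢 t z)⁻¹ * koszM (𝒢 t) (h (𝒢 t)) j z) y a b) t := fun i j a b =>
    hasDerivAt_partialDeriv (f := fun s z => chrM (𝒢 s) j z a b) hF.isOpen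
      (hF.contDiffOn_christoffel a j b) ht hy (fun z hz => hF.hasDerivAt_chrM ht hz j a b) i
  have hm : ∀ i j a b, HasDerivAt (fun s => (chrM (𝒢 s) i y * chrM (𝒢 s) j y) a b)
      (((𝒢 t y)⁻¹ * koszM (𝒢 t) (h (𝒢 t)) i y * chrM (𝒢 t) j y
        + chrM (𝒢 t) i y * ((𝒢 t y)⁻¹ * koszM (𝒢 t) (h (𝒢 t)) j y)) a b) t := by
    intro i j a b
    have := HasDerivAt.fun_sum (u := Finset.univ) fun k _ => (hc i a k).fun_mul (hc j k b)
    simpa only [Matrix.mul_apply (M := chrM _ _ _), Matrix.add_apply, Finset.sum_add_distrib,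
      Matrix.mul_apply (M := _ * _)] using this
  have hR : ∀ a b, HasDerivAt (fun s => curvM (𝒢 s) i j y a b) _ t := fun a b =>
    ((hp i j a b).sub (hp j i a b)).add ((hm i j a b).sub (hm j i a b))
  have h1 := HasDerivAt.fun_sum (u := Finset.univ) fun a _ => (hF.evol t ht y hy k a).fun_mul (hR a l)
  simp only [← Matrix.sub_apply, ← Matrix.add_apply, Finset.sum_add_distrib,
    ← Matrix.mul_apply] at h1
  simp only [rmT_apply, riem_eq]
  refine h1.congr_deriv ?_
  rw [Pi.add_apply, lowRm_apply hG hy, linRm_apply]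
  have e1 := gcov_koszM (𝒢 t) h y i j k l
  have e2 := gcov_koszM (𝒢 t) h y j i k l
  rw [gcov_kosz hG hh hy] at e1 e2
  have e3 : ∑ p, christoffel (𝒢 t) p j i y * koszM (𝒢 t) (h (𝒢 t)) p y k l
      = ∑ p, christoffel (𝒢 t) p i j y * koszM (𝒢 t) (h (𝒢 t)) p y k l :=
    Finset.sum_congr rfl fun p _ => by rw [hG.christoffel_symm hy]
  rw [e3] at e2
  -- Palatini's formula: with an index lowered, the variation of the curvature endomorphism is the
  -- antisymmetrized covariant derivative of `kosz`. The derivatives of the inverse metric become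
  -- connection terms by `pdM_inv`, and the terms of `e3`, being symmetric in `i` and `j`, drop out.
  have e4 : 𝒢 t y * (pdM i (fun z => (𝒢 t z)⁻¹ * koszM (𝒢 t) (h (𝒢 t)) j z) y
      - pdM j (fun z => (𝒢 t z)⁻¹ * koszM (𝒢 t) (h (𝒢 t)) i z) y
      + ((𝒢 t y)⁻¹ * koszM (𝒢 t) (h (𝒢 t)) i y * chrM (𝒢 t) j y
        + chrM (𝒢 t) i y * ((𝒢 t y)⁻¹ * koszM (𝒢 t) (h (𝒢 t)) j y)
        - ((𝒢 t y)⁻¹ * koszM (𝒢 t) (h (𝒢 t)) j y * chrM (𝒢 t) i y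
        + chrM (𝒢 t) j y * ((𝒢 t y)⁻¹ * koszM (𝒢 t) (h (𝒢 t)) i y))))
      = (pdM i (koszM (𝒢 t) (h (𝒢 t)) j) y - (chrM (𝒢 t) i y)ᵀ * koszM (𝒢 t) (h (𝒢 t)) j y
          - koszM (𝒢 t) (h (𝒢 t)) j y * chrM (𝒢 t) i y)
        - (pdM j (koszM (𝒢 t) (h (𝒢 t)) i) y - (chrM (𝒢 t) j y)ᵀ * koszM (𝒢 t) (h (𝒢 t)) i y
          - koszM (𝒢 t) (h (𝒢 t)) i y * chrM (𝒢 t) j y) := by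
    rw [pdM_mul i hH (hK j), pdM_mul j hH (hK i), pdM_inv hG hy, pdM_inv hG hy]
    have hu : 𝒢 t y * (𝒢 t y)⁻¹ = 1 := Matrix.mul_nonsing_inv _ (hG.isUnit_det hy)
    have hu' : ∀ M : Mat n, 𝒢 t y * ((𝒢 t y)⁻¹ * M) = M := fun M => by
      rw [← Matrix.mul_assoc, hu, Matrix.one_mul]
    simp only [Matrix.mul_add, Matrix.mul_sub, Matrix.sub_mul, Matrix.neg_mul, Matrix.mul_neg,
      Matrix.mul_assoc, hu']
    abel
  rw [e4]
  refine ((Matrix.add_apply _ _ _ _).trans (congrArg (_ + ·) (Matrix.sub_apply _ _ _ _))).trans ?_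
  linarith

/-! ### Evolution of densities -/

/-- Jacobi's formula. As the determinant is differentiable, its derivative along a curve depends
only on the tangent, so it may be computed along the line `A x + r • A'`. -/
lemma hasDerivAt_det {A : ℝ → Mat n} {A' : Mat n} {x : ℝ}
    (hA : ∀ i j, HasDerivAt (fun r => A r i j) (A' i j) x) (h0 : (A x).det ≠ 0) :
    HasDerivAt (fun r => (A r).det) ((A x).det * ((A x)⁻¹ * A').trace) x := by
  have hD : DifferentiableAt ℝ (fun B : Fin n → Fin n → ℝ => (Matrix.of B).det) (A x) :=
    ((contDiffOn_det (S := Set.univ) (A := fun B : Fin n → Fin n → ℝ => Matrix.of B)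
      (fun i j => ((contDiff_apply ℝ ℝ j).comp
        (contDiff_apply ℝ (Fin n → ℝ) i)).contDiffOn)).contDiffAt
      Filter.univ_mem).differentiableAt (by simp)
  have key : ∀ (B : ℝ → Mat n) (s : ℝ), B s = A x →
      (∀ i j, HasDerivAt (fun r => B r i j) (A' i j) s) →
      HasDerivAt (fun r => (B r).det) (fderiv ℝ (fun B : Fin n → Fin n → ℝ => (Matrix.of B).det)
        (A x) A') s := by
    intro B s hs hB
    have h3 : HasDerivAt (fun r => (B r : Fin n → Fin n → ℝ)) A' s :=
      hasDerivAt_pi.2 fun i => hasDerivAt_pi.2 fun j => hB i j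
    rw [← hs] at hD ⊢
    exact hD.hasFDerivAt.comp_hasDerivAt s h3
  have h1 := key (fun r => A x + r • A') 0 (by simp) fun i j => by
    simpa using ((hasDerivAt_id (0 : ℝ)).mul_const (A' i j)).const_add (A x i j)
  have h2 : HasDerivAt (fun r : ℝ => (A x + r • A').det) ((A x).det * ((A x)⁻¹ * A').trace) 0 := by
    have e : ∀ r : ℝ, (A x + r • A').det = (A x).det * (1 + r • ((A x)⁻¹ * A')).det := fun r => by
      rw [← Matrix.det_mul, Matrix.mul_add, Matrix.mul_one, Matrix.mul_smul,
        Matrix.mul_nonsing_inv_cancel_left _ _ h0.isUnit]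
    simp only [e]
    simp_rw [fun r => Matrix.det_one_add_smul r ((A x)⁻¹ * A')]
    have hq : ∀ Q : Polynomial ℝ, HasDerivAt (fun r => (1 : ℝ) + ((A x)⁻¹ * A').trace * r
        + Q.eval r * r ^ 2) ((A x)⁻¹ * A').trace 0 := fun Q => by
      have := (((hasDerivAt_id' (0 : ℝ)).const_mul ((A x)⁻¹ * A').trace).const_add 1).fun_add
        ((Q.hasDerivAt 0).fun_mul (hasDerivAt_pow 2 0))
      simpa using this
    exact (hq _).const_mul _
  rw [← h1.unique h2]
  exact key A x rfl hA

/-- The terms in the derivative of `|X|² √(det g)` that do not involve the derivative of `X`. -/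
def densT (h : CMetric n → TField n Two) (X : CMetric n → TField n ι) (G : CMetric n) :
    TField n ι := fun y =>
  relabC (Equiv.emptySum (Fin 0) ι) ((1 / 2 : ℝ) • mulC (trcC (G y)⁻¹ (h G y)) (X G y)
    - derC (G y)⁻¹ (h G y) (X G y))

lemma Ctl.densT {h : CMetric n → TField n Two} {X : CMetric n → TField n ι} {s ℓ s' ℓ' : ℕ}
    (hh : Ctl s ℓ h) (hX : Ctl s' ℓ' X) : Ctl (s + s') (max ℓ ℓ') (densT h X) :=
  (((hh.trcC.mulC hX).smul _).sub (hh.derC hX)).relabC (Equiv.bijective _)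

lemma densT_eq (h : CMetric n → TField n Two) (X : CMetric n → TField n ι) (G : CMetric n)
    (y : Coord n) : densT h X G y = (1 / 2 * ((G y)⁻¹ * (matT (h G) y)ᵀ).trace) • X G y
      - der ((G y)⁻¹ * matT (h G) y) (X G y) := by
  funext c
  have e : (c ∘ Equiv.emptySum (Fin 0) ι) ∘ Sum.inl = Fin.elim0 := Subsingleton.elim _ _
  simp only [densT, relabC, Pi.sub_apply, Pi.smul_apply, mulC, derC, e, trcC, smul_eq_mul,
    Matrix.trace, Matrix.diag_apply, Matrix.mul_apply, Matrix.transpose_apply, matT,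
    Matrix.of_apply, mul_assoc]
  rfl

/-- The derivative of the inverse metric acts on `X` as a derivation, and the volume density
contributes half the trace of `h`. These two effects are collected in `densT`. -/
lemma flowDens_zero {h : CMetric n → TField n Two} {X X' : CMetric n → TField n ι}
    (hX : FlowDer h X X') : FlowDens h (ipJet 0 X X)
      (fun G y => ipJet 0 (densT h X) X G y + 2 * ipJet 0 X' X G y) := by
  intro 𝒢 I U hF t ht y hy
  have hG := hF.riemOn (mem_of_mem_nhds ht)
  have hpos := (hG.posDef y hy).det_pos
  have h1 := hasDerivAt_ip (H := fun s => (𝒢 s y)⁻¹) (hF.hasDerivAt_inv ht hy)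
    (hX 𝒢 I U hF t ht y hy) (hX 𝒢 I U hF t ht y hy)
  have h2 := (hasDerivAt_det (hF.evol t ht y hy) hpos.ne').sqrt hpos.ne'
  refine (h1.fun_mul h2).congr_deriv ?_
  have hT : (matT (h (𝒢 t)) y)ᵀ = matT (h (𝒢 t)) y := by
    ext i j; exact hF.symm ht hy j i
  simp only [ipJet, densT_eq, hT, ip_sub_left, ip_smul_left, ip_der_left, ipD_neg,
    ip_symm (hG.inv_posDef hy) (X (𝒢 t) y) (X' (𝒢 t) y)]
  have hs : (𝒢 t y).det = Real.sqrt (𝒢 t y).det ^ 2 := (Real.sq_sqrt hpos.le).symm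
  have hs0 := (Real.sqrt_pos.2 hpos).ne'
  generalize Real.sqrt (𝒢 t y).det = r at *
  rw [hs]
  field_simp
  ring

/-- Induction on `m`, replacing `X` by its covariant derivative. Each step adds the variation of the
connection `derK h X`, whose product with the derivatives of `X` is negligible because the latter
have order less than `q`. -/
lemma exists_flowDens {h : CMetric n → TField n Two} (hh : Ctl 4 2 h) (m : ℕ) :
    ∀ {ι : Type} [Fintype ι] [DecidableEq ι] {s ℓ q : ℕ} {X X' : CMetric n → TField n ι},
    Ctl s ℓ X → IsNat X' → FlowDer h X X' → 1 ≤ s → s + m = q → ℓ + m + 1 ≤ q → 2 + m ≤ q →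
    ∃ f, NEq q f (fun G y => 2 * ipJet m X' X G y) ∧ FlowDens h (ipJet m X X) f := by
  induction m with
  | zero =>
    intro ι _ _ s ℓ q X X' hX hX' hd hs hq hl h2
    refine ⟨_, ?_, flowDens_zero hd⟩
    have h1 := negl_ipJet' (m := 0) (q := q) (hh.densT hX) hX (by omega) (by omega) (by omega) hs
    have h3 := NEq.of_eq (q := q) ((isNatCont_ipJet 0 hX' hX.1).smul 2)
      ((isNatCont_ipJet 0 hX' hX.1).smul 2) fun _ _ _ _ _ => rfl
    simpa only [zero_add] using (NEq.of_negl h1).add h3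
  | succ m ih =>
    intro ι _ _ s ℓ q X X' hX hX' hd hs hq hl h2
    have hK := hh.derK hX
    obtain ⟨f, hf, hfd⟩ := ih hX.gcov (hX'.gcov.sub hK.1) (hd.gcov hX.1) (q := q) (by omega)
      (by omega) (by omega) (by omega)
    refine ⟨f, hf.trans ?_, hfd⟩
    have h1 := negl_ipJet' (m := m) (q := q) hK hX.gcov (by omega) (by omega) (by omega) (by omega)
    have hc := isNatCont_ipJet m hX'.gcov hX.gcov.1
    refine ⟨(isNatCont_ipJet m (hX'.gcov.sub hK.1) hX.gcov.1).smul 2, hc.smul 2, ?_⟩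
    refine (h1.smul (-2)).congr (((isNatCont_ipJet m (hX'.gcov.sub hK.1) hX.gcov.1).smul 2).sub
      (hc.smul 2)) fun G U hG y hy => ?_
    rw [ipJet_sub_left m hX'.gcov hK.1 G U hG y hy]
    simp only [ipJet]
    ring

/-- The evolution of `|∇^m Rm|² √(det g)` along the flow. -/
theorem exists_energy_evolution (hn : 2 ≤ n) (P : FlowOperator)
    (hP : P.a < 1 / (2 * ((n : ℝ) - 1))) (m : ℕ) :
    ∃ c : ℝ, 0 < c ∧ ∃ C : ℝ, 0 ≤ C ∧ ∃ f : CMetric n → Coord n → ℝ, IsNatCont f ∧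
      FlowDens (flowT P) (fun G y => rmN m G y ^ 2) f ∧ ∀ 𝓘 : CInt n,
        𝓘 f ≤ -c * 𝓘 (rmPow (m + 2) (m + 2)) + C * 𝓘 (rmPow (m + 2) 0) := by
  obtain ⟨c, hc, C, hC, hb⟩ := exists_dissipation hn P hP m
  have hh := ctl_flowT (n := n) P
  have hL := hh.linRm.1
  have hW := ctl_lowRm hh
  obtain ⟨f, hf, hfd⟩ := exists_flowDens hh m ctl_rmT (hL.add hW.1) (flowDer_rmT hh.1)
    (q := m + 2) (by omega) (by omega) (by omega) (by omega)
  have h1 := negl_ipJet' (m := m) (q := m + 2) hW (ctl_rmT (n := n)) (by omega) (by omega) (by omega)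
    (by omega)
  have hR := isNatCont_ipJet m (ctl_rmT (n := n)).1 hL
  have h2 : NEq (m + 2) f (fun G y => 2 * ipJet m rmT (linRm (flowT P)) G y) := by
    refine hf.trans ⟨hf.right, hR.smul 2, (h1.smul 2).congr (hf.right.sub (hR.smul 2))
      fun G U hG y hy => ?_⟩
    rw [ipJet_add_left m hL hW.1 G U hG y hy, ipJet_symm m (X := rmT) G U hG y hy]
    ring
  -- The integral estimated by `exists_dissipation` occurs twice, which gives `-2 * c`. An error
  -- with coefficient `c` is affordable and leaves `-c`.
  obtain ⟨C', hC', hb'⟩ := h2.bound hc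
  refine ⟨c, hc, 2 * C + C', by positivity, f, hf.left, fun 𝒢 I U hF t ht y hy => ?_, fun 𝓘 => ?_⟩
  · refine (hfd 𝒢 I U hF t ht y hy).congr_of_eventuallyEq ?_
    filter_upwards [ht] with s hs
    rw [ipJet_rmT (hF.riemOn hs) hy]
  · have h3 := hb' 𝓘
    rw [𝓘.map_smul _ _ hR] at h3
    have h4 := hb 𝓘
    have := (abs_le.1 h3).2
    linarith

end Evolution

/-! ### Metrics and natural functions in the charts of a manifold -/

section Charts

open Function Matrix

variable {n : ℕ} {M : Type*} [TopologicalSpace M] [ChartedSpace (Coord n) M]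
  [IsManifold (𝓡 n) ∞ M]

/-! ### Metrics on a manifold in charts -/

variable (n) in
/-- The change of coordinates between two preferred charts. -/
def coordChange (x x' : M) : Coord n → Coord n := chartAt (Coord n) x' ∘ (chartAt (Coord n) x).symm

variable (n) in
/-- The domain of the change of coordinates. -/
def coordDom (x x' : M) : Set (Coord n) :=
  ((chartAt (Coord n) x).symm.trans (chartAt (Coord n) x')).source

omit [IsManifold (𝓡 n) ∞ M] in
lemma mem_coordDom {x x' : M} {y : Coord n} : y ∈ coordDom n x x' ↔
    y ∈ (chartAt (Coord n) x).target ∧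
      (chartAt (Coord n) x).symm y ∈ (chartAt (Coord n) x').source := by
  simp [coordDom]

omit [IsManifold (𝓡 n) ∞ M] in
lemma isOpen_coordDom (x x' : M) : IsOpen (coordDom n x x') :=
  ((chartAt (Coord n) x).symm.trans (chartAt (Coord n) x')).open_source

omit [IsManifold (𝓡 n) ∞ M] in
lemma coordChange_mem {x x' : M} {y : Coord n} (hy : y ∈ coordDom n x x') :
    coordChange n x x' y ∈ coordDom n x' x := by
  rw [mem_coordDom] at *
  refine ⟨(chartAt (Coord n) x').map_source hy.2, ?_⟩
  rw [coordChange, Function.comp_apply, (chartAt (Coord n) x').left_inv hy.2]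
  exact (chartAt (Coord n) x).map_target hy.1

omit [IsManifold (𝓡 n) ∞ M] in
lemma symm_coordChange {x x' : M} {y : Coord n} (hy : y ∈ coordDom n x x') :
    (chartAt (Coord n) x').symm (coordChange n x x' y) = (chartAt (Coord n) x).symm y :=
  (chartAt (Coord n) x').left_inv (mem_coordDom.1 hy).2

omit [IsManifold (𝓡 n) ∞ M] in
lemma coordChange_coordChange {x x' : M} {y : Coord n} (hy : y ∈ coordDom n x x') :
    coordChange n x' x (coordChange n x x' y) = y := by
  rw [coordChange, Function.comp_apply, symm_coordChange hy, (chartAt (Coord n) x).right_inv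
    (mem_coordDom.1 hy).1]

variable (n) in
lemma contDiffOn_coordChange (x x' : M) :
    ContDiffOn ℝ ∞ (coordChange n x x') (coordDom n x x') := by
  have := contDiffOn_ext_coord_change (I := 𝓡 n) (n := ∞) x' x
  simpa [extChartAt, coordDom, coordChange, OpenPartialHomeomorph.extend] using this

lemma differentiableAt_coordChange {x x' : M} {y : Coord n} (hy : y ∈ coordDom n x x') :
    DifferentiableAt ℝ (coordChange n x x') y :=
  ((contDiffOn_coordChange n x x').contDiffAt ((isOpen_coordDom x x').mem_nhds hy)).differentiableAt
    (by simp)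

lemma partialDeriv_coord (a i : Fin n) (y : Coord n) :
    partialDeriv i (fun z => z a) y = (1 : Mat n) a i := by
  have : HasFDerivAt (fun z : Coord n => z a) (EuclideanSpace.proj (𝕜 := ℝ) a) y :=
    (EuclideanSpace.proj (𝕜 := ℝ) a).hasFDerivAt
  rw [partialDeriv, this.fderiv]
  simp [Matrix.one_apply]

variable (n) in
lemma lDiffeo_coordChange (x x' : M) :
    LDiffeo (coordChange n x x') (coordDom n x x') (chartAt (Coord n) x').target where
  isOpen := isOpen_coordDom x x'
  smooth := contDiffOn_coordChange n x x'
  mapsTo _ hy := (mem_coordDom.1 (coordChange_mem hy)).1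
  isUnit y hy := by
    refine Matrix.isUnit_det_of_left_inverse (B := Jac (coordChange n x' x) (coordChange n x x' y)) ?_
    have hd := differentiableAt_coordChange (coordChange_mem hy)
    ext a i
    have h1 := partialDeriv_comp (f := fun z => coordChange n x' x z a)
      ((EuclideanSpace.proj (𝕜 := ℝ) a).differentiableAt.comp _ hd)
      (differentiableAt_coordChange hy) i
    have h2 : (fun z => coordChange n x' x (coordChange n x x' z) a) =ᶠ[nhds y] fun z => z a := by
      filter_upwards [(isOpen_coordDom x x').mem_nhds hy] with z hz
      rw [coordChange_coordChange hz]
    rw [Filter.EventuallyEq.partialDeriv_eq h2, partialDeriv_coord] at h1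
    rw [h1, Matrix.mul_apply]
    exact Finset.sum_congr rfl fun b _ => mul_comm _ _

lemma coordVector_coordChange {x x' : M} {y : Coord n} (hy : y ∈ coordDom n x x') (i : Fin n) :
    (coordVector (chartAt (Coord n) x) y i : Coord n)
      = ∑ a, Jac (coordChange n x x') y a i •
        (coordVector (chartAt (Coord n) x') (coordChange n x x' y) a : Coord n) := by
  have : IsManifold (𝓡 n) 1 M := IsManifold.of_le (n := ∞) (by simp)
  have hd := differentiableAt_coordChange hy
  have hm : MDifferentiableAt (𝓡 n) (𝓡 n) (chartAt (Coord n) x').symm (coordChange n x x' y) :=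
    mdifferentiableAt_atlas_symm (chart_mem_atlas _ _) (mem_coordDom.1 (coordChange_mem hy)).1
  have h1 : ((chartAt (Coord n) x).symm : Coord n → M) =ᶠ[nhds y]
      (chartAt (Coord n) x').symm ∘ coordChange n x x' := by
    filter_upwards [(isOpen_coordDom x x').mem_nhds hy] with z hz
    exact (symm_coordChange hz).symm
  have h2 := h1.mfderiv_eq (I := 𝓡 n) (I' := 𝓡 n)
  have h3 := mfderiv_comp y hm hd.mdifferentiableAt
  have h4 := fderiv_single hd i
  have h5 : (coordVector (chartAt (Coord n) x) y i : Coord n)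
      = mfderiv (𝓡 n) (𝓡 n) (chartAt (Coord n) x').symm (coordChange n x x' y)
        (fderiv ℝ (coordChange n x x') y (EuclideanSpace.single i 1)) := by
    rw [← mfderiv_eq_fderiv]
    exact (congrArg (fun L : Coord n →L[ℝ] Coord n => L (EuclideanSpace.single i 1)) h2).trans
      (congrArg (fun L : Coord n →L[ℝ] Coord n => L (EuclideanSpace.single i 1)) h3)
  rw [h5, h4]
  exact (map_sum (mfderiv (𝓡 n) (𝓡 n) (chartAt (Coord n) x').symm (coordChange n x x' y)) _ _).trans
    (Finset.sum_congr rfl fun a _ => map_smul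
      (mfderiv (𝓡 n) (𝓡 n) (chartAt (Coord n) x').symm (coordChange n x x' y)) _ _)

lemma metricCoord_coordChange (g : SmoothMetric n M) {x x' : M} {y : Coord n}
    (hy : y ∈ coordDom n x x') : metricCoord g (chartAt (Coord n) x) y
      = pullG (coordChange n x x') (metricCoord g (chartAt (Coord n) x')) y := by
  -- All tangent spaces are definitionally the model space, which allows the inner product to be
  -- transported along an equality of base points.
  have hp : ∀ (p q : M) (_ : p = q) (v w : Coord n),
      (g.inner p (v : TangentSpace (𝓡 n) p) (w : TangentSpace (𝓡 n) p) : ℝ)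
        = g.inner q (v : TangentSpace (𝓡 n) q) (w : TangentSpace (𝓡 n) q) := by
    rintro p _ rfl v w; rfl
  ext i j
  refine (hp _ _ (symm_coordChange hy).symm (coordVector (chartAt (Coord n) x) y i)
    (coordVector (chartAt (Coord n) x) y j)).trans ?_
  rw [coordVector_coordChange hy, coordVector_coordChange hy]
  generalize hq : coordChange n x x' y = q
  have hb : ∀ (J : Mat n) (v : Fin n → Coord n) (B : Coord n →L[ℝ] Coord n →L[ℝ] ℝ) (i j : Fin n),
      B (∑ a, J a i • v a) (∑ b, J b j • v b)
        = (Jᵀ * (Matrix.of fun a b => B (v a) (v b)) * J) i j := by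
    intro J v B i j
    simp only [map_sum, map_smul, _root_.sum_apply, _root_.smul_apply,
      Matrix.mul_apply, Matrix.transpose_apply, Matrix.of_apply, Finset.sum_mul, smul_eq_mul,
      Finset.mul_sum]
    exact Finset.sum_congr rfl fun b _ => Finset.sum_congr rfl fun a _ => by ring
  refine (hb _ _ (g.inner ((chartAt (Coord n) x').symm q)) i j).trans ?_
  rw [← hq]
  rfl

/-- The components of the metric in the preferred charts are smooth. -/
def ChartSmooth (g : SmoothMetric n M) : Prop :=
  ∀ (x : M) (i j : Fin n), ContDiffOn ℝ ∞ (fun y => metricCoord g (chartAt (Coord n) x) y i j)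
    (chartAt (Coord n) x).target

/-- The differential of the inverse chart is injective, having the differential of the chart as a
left inverse, so the inner product pulls back to a positive definite form. -/
lemma posDef_metricCoord (g : SmoothMetric n M) (x : M) {y : Coord n}
    (hy : y ∈ (chartAt (Coord n) x).target) : (metricCoord g (chartAt (Coord n) x) y).PosDef := by
  have : IsManifold (𝓡 n) 1 M := IsManifold.of_le (n := ∞) (by simp)
  set e := chartAt (Coord n) x with he
  set L : Coord n →L[ℝ] Coord n := mfderiv (𝓡 n) (𝓡 n) e.symm y with hL
  have hinj : ∀ v, L v = 0 → v = 0 := by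
    have h1 : MDifferentiableAt (𝓡 n) (𝓡 n) e.symm y :=
      mdifferentiableAt_atlas_symm (chart_mem_atlas _ _) hy
    have h2 : MDifferentiableAt (𝓡 n) (𝓡 n) e (e.symm y) :=
      mdifferentiableAt_atlas (chart_mem_atlas _ _) (e.map_target hy)
    have h3 : (e ∘ e.symm : Coord n → Coord n) =ᶠ[nhds y] id := by
      filter_upwards [e.open_target.mem_nhds hy] with z hz using e.right_inv hz
    have h4 := h3.mfderiv_eq (I := 𝓡 n) (I' := 𝓡 n)
    have h5 := mfderiv_comp y h2 h1
    have h6 := mfderiv_id (I := 𝓡 n) (x := y)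
    intro v hv
    have h7 : (mfderiv (𝓡 n) (𝓡 n) e (e.symm y) : Coord n →L[ℝ] Coord n) (L v) = v :=
      congrArg (fun L : Coord n →L[ℝ] Coord n => L v) (h5.symm.trans (h4.trans h6))
    rw [hv] at h7
    exact h7.symm.trans
      (map_zero (mfderiv (𝓡 n) (𝓡 n) e (e.symm y) : Coord n →L[ℝ] Coord n))
  have hv : ∀ u : Fin n → ℝ, u ⬝ᵥ (metricCoord g e y *ᵥ u)
      = g.inner (e.symm y) (L (WithLp.toLp 2 u)) (L (WithLp.toLp 2 u)) := by
    intro u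
    have hu : (WithLp.toLp 2 u : Coord n) = ∑ a, u a • EuclideanSpace.single a (1 : ℝ) := by
      ext b; simp [Finset.sum_apply, Pi.single_apply]
    have hb : ∀ (v : Fin n → Coord n) (B : Coord n →L[ℝ] Coord n →L[ℝ] ℝ),
        u ⬝ᵥ ((Matrix.of fun a b => B (v a) (v b)) *ᵥ u) = B (∑ a, u a • v a) (∑ b, u b • v b) := by
      intro v B
      simp only [map_sum, map_smul, _root_.sum_apply, _root_.smul_apply,
        dotProduct, Matrix.mulVec, Matrix.of_apply, smul_eq_mul, Finset.mul_sum]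
      rw [Finset.sum_comm]
      exact Finset.sum_congr rfl fun b _ => Finset.sum_congr rfl fun a _ => by ring
    refine (hb (fun a => L (EuclideanSpace.single a 1)) (g.inner (e.symm y))).trans ?_
    have hs : ∑ a, u a • L (EuclideanSpace.single a 1) = L (WithLp.toLp 2 u) := by
      rw [hu, map_sum]
      simp only [map_smul]
    exact congrArg (fun w : Coord n => (g.inner (e.symm y) w w : ℝ)) hs
  refine Matrix.PosDef.of_dotProduct_mulVec_pos ?_ fun u hu => ?_
  · ext i j
    exact g.symm _ _ _
  · rw [star_trivial, hv]
    refine g.pos _ _ fun h0 => hu ?_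
    have := hinj _ h0
    exact (WithLp.toLp_injective 2 (this.trans (WithLp.toLp_zero 2).symm))

lemma ChartSmooth.riemOn {g : SmoothMetric n M} (hg : ChartSmooth g) (x : M) :
    RiemOn (metricCoord g (chartAt (Coord n) x)) (chartAt (Coord n) x).target :=
  ⟨(chartAt (Coord n) x).open_target, hg x, fun _ hy => posDef_metricCoord g x hy⟩

lemma metricCoord_eventuallyEq (g : SmoothMetric n M) {x x' : M} {y : Coord n}
    (hy : y ∈ coordDom n x x') : metricCoord g (chartAt (Coord n) x) =ᶠ[nhds y]
      pullG (coordChange n x x') (metricCoord g (chartAt (Coord n) x')) := by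
  filter_upwards [(isOpen_coordDom x x').mem_nhds hy] with z hz using metricCoord_coordChange g hz

/-- A function on `M` given by its expressions in the preferred charts. -/
def chartVal (v : M → Coord n → ℝ) (x : M) : ℝ := v x (chartAt (Coord n) x x)

/-- Compatibility of the expressions of a function in the preferred charts. -/
def ChartCompat (v : M → Coord n → ℝ) : Prop :=
  ∀ x x', ∀ y ∈ coordDom n x x', v x y = v x' (coordChange n x x' y)

omit [IsManifold (𝓡 n) ∞ M] in
lemma ChartCompat.apply {v : M → Coord n → ℝ} (hv : ChartCompat v) (x : M) {y : Coord n}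
    (hy : y ∈ (chartAt (Coord n) x).target) :
    chartVal v ((chartAt (Coord n) x).symm y) = v x y :=
  (hv x ((chartAt (Coord n) x).symm y) y
    (mem_coordDom.2 ⟨hy, mem_chart_source (Coord n) _⟩)).symm

omit [IsManifold (𝓡 n) ∞ M] in
lemma ChartCompat.continuous {v : M → Coord n → ℝ} (hv : ChartCompat v)
    (hc : ∀ x, ContinuousOn (v x) (chartAt (Coord n) x).target) : Continuous (chartVal v) := by
  refine continuous_iff_continuousAt.2 fun x => ?_
  have hs := chart_source_mem_nhds (Coord n) x
  have h1 : chartVal v =ᶠ[nhds x] v x ∘ chartAt (Coord n) x := by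
    filter_upwards [hs] with z hz
    have := hv.apply x ((chartAt (Coord n) x).map_source hz)
    rwa [(chartAt (Coord n) x).left_inv hz] at this
  refine ContinuousAt.congr ?_ h1.symm
  have hx := mem_chart_source (Coord n) x
  exact ((hc x).continuousAt ((chartAt (Coord n) x).open_target.mem_nhds
    ((chartAt (Coord n) x).map_source hx))).comp ((chartAt (Coord n) x).continuousAt hx)

/-- The expressions of a natural function in the preferred charts. -/
def natV (g : SmoothMetric n M) (f : CMetric n → Coord n → ℝ) (x : M) : Coord n → ℝ :=
  f (metricCoord g (chartAt (Coord n) x))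

lemma chartCompat_natV {g : SmoothMetric n M} (hg : ChartSmooth g) {f : CMetric n → Coord n → ℝ}
    (hf : IsNatCont f) : ChartCompat (natV g f) := fun x x' y hy => by
  rw [natV, hf.congr (metricCoord_eventuallyEq g hy),
    hf.pull (lDiffeo_coordChange n x x') (hg.riemOn x') y hy, natV]

lemma continuousOn_natV {g : SmoothMetric n M} (hg : ChartSmooth g) {f : CMetric n → Coord n → ℝ}
    (hf : IsNatCont f) (x : M) : ContinuousOn (natV g f x) (chartAt (Coord n) x).target :=
  (hf.cont (hg.riemOn x).fam).comp (f := fun y => ((0 : ℝ), y))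
    (continuous_const.prodMk continuous_id).continuousOn (fun _ hy => ⟨Set.mem_univ _, hy⟩)

end Charts

/-! ### The Riemannian volume and integration in charts -/

section Volume

open Function Matrix MeasureTheory

variable {n : ℕ} {M : Type*} [TopologicalSpace M] [ChartedSpace (Coord n) M]
  [IsManifold (𝓡 n) ∞ M]

/-! ### The Riemannian volume in charts -/

/-- The density of the Riemannian volume in a preferred chart. -/
def dens (g : SmoothMetric n M) (x : M) (y : Coord n) : ℝ :=
  Real.sqrt (metricCoord g (chartAt (Coord n) x) y).det

lemma continuousOn_dens {g : SmoothMetric n M} (hg : ChartSmooth g) (x : M) :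
    ContinuousOn (dens g x) (chartAt (Coord n) x).target :=
  (contDiffOn_det (hg x)).continuousOn.sqrt

lemma dens_coordChange (g : SmoothMetric n M) {x x' : M} {y : Coord n} (hy : y ∈ coordDom n x x') :
    dens g x y = |(fderiv ℝ (coordChange n x x') y).det| * dens g x' (coordChange n x x' y) := by
  have h1 : (fderiv ℝ (coordChange n x x') y).det = (Jac (coordChange n x x') y).det := by
    rw [ContinuousLinearMap.det, ← LinearMap.det_toMatrix
      (EuclideanSpace.basisFun (Fin n) ℝ).toBasis]
    congr 1
    ext a i
    simp only [LinearMap.toMatrix_apply, OrthonormalBasis.coe_toBasis, EuclideanSpace.basisFun_apply,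
      OrthonormalBasis.coe_toBasis_repr_apply, EuclideanSpace.basisFun_repr, Jac, Matrix.of_apply,
      partialDeriv]
    exact (fderiv_apply_coord (differentiableAt_coordChange hy) _ a).symm
  rw [dens, metricCoord_coordChange g hy, pullG, Matrix.det_mul, Matrix.det_mul,
    Matrix.det_transpose, h1, dens, ← Real.sqrt_sq_eq_abs, ← Real.sqrt_mul (sq_nonneg _)]
  congr 1
  ring

/-- The image of a set in a preferred chart. -/
def chartImg (x : M) (B : Set M) : Set (Coord n) :=
  (chartAt (Coord n) x).target ∩ (chartAt (Coord n) x).symm ⁻¹' B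

variable [MeasurableSpace M] [BorelSpace M]

omit [IsManifold (𝓡 n) ∞ M] in
lemma measurableSet_chartImg (x : M) {B : Set M} (hB : MeasurableSet B) :
    MeasurableSet (chartImg (n := n) x B) := by
  have h1 : Measurable fun y : (chartAt (Coord n) x).target => (chartAt (Coord n) x).symm y :=
    (continuousOn_iff_continuous_domRestrict.1 (chartAt (Coord n) x).continuousOn_symm).measurable
  have h2 := (chartAt (Coord n) x).open_target.measurableSet.subtype_image (h1 hB)
  convert h2 using 1
  ext y
  simp [chartImg, and_comm]

omit [MeasurableSpace M] [BorelSpace M] in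
lemma aemeasurable_dens {g : SmoothMetric n M} (hg : ChartSmooth g) (x : M) {S : Set (Coord n)}
    (hS : S ⊆ (chartAt (Coord n) x).target) :
    AEMeasurable (fun y => ENNReal.ofReal (dens g x y)) (volume.restrict S) :=
  ((((continuousOn_dens hg x).aemeasurable (chartAt (Coord n) x).open_target.measurableSet)).mono_measure
    (Measure.restrict_mono hS le_rfl)).ennreal_ofReal

lemma aemeasurable_symm (g : SmoothMetric n M) (x : M) (B : Set M) :
    AEMeasurable (chartAt (Coord n) x).symm
      ((volume.restrict (chartImg x B)).withDensity fun y => ENNReal.ofReal (dens g x y)) :=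
  ((((chartAt (Coord n) x).continuousOn_symm.aemeasurable
    (chartAt (Coord n) x).open_target.measurableSet)).mono_measure
    (Measure.restrict_mono Set.inter_subset_left le_rfl)).mono_ac (withDensity_absolutelyContinuous _ _)

lemma volumePiece_apply (g : SmoothMetric n M) (x : M) {A S : Set M} (hA : MeasurableSet A)
    (hS : MeasurableSet S) : volumePiece g (chartAt (Coord n) x) A S
      = ∫⁻ y in chartImg x (A ∩ S), ENNReal.ofReal (dens g x y) := by
  have h := Measure.map_apply_of_aemeasurable (aemeasurable_symm g x A) hS
  refine h.trans ?_
  rw [withDensity_apply', Measure.restrict_restrict' (measurableSet_chartImg x hA)]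
  have : (chartAt (Coord n) x).symm ⁻¹' S ∩ chartImg x A = chartImg x (A ∩ S) := by
    ext y; simp only [chartImg, Set.mem_inter_iff, Set.mem_preimage]; tauto
  rw [this]

lemma lintegral_dens_coordChange (g : SmoothMetric n M) (x x' : M) {B : Set M}
    (hB : MeasurableSet B) (hx : B ⊆ (chartAt (Coord n) x).source)
    (hx' : B ⊆ (chartAt (Coord n) x').source) :
    ∫⁻ y in chartImg x B, ENNReal.ofReal (dens g x y)
      = ∫⁻ y in chartImg x' B, ENNReal.ofReal (dens g x' y) := by
  have hd : ∀ y ∈ chartImg (n := n) x B, y ∈ coordDom n x x' := fun y hy =>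
    mem_coordDom.2 ⟨hy.1, hx' hy.2⟩
  have him : coordChange n x x' '' chartImg x B = chartImg x' B := by
    ext z
    constructor
    · rintro ⟨y, hy, rfl⟩
      exact ⟨(mem_coordDom.1 (coordChange_mem (hd y hy))).1, by
        rw [Set.mem_preimage, symm_coordChange (hd y hy)]; exact hy.2⟩
    · intro hz
      have hz' : z ∈ coordDom n x' x := mem_coordDom.2 ⟨hz.1, hx hz.2⟩
      refine ⟨coordChange n x' x z, ⟨(mem_coordDom.1 (coordChange_mem hz')).1, ?_⟩,
        coordChange_coordChange hz'⟩
      rw [Set.mem_preimage, symm_coordChange hz']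
      exact hz.2
  have h := lintegral_image_eq_lintegral_abs_det_fderiv_mul volume (measurableSet_chartImg x hB)
    (f := coordChange n x x') (f' := fun y => fderiv ℝ (coordChange n x x') y)
    (fun y hy => (differentiableAt_coordChange (hd y hy)).hasFDerivAt.hasFDerivWithinAt)
    (fun y hy z hz e => by
      rw [← coordChange_coordChange (hd y hy), e, coordChange_coordChange (hd z hz)])
    (fun y => ENNReal.ofReal (dens g x' y))
  rw [him] at h
  rw [h]
  refine setLIntegral_congr_fun (measurableSet_chartImg x hB) fun y hy => ?_
  rw [dens_coordChange g (hd y hy), ENNReal.ofReal_mul (abs_nonneg _)]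

variable [CompactSpace M]

/-- Independence of the charts in the definition of `vol`: the change of variables formula carries
each disjoint piece of `B` to the chart at `x`, and the pieces are then added up. -/
lemma vol_apply (g : SmoothMetric n M) (x : M) {B : Set M} (hB : MeasurableSet B)
    (hx : B ⊆ (chartAt (Coord n) x).source) :
    vol g B = ∫⁻ y in chartImg x B, ENNReal.ofReal (dens g x y) := by
  have hne : Nonempty M := ⟨x⟩
  rw [vol, dif_pos hne]
  set u := Classical.choose (exists_chart_cover n M) with hu
  have hcov := Classical.choose_spec (exists_chart_cover n M)
  set A : ℕ → Set M := disjointed fun j => (chartAt (Coord n) (u j)).source with hA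
  have hAm : ∀ i, MeasurableSet (A i) := fun i =>
    MeasurableSet.disjointed (fun j => (chartAt (Coord n) (u j)).open_source.measurableSet) i
  have hAs : ∀ i, A i ⊆ (chartAt (Coord n) (u i)).source := fun i => disjointed_subset _ i
  have hAu : ⋃ i, A i = Set.univ := by rw [hA, iUnion_disjointed]; exact hcov
  rw [Measure.sum_apply _ hB]
  have h1 : ∀ i, volumePiece g (chartAt (Coord n) (u i)) (A i) B
      = ∫⁻ y in chartImg x (A i ∩ B), ENNReal.ofReal (dens g x y) := fun i => by
    rw [volumePiece_apply g (u i) (hAm i) hB, lintegral_dens_coordChange g (u i) x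
      ((hAm i).inter hB) (fun z hz => hAs i hz.1) (fun z hz => hx hz.2)]
  refine (tsum_congr h1).trans ?_
  rw [← lintegral_iUnion (fun i => measurableSet_chartImg x ((hAm i).inter hB))]
  · congr 2
    have : B = ⋃ i, A i ∩ B := by rw [← Set.iUnion_inter, hAu, Set.univ_inter]
    conv_rhs => rw [this]
    ext y
    simp [chartImg]
  · intro i j hij
    refine Set.disjoint_left.2 fun y hy hy' => ?_
    exact Set.disjoint_left.1 (disjoint_disjointed (fun j => (chartAt (Coord n) (u j)).source) hij)
      hy.2.1 hy'.2.1

lemma vol_restrict (g : SmoothMetric n M) (x : M) {B : Set M} (hB : MeasurableSet B)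
    (hx : B ⊆ (chartAt (Coord n) x).source) :
    (vol g).restrict B = volumePiece g (chartAt (Coord n) x) B := by
  ext S hS
  rw [Measure.restrict_apply hS, vol_apply g x (hS.inter hB) fun z hz => hx hz.2,
    volumePiece_apply g x hB hS, Set.inter_comm]

/-- Integrals of functions that vanish outside of a chart domain. -/
lemma integral_vol_of_chart {g : SmoothMetric n M} (hg : ChartSmooth g) (x : M) {F : M → ℝ}
    (hF : Continuous F) (h0 : ∀ z, z ∉ (chartAt (Coord n) x).source → F z = 0) :
    ∫ z, F z ∂(vol g) = ∫ y in (chartAt (Coord n) x).target,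
      F ((chartAt (Coord n) x).symm y) * dens g x y := by
  have hs := (chartAt (Coord n) x).open_source.measurableSet
  rw [← setIntegral_eq_integral_of_forall_compl_eq_zero h0, vol_restrict g x hs subset_rfl]
  have e : chartImg x (chartAt (Coord n) x).source = (chartAt (Coord n) x).target := by
    ext y
    exact ⟨fun h => h.1, fun h => ⟨h, (chartAt (Coord n) x).map_target h⟩⟩
  have h1 := integral_map (aemeasurable_symm g x (chartAt (Coord n) x).source)
    (f := F) hF.aestronglyMeasurable
  refine h1.trans ?_
  rw [e, integral_withDensity_eq_integral_toReal_smul₀ (aemeasurable_dens hg x subset_rfl)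
    (Filter.Eventually.of_forall fun _ => ENNReal.ofReal_lt_top)]
  refine integral_congr_ae (Filter.Eventually.of_forall fun y => ?_)
  simp only [smul_eq_mul]
  rw [ENNReal.toReal_ofReal (show 0 ≤ dens g x y from Real.sqrt_nonneg _), mul_comm]

omit [IsManifold (𝓡 n) ∞ M] [MeasurableSpace M] [BorelSpace M] [CompactSpace M] in
lemma chartImg_eq_image (x : M) {B : Set M} (hB : B ⊆ (chartAt (Coord n) x).source) :
    chartImg x B = chartAt (Coord n) x '' B :=
  ((chartAt (Coord n) x).image_eq_target_inter_inv_preimage hB).symm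

omit [IsManifold (𝓡 n) ∞ M] [MeasurableSpace M] [BorelSpace M] [CompactSpace M] in
lemma isCompact_chartImg (x : M) {B : Set M} (hB : IsCompact B)
    (hx : B ⊆ (chartAt (Coord n) x).source) : IsCompact (chartImg (n := n) x B) := by
  rw [chartImg_eq_image x hx]
  exact hB.image_of_continuousOn ((chartAt (Coord n) x).continuousOn.mono hx)

variable [T2Space M]

lemma isFiniteMeasure_vol {g : SmoothMetric n M} (hg : ChartSmooth g) : IsFiniteMeasure (vol g) := by
  refine ⟨isCompact_univ.measure_lt_top_of_nhdsWithin fun x _ => ?_⟩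
  obtain ⟨K, hK, hKs, hKc⟩ := local_compact_nhds (chart_source_mem_nhds (Coord n) x)
  refine ⟨K, mem_nhdsWithin_of_mem_nhds hK, ?_⟩
  rw [vol_apply g x hKc.measurableSet hKs]
  have h1 := ((continuousOn_dens hg x).mono Set.inter_subset_left).integrableOn_compact (μ := volume)
    (isCompact_chartImg x hKc hKs)
  exact h1.lintegral_lt_top

lemma integrable_vol {g : SmoothMetric n M} (hg : ChartSmooth g) {F : M → ℝ} (hF : Continuous F) :
    Integrable F (vol g) := by
  have := isFiniteMeasure_vol hg
  exact hF.integrable_of_hasCompactSupport (HasCompactSupport.of_compactSpace F)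

omit [MeasurableSpace M] [BorelSpace M] in
variable (n M) in
/-- A finite smooth partition of unity that is subordinate to preferred charts. -/
lemma exists_partition : ∃ (t : Finset M) (ρ : t → M → ℝ),
    (∀ k, ContMDiff (𝓡 n) 𝓘(ℝ, ℝ) ∞ (ρ k)) ∧
    (∀ k : t, tsupport (ρ k) ⊆ (chartAt (Coord n) (k : M)).source) ∧ ∀ x, ∑ k, ρ k x = 1 := by
  obtain ⟨t, ht⟩ := isCompact_univ.elim_finite_subcover
    (fun x : M => (chartAt (Coord n) x).source) (fun x => (chartAt (Coord n) x).open_source)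
    (fun x _ => Set.mem_iUnion.2 ⟨x, mem_chart_source _ x⟩)
  obtain ⟨f, hf⟩ := SmoothPartitionOfUnity.exists_isSubordinate (𝓡 n) (isClosed_univ (X := M))
    (fun k : t => (chartAt (Coord n) (k : M)).source)
    (fun k => (chartAt (Coord n) (k : M)).open_source) (fun x hx => by
      have := ht hx
      simp only [Set.mem_iUnion] at this ⊢
      obtain ⟨k, hk, hkx⟩ := this
      exact ⟨⟨k, hk⟩, hkx⟩)
  refine ⟨t, fun k => f k, fun k => (f k).contMDiff, hf, fun x => ?_⟩
  rw [← finsum_eq_sum_of_fintype]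
  exact f.sum_eq_one (Set.mem_univ x)

/-- Integrals as sums of integrals in charts. -/
lemma integral_chartVal {g : SmoothMetric n M} (hg : ChartSmooth g) {v : M → Coord n → ℝ}
    (hv : ChartCompat v) (hc : ∀ x, ContinuousOn (v x) (chartAt (Coord n) x).target)
    {t : Finset M} {ρ : t → M → ℝ} (hρ : ∀ k, Continuous (ρ k))
    (hs : ∀ k : t, tsupport (ρ k) ⊆ (chartAt (Coord n) (k : M)).source)
    (h1 : ∀ x, ∑ k, ρ k x = 1) :
    ∫ z, chartVal v z ∂(vol g) = ∑ k : t, ∫ y in chartImg (k : M) (tsupport (ρ k)),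
      ρ k ((chartAt (Coord n) (k : M)).symm y) * (v k y * dens g k y) := by
  have hcont := hv.continuous hc
  have e : ∀ z, chartVal v z = ∑ k : t, ρ k z * chartVal v z := fun z => by
    rw [← Finset.sum_mul, h1, one_mul]
  rw [integral_congr_ae (Filter.Eventually.of_forall e), integral_finsetSum _
    fun k _ => integrable_vol (F := fun z => ρ k z * chartVal v z) hg ((hρ k).mul hcont)]
  refine Finset.sum_congr rfl fun k _ => ?_
  have h0 : ∀ z, z ∉ (chartAt (Coord n) (k : M)).source → ρ k z * chartVal v z = 0 := fun z hz => by
    rw [image_eq_zero_of_notMem_tsupport fun h => hz (hs k h), zero_mul]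
  rw [integral_vol_of_chart (F := fun z => ρ k z * chartVal v z) hg k ((hρ k).mul hcont) h0]
  have hsub : chartImg (n := n) (k : M) (tsupport (ρ k)) ⊆ (chartAt (Coord n) (k : M)).target :=
    Set.inter_subset_left
  have h2 := setIntegral_eq_of_subset_of_forall_sdiff_eq_zero (μ := volume)
    (f := fun y => ρ k ((chartAt (Coord n) (k : M)).symm y)
      * chartVal v ((chartAt (Coord n) (k : M)).symm y) * dens g k y)
    (chartAt (Coord n) (k : M)).open_target.measurableSet hsub fun y hy => by
      have : (chartAt (Coord n) (k : M)).symm y ∉ tsupport (ρ k) := fun h => hy.2 ⟨hy.1, h⟩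
      rw [image_eq_zero_of_notMem_tsupport this, zero_mul, zero_mul]
  refine h2.trans (setIntegral_congr_fun
    (measurableSet_chartImg _ (isClosed_tsupport _).measurableSet) fun y hy => ?_)
  rw [hv.apply _ hy.1, mul_assoc]

end Volume

/-! ### The divergence theorem in coordinates -/

section Divergence

open Function Matrix MeasureTheory

variable {n : ℕ}

/-! ### The divergence theorem -/

/-- As `V` vanishes off the compact set `Q`, its extension by zero is smooth with compact support on
the whole space. The claim is then integration by parts against the constant `1`. -/
lemma integral_partialDeriv_eq_zero {V : Coord n → ℝ} {U Q : Set (Coord n)} (hU : IsOpen U)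
    (hV : ContDiffOn ℝ ∞ V U) (hQ : IsCompact Q) (hQU : Q ⊆ U) (h0 : ∀ y ∈ U, y ∉ Q → V y = 0)
    (i : Fin n) : IntegrableOn (partialDeriv i V) U ∧ ∫ y in U, partialDeriv i V y = 0 := by
  set W : Coord n → ℝ := U.indicator V with hW
  have h1 : ∀ y ∉ Q, W y = 0 := fun y hy => by
    by_cases hyU : y ∈ U
    · rw [hW, Set.indicator_of_mem hyU, h0 y hyU hy]
    · rw [hW, Set.indicator_of_notMem hyU]
  have h2 : ∀ y ∈ U, W =ᶠ[nhds y] V := fun y hy => by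
    filter_upwards [hU.mem_nhds hy] with z hz
    rw [hW, Set.indicator_of_mem hz]
  have h3 : ∀ y ∉ Q, W =ᶠ[nhds y] fun _ => 0 := fun y hy => by
    filter_upwards [hQ.isClosed.isOpen_compl.mem_nhds hy] with z hz using h1 z hz
  have hc : ContDiff ℝ ∞ W := contDiff_iff_contDiffAt.2 fun y => by
    by_cases hy : y ∈ Q
    · exact (hV.contDiffAt (hU.mem_nhds (hQU hy))).congr_of_eventuallyEq (h2 y (hQU hy))
    · exact contDiffAt_const.congr_of_eventuallyEq (h3 y hy)
  have hs : HasCompactSupport W := HasCompactSupport.intro hQ h1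
  have hcd : Continuous (partialDeriv i W) :=
    (hc.continuous_fderiv (by simp)).clm_apply continuous_const
  have hsd : HasCompactSupport (partialDeriv i W) := hs.fderiv_apply (𝕜 := ℝ) _
  have hint : Integrable (partialDeriv i W) := hcd.integrable_of_hasCompactSupport hsd
  have e : Set.EqOn (partialDeriv i W) (partialDeriv i V) U := fun y hy =>
    Filter.EventuallyEq.partialDeriv_eq (h2 y hy) i
  refine ⟨hint.integrableOn.congr_fun e hU.measurableSet, ?_⟩
  rw [← setIntegral_congr_fun hU.measurableSet e,
    setIntegral_eq_integral_of_forall_compl_eq_zero fun y hy => ?_]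
  · have h := integral_mul_fderiv_eq_neg_fderiv_mul_of_integrable (μ := (volume : Measure (Coord n)))
      (f := fun _ => (1 : ℝ)) (g := W) (v := EuclideanSpace.single i (1 : ℝ)) (by simp)
      (by simp only [one_mul]; exact hint)
      (by simpa only [one_mul] using hc.continuous.integrable_of_hasCompactSupport hs)
      (fun _ _ => differentiableAt_const _) (fun _ _ => hc.differentiable (by simp) _)
    simpa [partialDeriv] using h
  · rw [Filter.EventuallyEq.partialDeriv_eq (h3 y fun h => hy (hQU h)) i]
    simp [partialDeriv]

/-- The classical expression of the divergence in coordinates. It rests on the fact that the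
logarithmic derivative of the volume density is the trace of the connection matrix. -/
lemma divT_mul_sqrt_det {G : CMetric n} {U : Set (Coord n)} (hG : RiemOn G U) {y : Coord n}
    (hy : y ∈ U) {T : TField n (Option (Fin 0))}
    (hT : ∀ c, DifferentiableAt ℝ (fun z => T z c) y) :
    divT G T y Fin.elim0 * Real.sqrt (G y).det = ∑ i, partialDeriv i (fun z =>
      (∑ j, (G z)⁻¹ i j * T z (oc j Fin.elim0)) * Real.sqrt (G z).det) y := by
  have hpos := (hG.posDef y hy).det_pos
  have hu := hG.isUnit_det hy
  have hD : ∀ i, DifferentiableAt ℝ (fun z => ∑ j, (G z)⁻¹ i j * T z (oc j Fin.elim0)) y := fun i =>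
    DifferentiableAt.fun_sum fun j _ => (hG.diffM_inv hy i j).fun_mul (hT _)
  have hS : DifferentiableAt ℝ (fun z => Real.sqrt (G z).det) y :=
    ((contDiffOn_det hG.smooth).contDiffAt (hG.isOpen.mem_nhds hy)).differentiableAt
      (by simp) |>.sqrt hpos.ne'
  have h1 : ∀ i, partialDeriv i (fun z => Real.sqrt (G z).det) y
      = (chrM G i y).trace * Real.sqrt (G y).det := by
    intro i
    have h2 := (hasDerivAt_det (A := fun s => G (lineAt y i s)) (A' := pdM i G y) (x := 0)
      (fun a b => hasDerivAt_line (hG.differentiableAt hy a b) i)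
      (by simpa using hpos.ne')).sqrt (by simpa using hpos.ne')
    have h3 := (hasDerivAt_line hS i).unique h2
    simp only [lineAt_zero] at h3
    have e1 : ((G y)⁻¹ * pdM i G y).trace = 2 * (chrM G i y).trace := by
      rw [pdM_metric hG hy, Matrix.mul_add, Matrix.trace_add,
        Matrix.nonsing_inv_mul_cancel_left _ _ hu, Matrix.trace_mul_comm, Matrix.mul_assoc,
        Matrix.mul_nonsing_inv _ hu, Matrix.mul_one, Matrix.trace_transpose, two_mul]
    rw [h3, e1]
    have hs0 := (Real.sqrt_pos.2 hpos).ne'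
    have hs : (G y).det = Real.sqrt (G y).det ^ 2 := (Real.sq_sqrt hpos.le).symm
    generalize Real.sqrt (G y).det = r at *
    rw [hs]
    field_simp
  have h4 : ∀ i, partialDeriv i (fun z => (∑ j, (G z)⁻¹ i j * T z (oc j Fin.elim0))
      * Real.sqrt (G z).det) y = (∑ j, (pdM i (fun z => (G z)⁻¹) y i j * T y (oc j Fin.elim0)
        + (G y)⁻¹ i j * pd i T y (oc j Fin.elim0))
        + (chrM G i y).trace * ∑ j, (G y)⁻¹ i j * T y (oc j Fin.elim0)) * Real.sqrt (G y).det := by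
    intro i
    rw [partialDeriv_mul i (hD i) hS, h1,
      partialDeriv_sum _ _ fun j _ => (hG.diffM_inv hy i j).fun_mul (hT _),
      Finset.sum_congr rfl fun j _ => partialDeriv_mul i (hG.diffM_inv hy i j) (hT _)]
    simp only [pdM, pd, Matrix.of_apply]
    ring
  rw [Finset.sum_congr rfl fun i _ => h4 i, ← Finset.sum_mul]
  congr 1
  have h0 : ∀ (A : Mat n) (t : Comp n (Fin 0)), der A t Fin.elim0 = 0 := fun A t => by simp [der]
  simp only [divT, trcC, gcov_oc, cov, Pi.sub_apply, der_oc, h0, add_zero, pdM_inv hG hy,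
    Matrix.sub_apply, Matrix.neg_apply, Matrix.mul_apply, Matrix.transpose_apply, mul_sub, sub_mul,
    neg_mul, Finset.sum_add_distrib, Finset.sum_sub_distrib, Finset.sum_neg_distrib, chrM,
    Matrix.of_apply, Matrix.trace, Matrix.diag_apply]
  have e1 : ∑ i, ∑ j, (∑ a, christoffel G i i a y * (G y)⁻¹ a j) * T y (oc j Fin.elim0)
      = ∑ i, (∑ a, christoffel G a i a y) * ∑ j, (G y)⁻¹ i j * T y (oc j Fin.elim0) := by
    simp only [Finset.sum_mul, Finset.mul_sum]
    calc _ = ∑ i, ∑ a, ∑ j, christoffel G i i a y * (G y)⁻¹ a j * T y (oc j Fin.elim0) :=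
          Finset.sum_congr rfl fun i _ => Finset.sum_comm
      _ = ∑ a, ∑ i, ∑ j, christoffel G i i a y * (G y)⁻¹ a j * T y (oc j Fin.elim0) :=
          Finset.sum_comm
      _ = _ := Finset.sum_congr rfl fun a _ => by
          rw [Finset.sum_comm]
          refine Finset.sum_congr rfl fun j _ => Finset.sum_congr rfl fun i _ => ?_
          rw [hG.christoffel_symm hy i i a]
          ring
  have e2 : ∑ i, ∑ j, (∑ b, (G y)⁻¹ i b * christoffel G j i b y) * T y (oc j Fin.elim0)
      = ∑ i, ∑ b, (G y)⁻¹ i b * ∑ j, christoffel G j i b y * T y (oc j Fin.elim0) := by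
    simp only [Finset.sum_mul, Finset.mul_sum]
    refine Finset.sum_congr rfl fun i _ => ?_
    rw [Finset.sum_comm]
    exact Finset.sum_congr rfl fun b _ => Finset.sum_congr rfl fun j _ => by ring
  rw [e1, e2]
  ring

lemma integral_divT_eq_zero {G : CMetric n} {U Q : Set (Coord n)} (hG : RiemOn G U)
    {T : TField n (Option (Fin 0))} (hT : ∀ c, ContDiffOn ℝ ∞ (fun y => T y c) U)
    (hQ : IsCompact Q) (hQU : Q ⊆ U) (h0 : ∀ y ∈ U, y ∉ Q → T y = 0) :
    ∫ y in U, divT G T y Fin.elim0 * Real.sqrt (G y).det = 0 := by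
  have hS : ContDiffOn ℝ ∞ (fun z => Real.sqrt (G z).det) U :=
    (contDiffOn_det hG.smooth).sqrt fun y hy => (hG.posDef y hy).det_pos.ne'
  have h := fun i : Fin n => integral_partialDeriv_eq_zero (V := fun z =>
      (∑ j, (G z)⁻¹ i j * T z (oc j Fin.elim0)) * Real.sqrt (G z).det) hG.isOpen
    ((ContDiffOn.sum fun j _ => (hG.contDiffOn_inv i j).mul (hT _)).mul hS) hQ hQU
    (fun y hy hyQ => by simp [h0 y hy hyQ]) i
  rw [setIntegral_congr_fun hG.isOpen.measurableSet fun y hy =>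
    divT_mul_sqrt_det hG hy fun c => ContDiffOn.diffAt hG.isOpen (hT c) hy,
    integral_finsetSum _ fun i _ => (h i).1]
  exact Finset.sum_eq_zero fun i _ => (h i).2

end Divergence

/-! ### The divergence theorem on a compact manifold -/

section ManifoldDivergence

open Function Matrix MeasureTheory

variable {n : ℕ} {M : Type*} [TopologicalSpace M] [ChartedSpace (Coord n) M]
  [IsManifold (𝓡 n) ∞ M] [MeasurableSpace M] [BorelSpace M] [CompactSpace M] [T2Space M]

/-- The case of a field supported in a single chart domain. The field is a compatible family of
local expressions rather than a natural tensor, since naturality is lost after multiplication by a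
cutoff function. -/
lemma integral_divT_chart_eq_zero {g : SmoothMetric n M} (hg : ChartSmooth g)
    {T : M → TField n (Option (Fin 0))}
    (hT : ∀ x c, ContDiffOn ℝ ∞ (fun y => T x y c) (chartAt (Coord n) x).target)
    (hc : ∀ x x', ∀ y ∈ coordDom n x x',
      T x y = act (Jac (coordChange n x x') y) (T x' (coordChange n x x' y)))
    (x₀ : M) {K : Set M} (hK : IsCompact K) (hKs : K ⊆ (chartAt (Coord n) x₀).source)
    (h0 : ∀ x, ∀ y ∈ (chartAt (Coord n) x).target, (chartAt (Coord n) x).symm y ∉ K → T x y = 0) :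
    Continuous (chartVal fun x y => divT (metricCoord g (chartAt (Coord n) x)) (T x) y Fin.elim0) ∧
    ∫ z, chartVal (fun x y => divT (metricCoord g (chartAt (Coord n) x)) (T x) y Fin.elim0) z
      ∂(vol g) = 0 := by
  set v : M → Coord n → ℝ := fun x y =>
    divT (metricCoord g (chartAt (Coord n) x)) (T x) y Fin.elim0 with hv
  have hcompat : ChartCompat v := by
    intro x x' y hy
    have hφ := lDiffeo_coordChange n x x'
    have h1 : T x =ᶠ[nhds y] pullT (coordChange n x x') (T x') := by
      filter_upwards [(isOpen_coordDom x x').mem_nhds hy] with z hz using hc x x' z hz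
    have h2 := gcov_pull hφ (hg.riemOn x') hy fun c =>
      ContDiffOn.diffAt (chartAt (Coord n) x').open_target (hT x' c) (hφ.mapsTo hy)
    simp only [hv, divT]
    rw [gcov_congr (metricCoord_eventuallyEq g hy) h1, h2, metricCoord_coordChange g hy, trcC_act,
      pullG_inv hφ _ hy, act_empty]
  have hcont : ∀ x, ContinuousOn (v x) (chartAt (Coord n) x).target := fun x => by
    simp only [hv, divT, trcC]
    exact continuousOn_finsetSum _ fun a _ => continuousOn_finsetSum _ fun b _ =>
      ((hg.riemOn x).contDiffOn_inv a b).continuousOn.mul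
        (contDiffOn_gcov' (hg.riemOn x) (hT x) _).continuousOn
  have hC := hcompat.continuous hcont
  refine ⟨hC, ?_⟩
  have hz : ∀ z, z ∉ (chartAt (Coord n) x₀).source → chartVal v z = 0 := by
    intro z hz
    have hs := mem_chart_source (Coord n) z
    have hy := (chartAt (Coord n) z).map_source hs
    have hK' : (chartAt (Coord n) z).symm (chartAt (Coord n) z z) ∈ Kᶜ := by
      rw [(chartAt (Coord n) z).left_inv hs]
      exact fun h => hz (hKs h)
    have h1 : T z =ᶠ[nhds (chartAt (Coord n) z z)] fun _ => 0 := by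
      filter_upwards [(chartAt (Coord n) z).open_target.mem_nhds hy,
        ((chartAt (Coord n) z).continuousAt_symm hy).preimage_mem_nhds
          (hK.isClosed.isOpen_compl.mem_nhds hK')] with w hw hw' using h0 z w hw hw'
    simp only [chartVal, hv, divT]
    rw [gcov_congr (Filter.EventuallyEq.refl _ _) h1, gcov_zero]
    simp [trcC]
  rw [integral_vol_of_chart hg x₀ hC hz, setIntegral_congr_fun
    (chartAt (Coord n) x₀).open_target.measurableSet fun y hy => by
      rw [hcompat.apply x₀ hy]]
  exact integral_divT_eq_zero (hg.riemOn x₀) (hT x₀) (isCompact_chartImg x₀ hK hKs)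
    Set.inter_subset_left fun y hy hyQ => h0 x₀ y hy fun h => hyQ ⟨hy, h⟩

/-- The divergence theorem on a compact manifold. -/
lemma integral_div_eq_zero {g : SmoothMetric n M} (hg : ChartSmooth g)
    {X : CMetric n → TField n (Option (Fin 0))} (hX : IsNat X) :
    ∫ z, chartVal (natV g fun G y => divT G (X G) y Fin.elim0) z ∂(vol g) = 0 := by
  obtain ⟨t, ρ, hρ, hs, h1⟩ := exists_partition n M
  set G : M → CMetric n := fun x => metricCoord g (chartAt (Coord n) x) with hG
  set φ : t → M → Coord n → ℝ := fun k x y => ρ k ((chartAt (Coord n) x).symm y) with hφd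
  have hφ : ∀ k x, ContDiffOn ℝ ∞ (φ k x) (chartAt (Coord n) x).target := fun k x =>
    contMDiffOn_iff_contDiffOn.1 ((hρ k).comp_contMDiffOn contMDiffOn_chart_symm)
  have hXs : ∀ x c, ContDiffOn ℝ ∞ (fun y => X (G x) y c) (chartAt (Coord n) x).target :=
    fun x c => hX.contDiffOn (hg.riemOn x) c
  have key := fun k : t => integral_divT_chart_eq_zero hg (T := fun x y => φ k x y • X (G x) y)
    (fun x c => (hφ k x).mul (hXs x c))
    (fun x x' y hy => by
      have e : X (G x) y
          = act (Jac (coordChange n x x') y) (X (G x') (coordChange n x x' y)) := by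
        rw [← hX.pull (lDiffeo_coordChange n x x') (hg.riemOn x') y hy]
        exact hX.congr (metricCoord_eventuallyEq g hy)
      have e2 : φ k x' (coordChange n x x' y) = φ k x y := by
        simp only [hφd, symm_coordChange hy]
      rw [e2, e]
      funext c
      simp only [Pi.smul_apply, smul_eq_mul, act, Finset.mul_sum]
      exact Finset.sum_congr rfl fun _ _ => by ring)
    k (isClosed_tsupport (ρ k)).isCompact (hs k)
    (fun x y _ hK => by simp only [hφd, image_eq_zero_of_notMem_tsupport hK, zero_smul])
  -- The product rule for each `φ k • X`: the functions `φ k` add up to one and their derivatives to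
  -- zero, so the divergences add up to that of `X`.
  have hsum : ∀ z, chartVal (natV g fun G y => divT G (X G) y Fin.elim0) z
      = ∑ k : t, chartVal (fun x y => divT (G x) (fun y => φ k x y • X (G x) y) y Fin.elim0) z := by
    intro z
    have hy := (chartAt (Coord n) z).map_source (mem_chart_source (Coord n) z)
    have ho := (chartAt (Coord n) z).open_target
    have hd := fun k => ContDiffOn.diffAt ho (hφ k z) hy
    have e := fun k => divT_funMul (G z) (hd k) (T := X (G z))
      fun c => ContDiffOn.diffAt ho (hXs z c) hy
    have e1 : ∀ a, ∑ k, partialDeriv a (φ k z) (chartAt (Coord n) z z) = 0 := fun a => by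
      have h2 := partialDeriv_sum Finset.univ a fun k _ => hd k
      rw [← h2]
      simp only [hφd, h1, partialDeriv_const]
    simp only [chartVal]
    rw [Finset.sum_congr rfl fun k _ => e k, Finset.sum_add_distrib, ← Finset.sum_mul]
    have e2 : ∑ k, φ k z (chartAt (Coord n) z z) = 1 := h1 _
    rw [e2, one_mul, Finset.sum_comm]
    refine (zero_add _).symm.trans (congrArg (· + _) (Finset.sum_eq_zero fun a _ => ?_).symm)
    rw [Finset.sum_comm]
    refine Finset.sum_eq_zero fun b _ => ?_
    rw [← Finset.mul_sum, ← Finset.sum_mul, e1, zero_mul, mul_zero]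
  rw [integral_congr_ae (Filter.Eventually.of_forall hsum),
    integral_finsetSum _ fun k _ => integrable_vol hg (key k).1]
  exact Finset.sum_eq_zero fun k _ => (key k).2

/-- Integration of natural functions over a compact Riemannian manifold. -/
def intVol (g : SmoothMetric n M) (f : CMetric n → Coord n → ℝ) : ℝ :=
  ∫ z, chartVal (natV g f) z ∂(vol g)

omit [MeasurableSpace M] [BorelSpace M] [CompactSpace M] [T2Space M] in
lemma continuous_natV {g : SmoothMetric n M} (hg : ChartSmooth g) {f : CMetric n → Coord n → ℝ}
    (hf : IsNatCont f) : Continuous (chartVal (natV g f)) :=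
  (chartCompat_natV hg hf).continuous (continuousOn_natV hg hf)

lemma integrable_natV {g : SmoothMetric n M} (hg : ChartSmooth g) {f : CMetric n → Coord n → ℝ}
    (hf : IsNatCont f) : Integrable (chartVal (natV g f)) (vol g) :=
  integrable_vol hg (continuous_natV hg hf)

/-- Integration over a compact Riemannian manifold as an abstract integral. -/
def cInt (g : SmoothMetric n M) (hg : ChartSmooth g) : CInt n where
  toFun := intVol g
  map_add _ _ hf hf' := integral_add (integrable_natV hg hf) (integrable_natV hg hf')
  map_smul r _ _ := integral_const_mul r _
  mono _ _ hf hf' h := integral_mono (integrable_natV hg hf) (integrable_natV hg hf') fun z =>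
    h _ _ (hg.riemOn z) _ ((chartAt (Coord n) z).map_source (mem_chart_source (Coord n) z))
  map_div _ hX := integral_div_eq_zero hg hX

end ManifoldDivergence

/-! ### Differentiation of integrals along the flow -/

section Evolution

open Function Matrix MeasureTheory

variable {n : ℕ}

/-! ### Evolution of integrals -/

lemma hasDerivAt_setIntegral {Q : Set (Coord n)} (hQ : IsCompact Q) {I : Set ℝ}
    {F F' : ℝ → Coord n → ℝ} (hF : ContinuousOn (fun q : ℝ × Coord n => F q.1 q.2) (I ×ˢ Q))
    (hF' : ContinuousOn (fun q : ℝ × Coord n => F' q.1 q.2) (I ×ˢ Q))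
    (hd : ∀ t, I ∈ nhds t → ∀ y ∈ Q, HasDerivAt (fun s => F s y) (F' t y) t) {t : ℝ}
    (ht : I ∈ nhds t) : HasDerivAt (fun s => ∫ y in Q, F s y) (∫ y in Q, F' t y) t := by
  obtain ⟨δ, hδ, hI⟩ := Metric.nhds_basis_closedBall.mem_iff.1 (interior_mem_nhds.2 ht)
  have hII := hI.trans interior_subset
  obtain ⟨C, hC⟩ := ((isCompact_closedBall t δ).prod hQ).exists_bound_of_continuousOn
    (hF'.mono (Set.prod_mono_left hII))
  have hsl : ∀ {F : ℝ → Coord n → ℝ},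
      ContinuousOn (fun q : ℝ × Coord n => F q.1 q.2) (I ×ˢ Q) → ∀ s ∈ I, ContinuousOn (F s) Q :=
    fun h s hs => h.comp (f := fun y => (s, y)) (continuous_const.prodMk continuous_id).continuousOn
      fun _ hy => ⟨hs, hy⟩
  refine (hasDerivAt_integral_of_dominated_loc_of_deriv_le (bound := fun _ => C)
    (Metric.closedBall_mem_nhds t hδ) ?_ ((hsl hF t (mem_of_mem_nhds ht)).integrableOn_compact hQ)
    ((hsl hF' t (mem_of_mem_nhds ht)).aestronglyMeasurable hQ.measurableSet) ?_ ?_ ?_).2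
  · filter_upwards [ht] with s hs using (hsl hF s hs).aestronglyMeasurable hQ.measurableSet
  · filter_upwards [ae_restrict_mem hQ.measurableSet] with y hy s hs using hC (s, y) ⟨hs, hy⟩
  · have : IsFiniteMeasure (volume.restrict Q) := ⟨by simpa using hQ.measure_lt_top⟩
    exact integrable_const C
  · filter_upwards [ae_restrict_mem hQ.measurableSet] with y hy s hs using
      hd s (mem_interior_iff_mem_nhds.1 (hI hs)) y hy

lemma continuousOn_setIntegral {Q : Set (Coord n)} (hQ : IsCompact Q) {I : Set ℝ}
    (hI : IsCompact I) {F : ℝ → Coord n → ℝ}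
    (hF : ContinuousOn (fun q : ℝ × Coord n => F q.1 q.2) (I ×ˢ Q)) :
    ContinuousOn (fun s => ∫ y in Q, F s y) I := by
  obtain ⟨C, hC⟩ := (hI.prod hQ).exists_bound_of_continuousOn hF
  refine continuousOn_of_dominated (bound := fun _ => C) (fun s hs => ?_) (fun s hs => ?_) ?_ ?_
  · exact (hF.comp (f := fun y => (s, y)) (continuous_const.prodMk continuous_id).continuousOn
      fun _ hy => ⟨hs, hy⟩).aestronglyMeasurable hQ.measurableSet
  · filter_upwards [ae_restrict_mem hQ.measurableSet] with y hy using hC (s, y) ⟨hs, hy⟩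
  · have : IsFiniteMeasure (volume.restrict Q) := ⟨by simpa using hQ.measure_lt_top⟩
    exact integrable_const C
  · filter_upwards [ae_restrict_mem hQ.measurableSet] with y hy
    exact hF.comp (f := fun s => (s, y)) (continuous_id.prodMk continuous_const).continuousOn
      fun _ hs => ⟨hs, hy⟩

lemma timeInterval_mem_nhds {T : EReal} {t : ℝ} (ht : 0 < t) (htT : (t : EReal) < T) :
    timeInterval T ∈ nhds t := by
  filter_upwards [lt_mem_nhds ht, (isOpen_Iio.preimage continuous_coe_real_ereal).mem_nhds htT]
    with s hs hs' using ⟨hs.le, hs'⟩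

lemma Icc_subset_timeInterval {T : EReal} {t : ℝ} (htT : (t : EReal) < T) :
    Set.Icc 0 t ⊆ timeInterval T := fun _ hs =>
  ⟨hs.1, (EReal.coe_le_coe_iff.2 hs.2).trans_lt htT⟩

lemma uniqueDiffOn_timeInterval {T : EReal} {t : ℝ} (ht : 0 < t) (htT : (t : EReal) < T) :
    UniqueDiffOn ℝ (timeInterval T) := by
  refine uniqueDiffOn_convex (Set.OrdConnected.convex ⟨fun x hx y hy z hz => ?_⟩)
    ⟨t, mem_interior_iff_mem_nhds.2 (timeInterval_mem_nhds ht htT)⟩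
  exact ⟨hx.1.trans hz.1, (EReal.coe_le_coe_iff.2 hz.2).trans_lt hy.2⟩

variable {M : Type*} [TopologicalSpace M] [ChartedSpace (Coord n) M] [IsManifold (𝓡 n) ∞ M]
  {P : FlowOperator} {g₀ : SmoothMetric n M} {T : EReal} {g : ℝ → SmoothMetric n M}

/-- Restriction of the joint smoothness of the flow to a fixed time. -/
lemma IsFlowSolution.chartSmooth (h : IsFlowSolution P g₀ T g) {t : ℝ} (ht : t ∈ timeInterval T) :
    ChartSmooth (g t) := fun x i j =>
  contDiffOn_slice (f := fun t y => metricCoord (g t) (chartAt (Coord n) x) y i j)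
    (h.smooth _ (chart_mem_atlas _ x) i j) ht

lemma IsFlowSolution.flowOn (h : IsFlowSolution P g₀ T g) (hu : UniqueDiffOn ℝ (timeInterval T))
    (x : M) : FlowOn (flowT P) (fun s => metricCoord (g s) (chartAt (Coord n) x)) (timeInterval T)
      (chartAt (Coord n) x).target where
  uniqueDiff := hu
  isOpen := (chartAt (Coord n) x).open_target
  smooth := h.smooth _ (chart_mem_atlas _ x)
  posDef _ _ _ hy := posDef_metricCoord _ x hy
  evol t ht y hy i j := (h.evolution t (mem_of_mem_nhds ht) _ (chart_mem_atlas _ x) y hy i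
    j).hasDerivAt ht

lemma IsFlowSolution.continuousOn_integrand (h : IsFlowSolution P g₀ T g)
    (hu : UniqueDiffOn ℝ (timeInterval T)) {f : CMetric n → Coord n → ℝ} (hf : IsNatCont f)
    {ρ : M → ℝ} (hρ : Continuous ρ) (x : M) (B : Set M) :
    ContinuousOn (fun q : ℝ × Coord n => ρ ((chartAt (Coord n) x).symm q.2)
      * (natV (g q.1) f x q.2 * dens (g q.1) x q.2)) (timeInterval T ×ˢ chartImg x B) := by
  have hF := (h.flowOn hu x).toRiemFam
  refine ContinuousOn.mono (.mul ?_ ((hf.cont hF).mul (contDiffOn_det hF.smooth).continuousOn.sqrt))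
    (Set.prod_mono_right Set.inter_subset_left)
  exact hρ.comp_continuousOn ((chartAt (Coord n) x).continuousOn_symm.comp continuousOn_snd
    fun q hq => hq.2)

variable [MeasurableSpace M] [BorelSpace M] [CompactSpace M] [T2Space M]

/-- The partition of unity does not depend on time. The integral is thus a sum of integrals over
fixed compact sets of coordinates, which can be differentiated under the integral sign. -/
lemma IsFlowSolution.intVol_eq (h : IsFlowSolution P g₀ T g)
    {f : CMetric n → Coord n → ℝ} (hf : IsNatCont f) {t : Finset M} {ρ : t → M → ℝ}
    (hρ : ∀ k, Continuous (ρ k))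
    (hs : ∀ k : t, tsupport (ρ k) ⊆ (chartAt (Coord n) (k : M)).source)
    (h1 : ∀ x, ∑ k, ρ k x = 1) {s : ℝ} (hsT : s ∈ timeInterval T) :
    intVol (g s) f = ∑ k : t, ∫ y in chartImg (k : M) (tsupport (ρ k)),
      ρ k ((chartAt (Coord n) (k : M)).symm y) * (natV (g s) f k y * dens (g s) k y) :=
  have hg := h.chartSmooth hsT
  integral_chartVal hg (chartCompat_natV hg hf) (continuousOn_natV hg hf) hρ hs h1

lemma IsFlowSolution.hasDerivAt_intVol (h : IsFlowSolution P g₀ T g)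
    (hu : UniqueDiffOn ℝ (timeInterval T)) {f f' : CMetric n → Coord n → ℝ} (hf : IsNatCont f)
    (hf' : IsNatCont f') (hd : FlowDens (flowT P) f f') {t : ℝ} (ht : timeInterval T ∈ nhds t) :
    HasDerivAt (fun s => intVol (g s) f) (intVol (g t) f') t := by
  obtain ⟨S, ρ, hρ, hs, h1⟩ := exists_partition n M
  have hρ' := fun k => (hρ k).continuous
  rw [h.intVol_eq hf' hρ' hs h1 (mem_of_mem_nhds ht)]
  have hk : ∀ k : S, HasDerivAt (fun s => ∫ y in chartImg (k : M) (tsupport (ρ k)),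
      ρ k ((chartAt (Coord n) (k : M)).symm y) * (natV (g s) f k y * dens (g s) k y))
      (∫ y in chartImg (k : M) (tsupport (ρ k)),
        ρ k ((chartAt (Coord n) (k : M)).symm y) * (natV (g t) f' k y * dens (g t) k y)) t :=
    fun k => hasDerivAt_setIntegral
      (isCompact_chartImg (k : M) (isClosed_tsupport (ρ k)).isCompact (hs k))
      (h.continuousOn_integrand hu hf (hρ' k) k _) (h.continuousOn_integrand hu hf' (hρ' k) k _)
      (fun s hsI y hy => (hd _ _ _ (h.flowOn hu (k : M)) s hsI y hy.1).const_mul _) ht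
  refine (HasDerivAt.fun_sum fun k _ => hk k).congr_of_eventuallyEq ?_
  filter_upwards [ht] with s hsT using h.intVol_eq hf hρ' hs h1 hsT

lemma IsFlowSolution.continuousOn_intVol (h : IsFlowSolution P g₀ T g)
    (hu : UniqueDiffOn ℝ (timeInterval T)) {f : CMetric n → Coord n → ℝ} (hf : IsNatCont f) {t : ℝ}
    (htT : (t : EReal) < T) : ContinuousOn (fun s => intVol (g s) f) (Set.Icc 0 t) := by
  obtain ⟨S, ρ, hρ, hs, h1⟩ := exists_partition n M
  have hρ' := fun k => (hρ k).continuous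
  have hI := Icc_subset_timeInterval htT
  have hk : ∀ k : S, ContinuousOn (fun s => ∫ y in chartImg (k : M) (tsupport (ρ k)),
      ρ k ((chartAt (Coord n) (k : M)).symm y) * (natV (g s) f k y * dens (g s) k y))
      (Set.Icc 0 t) := fun k => continuousOn_setIntegral
    (isCompact_chartImg (k : M) (isClosed_tsupport (ρ k)).isCompact (hs k)) isCompact_Icc
    ((h.continuousOn_integrand hu hf (hρ' k) k _).mono (Set.prod_mono_left hI))
  exact (continuousOn_finsetSum _ fun k _ => hk k).congr
    fun s hs' => h.intVol_eq hf hρ' hs h1 (hI hs')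

end Evolution

/-! ### The hierarchy of energy inequalities -/

section Smoothing

/-! ### The smoothing estimate -/

lemma le_of_hasDerivAt_nonpos {f f' : ℝ → ℝ} {t : ℝ} (ht : 0 ≤ t) (hf : ContinuousOn f (Set.Icc 0 t))
    (hd : ∀ s ∈ Set.Ioo 0 t, HasDerivAt f (f' s) s) (h0 : ∀ s ∈ Set.Ioo 0 t, f' s ≤ 0) :
    f t ≤ f 0 := by
  refine antitoneOn_of_deriv_nonpos (convex_Icc 0 t) hf (fun s hs => ?_) (fun s hs => ?_)
    (Set.left_mem_Icc.2 ht) (Set.right_mem_Icc.2 ht) ht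
  · rw [interior_Icc] at hs
    exact (hd s hs).differentiableAt.differentiableWithinAt
  · rw [interior_Icc] at hs
    rw [(hd s hs).deriv]
    exact h0 s hs

/-- The weights of the energies in the smoothing estimate. -/
def energyWeight (c : ℕ → ℝ) : ℕ → ℝ
  | 0 => 1
  | j + 1 => energyWeight c j * c j / (j + 1)

lemma energyWeight_pos {c : ℕ → ℝ} (hc : ∀ j, 0 < c j) : ∀ j, 0 < energyWeight c j
  | 0 => one_pos
  | j + 1 => div_pos (mul_pos (energyWeight_pos hc j) (hc j)) (by positivity)

/-- A hierarchy of differential inequalities `e_j' ≤ -c_j e_{j+1} + C_j B^{j+1} e_0` forces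
`t^k e_k(t)` to be bounded in terms of `e_0(0)`. -/
lemma exists_smoothing_constant {c C : ℕ → ℝ} (hc : ∀ j, 0 < c j) (hC : ∀ j, 0 ≤ C j) (k : ℕ) :
    ∃ K : ℝ, 0 ≤ K ∧ ∀ (e e' : ℕ → ℝ → ℝ) (t B : ℝ), 0 ≤ t → 0 ≤ B →
      (∀ j, ContinuousOn (e j) (Set.Icc 0 t)) →
      (∀ j, ∀ s ∈ Set.Ioo 0 t, HasDerivAt (e j) (e' j s) s) →
      (∀ j, ∀ s ∈ Set.Icc 0 t, 0 ≤ e j s) →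
      (∀ j, ∀ s ∈ Set.Ioo 0 t, e' j s ≤ -c j * e (j + 1) s + C j * B ^ (j + 1) * e 0 s) →
      t ^ k * e k t ≤ e 0 0 * Real.exp (K * (1 + B * t)) := by
  set β := energyWeight c with hβ
  have hβ0 : ∀ j, 0 < β j := energyWeight_pos hc
  set S : ℝ := ∑ j ∈ Finset.range (k + 1), β j * C j * (j.factorial : ℝ) with hS
  have hS0 : 0 ≤ S := Finset.sum_nonneg fun j _ =>
    mul_nonneg (mul_nonneg (hβ0 j).le (hC j)) (Nat.cast_nonneg _)
  -- The two parts of the growth rate: `C 0` comes from the growth of `e 0`, and `1` from bounding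
  -- the powers of `B * s` by an exponential.
  set l : ℝ := 1 + C 0 with hl
  have hl1 : 1 ≤ l := by linarith [hC 0]
  -- The logarithm puts the prefactor `(1 + S) / β k` into the exponent.
  refine ⟨l + |Real.log ((1 + S) / β k)|, by positivity, ?_⟩
  intro e e' t B ht hB hcont hder hpos hle
  have hmem : ∀ s ∈ Set.Ioo 0 t, s ∈ Set.Icc 0 t := fun s hs => Set.Ioo_subset_Icc_self hs
  have h0 : 0 ≤ e 0 0 := hpos 0 0 (Set.left_mem_Icc.2 ht)
  -- Grönwall's inequality for the lowest energy, whose dissipation is simply dropped.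
  have step1 : ∀ s ∈ Set.Icc 0 t, e 0 s ≤ e 0 0 * Real.exp (C 0 * B * s) := by
    intro s hs
    have hsub : Set.Ioo 0 s ⊆ Set.Ioo 0 t := Set.Ioo_subset_Ioo_right hs.2
    have h := le_of_hasDerivAt_nonpos (f := fun s => e 0 s * Real.exp (-(C 0 * B * s)))
      (f' := fun s => (e' 0 s - C 0 * B * e 0 s) * Real.exp (-(C 0 * B * s))) hs.1
      (((hcont 0).mono (Set.Icc_subset_Icc_right hs.2)).mul (by fun_prop)) (fun r hr => by
        have h1 : HasDerivAt (fun s => Real.exp (-(C 0 * B * s)))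
            (Real.exp (-(C 0 * B * r)) * -(C 0 * B * 1)) r :=
          (((hasDerivAt_id r).const_mul (C 0 * B)).neg).exp
        exact ((hder 0 r (hsub hr)).mul h1).congr_deriv (by ring)) fun r hr => by
        refine mul_nonpos_of_nonpos_of_nonneg ?_ (Real.exp_pos _).le
        have h1 := hle 0 r (hsub hr)
        have h2 := mul_nonneg (hc 0).le (hpos 1 r (hmem r (hsub hr)))
        simp only [zero_add, pow_one] at h1
        linarith
    simp only [mul_zero, neg_zero, Real.exp_zero, mul_one] at h
    rw [Real.exp_neg, ← div_eq_mul_inv, div_le_iff₀ (Real.exp_pos _)] at h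
    exact h
  set Φ : ℝ → ℝ := fun s => ∑ j ∈ Finset.range (k + 1), β j * (s ^ j * e j s) with hΦ
  have step2 := le_of_hasDerivAt_nonpos
    (f := fun s => Φ s - e 0 0 * S * Real.exp (l * B * s))
    (f' := fun s => (∑ j ∈ Finset.range (k + 1),
      β j * (j * s ^ (j - 1) * e j s + s ^ j * e' j s))
        - e 0 0 * S * (Real.exp (l * B * s) * (l * B))) ht
    ((continuousOn_finsetSum _ fun j _ => continuousOn_const.mul
      ((continuous_pow j).continuousOn.mul (hcont j))).sub (by fun_prop))
    (fun s hs => by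
      have h1 : HasDerivAt (fun s => Real.exp (l * B * s)) (Real.exp (l * B * s) * (l * B)) s := by
        simpa using ((hasDerivAt_id s).const_mul (l * B)).exp
      exact (HasDerivAt.fun_sum fun j _ => ((hasDerivAt_pow j s).mul (hder j s hs)).const_mul
        (β j)).sub (h1.const_mul _)) fun s hs => by
      have hs0 := hs.1.le
      have hE := step1 s (hmem s hs)
      have hterm : ∀ j ∈ Finset.range (k + 1),
          β j * (j * s ^ (j - 1) * e j s + s ^ j * e' j s)
          ≤ (β j * (j * s ^ (j - 1) * e j s)
            - β (j + 1) * (((j + 1 : ℕ) : ℝ) * s ^ (j + 1 - 1) * e (j + 1) s))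
            + β j * C j * (j.factorial : ℝ) * (B * Real.exp (B * s) * e 0 s) := by
        intro j _
        have h1 := mul_le_mul_of_nonneg_left (hle j s hs)
          (mul_nonneg (hβ0 j).le (pow_nonneg hs0 j))
        -- The recursion of the weights: the term from differentiating `s ^ (j + 1)` is matched with
        -- the dissipation of `e j`. The sum over `j` therefore telescopes, and its last term has
        -- the favourable sign.
        have h2 : β (j + 1) * ((j + 1 : ℕ) : ℝ) = β j * c j := by
          have : ((j : ℝ) + 1) ≠ 0 := by positivity
          simp only [hβ, energyWeight]
          push_cast
          field_simp
        -- Thus `s ^ j * B ^ (j + 1)` is at most `j! * B * exp (B * s)`: every error term has the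
        -- same form, and the final bound depends on `B` and `t` only through `B * t`.
        have h3 : (B * s) ^ j ≤ (j.factorial : ℝ) * Real.exp (B * s) := by
          have := Real.pow_div_factorial_le_exp (B * s) (mul_nonneg hB hs0) j
          rwa [div_le_iff₀ (by positivity), mul_comm (Real.exp _)] at this
        have h4 := mul_le_mul_of_nonneg_left h3
          (mul_nonneg (mul_nonneg (mul_nonneg (hβ0 j).le (hC j)) hB) (hpos 0 s (hmem s hs)))
        rw [mul_pow] at h4
        have h5 : β (j + 1) * (((j + 1 : ℕ) : ℝ) * s ^ (j + 1 - 1) * e (j + 1) s)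
            = β j * c j * s ^ j * e (j + 1) s := by
          rw [← h2, Nat.add_sub_cancel]; ring
        rw [h5]
        have h6 : B ^ (j + 1) = B * B ^ j := pow_succ' B j
        rw [h6] at h1
        linarith
      have hsum := Finset.sum_le_sum hterm
      rw [Finset.sum_add_distrib, Finset.sum_range_sub', ← Finset.sum_mul, ← hS] at hsum
      have hlast : 0 ≤ β (k + 1) * (((k + 1 : ℕ) : ℝ) * s ^ (k + 1 - 1) * e (k + 1) s) :=
        mul_nonneg (hβ0 _).le (mul_nonneg (mul_nonneg (Nat.cast_nonneg _) (pow_nonneg hs0 _))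
          (hpos _ s (hmem s hs)))
      simp only [Nat.cast_zero, zero_mul, mul_zero] at hsum
      have h7 : S * (B * Real.exp (B * s) * e 0 s)
          ≤ e 0 0 * S * (Real.exp (l * B * s) * B) := by
        have h8 := mul_le_mul_of_nonneg_left hE
          (mul_nonneg hS0 (mul_nonneg hB (Real.exp_pos (B * s)).le))
        have h9 : Real.exp (l * B * s) = Real.exp (B * s) * Real.exp (C 0 * B * s) := by
          rw [← Real.exp_add]; congr 1; rw [hl]; ring
        rw [h9]
        linarith
      have h10 : e 0 0 * S * (Real.exp (l * B * s) * B)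
          ≤ e 0 0 * S * (Real.exp (l * B * s) * (l * B)) :=
        mul_le_mul_of_nonneg_left (mul_le_mul_of_nonneg_left (by nlinarith) (Real.exp_pos _).le)
          (mul_nonneg h0 hS0)
      linarith
  have hΦ0 : Φ 0 = e 0 0 := by
    simp only [hΦ, Finset.sum_range_succ']
    simp [hβ, energyWeight]
  have hΦt : β k * (t ^ k * e k t) ≤ Φ t :=
    Finset.single_le_sum (f := fun j => β j * (t ^ j * e j t)) (fun j _ => mul_nonneg (hβ0 j).le
      (mul_nonneg (pow_nonneg ht j) (hpos j t (Set.right_mem_Icc.2 ht))))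
      (Finset.mem_range.2 k.lt_succ_self)
  have hlBt : 0 ≤ l * B * t := by positivity
  have h1 : β k * (t ^ k * e k t) ≤ e 0 0 * (1 + S) * Real.exp (l * B * t) := by
    have h2 : e 0 0 * 1 ≤ e 0 0 * Real.exp (l * B * t) :=
      mul_le_mul_of_nonneg_left (Real.one_le_exp hlBt) h0
    simp only [hΦ0, mul_zero, Real.exp_zero] at step2
    nlinarith [mul_nonneg h0 hS0]
  have hq : 0 < (1 + S) / β k := div_pos (by positivity) (hβ0 k)
  have h3 : t ^ k * e k t ≤ e 0 0 * ((1 + S) / β k * Real.exp (l * B * t)) := by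
    rw [← mul_le_mul_iff_right₀ (hβ0 k)]
    refine h1.trans_eq ?_
    have := (hβ0 k).ne'
    field_simp
  refine h3.trans (mul_le_mul_of_nonneg_left ?_ h0)
  rw [← Real.exp_log hq, ← Real.exp_add, Real.log_exp]
  refine Real.exp_le_exp.2 ?_
  have h4 := le_abs_self (Real.log ((1 + S) / β k))
  have h5 := mul_nonneg (abs_nonneg (Real.log ((1 + S) / β k))) (mul_nonneg hB ht)
  nlinarith

end Smoothing

/-! ### The smoothing estimate on a manifold -/

section Main

open MeasureTheory

variable {n : ℕ} {M : Type*} [TopologicalSpace M] [ChartedSpace (Coord n) M]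
  [IsManifold (𝓡 n) ∞ M]

lemma isNatCont_rmN_sq (k : ℕ) : IsNatCont (n := n) fun G y => rmN k G y ^ 2 :=
  (IsNatCont.rmN k).pow 2

lemma normSqRm_eq {g : SmoothMetric n M} (hg : ChartSmooth g) (k : ℕ) (x : M) :
    normSqRm g k x = 1 / 4 * chartVal (natV g fun G y => rmN k G y ^ 2) x := by
  have h := nrm_sq ((hg.riemOn x).inv_posDef
    ((chartAt (Coord n) x).map_source (mem_chart_source (Coord n) x)))
    (iterCovDeriv (metricCoord g (chartAt (Coord n) x))
      (riem (metricCoord g (chartAt (Coord n) x))) k (chartAt (Coord n) x x))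
  exact congrArg (1 / 4 * ·) h.symm

variable [MeasurableSpace M] [BorelSpace M] [CompactSpace M] [T2Space M]

omit [BorelSpace M] [T2Space M] in
lemma integral_normSqRm {g : SmoothMetric n M} (hg : ChartSmooth g) (k : ℕ) :
    ∫ x, normSqRm g k x ∂(vol g) = 1 / 4 * intVol g fun G y => rmN k G y ^ 2 := by
  rw [intVol, ← integral_const_mul]
  exact integral_congr_ae (Filter.Eventually.of_forall fun x => normSqRm_eq hg k x)

lemma integrable_normSqRm {g : SmoothMetric n M} (hg : ChartSmooth g) (k : ℕ) :
    Integrable (normSqRm g k) (vol g) :=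
  ((integrable_natV hg (isNatCont_rmN_sq k)).const_mul (1 / 4)).congr
    (Filter.Eventually.of_forall fun x => (normSqRm_eq hg k x).symm)

/-- The factor `4` is due to normalization: `rmN` is the norm by full contraction, whose square is
four times that of the double-form norm. All but two of the `2 * j + 4` factors are bounded by the
supremum. -/
lemma intVol_rmPow_zero_le {g : SmoothMetric n M} (hg : ChartSmooth g) {D : ℝ}
    (hD : ∀ x, Real.sqrt (normSqRm g 0 x) ≤ D) (j : ℕ) :
    intVol g (rmPow (2 * j + 2) 0)
      ≤ (4 * D ^ 2) ^ (j + 1) * intVol g fun G y => rmN 0 G y ^ 2 := by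
  rw [intVol, intVol, ← integral_const_mul]
  refine integral_mono (integrable_natV hg (.rmPow _ _))
    ((integrable_natV hg (isNatCont_rmN_sq 0)).const_mul _) fun x => ?_
  have h1 := Real.sqrt_le_iff.1 (hD x)
  rw [normSqRm_eq hg] at h1
  simp only [chartVal, natV] at h1 ⊢
  rw [rmPow_zero]
  set r := rmN 0 (metricCoord g (chartAt (Coord n) x)) (chartAt (Coord n) x x)
  have e : r ^ (2 * j + 2 + 2) = (r ^ 2) ^ (j + 1) * r ^ 2 := by ring
  rw [e]
  exact mul_le_mul_of_nonneg_right (pow_le_pow_left₀ (sq_nonneg r) (by linarith [h1.2]) _)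
    (sq_nonneg r)

/-- The smoothing estimate for a flow on a nonempty manifold. -/
theorem exists_curvature_estimate (hn : 2 ≤ n) (P : FlowOperator)
    (hP : P.a < 1 / (2 * ((n : ℝ) - 1))) (k : ℕ) :
    ∃ C : ℝ, 0 ≤ C ∧ ∀ (M : Type*) [TopologicalSpace M] [T2Space M] [CompactSpace M]
      [ChartedSpace (Coord n) M] [IsManifold (𝓡 n) ∞ M] [MeasurableSpace M] [BorelSpace M]
      (g₀ : SmoothMetric n M) (T : EReal) (g : ℝ → SmoothMetric n M) (D : ℝ),
      IsFlowSolution P g₀ T g →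
      (∀ t ∈ timeInterval T, ∀ x : M, Real.sqrt (normSqRm (g t) 0 x) ≤ D) →
      ∀ t : ℝ, 0 < t → (t : EReal) < T →
        t ^ k * ∫ x, normSqRm (g t) (2 * k) x ∂(vol (g t)) ≤
          (∫ x, normSqRm g₀ 0 x ∂(vol g₀)) * Real.exp (C * (1 + D ^ 2 * t)) := by
  -- Only derivatives of even order enter, since the dissipation of the energy of order `m` is the
  -- energy of order `m + 2`.
  choose c hc C hC f hf hfd hle using fun j : ℕ => exists_energy_evolution hn P hP (2 * j)
  obtain ⟨K, hK0, hK⟩ := exists_smoothing_constant hc hC k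
  refine ⟨4 * K, by positivity, ?_⟩
  intro M _ _ _ _ _ _ _ g₀ T g D h hD t ht htT
  have hu := uniqueDiffOn_timeInterval ht htT
  have hI := Icc_subset_timeInterval htT
  have hmem : ∀ s ∈ Set.Ioo 0 t, s ∈ timeInterval T := fun s hs => hI (Set.Ioo_subset_Icc_self hs)
  have hnn : ∀ j, ∀ s ∈ Set.Icc 0 t, 0 ≤ intVol (g s) fun G y => rmN (2 * j) G y ^ 2 :=
    fun j s _ => integral_nonneg fun x => sq_nonneg _
  have key := hK (fun j s => intVol (g s) fun G y => rmN (2 * j) G y ^ 2)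
    (fun j s => intVol (g s) (f j)) t (4 * D ^ 2) ht.le (by positivity)
    (fun j => h.continuousOn_intVol hu (isNatCont_rmN_sq _) htT)
    (fun j s hs => h.hasDerivAt_intVol hu (isNatCont_rmN_sq _) (hf j) (hfd j)
      (timeInterval_mem_nhds hs.1 ((EReal.coe_lt_coe_iff.2 hs.2).trans htT)))
    hnn (fun j s hs => by
      have hg := h.chartSmooth (hmem s hs)
      have h1 := hle j (cInt (g s) hg)
      have h2 := mul_le_mul_of_nonneg_left (intVol_rmPow_zero_le hg (hD s (hmem s hs)) j) (hC j)
      have e : rmPow (n := n) (2 * j + 2) (2 * j + 2) = fun G y => rmN (2 * (j + 1)) G y ^ 2 :=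
        funext fun G => funext fun y => rmPow_self _ _ _
      rw [e] at h1
      refine h1.trans ((add_le_add_right h2 _).trans_eq ?_)
      simp only [mul_zero, mul_assoc]
      rfl)
  have h0 : g₀ = g 0 := h.initial.symm
  rw [h0, integral_normSqRm (h.chartSmooth (hI (Set.right_mem_Icc.2 ht.le))),
    integral_normSqRm (h.chartSmooth (hI (Set.left_mem_Icc.2 ht.le)))]
  have h3 : Real.exp (K * (1 + 4 * D ^ 2 * t)) ≤ Real.exp (4 * K * (1 + D ^ 2 * t)) :=
    Real.exp_le_exp.2 (by nlinarith)
  have h4 := key.trans (mul_le_mul_of_nonneg_left h3 (hnn 0 0 (Set.left_mem_Icc.2 ht.le)))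
  simp only [mul_zero] at h4
  linarith

end Main

end CurvatureFlow

end

theorem mainTheorem9 (n : ℕ) (hn : 3 ≤ n) (P : CurvatureFlow.FlowOperator)
    (hP : P.a < 1 / (2 * ((n : ℝ) - 1))) (k : ℕ) :
    ∃ C : ℝ, ∀ (M : Type*) [TopologicalSpace M] [T2Space M] [CompactSpace M]
      [ChartedSpace (EuclideanSpace ℝ (Fin n)) M] [IsManifold (𝓡 n) ∞ M]
      [MeasurableSpace M] [BorelSpace M]
      (g₀ : CurvatureFlow.SmoothMetric n M) (T : EReal) (g : ℝ → CurvatureFlow.SmoothMetric n M)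
      (D : ℝ),
      CurvatureFlow.IsFlowSolution P g₀ T g →
      (∀ t : ℝ, 0 ≤ t → (t : EReal) < T → ∀ x : M,
        Real.sqrt (CurvatureFlow.normSqRm (g t) 0 x) ≤ D) →
      ∀ t : ℝ, 0 < t → (t : EReal) < T →
        MeasureTheory.Integrable (CurvatureFlow.normSqRm (g t) (2 * k))
          (CurvatureFlow.vol (g t)) ∧
        ∫ x, CurvatureFlow.normSqRm (g t) (2 * k) x ∂(CurvatureFlow.vol (g t)) ≤
          (∫ x, CurvatureFlow.normSqRm g₀ 0 x ∂(CurvatureFlow.vol g₀)) *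
            (Real.exp (C * (1 + D) * (1 + D * t) ^ (k + 1)) / t ^ k) := by
  obtain ⟨C, hC, h⟩ := CurvatureFlow.exists_curvature_estimate (by omega : 2 ≤ n) P hP k
  refine ⟨C, ?_⟩
  intro M _ _ _ _ _ _ _ g₀ T g D hflow hD t ht htT
  have hg := hflow.chartSmooth (t := t) ⟨ht.le, htT⟩
  refine ⟨CurvatureFlow.integrable_normSqRm hg _, ?_⟩
  -- If `M` is empty then `D` could be negative, but both integrals vanish. Otherwise the bound at a
  -- single point shows that `D` is nonnegative.
  rcases isEmpty_or_nonempty M with hM | ⟨⟨x⟩⟩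
  · simp [MeasureTheory.integral_of_isEmpty]
  have hD0 : 0 ≤ D := (Real.sqrt_nonneg _).trans (hD t ht.le htT x)
  have hI : 0 ≤ ∫ x, CurvatureFlow.normSqRm g₀ 0 x ∂(CurvatureFlow.vol g₀) := by
    have h0 := hflow.chartSmooth (t := 0) ⟨le_rfl, (EReal.coe_lt_coe_iff.2 ht).trans htT⟩
    rw [hflow.initial] at h0
    exact MeasureTheory.integral_nonneg fun x => by
      rw [CurvatureFlow.normSqRm_eq h0]
      exact mul_nonneg (by norm_num) (sq_nonneg _)
  have h1 := h M g₀ T g D hflow (fun s hs => hD s hs.1 hs.2) t ht htT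
  have hDt : 0 ≤ D * t := mul_nonneg hD0 ht.le
  -- For `D` and `t` nonnegative, `1 + D² t ≤ (1 + D) (1 + D t)`, and the power `k + 1` only
  -- increases the right side.
  have h2 : C * (1 + D ^ 2 * t) ≤ C * (1 + D) * (1 + D * t) ^ (k + 1) := by
    rw [mul_assoc]
    refine mul_le_mul_of_nonneg_left ?_ hC
    have h3 : (1 + D * t) ^ 1 ≤ (1 + D * t) ^ (k + 1) :=
      pow_le_pow_right₀ (by linarith) (by omega)
    nlinarith [mul_le_mul_of_nonneg_left h3 (by linarith : 0 ≤ 1 + D)]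
  rw [← mul_div_assoc, le_div_iff₀ (pow_pos ht k), mul_comm]
  exact h1.trans (mul_le_mul_of_nonneg_left (Real.exp_le_exp.2 h2) hI)
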